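/- Let $k$ be a field of characteristic zero, let $\mathcal H,\mathcal K$ be Hopf algebras over $k$ with bijective antipodes, and let $M$, $N$ be stable anti-Yetter--Drinfeld (SAYD) modules over $\mathcal H$, $\mathcal K$: right modules and left comodules with $\varphi(mh)=S(h^{(3)})m^{(-1)}h^{(1)}\otimes m^{(0)}h^{(2)}$ and $m^{(0)}m^{(-1)}=m$. Then $M\otimes N$ is a SAYD module over $\mathcal H\otimes\mathcal K$ with $(m\otimes n)(h\otimes x)=mh\otimes nx$ and coaction $m\otimes n\mapsto m^{(-1)}\otimes n^{(-1)}\otimes m^{(0)}\otimes n^{(0)}$. Let $C(\mathcal H,M)$ be the cocyclic module with $C^n(\mathcal H,M)=M\otimes_{\mathcal H}\mathcal H^{\otimes(n+1)}$ (diagonal action on $\mathcal H^{\otimes (n+1)}$), where $\delta_i$ applies $\Delta$ to $h_i$ for $0\le i\le n$, $\sigma_i$ applies $\varepsilon$ to $h_{i+1}$, $\tau_n(m\otimes h_0\otimes\dots\otimes h_n)=m^{(0)}\otimes h_1\otimes\dots\otimes h_n\otimes m^{(-1)}h_0$, and the last coface is $\delta_{n+1}=\tau_{n+1}\delta_0$.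 With $b=\sum_i(-1)^i\delta_i$, $\lambda_n=(-1)^n\tau_n$ and $B=(1+\lambda_n+\dots+\lambda_n^n)\,\sigma_n\tau_{n+1}(1-\lambda_{n+1})$, denote by $HH^n(\mathcal H,M)$ the cohomology of $b$, by $HC^n(\mathcal H,M)$ the cohomology of $\mathrm{Tot}^n\mathcal B(C)=\bigoplus_{2i+m=n}u^i\otimes C^m$ with differential $b+uB$, by $S:HC^n\to HC^{n+2}$ multiplication by $u$, and by $HP^n(\mathcal H,M)$, $n\in\mathbb Z/2$, the cohomology of $\bigoplus_{m\equiv n}C^m$ with differential $b+B$. The same notation is used for the tensor product mixed complex $C(\mathcal H,M)\otimes C(\mathcal K,N)$, with $b$ and $B$ acting by the Koszul sign rule. (1) For every $n\ge0$ there is an isomorphism $$\bigoplus_{i+j=n}HH^i(\mathcal H,M)\otimes HH^j(\mathcal K,N)\;\cong\;HH^n(\mathcal H\otimes\mathcal K,M\otimes N),\qquad [\alpha]\otimes[\beta]\mapsto[\zeta],$$ where $\zeta$ corresponds to the Alexander--Whitney product $\delta_n\cdots\delta_{i+1}\alpha\otimes\delta_0\cdots\delta_0\beta$ under the map $C^n(\mathcal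 H\otimes\mathcal K,M\otimes N)\to C^n(\mathcal H,M)\otimes C^n(\mathcal K,N)$ that separates the tensor factors. (2) There are isomorphisms $\Theta:HC^n(\mathcal H\otimes\mathcal K,M\otimes N)\cong HC^n(C(\mathcal H,M)\otimes C(\mathcal K,N))$, commuting with $S$ and compatible with the Alexander--Whitney isomorphism on Hochschild cohomology, and a long exact sequence (terms of negative degree being zero) $$\cdots\to HC^{n-1}(\mathcal H\otimes\mathcal K,M\otimes N)\xrightarrow{\partial}\bigoplus_{p+q=n-2}HC^p(\mathcal H,M)\otimes HC^q(\mathcal K,N)\xrightarrow{S\otimes\mathrm{id}-\mathrm{id}\otimes S}\bigoplus_{r+s=n}HC^r(\mathcal H,M)\otimes HC^s(\mathcal K,N)$$ $$\xrightarrow{\mu}HC^n(\mathcal H\otimes\mathcal K,M\otimes N)\xrightarrow{\partial}\bigoplus_{i+j=n-1}HC^i(\mathcal H,M)\otimes HC^j(\mathcal K,N)\xrightarrow{S\otimes\mathrm{id}-\mathrm{id}\otimes S}\cdots,$$ in which, under $\Theta$, the map $\mu$ is induced by the product $(u^i\otimes x)\otimes(u^j\otimes y)\mapsto u^{i+j}\otimes(x\otimes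 y)$ of total complexes, and $\partial$ is the connecting homomorphism of the short exact sequence $$0\to(\mathrm{Tot}\otimes\mathrm{Tot}')^{n-2}\xrightarrow{S\otimes \mathrm{id}-\mathrm{id}\otimes S}(\mathrm{Tot}\otimes\mathrm{Tot}')^{n}\xrightarrow{\mu}\mathrm{Tot}^n\mathcal B(C(\mathcal H,M)\otimes C(\mathcal K,N))\to0,$$ where $\mathrm{Tot}=\mathrm{Tot}\,\mathcal B(C(\mathcal H,M))$ and $\mathrm{Tot}'=\mathrm{Tot}\,\mathcal B(C(\mathcal K,N))$. (3) There are isomorphisms $\Theta_P:HP^n(\mathcal H\otimes\mathcal K,M\otimes N)\cong HP^n(C(\mathcal H,M)\otimes C(\mathcal K,N))$, compatible with $\Theta$ under the canonical maps $HC^n\to HP^{n\bmod 2}$, and for $n\in\mathbb Z/2$ an isomorphism $$\bigoplus_{i+j=n}HP^i(\mathcal H,M)\otimes HP^j(\mathcal K,N)\;\cong\;HP^n(\mathcal H\otimes\mathcal K,M\otimes N)$$ whose composite with $\Theta_P$ is $[\alpha]\otimes[\beta]\mapsto[\alpha\otimes\beta]$. -/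

import Mathlib

open scoped TensorProduct DirectSum

universe u v v' w w'

namespace HopfCyclic

section Algebra

variable {k : Type u} [Field k] {H : Type v} [Ring H] [HopfAlgebra k H]
  {M : Type w} [AddCommGroup M] [Module k M]

/-- `aydTwist act (h₁ ⊗ (h₂ ⊗ h₃)) (g ⊗ m) = S(h₃) g h₁ ⊗ m h₂`, for a right action `act`. -/
noncomputable def aydTwist (act : M →ₗ[k] H →ₗ[k] M) :
    H ⊗[k] (H ⊗[k] H) →ₗ[k] (H ⊗[k] M) →ₗ[k] (H ⊗[k] M) :=
  TensorProduct.lift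
    ((LinearMap.mul k (Module.End k (H ⊗[k] M))).flip.compl₁₂
      (LinearMap.rTensorHom M ∘ₗ (LinearMap.mul k H).flip)
      (TensorProduct.homTensorHomMap (.id k) H M H M ∘ₗ
        TensorProduct.map (LinearMap.mul k H ∘ₗ HopfAlgebra.antipode k (A := H)) act.flip ∘ₗ
          (TensorProduct.comm k H H).toLinearMap))

theorem aydTwist_tmul (act : M →ₗ[k] H →ₗ[k] M) (a b c g : H) (m : M) :
    aydTwist act (a ⊗ₜ (b ⊗ₜ c)) (g ⊗ₜ m) =
      (HopfAlgebra.antipode k c * (g * a)) ⊗ₜ[k] act m b := by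
  simp [aydTwist]

variable (k H M) in
/-- A stable anti-Yetter-Drinfeld module structure on `M` over the Hopf algebra `H`: a right
`H`-action `act m h = mh` and a left coaction `coact m = m⁽⁻¹⁾ ⊗ m⁽⁰⁾` such that
`(mh)⁽⁻¹⁾ ⊗ (mh)⁽⁰⁾ = S(h⁽³⁾) m⁽⁻¹⁾ h⁽¹⁾ ⊗ m⁽⁰⁾ h⁽²⁾` and `m⁽⁰⁾ m⁽⁻¹⁾ = m`. -/
structure SAYDModule where
  act : M →ₗ[k] H →ₗ[k] M
  act_one : ∀ m, act m 1 = m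
  act_mul : ∀ m g h, act m (g * h) = act (act m g) h
  coact : M →ₗ[k] H ⊗[k] M
  coact_counit : ∀ m,
    TensorProduct.lid k M ((Coalgebra.counit (R := k) (A := H)).rTensor M (coact m)) = m
  coact_coassoc : ∀ m,
    TensorProduct.assoc k H H M ((Coalgebra.comul (R := k) (A := H)).rTensor M (coact m)) =
      coact.lTensor H (coact m)
  ayd : ∀ m h, coact (act m h) =
    aydTwist act ((Coalgebra.comul (R := k) (A := H)).lTensor H (Coalgebra.comul (R := k) h))
      (coact m)
  stable : ∀ m, TensorProduct.lift act.flip (coact m) = m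

end Algebra

section Tensor
variable {k : Type u} [Field k] {H : Type v} [Ring H] [HopfAlgebra k H]
  {M : Type w} [AddCommGroup M] [Module k M]
  {K : Type v'} [Ring K] [HopfAlgebra k K]
  {N : Type w'} [AddCommGroup N] [Module k N]

/-- `(m ⊗ n)(h ⊗ x) = mh ⊗ nx`. -/
noncomputable def tensorAct (a : M →ₗ[k] H →ₗ[k] M) (b : N →ₗ[k] K →ₗ[k] N) :
    M ⊗[k] N →ₗ[k] (H ⊗[k] K) →ₗ[k] (M ⊗[k] N) :=
  TensorProduct.homTensorHomMap (.id k) H K M N ∘ₗ TensorProduct.map a b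

theorem tensorAct_tmul (a : M →ₗ[k] H →ₗ[k] M) (b : N →ₗ[k] K →ₗ[k] N) (m : M) (n : N)
    (h : H) (x : K) : tensorAct a b (m ⊗ₜ n) (h ⊗ₜ x) = a m h ⊗ₜ b n x := by
  simp [tensorAct]

/-- `m ⊗ n ↦ (m⁽⁻¹⁾ ⊗ n⁽⁻¹⁾) ⊗ (m⁽⁰⁾ ⊗ n⁽⁰⁾)`. -/
noncomputable def tensorCoact (a : M →ₗ[k] H ⊗[k] M) (b : N →ₗ[k] K ⊗[k] N) :
    M ⊗[k] N →ₗ[k] (H ⊗[k] K) ⊗[k] (M ⊗[k] N) :=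
  (TensorProduct.tensorTensorTensorComm k H M K N).toLinearMap ∘ₗ TensorProduct.map a b

theorem tensorCoact_tmul (a : M →ₗ[k] H ⊗[k] M) (b : N →ₗ[k] K ⊗[k] N) (m : M) (n : N) :
    tensorCoact a b (m ⊗ₜ n) =
      TensorProduct.tensorTensorTensorComm k H M K N (a m ⊗ₜ b n) := rfl

variable (H M K N) in
/-- `(h ⊗ (p ⊗ m)) ⊗ (x ⊗ (q ⊗ n)) ↦ (h ⊗ x) ⊗ ((p ⊗ q) ⊗ (m ⊗ n))`. -/
noncomputable def shuffle3 {P : Type*} [AddCommGroup P] [Module k P] {Q : Type*} [AddCommGroup Q]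
    [Module k Q] :
    (H ⊗[k] (P ⊗[k] M)) ⊗[k] (K ⊗[k] (Q ⊗[k] N)) →ₗ[k]
      (H ⊗[k] K) ⊗[k] ((P ⊗[k] Q) ⊗[k] (M ⊗[k] N)) :=
  (TensorProduct.tensorTensorTensorComm k P M Q N).toLinearMap.lTensor (H ⊗[k] K) ∘ₗ
    (TensorProduct.tensorTensorTensorComm k H (P ⊗[k] M) K (Q ⊗[k] N)).toLinearMap

theorem assoc_comul_rTensor_comm (U : H ⊗[k] M) (V : K ⊗[k] N) :
    TensorProduct.assoc k (H ⊗[k] K) (H ⊗[k] K) (M ⊗[k] N)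
      ((Coalgebra.comul (R := k) (A := H ⊗[k] K)).rTensor (M ⊗[k] N)
        (TensorProduct.tensorTensorTensorComm k H M K N (U ⊗ₜ V))) =
    shuffle3 H M K N
      (TensorProduct.assoc k H H M ((Coalgebra.comul (R := k) (A := H)).rTensor M U) ⊗ₜ
        TensorProduct.assoc k K K N ((Coalgebra.comul (R := k) (A := K)).rTensor N V)) := by
  induction U with
  | zero => simp
  | add x y hx hy => simp only [map_add, TensorProduct.add_tmul, hx, hy]
  | tmul g m =>
    induction V with
    | zero => simp
    | add x y hx hy => simp only [map_add, TensorProduct.tmul_add, hx, hy]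
    | tmul g' n =>
      simp only [TensorProduct.tensorTensorTensorComm_tmul, LinearMap.rTensor_tmul,
        TensorProduct.comul_tmul]
      generalize (Coalgebra.comul (R := k) g) = U
      generalize (Coalgebra.comul (R := k) g') = V
      induction U with
      | zero => simp
      | add x y hx hy => simp only [map_add, TensorProduct.add_tmul, hx, hy]
      | tmul a b =>
        induction V with
        | zero => simp
        | add x y hx hy => simp only [map_add, TensorProduct.add_tmul, TensorProduct.tmul_add, hx, hy]
        | tmul c d => simp [shuffle3]

theorem lTensor_tensorCoact_comm {P : Type*} [AddCommGroup P] [Module k P] {Q : Type*}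
    [AddCommGroup Q] [Module k Q] (a : P →ₗ[k] H ⊗[k] M) (b : Q →ₗ[k] K ⊗[k] N)
    (U : H ⊗[k] P) (V : K ⊗[k] Q) :
    ((TensorProduct.tensorTensorTensorComm k H M K N).toLinearMap ∘ₗ
      TensorProduct.map a b).lTensor (H ⊗[k] K)
        (TensorProduct.tensorTensorTensorComm k H P K Q (U ⊗ₜ V)) =
    shuffle3 H M K N (a.lTensor H U ⊗ₜ b.lTensor K V) := by
  induction U with
  | zero => simp
  | add x y hx hy => simp only [map_add, TensorProduct.add_tmul, hx, hy]
  | tmul g m =>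
    induction V with
    | zero => simp
    | add x y hx hy => simp only [map_add, TensorProduct.tmul_add, hx, hy]
    | tmul g' n => simp [shuffle3]

theorem aydTwist_tensor (a : M →ₗ[k] H →ₗ[k] M) (b : N →ₗ[k] K →ₗ[k] N)
    (Z : H ⊗[k] (H ⊗[k] H)) (Z' : K ⊗[k] (K ⊗[k] K)) (U : H ⊗[k] M) (V : K ⊗[k] N) :
    TensorProduct.tensorTensorTensorComm k H M K N (aydTwist a Z U ⊗ₜ aydTwist b Z' V) =
      aydTwist (tensorAct a b) (shuffle3 H H K K (Z ⊗ₜ Z'))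
        (TensorProduct.tensorTensorTensorComm k H M K N (U ⊗ₜ V)) := by
  induction Z with
  | zero => simp
  | add x y hx hy => simp only [map_add, TensorProduct.add_tmul, LinearMap.add_apply, hx, hy]
  | tmul z₁ z =>
  induction z with
  | zero => simp
  | add x y hx hy =>
    simp only [map_add, TensorProduct.add_tmul, TensorProduct.tmul_add, LinearMap.add_apply, hx, hy]
  | tmul z₂ z₃ =>
  induction Z' with
  | zero => simp
  | add x y hx hy => simp only [map_add, TensorProduct.tmul_add, LinearMap.add_apply, hx, hy]
  | tmul y₁ y =>
  induction y with
  | zero => simp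
  | add x y hx hy => simp only [map_add, TensorProduct.tmul_add, LinearMap.add_apply, hx, hy]
  | tmul y₂ y₃ =>
  induction U with
  | zero => simp
  | add x y hx hy => simp only [map_add, TensorProduct.add_tmul, hx, hy]
  | tmul g m =>
  induction V with
  | zero => simp
  | add x y hx hy => simp only [map_add, TensorProduct.tmul_add, hx, hy]
  | tmul g' n =>
    simp [shuffle3, aydTwist_tmul, tensorAct_tmul]

theorem comul_comul_tensor (h : H) (h' : K) :
    (Coalgebra.comul (R := k) (A := H ⊗[k] K)).lTensor (H ⊗[k] K)
      (Coalgebra.comul (R := k) (h ⊗ₜ[k] h')) =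
    shuffle3 H H K K
      ((Coalgebra.comul (R := k) (A := H)).lTensor H (Coalgebra.comul (R := k) h) ⊗ₜ
        (Coalgebra.comul (R := k) (A := K)).lTensor K (Coalgebra.comul (R := k) h')) := by
  rw [← lTensor_tensorCoact_comm]
  rfl

/-- The SAYD module `M ⊗ N` over `H ⊗ K`. -/
noncomputable def SAYDModule.tensor (S : SAYDModule k H M) (T : SAYDModule k K N) :
    SAYDModule k (H ⊗[k] K) (M ⊗[k] N) where
  act := tensorAct S.act T.act
  act_one x := by
    induction x with
    | zero => simp
    | add x y hx hy => simp [hx, hy]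
    | tmul m n => simp [Algebra.TensorProduct.one_def, tensorAct_tmul, S.act_one, T.act_one]
  act_mul x g h := by
    induction x with
    | zero => simp
    | add x y hx hy => simp [hx, hy]
    | tmul m n =>
      induction g with
      | zero => simp
      | add x y hx hy => simp [hx, hy, add_mul]
      | tmul g g' =>
        induction h with
        | zero => simp
        | add x y hx hy => simp [hx, hy, mul_add]
        | tmul h h' => simp [tensorAct_tmul, S.act_mul, T.act_mul]
  coact := tensorCoact S.coact T.coact
  coact_counit x := by
    induction x with
    | zero => simp
    | add x y hx hy => simp only [map_add, hx, hy]
    | tmul m n =>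
      rw [tensorCoact_tmul]
      conv_rhs => rw [← S.coact_counit m, ← T.coact_counit n]
      generalize S.coact m = U
      generalize T.coact n = V
      induction U with
      | zero => simp
      | add x y hx hy => simp only [map_add, TensorProduct.add_tmul, hx, hy]
      | tmul g m =>
        induction V with
        | zero => simp
        | add x y hx hy => simp only [map_add, TensorProduct.tmul_add, hx, hy]
        | tmul g' n => 
          simp only [TensorProduct.tensorTensorTensorComm_tmul, LinearMap.rTensor_tmul,
            TensorProduct.counit_tmul, TensorProduct.lid_tmul, TensorProduct.smul_tmul_smul,
            smul_eq_mul, mul_comm]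
  coact_coassoc x := by
    induction x with
    | zero => simp
    | add x y hx hy => simp only [map_add, hx, hy]
    | tmul m n =>
      rw [tensorCoact_tmul, assoc_comul_rTensor_comm, S.coact_coassoc, T.coact_coassoc]
      exact (lTensor_tensorCoact_comm _ _ _ _).symm
  ayd x z := by
    induction x with
    | zero => simp
    | add x y hx hy => simp only [map_add, LinearMap.add_apply, hx, hy]
    | tmul m n =>
      induction z with
      | zero => simp
      | add x y hx hy => simp only [map_add, LinearMap.add_apply, hx, hy]
      | tmul h h' =>
        rw [tensorAct_tmul, tensorCoact_tmul, S.ayd, T.ayd, tensorCoact_tmul]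
        rw [comul_comul_tensor, aydTwist_tensor]
  stable x := by
    induction x with
    | zero => simp
    | add x y hx hy => simp only [map_add, hx, hy]
    | tmul m n =>
      rw [tensorCoact_tmul]
      conv_rhs => rw [← S.stable m, ← T.stable n]
      generalize S.coact m = U
      generalize T.coact n = V
      induction U with
      | zero => simp
      | add x y hx hy => simp only [map_add, TensorProduct.add_tmul, hx, hy]
      | tmul g m =>
        induction V with
        | zero => simp
        | add x y hx hy => simp only [map_add, TensorProduct.tmul_add, hx, hy]
        | tmul g' n => simp [tensorAct_tmul]

end Tensor
section Powers

variable (k : Type u) [Field k] (H : Type v) [Ring H] [HopfAlgebra k H]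

/-- The tensor power `H^{⊗(n+1)}`, bracketed to the right. -/
noncomputable def tpow : ℕ → ModuleCat.{v} k
  | 0 => ModuleCat.of k H
  | n + 1 => ModuleCat.of k (H ⊗[k] tpow n)

/-- `H^{⊗1} = H`. -/
noncomputable def single : H ≃ₗ[k] tpow k H 0 := LinearEquiv.refl k H

/-- `H^{⊗(n+2)} = H ⊗ H^{⊗(n+1)}`. -/
noncomputable def cons (n : ℕ) : H ⊗[k] tpow k H n ≃ₗ[k] tpow k H (n + 1) :=
  LinearEquiv.refl k (H ⊗[k] tpow k H n)

/-- The diagonal left action of `H` on `H^{⊗(n+1)}`: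
`h · (h₀ ⊗ ⋯ ⊗ hₙ) = h⁽¹⁾h₀ ⊗ ⋯ ⊗ h⁽ⁿ⁺¹⁾hₙ`. -/
noncomputable def diagAct : ∀ n, H →ₗ[k] tpow k H n →ₗ[k] tpow k H n
  | 0 => (single k H).conj.toLinearMap ∘ₗ LinearMap.mul k H
  | n + 1 => (cons k H n).conj.toLinearMap ∘ₗ
      TensorProduct.homTensorHomMap (.id k) H (tpow k H n) H (tpow k H n) ∘ₗ
        TensorProduct.map (LinearMap.mul k H) (diagAct n) ∘ₗ Coalgebra.comul

/-- `h₀ ⊗ ⋯ ⊗ hₙ ↦ h₀ ⊗ ⋯ ⊗ hᵢ⁽¹⁾ ⊗ hᵢ⁽²⁾ ⊗ ⋯ ⊗ hₙ`. -/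
noncomputable def comulAt : ∀ n, Fin (n + 1) → (tpow k H n →ₗ[k] tpow k H (n + 1))
  | 0, _ => (cons k H 0).toLinearMap ∘ₗ (single k H).toLinearMap.lTensor H ∘ₗ
      Coalgebra.comul ∘ₗ (single k H).symm.toLinearMap
  | n + 1, i => Fin.cases
      ((cons k H (n + 1)).toLinearMap ∘ₗ (cons k H n).toLinearMap.lTensor H ∘ₗ
        (TensorProduct.assoc k H H (tpow k H n)).toLinearMap ∘ₗ
          (Coalgebra.comul (R := k) (A := H)).rTensor (tpow k H n) ∘ₗ
            (cons k H n).symm.toLinearMap)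
      (fun j => (cons k H (n + 1)).toLinearMap ∘ₗ (comulAt n j).lTensor H ∘ₗ
        (cons k H n).symm.toLinearMap) i

/-- `h₀ ⊗ ⋯ ⊗ hₙ₊₁ ↦ h₀ ⊗ ⋯ ⊗ ε(hᵢ₊₁) ⊗ ⋯ ⊗ hₙ₊₁`. -/
noncomputable def counitAt : ∀ n, Fin (n + 1) → (tpow k H (n + 1) →ₗ[k] tpow k H n)
  | 0, _ => (single k H).toLinearMap ∘ₗ (TensorProduct.rid k H).toLinearMap ∘ₗ
      (Coalgebra.counit (R := k) (A := H) ∘ₗ (single k H).symm.toLinearMap).lTensor H ∘ₗ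
        (cons k H 0).symm.toLinearMap
  | n + 1, i => Fin.cases
      ((cons k H n).toLinearMap ∘ₗ
        ((TensorProduct.lid k (tpow k H n)).toLinearMap ∘ₗ
          (Coalgebra.counit (R := k) (A := H)).rTensor (tpow k H n) ∘ₗ
            (cons k H n).symm.toLinearMap).lTensor H ∘ₗ (cons k H (n + 1)).symm.toLinearMap)
      (fun j => (cons k H n).toLinearMap ∘ₗ (counitAt n j).lTensor H ∘ₗ
        (cons k H (n + 1)).symm.toLinearMap) i

/-- `(h₀ ⊗ ⋯ ⊗ hₙ) ⊗ h ↦ h₀ ⊗ ⋯ ⊗ hₙ ⊗ h`. -/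
noncomputable def snoc : ∀ n, (tpow k H n ⊗[k] H →ₗ[k] tpow k H (n + 1))
  | 0 => (cons k H 0).toLinearMap ∘ₗ
      TensorProduct.map (single k H).symm.toLinearMap (single k H).toLinearMap
  | n + 1 => (cons k H (n + 1)).toLinearMap ∘ₗ (snoc n).lTensor H ∘ₗ
      (TensorProduct.assoc k H (tpow k H n) H).toLinearMap ∘ₗ
        (cons k H n).symm.toLinearMap.rTensor H

/-- `g ⊗ (h₀ ⊗ h₁ ⊗ ⋯ ⊗ hₙ) ↦ h₁ ⊗ ⋯ ⊗ hₙ ⊗ g h₀`. -/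
noncomputable def rotate : ∀ n, (H ⊗[k] tpow k H n →ₗ[k] tpow k H n)
  | 0 => (single k H).toLinearMap ∘ₗ LinearMap.mul' k H ∘ₗ
      (single k H).symm.toLinearMap.lTensor H
  | n + 1 => snoc k H n ∘ₗ (TensorProduct.comm k H (tpow k H n)).toLinearMap ∘ₗ
      (LinearMap.mul' k H).rTensor (tpow k H n) ∘ₗ
        (TensorProduct.assoc k H H (tpow k H n)).symm.toLinearMap ∘ₗ
          (cons k H n).symm.toLinearMap.lTensor H

variable {k H}

theorem diagAct_single (h y : H) : diagAct k H 0 h (single k H y) = single k H (h * y) := by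
  simp [diagAct, LinearEquiv.conj_apply]

theorem diagAct_cons (n : ℕ) (h y : H) (t : tpow k H n) :
    diagAct k H (n + 1) h (cons k H n (y ⊗ₜ[k] t)) =
      cons k H n (TensorProduct.map (LinearMap.mulRight k y) ((diagAct k H n).flip t)
        (Coalgebra.comul (R := k) h)) := by
  simp only [diagAct, LinearMap.comp_apply, LinearEquiv.coe_coe, LinearEquiv.conj_apply,
    LinearEquiv.symm_apply_apply]
  congr 1
  generalize (Coalgebra.comul (R := k) h) = U
  induction U with
  | zero => simp
  | add a b ha hb => simp only [map_add, LinearMap.add_apply, ha, hb]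
  | tmul a b => simp

theorem snoc_single (y z : H) :
    snoc k H 0 (single k H y ⊗ₜ z) = cons k H 0 (y ⊗ₜ single k H z) := by
  simp [snoc]

theorem snoc_cons (n : ℕ) (y z : H) (t : tpow k H n) :
    snoc k H (n + 1) (cons k H n (y ⊗ₜ[k] t) ⊗ₜ[k] z) =
      cons k H (n + 1) (y ⊗ₜ[k] snoc k H n (t ⊗ₜ z)) := by
  simp [snoc]

theorem rotate_single (g y : H) :
    rotate k H 0 (g ⊗ₜ[k] single k H y) = single k H (g * y) := by
  simp [rotate]

theorem rotate_cons (n : ℕ) (g y : H) (t : tpow k H n) :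
    rotate k H (n + 1) (g ⊗ₜ[k] cons k H n (y ⊗ₜ[k] t)) = snoc k H n (t ⊗ₜ (g * y)) := by
  simp [rotate]

theorem diagAct_snoc : ∀ (n : ℕ) (h y : H) (t : tpow k H n),
    diagAct k H (n + 1) h (snoc k H n (t ⊗ₜ y)) =
      snoc k H n (TensorProduct.map ((diagAct k H n).flip t) (LinearMap.mulRight k y)
        (Coalgebra.comul (R := k) h))
  | 0, h, y, t => by
    obtain ⟨t, rfl⟩ := (single k H).surjective t
    rw [snoc_single, diagAct_cons]
    generalize (Coalgebra.comul (R := k) h) = U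
    induction U with
    | zero => simp
    | add a b ha hb => simp only [map_add, ha, hb]
    | tmul a b => simp [diagAct_single, snoc_single]
  | n + 1, h, y, t => by
    obtain ⟨t, rfl⟩ := (cons k H n).surjective t
    induction t with
    | zero => simp
    | add a b ha hb =>
      simp only [map_add, TensorProduct.add_tmul, ha, hb, TensorProduct.map_add_left,
        LinearMap.add_apply]
    | tmul a s =>
      rw [snoc_cons, diagAct_cons]
      let F : H ⊗[k] (H ⊗[k] H) →ₗ[k] tpow k H (n + 2) :=
        (cons k H (n + 1)).toLinearMap ∘ₗ TensorProduct.map (LinearMap.mulRight k a)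
          (snoc k H n ∘ₗ TensorProduct.map ((diagAct k H n).flip s) (LinearMap.mulRight k y))
      have h1 : ∀ U : H ⊗[k] H,
          cons k H (n + 1) (TensorProduct.map (LinearMap.mulRight k a)
            ((diagAct k H (n + 1)).flip (snoc k H n (s ⊗ₜ y))) U) =
          F ((Coalgebra.comul (R := k) (A := H)).lTensor H U) := by
        intro U
        induction U with
        | zero => simp
        | add a b ha hb => simp only [map_add, ha, hb]
        | tmul p q =>
          simp only [TensorProduct.map_tmul, LinearMap.flip_apply, diagAct_snoc n q y s,
            LinearMap.lTensor_tmul, F, LinearMap.comp_apply, LinearEquiv.coe_coe]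
      have h2 : ∀ U : H ⊗[k] H,
          snoc k H (n + 1) (TensorProduct.map
            ((diagAct k H (n + 1)).flip (cons k H n (a ⊗ₜ[k] s)))
            (LinearMap.mulRight k y) U) =
          F (TensorProduct.assoc k H H H
            ((Coalgebra.comul (R := k) (A := H)).rTensor H U)) := by
        intro U
        induction U with
        | zero => simp
        | add a b ha hb => simp only [map_add, ha, hb]
        | tmul p q =>
          rw [TensorProduct.map_tmul, LinearMap.flip_apply, diagAct_cons, LinearMap.rTensor_tmul]
          generalize (Coalgebra.comul (R := k) p) = V
          induction V with
          | zero => simp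
          | add a b ha hb => simp only [map_add, TensorProduct.add_tmul, ha, hb]
          | tmul c d => simp [F, snoc_cons]
      rw [h1, h2, Coalgebra.coassoc_apply]

/-- `∑ f(d⁽¹⁾, d⁽²⁾ S(d⁽³⁾)) = f(d, 1)`. -/
theorem antipode_collapse {V : Type*} [AddCommGroup V] [Module k V] (f : H ⊗[k] H →ₗ[k] V)
    (d : H) :
    f ((LinearMap.mul' k H ∘ₗ (HopfAlgebra.antipode k (A := H)).lTensor H).lTensor H
      ((Coalgebra.comul (R := k) (A := H)).lTensor H (Coalgebra.comul (R := k) d))) =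
      f (d ⊗ₜ 1) := by
  congr 1
  rw [← LinearMap.comp_apply, ← LinearMap.lTensor_comp, LinearMap.comp_assoc,
    HopfAlgebra.mul_antipode_lTensor_comul, LinearMap.lTensor_comp, LinearMap.comp_apply,
    Coalgebra.lTensor_counit_comul]
  simp

/-- `∑ d⁽¹⁾ · (t ⊗ S(d⁽²⁾) z) = (d · t) ⊗ z`. -/
theorem diagAct_snoc_antipode (n : ℕ) (d z : H) (t : tpow k H n) (Λ : H ⊗[k] H →ₗ[k] tpow k H (n + 1))
    (hΛ : ∀ b c, Λ (b ⊗ₜ c) =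
      diagAct k H (n + 1) b (snoc k H n (t ⊗ₜ (HopfAlgebra.antipode k c * z)))) :
    Λ (Coalgebra.comul (R := k) d) = snoc k H n (diagAct k H n d t ⊗ₜ z) := by
  let f : H ⊗[k] H →ₗ[k] tpow k H (n + 1) :=
    snoc k H n ∘ₗ TensorProduct.map ((diagAct k H n).flip t) (LinearMap.mulRight k z)
  have h1 : ∀ U : H ⊗[k] H, Λ U =
      f ((LinearMap.mul' k H ∘ₗ (HopfAlgebra.antipode k (A := H)).lTensor H).lTensor H
        (TensorProduct.assoc k H H H ((Coalgebra.comul (R := k) (A := H)).rTensor H U))) := by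
    intro U
    induction U with
    | zero => simp
    | add a b ha hb => simp only [map_add, ha, hb]
    | tmul b c =>
      rw [hΛ, diagAct_snoc, LinearMap.rTensor_tmul]
      generalize (Coalgebra.comul (R := k) b) = V
      induction V with
      | zero => simp
      | add a b ha hb => simp only [map_add, TensorProduct.add_tmul, ha, hb]
      | tmul p q => simp [f, mul_assoc]
  rw [h1, Coalgebra.coassoc_apply, antipode_collapse]
  simp [f]

/-- `∑ h⁽²⁾ · rotate (S(h⁽³⁾) g h⁽¹⁾ ⊗ x) = rotate (g ⊗ h · x)`. -/
theorem rotate_twist (n : ℕ) (g h : H) (x : tpow k H n)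
    (G : H ⊗[k] (H ⊗[k] H) →ₗ[k] tpow k H n)
    (hG : ∀ a b c : H, G (a ⊗ₜ (b ⊗ₜ c)) =
      diagAct k H n b (rotate k H n ((HopfAlgebra.antipode k c * (g * a)) ⊗ₜ x))) :
    G ((Coalgebra.comul (R := k) (A := H)).lTensor H (Coalgebra.comul (R := k) h)) =
      rotate k H n (g ⊗ₜ diagAct k H n h x) := by
  cases n with
  | zero =>
    obtain ⟨x, rfl⟩ := (single k H).surjective x
    have h1 : ∀ U : H ⊗[k] H, G ((Coalgebra.comul (R := k) (A := H)).lTensor H U) =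
        single k H ((LinearMap.mulRight k x ∘ₗ LinearMap.mulLeft k g)
          (TensorProduct.rid k H ((Coalgebra.counit (R := k) (A := H)).lTensor H U))) := by
      intro U
      induction U with
      | zero => simp
      | add a b ha hb => simp only [map_add, ha, hb]
      | tmul a b =>
        have h2 : ∀ V : H ⊗[k] H, G (a ⊗ₜ V) = single k H
            (LinearMap.mul' k H ((HopfAlgebra.antipode k (A := H)).lTensor H V) * (g * a * x)) := by
          intro V
          induction V with
          | zero => simp
          | add a b ha hb => simp only [map_add, TensorProduct.tmul_add, add_mul, ha, hb]
          | tmul b c => rw [hG, rotate_single, diagAct_single]; simp [mul_assoc]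
        rw [LinearMap.lTensor_tmul, h2, HopfAlgebra.mul_antipode_lTensor_comul_apply]
        simp [Algebra.algebraMap_eq_smul_one]
    rw [h1, Coalgebra.lTensor_counit_comul, diagAct_single, rotate_single]
    simp [mul_assoc]
  | succ n =>
    obtain ⟨x, rfl⟩ := (cons k H n).surjective x
    induction x generalizing G with
    | zero =>
      have : G = 0 := by
        ext a b c
        simp [hG]
      simp [this]
    | add x y hx hy =>
      let Gx (x : tpow k H (n + 1)) : H ⊗[k] (H ⊗[k] H) →ₗ[k] tpow k H (n + 1) :=
        TensorProduct.lift ((diagAct k H (n + 1)).flip ∘ₗ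
          rotate k H (n + 1) ∘ₗ (TensorProduct.mk k H (tpow k H (n + 1))).flip x) ∘ₗ
          (aydTwist (LinearMap.mul k H)).flip (g ⊗ₜ 1)
      have hGx : ∀ x a b c, Gx x (a ⊗ₜ (b ⊗ₜ c)) = diagAct k H (n + 1) b
          (rotate k H (n + 1) ((HopfAlgebra.antipode k c * (g * a)) ⊗ₜ x)) := by
        intro x a b c
        simp [Gx, aydTwist_tmul]
      have : G = Gx (cons k H n x) + Gx (cons k H n y) := by
        ext a b c
        simp [hG, hGx, TensorProduct.tmul_add]
      rw [this, LinearMap.add_apply, hx _ (hGx _), hy _ (hGx _)]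
      simp [TensorProduct.tmul_add]
    | tmul y t =>
      have h1 : ∀ U : H ⊗[k] H, G ((Coalgebra.comul (R := k) (A := H)).lTensor H U) =
          rotate k H (n + 1) (g ⊗ₜ cons k H n
            (TensorProduct.map (LinearMap.mulRight k y) ((diagAct k H n).flip t) U)) := by
        intro U
        induction U with
        | zero => simp
        | add a b ha hb => simp only [map_add, TensorProduct.tmul_add, ha, hb]
        | tmul a d =>
          rw [LinearMap.lTensor_tmul, TensorProduct.map_tmul, rotate_cons]
          refine diagAct_snoc_antipode n d _ t (G ∘ₗ TensorProduct.mk k H _ a) fun b c => ?_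
          simp [hG, rotate_cons, mul_assoc]
      rw [h1, diagAct_cons]

end Powers

section Cochains

variable {k : Type u} [Field k] {H : Type v} [Ring H] [HopfAlgebra k H]

theorem comulAt_zero (y : H) (i : Fin 1) :
    comulAt k H 0 i (single k H y) =
      cons k H 0 ((single k H).toLinearMap.lTensor H (Coalgebra.comul (R := k) y)) := by
  simp [comulAt]

theorem comulAt_cons_zero (n : ℕ) (y : H) (t : tpow k H n) :
    comulAt k H (n + 1) 0 (cons k H n (y ⊗ₜ t)) =
      cons k H (n + 1) ((cons k H n).toLinearMap.lTensor H
        (TensorProduct.assoc k H H (tpow k H n) (Coalgebra.comul (R := k) y ⊗ₜ t))) := by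
  simp [comulAt]

theorem comulAt_cons_succ (n : ℕ) (j : Fin (n + 1)) (y : H) (t : tpow k H n) :
    comulAt k H (n + 1) j.succ (cons k H n (y ⊗ₜ t)) =
      cons k H (n + 1) (y ⊗ₜ comulAt k H n j t) := by
  simp [comulAt]

theorem counitAt_zero (y z : H) (i : Fin 1) :
    counitAt k H 0 i (cons k H 0 (y ⊗ₜ single k H z)) =
      Coalgebra.counit (R := k) z • single k H y := by
  simp [counitAt]

theorem counitAt_cons_zero (n : ℕ) (y z : H) (t : tpow k H n) :
    counitAt k H (n + 1) 0 (cons k H (n + 1) (y ⊗ₜ cons k H n (z ⊗ₜ t))) =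
      Coalgebra.counit (R := k) z • cons k H n (y ⊗ₜ t) := by
  simp [counitAt]

theorem counitAt_cons_succ (n : ℕ) (j : Fin (n + 1)) (y : H) (t : tpow k H (n + 1)) :
    counitAt k H (n + 1) j.succ (cons k H (n + 1) (y ⊗ₜ t)) =
      cons k H n (y ⊗ₜ counitAt k H n j t) := by
  simp [counitAt]

theorem comulAt_diagAct : ∀ (n : ℕ) (i : Fin (n + 1)) (h : H) (x : tpow k H n),
    comulAt k H n i (diagAct k H n h x) = diagAct k H (n + 1) h (comulAt k H n i x)
  | 0, i, h, x => by
    obtain ⟨y, rfl⟩ := (single k H).surjective x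
    rw [diagAct_single, comulAt_zero, comulAt_zero, Bialgebra.comul_mul]
    generalize (Coalgebra.comul (R := k) y) = V
    induction V with
    | zero => simp
    | add a b ha hb => simp only [map_add, mul_add, ha, hb]
    | tmul p q =>
      rw [LinearMap.lTensor_tmul, LinearEquiv.coe_coe, diagAct_cons]
      generalize (Coalgebra.comul (R := k) h) = U
      induction U with
      | zero => simp
      | add a b ha hb => simp only [map_add, add_mul, ha, hb]
      | tmul a b => simp [diagAct_single]
  | n + 1, i, h, x => by
    obtain ⟨x, rfl⟩ := (cons k H n).surjective x
    induction x with
    | zero => simp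
    | add a b ha hb => simp only [map_add, ha, hb]
    | tmul y t =>
      rw [diagAct_cons]
      cases i using Fin.cases with
      | zero =>
        rw [comulAt_cons_zero]
        let F (V : H ⊗[k] H) : H ⊗[k] (H ⊗[k] H) →ₗ[k] tpow k H (n + 2) :=
          (cons k H (n + 1)).toLinearMap ∘ₗ (cons k H n).toLinearMap.lTensor H ∘ₗ
            (TensorProduct.assoc k H H (tpow k H n)).toLinearMap ∘ₗ
            TensorProduct.map (LinearMap.mulRight k V) ((diagAct k H n).flip t) ∘ₗ
            (TensorProduct.assoc k H H H).symm.toLinearMap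
        have h1 : ∀ U : H ⊗[k] H, comulAt k H (n + 1) 0 (cons k H n (TensorProduct.map
            (LinearMap.mulRight k y) ((diagAct k H n).flip t) U)) =
            F (Coalgebra.comul (R := k) y) (TensorProduct.assoc k H H H
              ((Coalgebra.comul (R := k) (A := H)).rTensor H U)) := by
          intro U
          induction U with
          | zero => simp
          | add a b ha hb => simp only [map_add, ha, hb]
          | tmul a b =>
            rw [TensorProduct.map_tmul, comulAt_cons_zero]
            simp [F]
        have h2 : ∀ V : H ⊗[k] H, diagAct k H (n + 1 + 1) h (cons k H (n + 1)
            ((cons k H n).toLinearMap.lTensor H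
              (TensorProduct.assoc k H H (tpow k H n) (V ⊗ₜ t)))) =
            F V ((Coalgebra.comul (R := k) (A := H)).lTensor H
              (Coalgebra.comul (R := k) h)) := by
          intro V
          induction V with
          | zero =>
            have : F 0 = 0 := by
              ext a b c
              simp [F]
            simp [this]
          | add a b ha hb =>
            have : F (a + b) = F a + F b := by
              ext c d e
              simp [F, mul_add, TensorProduct.add_tmul]
            simp only [TensorProduct.add_tmul, map_add, ha, hb, this, LinearMap.add_apply]
          | tmul p q =>
            rw [TensorProduct.assoc_tmul, LinearMap.lTensor_tmul, LinearEquiv.coe_coe,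
              diagAct_cons]
            generalize (Coalgebra.comul (R := k) h) = U
            induction U with
            | zero => simp
            | add a b ha hb => simp only [map_add, ha, hb]
            | tmul a b =>
              rw [TensorProduct.map_tmul, LinearMap.flip_apply, diagAct_cons,
                LinearMap.lTensor_tmul]
              generalize (Coalgebra.comul (R := k) b) = W
              induction W with
              | zero => simp
              | add a b ha hb => simp only [map_add, TensorProduct.tmul_add, ha, hb]
              | tmul c d => simp [F]
        rw [h1, h2, Coalgebra.coassoc_apply]
      | succ j =>
        rw [comulAt_cons_succ, diagAct_cons]
        generalize (Coalgebra.comul (R := k) h) = U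
        induction U with
        | zero => simp
        | add a b ha hb => simp only [map_add, ha, hb]
        | tmul a b => simp [comulAt_cons_succ, comulAt_diagAct n j]

theorem counitAt_diagAct : ∀ (n : ℕ) (i : Fin (n + 1)) (h : H) (x : tpow k H (n + 1)),
    counitAt k H n i (diagAct k H (n + 1) h x) = diagAct k H n h (counitAt k H n i x)
  | 0, i, h, x => by
    obtain ⟨x, rfl⟩ := (cons k H 0).surjective x
    induction x with
    | zero => simp
    | add a b ha hb => simp only [map_add, ha, hb]
    | tmul y t =>
      obtain ⟨z, rfl⟩ := (single k H).surjective t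
      have h1 : ∀ U : H ⊗[k] H, counitAt k H 0 i (cons k H 0 (TensorProduct.map
          (LinearMap.mulRight k y) ((diagAct k H 0).flip (single k H z)) U)) =
          Coalgebra.counit (R := k) z • single k H (LinearMap.mulRight k y
            (TensorProduct.rid k H ((Coalgebra.counit (R := k) (A := H)).lTensor H U))) := by
        intro U
        induction U with
        | zero => simp
        | add a b ha hb => simp only [map_add, smul_add, ha, hb]
        | tmul a b => simp [diagAct_single, counitAt_zero, smul_smul, mul_comm]
      rw [diagAct_cons, counitAt_zero, h1, Coalgebra.lTensor_counit_comul]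
      simp [diagAct_single]
  | n + 1, i, h, x => by
    obtain ⟨x, rfl⟩ := (cons k H (n + 1)).surjective x
    induction x with
    | zero => simp
    | add a b ha hb => simp only [map_add, ha, hb]
    | tmul y t =>
      cases i using Fin.cases with
      | zero =>
        obtain ⟨t, rfl⟩ := (cons k H n).surjective t
        induction t with
        | zero => simp
        | add a b ha hb => simp only [map_add, TensorProduct.tmul_add, ha, hb]
        | tmul z t =>
          rw [diagAct_cons, counitAt_cons_zero, map_smul, diagAct_cons]
          generalize (Coalgebra.comul (R := k) h) = U
          induction U with
          | zero => simp
          | add a b ha hb => simp only [map_add, smul_add, ha, hb]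
          | tmul a b =>
            have h1 : ∀ U : H ⊗[k] H, counitAt k H (n + 1) 0 (cons k H (n + 1)
                ((a * y) ⊗ₜ cons k H n (TensorProduct.map
                  (LinearMap.mulRight k z) ((diagAct k H n).flip t) U))) =
                Coalgebra.counit (R := k) z • cons k H n ((a * y) ⊗ₜ
                  ((diagAct k H n).flip t (TensorProduct.lid k H
                    ((Coalgebra.counit (R := k) (A := H)).rTensor H U)))) := by
              intro U
              induction U with
              | zero => simp
              | add a b ha hb => simp only [map_add, TensorProduct.tmul_add, smul_add, ha, hb]
              | tmul c d => simp [counitAt_cons_zero, smul_smul, mul_comm]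
            rw [TensorProduct.map_tmul, LinearMap.flip_apply, diagAct_cons,
              LinearMap.mulRight_apply, h1, Coalgebra.rTensor_counit_comul]
            simp
      | succ j =>
        rw [counitAt_cons_succ, diagAct_cons, diagAct_cons]
        generalize (Coalgebra.comul (R := k) h) = U
        induction U with
        | zero => simp
        | add a b ha hb => simp only [map_add, ha, hb]
        | tmul a b => simp [counitAt_cons_succ, counitAt_diagAct n j]

variable {M : Type w} [AddCommGroup M] [Module k M] (S : SAYDModule k H M)

/-- The subspace of `M ⊗ H^{⊗(n+1)}` spanned by all `mh ⊗ x - m ⊗ h · x`. -/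
noncomputable def balancing (n : ℕ) : Submodule k (M ⊗[k] tpow k H n) :=
  Submodule.span k {z | ∃ m h x, z = S.act m h ⊗ₜ[k] x - m ⊗ₜ[k] diagAct k H n h x}

/-- `Cⁿ(H, M) = M ⊗_H H^{⊗(n+1)}`. -/
noncomputable abbrev HopfCochain (n : ℕ) : Type (max w v) := (M ⊗[k] tpow k H n) ⧸ balancing S n

/-- `id_M ⊗_H f`, for an `H`-linear map `f : H^{⊗(m+1)} → H^{⊗(n+1)}`. -/
noncomputable def cochainMap {m n : ℕ} (f : tpow k H m →ₗ[k] tpow k H n)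
    (hf : ∀ h x, f (diagAct k H m h x) = diagAct k H n h (f x)) :
    HopfCochain S m →ₗ[k] HopfCochain S n :=
  (balancing S m).mapQ (balancing S n) (f.lTensor M) <| by
    refine Submodule.span_le.2 ?_
    rintro _ ⟨a, h, x, rfl⟩
    exact Submodule.subset_span ⟨a, h, f x, by simp [hf]⟩

/-- `m ⊗ x ↦ m⁽⁰⁾ ⊗ rotate (m⁽⁻¹⁾ ⊗ x)`. -/
noncomputable def preTau (n : ℕ) : M ⊗[k] tpow k H n →ₗ[k] M ⊗[k] tpow k H n :=
  (rotate k H n).lTensor M ∘ₗ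
    (TensorProduct.leftComm k H M (tpow k H n)).toLinearMap ∘ₗ
      (TensorProduct.assoc k H M (tpow k H n)).toLinearMap ∘ₗ S.coact.rTensor (tpow k H n)

theorem balancing_le_comap_preTau (n : ℕ) :
    balancing S n ≤ (balancing S n).comap (preTau S n) := by
  refine Submodule.span_le.2 ?_
  rintro _ ⟨m, h, x, rfl⟩
  change preTau S n _ ∈ balancing S n
  rw [map_sub, ← Submodule.Quotient.mk_eq_zero, Submodule.Quotient.mk_sub, sub_eq_zero]
  let P (x : tpow k H n) : H ⊗[k] M →ₗ[k] HopfCochain S n :=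
    (balancing S n).mkQ ∘ₗ (rotate k H n).lTensor M ∘ₗ
      (TensorProduct.leftComm k H M (tpow k H n)).toLinearMap ∘ₗ
        (TensorProduct.assoc k H M (tpow k H n)).toLinearMap ∘ₗ
          (TensorProduct.mk k (H ⊗[k] M) (tpow k H n)).flip x
  have hP : ∀ m x, (Submodule.Quotient.mk (preTau S n (m ⊗ₜ x)) : HopfCochain S n) =
      P x (S.coact m) := fun m x => rfl
  rw [hP, hP, S.ayd]
  generalize S.coact m = U
  induction U with
  | zero => simp
  | add a b ha hb => simp only [map_add, ha, hb]
  | tmul g m =>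
    let G : H ⊗[k] (H ⊗[k] H) →ₗ[k] tpow k H n :=
      TensorProduct.lift ((diagAct k H n).flip ∘ₗ
        rotate k H n ∘ₗ (TensorProduct.mk k H (tpow k H n)).flip x) ∘ₗ
        (aydTwist (LinearMap.mul k H)).flip (g ⊗ₜ 1)
    have hG : ∀ a b c : H, G (a ⊗ₜ (b ⊗ₜ c)) = diagAct k H n b
        (rotate k H n ((HopfAlgebra.antipode k c * (g * a)) ⊗ₜ x)) := by
      intro a b c
      simp [G, aydTwist_tmul]
    have h1 : P x ∘ₗ (aydTwist S.act).flip (g ⊗ₜ m) =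
        (balancing S n).mkQ ∘ₗ TensorProduct.mk k M (tpow k H n) m ∘ₗ G := by
      ext a b c
      simp only [P, TensorProduct.AlgebraTensorModule.curry_apply, LinearMap.restrictScalars_self,
        TensorProduct.curry_apply, LinearMap.comp_apply, LinearMap.flip_apply, aydTwist_tmul,
        TensorProduct.mk_apply, LinearEquiv.coe_coe, TensorProduct.assoc_tmul,
        TensorProduct.leftComm_tmul, LinearMap.lTensor_tmul, hG, Submodule.mkQ_apply]
      exact (Submodule.Quotient.eq _).2 (Submodule.subset_span ⟨_, _, _, rfl⟩)
    have h2 := LinearMap.congr_fun h1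
      ((Coalgebra.comul (R := k) (A := H)).lTensor H (Coalgebra.comul (R := k) h))
    simp only [LinearMap.comp_apply, LinearMap.flip_apply, rotate_twist n g h x G hG] at h2
    rw [h2]
    simp [P]

/-- The cocyclic operator `m ⊗ h₀ ⊗ ⋯ ⊗ hₙ ↦ m⁽⁰⁾ ⊗ h₁ ⊗ ⋯ ⊗ hₙ ⊗ m⁽⁻¹⁾ h₀`. -/
noncomputable def cochainTau (n : ℕ) : HopfCochain S n →ₗ[k] HopfCochain S n :=
  (balancing S n).mapQ (balancing S n) (preTau S n) (balancing_le_comap_preTau S n)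

/-- The cofaces `δᵢ : Cⁿ → Cⁿ⁺¹`. For `i ≤ n` they apply `Δ` to `hᵢ`; the last one is the flip-over
face `m ⊗ h₀ ⊗ ⋯ ⊗ hₙ ↦ m⁽⁰⁾ ⊗ h₀⁽²⁾ ⊗ h₁ ⊗ ⋯ ⊗ hₙ ⊗ m⁽⁻¹⁾ h₀⁽¹⁾`, which is `τ δ₀`. -/
noncomputable def cochainCoface (n : ℕ) (i : Fin (n + 2)) :
    HopfCochain S n →ₗ[k] HopfCochain S (n + 1) :=
  Fin.lastCases
    (cochainTau S (n + 1) ∘ₗ cochainMap S (comulAt k H n 0) (comulAt_diagAct n 0))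
    (fun j => cochainMap S (comulAt k H n j) (comulAt_diagAct n j)) i

/-- The codegeneracies `σᵢ : Cⁿ⁺¹ → Cⁿ`, applying `ε` to `hᵢ₊₁`. -/
noncomputable def cochainCodegeneracy (n : ℕ) (i : Fin (n + 1)) :
    HopfCochain S (n + 1) →ₗ[k] HopfCochain S n :=
  cochainMap S (counitAt k H n i) (counitAt_diagAct n i)

end Cochains

section Omega

variable {k : Type u} [Field k] {H : Type v} [Ring H] [HopfAlgebra k H]
  {M : Type w} [AddCommGroup M] [Module k M]
  {K : Type v'} [Ring K] [HopfAlgebra k K]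
  {N : Type w'} [AddCommGroup N] [Module k N]

variable (k H K) in
/-- `(h₀ ⊗ k₀) ⊗ ⋯ ⊗ (hₙ ⊗ kₙ) ↦ (h₀ ⊗ ⋯ ⊗ hₙ) ⊗ (k₀ ⊗ ⋯ ⊗ kₙ)`. -/
noncomputable def tpowSplit :
    ∀ n, (tpow k (H ⊗[k] K) n →ₗ[k] tpow k H n ⊗[k] tpow k K n)
  | 0 => TensorProduct.map (single k H).toLinearMap (single k K).toLinearMap ∘ₗ
      (single k (H ⊗[k] K)).symm.toLinearMap
  | n + 1 => TensorProduct.map (cons k H n).toLinearMap (cons k K n).toLinearMap ∘ₗ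
      (TensorProduct.tensorTensorTensorComm k H K (tpow k H n) (tpow k K n)).toLinearMap ∘ₗ
        (tpowSplit n).lTensor (H ⊗[k] K) ∘ₗ (cons k (H ⊗[k] K) n).symm.toLinearMap

theorem tpowSplit_single (z : H ⊗[k] K) : tpowSplit k H K 0 (single k (H ⊗[k] K) z) =
    TensorProduct.map (single k H).toLinearMap (single k K).toLinearMap z := by
  simp [tpowSplit]

theorem tpowSplit_cons (n : ℕ) (z : H ⊗[k] K) (t : tpow k (H ⊗[k] K) n) :
    tpowSplit k H K (n + 1) (cons k (H ⊗[k] K) n (z ⊗ₜ t)) =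
      TensorProduct.map (cons k H n).toLinearMap (cons k K n).toLinearMap
        (TensorProduct.tensorTensorTensorComm k H K (tpow k H n) (tpow k K n)
          (z ⊗ₜ tpowSplit k H K n t)) := by
  simp [tpowSplit]

theorem tpowSplit_diagAct : ∀ (n : ℕ) (h : H) (g : K) (x : tpow k (H ⊗[k] K) n),
    tpowSplit k H K n (diagAct k (H ⊗[k] K) n (h ⊗ₜ g) x) =
      TensorProduct.map (diagAct k H n h) (diagAct k K n g) (tpowSplit k H K n x)
  | 0, h, g, x => by
    obtain ⟨z, rfl⟩ := (single k (H ⊗[k] K)).surjective x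
    rw [diagAct_single, tpowSplit_single, tpowSplit_single]
    induction z with
    | zero => simp
    | add a b ha hb => simp only [mul_add, map_add, ha, hb]
    | tmul y y' => simp [diagAct_single]
  | n + 1, h, g, x => by
    obtain ⟨x, rfl⟩ := (cons k (H ⊗[k] K) n).surjective x
    induction x with
    | zero => simp
    | add a b ha hb => simp only [map_add, ha, hb]
    | tmul z t =>
      induction z with
      | zero => simp
      | add a b ha hb => simp only [map_add, TensorProduct.add_tmul, ha, hb]
      | tmul y y' =>
        rw [diagAct_cons, tpowSplit_cons]
        have h1 : tpowSplit k H K n ∘ₗ (diagAct k (H ⊗[k] K) n).flip t =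
            tensorAct (diagAct k H n).flip (diagAct k K n).flip (tpowSplit k H K n t) := by
          ext a b
          simp only [TensorProduct.AlgebraTensorModule.curry_apply,
            LinearMap.restrictScalars_self, TensorProduct.curry_apply, LinearMap.comp_apply,
            LinearMap.flip_apply, tpowSplit_diagAct n]
          generalize tpowSplit k H K n t = s
          induction s with
          | zero => simp
          | add a b ha hb => simp only [map_add, LinearMap.add_apply, ha, hb]
          | tmul a b => simp [tensorAct_tmul]
        have h2 : ∀ W : (H ⊗[k] K) ⊗[k] (H ⊗[k] K),
            tpowSplit k H K (n + 1) (cons k (H ⊗[k] K) n (TensorProduct.map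
              (LinearMap.mulRight k (y ⊗ₜ[k] y')) ((diagAct k (H ⊗[k] K) n).flip t) W)) =
            TensorProduct.map (cons k H n).toLinearMap (cons k K n).toLinearMap
              (TensorProduct.tensorTensorTensorComm k H K (tpow k H n) (tpow k K n)
                (TensorProduct.map (LinearMap.mulRight k (y ⊗ₜ[k] y'))
                  (tensorAct (diagAct k H n).flip (diagAct k K n).flip
                    (tpowSplit k H K n t)) W)) := by
          intro W
          induction W with
          | zero => simp
          | add a b ha hb => simp only [map_add, ha, hb]
          | tmul a b => rw [TensorProduct.map_tmul, tpowSplit_cons, ← h1]; rfl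
        rw [h2]
        generalize tpowSplit k H K n t = s
        induction s with
        | zero => simp
        | add a b ha hb =>
          simp only [map_add, TensorProduct.tmul_add, TensorProduct.map_add_right,
            LinearMap.add_apply, ha, hb]
        | tmul a b =>
          rw [TensorProduct.comul_tmul, TensorProduct.tensorTensorTensorComm_tmul,
            TensorProduct.map_tmul, TensorProduct.map_tmul, LinearEquiv.coe_coe,
            LinearEquiv.coe_coe, diagAct_cons, diagAct_cons]
          generalize (Coalgebra.comul (R := k) h) = U
          generalize (Coalgebra.comul (R := k) g) = V
          induction U with
          | zero => simp
          | add a b ha hb => simp only [map_add, TensorProduct.add_tmul, ha, hb]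
          | tmul p q =>
            induction V with
            | zero => simp
            | add a b ha hb => simp only [map_add, TensorProduct.tmul_add, ha, hb]
            | tmul p' q' => simp [tensorAct_tmul]

variable (S : SAYDModule k H M) (T : SAYDModule k K N)

/-- `(m ⊗ n) ⊗ x ↦ ∑ (m ⊗_H x') ⊗ (n ⊗_K x'')`, where `x ↦ ∑ x' ⊗ x''` is `tpowSplit`. -/
noncomputable def preOmega (n : ℕ) : (M ⊗[k] N) ⊗[k] tpow k (H ⊗[k] K) n →ₗ[k]
    HopfCochain S n ⊗[k] HopfCochain T n :=
  TensorProduct.map (balancing S n).mkQ (balancing T n).mkQ ∘ₗ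
    (TensorProduct.tensorTensorTensorComm k M N (tpow k H n) (tpow k K n)).toLinearMap ∘ₗ
      (tpowSplit k H K n).lTensor (M ⊗[k] N)

theorem balancing_le_ker_preOmega (n : ℕ) :
    balancing (S.tensor T) n ≤ LinearMap.ker (preOmega S T n) := by
  refine Submodule.span_le.2 ?_
  rintro _ ⟨z, g, x, rfl⟩
  change preOmega S T n _ = 0
  rw [map_sub, sub_eq_zero]
  change preOmega S T n (tensorAct S.act T.act z g ⊗ₜ x) = _
  induction z with
  | zero => simp
  | add a b ha hb => simp only [map_add, LinearMap.add_apply, TensorProduct.add_tmul, ha, hb]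
  | tmul a b =>
    induction g with
    | zero => simp
    | add a b ha hb =>
      simp only [map_add, LinearMap.add_apply, TensorProduct.add_tmul, TensorProduct.tmul_add,
        ha, hb]
    | tmul h h' =>
      rw [tensorAct_tmul]
      simp only [preOmega, LinearMap.comp_apply, LinearMap.lTensor_tmul, tpowSplit_diagAct,
        LinearEquiv.coe_coe]
      generalize tpowSplit k H K n x = s
      induction s with
      | zero => simp
      | add a b ha hb => simp only [map_add, TensorProduct.tmul_add, ha, hb]
      | tmul p q =>
        simp only [TensorProduct.tensorTensorTensorComm_tmul, TensorProduct.map_tmul,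
          Submodule.mkQ_apply]
        congr 1
        · exact (Submodule.Quotient.eq _).2 (Submodule.subset_span ⟨_, _, _, rfl⟩)
        · exact (Submodule.Quotient.eq _).2 (Submodule.subset_span ⟨_, _, _, rfl⟩)

/-- The comparison map `Cⁿ(H ⊗ K, M ⊗ N) → Cⁿ(H, M) ⊗ Cⁿ(K, N)`,
`(m ⊗ n) ⊗ (h₀ ⊗ k₀) ⊗ ⋯ ⊗ (hₙ ⊗ kₙ) ↦ (m ⊗ h₀ ⊗ ⋯ ⊗ hₙ) ⊗ (n ⊗ k₀ ⊗ ⋯ ⊗ kₙ)`. -/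
noncomputable def omega (n : ℕ) :
    HopfCochain (S.tensor T) n →ₗ[k] HopfCochain S n ⊗[k] HopfCochain T n :=
  (balancing (S.tensor T) n).liftQ (preOmega S T n) (balancing_le_ker_preOmega S T n)

end Omega

section Complexes

/-- Cochain spaces `Xⁿ` with the operators of a cocyclic module: cofaces `δᵢ : Xⁿ → Xⁿ⁺¹`
(`0 ≤ i ≤ n + 1`), codegeneracies `σᵢ : Xⁿ⁺¹ → Xⁿ` (`0 ≤ i ≤ n`), cyclic operators `τₙ`.
Only the operators are recorded: the constructions below do not use the cocyclic identities. -/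
structure CocyclicOperators (k : Type u) [Field k] where
  X : ℕ → Type v
  [addCommGroup : ∀ n, AddCommGroup (X n)]
  [module : ∀ n, Module k (X n)]
  δ : ∀ n, Fin (n + 2) → (X n →ₗ[k] X (n + 1))
  σ : ∀ n, Fin (n + 1) → (X (n + 1) →ₗ[k] X n)
  τ : ∀ n, X n →ₗ[k] X n

/-- Cochain spaces with operators `b` of degree `1` and `B` of degree `-1`. -/
structure MixedOperators (k : Type u) [Field k] where
  X : ℕ → Type v
  [addCommGroup : ∀ n, AddCommGroup (X n)]
  [module : ∀ n, Module k (X n)]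
  b : ∀ n, X n →ₗ[k] X (n + 1)
  B : ∀ n, X (n + 1) →ₗ[k] X n

attribute [instance] CocyclicOperators.addCommGroup CocyclicOperators.module
  MixedOperators.addCommGroup MixedOperators.module

variable {k : Type u} [Field k]

namespace CocyclicOperators

variable (C : CocyclicOperators.{u, v} k)

/-- `λₙ = (-1)ⁿ τₙ`. -/
noncomputable def signedTau (n : ℕ) : C.X n →ₗ[k] C.X n := (-1 : k) ^ n • C.τ n

/-- The Hochschild differential `b = ∑ (-1)ⁱ δᵢ`. -/
noncomputable def hochschild (n : ℕ) : C.X n →ₗ[k] C.X (n + 1) :=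
  ∑ i : Fin (n + 2), (-1 : k) ^ (i : ℕ) • C.δ n i

/-- Connes' operator `B = N σ₋₁ (1 - λ)`, where `σ₋₁ = σₙ τₙ₊₁` and `N = 1 + λ + ⋯ + λⁿ`. -/
noncomputable def connes (n : ℕ) : C.X (n + 1) →ₗ[k] C.X n :=
  (∑ i ∈ Finset.range (n + 1), C.signedTau n ^ i) ∘ₗ (C.σ n (Fin.last n) ∘ₗ C.τ (n + 1)) ∘ₗ
    (LinearMap.id - C.signedTau (n + 1))

/-- The mixed complex of a cocyclic module. -/
noncomputable abbrev toMixed : MixedOperators.{u, v} k where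
  X := C.X
  b := C.hochschild
  B := C.connes

end CocyclicOperators

/-! ### Cohomology -/

/-- `ker g / im f` (more precisely `ker g / (ker g ∩ im f)`) for composable `f` and `g`, where
the image of `f` is given as a subspace `P`. -/
abbrev Cohomology {A : Type*} {A' : Type*} [AddCommGroup A] [Module k A] [AddCommGroup A']
    [Module k A'] (g : A →ₗ[k] A') (P : Submodule k A) : Type _ :=
  LinearMap.ker g ⧸ P.submoduleOf (LinearMap.ker g)

/-- `z` is a cocycle representing the class `x`. -/
def Represents {A : Type*} {A' : Type*} [AddCommGroup A] [Module k A] [AddCommGroup A']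
    [Module k A'] {g : A →ₗ[k] A'} {P : Submodule k A} (z : A) (x : Cohomology g P) : Prop :=
  ∃ hz : z ∈ LinearMap.ker g, Submodule.Quotient.mk ⟨z, hz⟩ = x

/-- The coboundaries of degree `n` in a cochain complex concentrated in degrees `≥ 0`. -/
def coboundaries {X : ℕ → Type*} [∀ n, AddCommGroup (X n)] [∀ n, Module k (X n)]
    (d : ∀ n, X n →ₗ[k] X (n + 1)) : ∀ n, Submodule k (X n)
  | 0 => ⊥
  | n + 1 => LinearMap.range (d n)

/-! ### Künneth sums -/

section KunnethSum

variable {ι : Type*} [Add ι] [DecidableEq ι]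
  (X : ι → Type*) [∀ i, AddCommGroup (X i)] [∀ i, Module k (X i)]
  (Y : ι → Type*) [∀ i, AddCommGroup (Y i)] [∀ i, Module k (Y i)]

variable (k) in
/-- `⨁_{i + j = n} Xⁱ ⊗ Yʲ`. -/
abbrev KunnethSum (n : ι) : Type _ :=
  ⨁ p : {p : ι × ι // p.1 + p.2 = n}, X p.1.1 ⊗[k] Y p.1.2

variable (k) in
/-- The inclusion of `Xⁱ ⊗ Yʲ` into `⨁_{i + j = n} Xⁱ ⊗ Yʲ`. -/
noncomputable def KunnethSum.incl {n : ι} (i j : ι) (h : i + j = n) :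
    X i ⊗[k] Y j →ₗ[k] KunnethSum k X Y n :=
  DirectSum.lof k {p : ι × ι // p.1 + p.2 = n} (fun p => X p.1.1 ⊗[k] Y p.1.2) ⟨(i, j), h⟩

variable {X Y}

/-- `f ⊗ g` on Künneth sums. -/
noncomputable def KunnethSum.map {X' : ι → Type*} [∀ i, AddCommGroup (X' i)]
    [∀ i, Module k (X' i)] {Y' : ι → Type*} [∀ i, AddCommGroup (Y' i)] [∀ i, Module k (Y' i)]
    (f : ∀ i, X i →ₗ[k] X' i) (g : ∀ i, Y i →ₗ[k] Y' i) (n : ι) :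
    KunnethSum k X Y n →ₗ[k] KunnethSum k X' Y' n :=
  DirectSum.toModule k _ _ fun p =>
    KunnethSum.incl k X' Y' p.1.1 p.1.2 p.2 ∘ₗ TensorProduct.map (f p.1.1) (g p.1.2)

end KunnethSum

section NatKunneth

variable {X : ℕ → Type*} [∀ n, AddCommGroup (X n)] [∀ n, Module k (X n)]
  {Y : ℕ → Type*} [∀ n, AddCommGroup (Y n)] [∀ n, Module k (Y n)]

/-- The tensor product differential `x ⊗ y ↦ d x ⊗ y + (-1)ⁱ x ⊗ d y` for `x ∈ Xⁱ`. -/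
noncomputable def tensorDifferential (d : ∀ n, X n →ₗ[k] X (n + 1))
    (d' : ∀ n, Y n →ₗ[k] Y (n + 1)) (n : ℕ) :
    KunnethSum k X Y n →ₗ[k] KunnethSum k X Y (n + 1) :=
  DirectSum.toModule k _ _ fun p =>
    KunnethSum.incl k X Y (p.1.1 + 1) p.1.2 (by have := p.2; omega) ∘ₗ
        (d p.1.1).rTensor (Y p.1.2) +
      (-1 : k) ^ p.1.1 • KunnethSum.incl k X Y p.1.1 (p.1.2 + 1) (by have := p.2; omega) ∘ₗ
        (d' p.1.2).lTensor (X p.1.1)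

/-- The summand `B ⊗ id` of the tensor product `B`, on `Xⁱ ⊗ Yʲ` with `i + j = n + 1`. -/
noncomputable def tensorLowerLeft (B : ∀ n, X (n + 1) →ₗ[k] X n) (n : ℕ) :
    ∀ i j : ℕ, i + j = n + 1 → (X i ⊗[k] Y j →ₗ[k] KunnethSum k X Y n)
  | 0, _, _ => 0
  | i + 1, j, h => KunnethSum.incl k X Y i j (by omega) ∘ₗ (B i).rTensor (Y j)

/-- The summand `(-1)ⁱ id ⊗ B` of the tensor product `B`, on `Xⁱ ⊗ Yʲ` with `i + j = n + 1`. -/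
noncomputable def tensorLowerRight (B' : ∀ n, Y (n + 1) →ₗ[k] Y n) (n : ℕ) :
    ∀ i j : ℕ, i + j = n + 1 → (X i ⊗[k] Y j →ₗ[k] KunnethSum k X Y n)
  | _, 0, _ => 0
  | i, j + 1, h => (-1 : k) ^ i • KunnethSum.incl k X Y i j (by omega) ∘ₗ (B' j).lTensor (X i)

/-- `S ⊗ id - id ⊗ S`, for operators `S` of degree `2`. -/
noncomputable def differenceS (s : ∀ n, X n →ₗ[k] X (n + 2)) (s' : ∀ n, Y n →ₗ[k] Y (n + 2))
    (n : ℕ) : KunnethSum k X Y n →ₗ[k] KunnethSum k X Y (n + 2) :=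
  DirectSum.toModule k _ _ fun p =>
    KunnethSum.incl k X Y (p.1.1 + 2) p.1.2 (by have := p.2; omega) ∘ₗ
        (s p.1.1).rTensor (Y p.1.2) -
      KunnethSum.incl k X Y p.1.1 (p.1.2 + 2) (by have := p.2; omega) ∘ₗ
        (s' p.1.2).lTensor (X p.1.1)

end NatKunneth

namespace MixedOperators

variable (C : MixedOperators.{u, v} k) (D : MixedOperators.{u, w} k)

/-- The tensor product mixed complex. -/
noncomputable abbrev tensor : MixedOperators.{u, max v w} k where
  X := KunnethSum k C.X D.X
  b := tensorDifferential C.b D.b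
  B n := DirectSum.toModule k _ _ fun p =>
    tensorLowerLeft C.B n p.1.1 p.1.2 p.2 + tensorLowerRight D.B n p.1.1 p.1.2 p.2

/-- Hochschild cohomology: the cohomology of `b`. -/
abbrev HH (n : ℕ) : Type v := Cohomology (C.b n) (coboundaries C.b n)

/-! The total complex `Tot 𝓑(C) = k[u] ⊗ C` of the `(b, B)`-bicomplex, with `|u| = 2` and
differential `b + u B`; the summand with index `(i, m)` is `uⁱ ⊗ Cᵐ`. -/

/-- `Totⁿ 𝓑(C) = ⨁_{2 i + m = n} uⁱ ⊗ Cᵐ`. -/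
abbrev Tot (n : ℕ) : Type v := ⨁ p : {p : ℕ × ℕ // 2 * p.1 + p.2 = n}, C.X p.1.2

/-- `x ↦ uⁱ ⊗ x`. -/
noncomputable def totIncl {n : ℕ} (i m : ℕ) (h : 2 * i + m = n) : C.X m →ₗ[k] C.Tot n :=
  DirectSum.lof k {p : ℕ × ℕ // 2 * p.1 + p.2 = n} (fun p => C.X p.1.2) ⟨(i, m), h⟩

/-- `uⁱ ⊗ x ↦ uⁱ⁺¹ ⊗ B x`, which vanishes on `C⁰`. -/
noncomputable def totLower (n : ℕ) : ∀ i m : ℕ, 2 * i + m = n → (C.X m →ₗ[k] C.Tot (n + 1))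
  | _, 0, _ => 0
  | i, m + 1, h => C.totIncl (i + 1) m (by omega) ∘ₗ C.B m

/-- The total differential `b + B`. -/
noncomputable def totD (n : ℕ) : C.Tot n →ₗ[k] C.Tot (n + 1) :=
  DirectSum.toModule k _ _ fun p =>
    C.totIncl p.1.1 (p.1.2 + 1) (by have := p.2; omega) ∘ₗ C.b p.1.2 +
      C.totLower n p.1.1 p.1.2 p.2

/-- Multiplication by `u`. -/
noncomputable def totS (n : ℕ) : C.Tot n →ₗ[k] C.Tot (n + 2) :=
  DirectSum.toModule k _ _ fun p => C.totIncl (p.1.1 + 1) p.1.2 (by have := p.2; omega)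

/-- The projection `Totⁿ 𝓑(C) → Cⁿ` to the component of `u⁰`. -/
noncomputable def totTop (n : ℕ) : C.Tot n →ₗ[k] C.X n :=
  DirectSum.component k {p : ℕ × ℕ // 2 * p.1 + p.2 = n} (fun p => C.X p.1.2)
    ⟨(0, n), by simp⟩

theorem totD_totIncl {n : ℕ} (i m : ℕ) (h : 2 * i + m = n) (x : C.X m) :
    C.totD n (C.totIncl i m h x) =
      C.totIncl i (m + 1) (by omega) (C.b m x) + C.totLower n i m h x := by
  simp [totD, totIncl]

theorem totS_totIncl {n : ℕ} (i m : ℕ) (h : 2 * i + m = n) (x : C.X m) :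
    C.totS n (C.totIncl i m h x) = C.totIncl (i + 1) m (by omega) x := by
  simp [totS, totIncl]

theorem totD_comp_totS (n : ℕ) : C.totD (n + 2) ∘ₗ C.totS n = C.totS (n + 1) ∘ₗ C.totD n := by
  refine DirectSum.linearMap_ext k fun ⟨⟨i, m⟩, h⟩ => LinearMap.ext fun x => ?_
  change C.totD _ (C.totS _ (C.totIncl i m h x)) = C.totS _ (C.totD _ (C.totIncl i m h x))
  rw [totS_totIncl, totD_totIncl, totD_totIncl, map_add, totS_totIncl]
  congr 1
  cases m with
  | zero => simp [totLower]
  | succ m =>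
    change C.totIncl _ _ _ _ = C.totS _ (C.totIncl _ _ _ _)
    rw [totS_totIncl]

/-- Cyclic cohomology: the cohomology of `Tot 𝓑(C)`. -/
abbrev HC (n : ℕ) : Type v := Cohomology (C.totD n) (coboundaries C.totD n)

/-- Connes' periodicity operator `S : HCⁿ → HCⁿ⁺²`. -/
noncomputable def S (n : ℕ) : C.HC n →ₗ[k] C.HC (n + 2) :=
  Submodule.mapQ _ _
    ((C.totS n).restrict (p := LinearMap.ker (C.totD n)) (q := LinearMap.ker (C.totD (n + 2)))
      fun x hx => by
        have := LinearMap.congr_fun (C.totD_comp_totS n) x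
        simp only [LinearMap.comp_apply] at this
        rw [LinearMap.mem_ker] at hx ⊢
        rw [this, hx, map_zero])
    (by
      rintro ⟨x, hx⟩ hx'
      cases n with
      | zero =>
        obtain rfl : x = 0 := by
          have : x ∈ coboundaries C.totD 0 := hx'
          simpa [coboundaries] using this
        change C.totS 0 0 ∈ coboundaries C.totD 2
        simp
      | succ n =>
        obtain ⟨y, hy⟩ : x ∈ LinearMap.range (C.totD n) := hx'
        have := LinearMap.congr_fun (C.totD_comp_totS n) y
        exact ⟨C.totS n y, this.trans (congrArg (C.totS (n + 1)) hy)⟩)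

/-! The periodic complex is the `ℤ/2`-graded complex `(⨁_{n even} Cⁿ) ⊕ (⨁_{n odd} Cⁿ)` with
differential `b + B`. -/

/-- `⨁_{n ≡ p mod 2} Cⁿ`. -/
abbrev Per (p : ZMod 2) : Type v := ⨁ n : {n : ℕ // (n : ZMod 2) = p}, C.X n.1

/-- The inclusion of `Cⁿ`. -/
noncomputable def perIncl {p : ZMod 2} (n : ℕ) (h : (n : ZMod 2) = p) : C.X n →ₗ[k] C.Per p :=
  DirectSum.lof k {n : ℕ // (n : ZMod 2) = p} (fun n => C.X n.1) ⟨n, h⟩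

theorem zmod_two_add_two (p : ZMod 2) : p + 1 + 1 = p := by
  revert p; decide

/-- `x ↦ B x`, which vanishes on `C⁰`. -/
noncomputable def perLower (p q : ZMod 2) (hq : q = p + 1) :
    ∀ n : ℕ, (n : ZMod 2) = p → (C.X n →ₗ[k] C.Per q)
  | 0, _ => 0
  | n + 1, h => C.perIncl n (by
      subst hq
      rw [← h, Nat.cast_add, Nat.cast_one, zmod_two_add_two]) ∘ₗ C.B n

/-- The differential `b + B` of the periodic complex. -/
noncomputable def perD (p q : ZMod 2) (hq : q = p + 1) : C.Per p →ₗ[k] C.Per q :=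
  DirectSum.toModule k _ _ fun n =>
    C.perIncl (n.1 + 1) (by have := n.2; rw [hq, Nat.cast_add, Nat.cast_one, this]) ∘ₗ C.b n.1 +
      C.perLower p q hq n.1 n.2

/-- Periodic cyclic cohomology. -/
abbrev HP (p : ZMod 2) : Type v :=
  Cohomology (C.perD p (p + 1) rfl)
    (LinearMap.range (C.perD (p + 1) p (zmod_two_add_two p).symm))

/-- The map `uⁱ ⊗ x ↦ x` from `Totⁿ 𝓑(C)` to the periodic complex. -/
noncomputable def totToPer (n : ℕ) : C.Tot n →ₗ[k] C.Per (n : ZMod 2) :=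
  DirectSum.toModule k _ _ fun p => C.perIncl p.1.2 (by
    have h : ((2 * p.1.1 + p.1.2 : ℕ) : ZMod 2) = (n : ZMod 2) := congrArg _ p.2
    have h2 : (2 : ZMod 2) = 0 := rfl
    rw [← h, Nat.cast_add, Nat.cast_mul, Nat.cast_ofNat, h2, zero_mul, zero_add])

variable {C D}

/-- The product `(uⁱ ⊗ x) ⊗ (uʲ ⊗ y) ↦ uⁱ⁺ʲ ⊗ (x ⊗ y)`. -/
noncomputable def totMul {n : ℕ} (r s : ℕ) (h : r + s = n) :
    C.Tot r →ₗ[k] D.Tot s →ₗ[k] (C.tensor D).Tot n :=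
  DirectSum.toModule k _ _ fun p => LinearMap.flip <|
    DirectSum.toModule k _ _ fun q => LinearMap.flip <|
      (TensorProduct.mk k (C.X p.1.2) (D.X q.1.2)).compr₂
        ((C.tensor D).totIncl (p.1.1 + q.1.1) (p.1.2 + q.1.2)
            (by have := p.2; have := q.2; omega) ∘ₗ
          KunnethSum.incl k C.X D.X p.1.2 q.1.2 rfl)

/-- The product `x ⊗ y ↦ x ⊗ y` on periodic complexes. -/
noncomputable def perMul {n : ZMod 2} (p q : ZMod 2) (h : p + q = n) :
    C.Per p →ₗ[k] D.Per q →ₗ[k] (C.tensor D).Per n :=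
  DirectSum.toModule k _ _ fun i => LinearMap.flip <|
    DirectSum.toModule k _ _ fun j => LinearMap.flip <|
      (TensorProduct.mk k (C.X i.1) (D.X j.1)).compr₂
        ((C.tensor D).perIncl (i.1 + j.1) (by
          have hi := i.2; have hj := j.2; rw [← h, Nat.cast_add, hi, hj]) ∘ₗ
          KunnethSum.incl k C.X D.X i.1 j.1 rfl)

variable (C D) in
/-- The chain map `μ : (Tot 𝓑(C) ⊗ Tot 𝓑(D))ⁿ → Totⁿ 𝓑(C ⊗ D)`. -/
noncomputable def totMu (n : ℕ) : KunnethSum k C.Tot D.Tot n →ₗ[k] (C.tensor D).Tot n :=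
  DirectSum.toModule k _ _ fun p => TensorProduct.lift (totMul p.1.1 p.1.2 p.2)

end MixedOperators

namespace CocyclicOperators

variable (C : CocyclicOperators.{u, v} k) (D : CocyclicOperators.{u, w} k)

/-- The iterated last coface `δⁿ_n ⋯ δⁱ⁺¹_{i+1} : Xⁱ → Xⁿ`. -/
noncomputable def lastCofaces {i n : ℕ} (h : i ≤ n) : C.X i →ₗ[k] C.X n :=
  Nat.leRecOn (C := fun n => C.X i →ₗ[k] C.X n) h (fun {m} f => C.δ m (Fin.last (m + 1)) ∘ₗ f)
    LinearMap.id

/-- The iterated zeroth coface `δⁿ₀ ⋯ δʲ⁺¹₀ : Xʲ → Xⁿ`. -/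
noncomputable def zeroCofaces {j n : ℕ} (h : j ≤ n) : C.X j →ₗ[k] C.X n :=
  Nat.leRecOn (C := fun n => C.X j →ₗ[k] C.X n) h (fun {m} f => C.δ m 0 ∘ₗ f) LinearMap.id

/-- The Alexander–Whitney map `⨁_{i + j = n} Cⁱ ⊗ Dʲ → Cⁿ ⊗ Dⁿ`. -/
noncomputable def alexanderWhitney (n : ℕ) :
    KunnethSum k C.X D.X n →ₗ[k] C.X n ⊗[k] D.X n :=
  DirectSum.toModule k _ _ fun p =>
    TensorProduct.map (C.lastCofaces (by have := p.2; omega))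
      (D.zeroCofaces (by have := p.2; omega))

end CocyclicOperators

end Complexes

section Main

variable {k : Type u} [Field k] {H : Type v} [Ring H] [HopfAlgebra k H]
  {M : Type w} [AddCommGroup M] [Module k M]

/-- The cocyclic module `C(H, M)`. -/
noncomputable abbrev SAYDModule.cocyclic (S : SAYDModule k H M) :
    CocyclicOperators.{u, max w v} k where
  X := HopfCochain S
  δ := cochainCoface S
  σ := cochainCodegeneracy S
  τ := cochainTau S

/-- The mixed complex of `C(H, M)`. -/
noncomputable abbrev SAYDModule.mixed (S : SAYDModule k H M) :
    MixedOperators.{u, max w v} k := S.cocyclic.toMixed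

/-- Hopf Hochschild cohomology `HHⁿ(H, M)`. -/
abbrev SAYDModule.HH (S : SAYDModule k H M) (n : ℕ) : Type (max w v) := S.mixed.HH n

/-- Hopf cyclic cohomology `HCⁿ(H, M)`. -/
abbrev SAYDModule.HC (S : SAYDModule k H M) (n : ℕ) : Type (max w v) := S.mixed.HC n

/-- Periodic Hopf cyclic cohomology `HPᵖ(H, M)`. -/
abbrev SAYDModule.HP (S : SAYDModule k H M) (p : ZMod 2) : Type (max w v) := S.mixed.HP p

end Main

end HopfCyclic

open HopfCyclic

set_option linter.unusedSimpArgs false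

namespace HopfCyclic

section Shortcuts

variable {k V W : Type*} [Semiring k] [AddCommMonoid V] [Module k V] [AddCommMonoid W]
  [Module k W]

instance zeroHomClass_linearMap : ZeroHomClass (V →ₗ[k] W) V W := ⟨LinearMap.map_zero⟩

instance addHomClass_linearMap : AddHomClass (V →ₗ[k] W) V W := ⟨LinearMap.map_add⟩

end Shortcuts

section KunnethMaps

variable {k : Type u} [Field k] {ι : Type*} [Add ι] [DecidableEq ι]
  {X : ι → Type*} [∀ i, AddCommGroup (X i)] [∀ i, Module k (X i)]
  {Y : ι → Type*} [∀ i, AddCommGroup (Y i)] [∀ i, Module k (Y i)]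
  {X' : ι → Type*} [∀ i, AddCommGroup (X' i)] [∀ i, Module k (X' i)]
  {Y' : ι → Type*} [∀ i, AddCommGroup (Y' i)] [∀ i, Module k (Y' i)]

theorem KunnethSum.ext {n : ι} {V : Type*} [AddCommGroup V] [Module k V]
    {f g : KunnethSum k X Y n →ₗ[k] V}
    (h : ∀ i j (hij : i + j = n) (x : X i) (y : Y j),
      f (KunnethSum.incl k X Y i j hij (x ⊗ₜ y)) = g (KunnethSum.incl k X Y i j hij (x ⊗ₜ y))) :
    f = g := by
  refine DirectSum.linearMap_ext k fun ⟨⟨i, j⟩, hij⟩ => TensorProduct.ext' fun x y => ?_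
  exact h i j hij x y

theorem KunnethSum.induction {n : ι} {P : KunnethSum k X Y n → Prop}
    (t : KunnethSum k X Y n) (h0 : P 0) (hadd : ∀ s t, P s → P t → P (s + t))
    (h : ∀ i j (hij : i + j = n) (x : X i) (y : Y j),
      P (KunnethSum.incl k X Y i j hij (x ⊗ₜ y))) : P t := by
  induction t using DirectSum.induction_on with
  | zero => exact h0
  | add s t hs ht => exact hadd s t hs ht
  | of p z =>
    obtain ⟨⟨i, j⟩, hij⟩ := p
    induction z with
    | zero => rw [map_zero]; exact h0
    | add a b ha hb => rw [map_add]; exact hadd _ _ ha hb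
    | tmul x y => exact h i j hij x y

theorem KunnethSum.map_incl (f : ∀ i, X i →ₗ[k] X' i) (g : ∀ i, Y i →ₗ[k] Y' i) {n : ι}
    (i j : ι) (h : i + j = n) (z : X i ⊗[k] Y j) :
    KunnethSum.map f g n (KunnethSum.incl k X Y i j h z) =
      KunnethSum.incl k X' Y' i j h (TensorProduct.map (f i) (g j) z) := by
  simp [KunnethSum.map, KunnethSum.incl]

end KunnethMaps

section TensorDifferential

variable {k : Type u} [Field k]
  {X : ℕ → Type*} [∀ n, AddCommGroup (X n)] [∀ n, Module k (X n)]
  {Y : ℕ → Type*} [∀ n, AddCommGroup (Y n)] [∀ n, Module k (Y n)]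

theorem tensorDifferential_incl (d : ∀ n, X n →ₗ[k] X (n + 1)) (d' : ∀ n, Y n →ₗ[k] Y (n + 1))
    {n : ℕ} (i j : ℕ) (h : i + j = n) (x : X i) (y : Y j) :
    tensorDifferential d d' n (KunnethSum.incl k X Y i j h (x ⊗ₜ y)) =
      KunnethSum.incl k X Y (i + 1) j (by omega) (d i x ⊗ₜ y) +
        (-1 : k) ^ i • KunnethSum.incl k X Y i (j + 1) (by omega) (x ⊗ₜ d' j y) := by
  simp [tensorDifferential, KunnethSum.incl]

end TensorDifferential

/-- Cosimplicial modules, with operators indexed by natural numbers; only `δ n i` for `i ≤ n + 1`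
and `σ n i` for `i ≤ n` are meaningful. -/
structure Cosimplicial (k : Type u) [Field k] where
  X : ℕ → Type v
  [addCommGroup : ∀ n, AddCommGroup (X n)]
  [module : ∀ n, Module k (X n)]
  δ : ∀ n, ℕ → (X n →ₗ[k] X (n + 1))
  σ : ∀ n, ℕ → (X (n + 1) →ₗ[k] X n)
  δ_δ : ∀ n i j, i ≤ j → j ≤ n + 1 → ∀ x, δ (n + 1) (j + 1) (δ n i x) = δ (n + 1) i (δ n j x)
  σ_δ_lt : ∀ n i j, i ≤ j → j ≤ n → ∀ x, σ (n + 1) (j + 1) (δ (n + 1) i x) = δ n i (σ n j x)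
  σ_δ_self : ∀ n i, i ≤ n → ∀ x, σ n i (δ n i x) = x
  σ_δ_succ : ∀ n i, i ≤ n → ∀ x, σ n i (δ n (i + 1) x) = x
  σ_δ_gt : ∀ n i j, j < i → i ≤ n + 1 → ∀ x,
    σ (n + 1) j (δ (n + 1) (i + 1) x) = δ n i (σ n j x)
  σ_σ : ∀ n i j, i ≤ j → j ≤ n → ∀ x, σ n j (σ (n + 1) i x) = σ n i (σ (n + 1) (j + 1) x)

attribute [instance] Cosimplicial.addCommGroup Cosimplicial.module

namespace Cosimplicial

variable {k : Type u} [Field k]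

/-- The décalage, dropping `δ₀` and `σ₀`. -/
def dec (C : Cosimplicial.{u, v} k) : Cosimplicial.{u, v} k where
  X n := C.X (n + 1)
  δ n i := C.δ (n + 1) (i + 1)
  σ n i := C.σ (n + 1) (i + 1)
  δ_δ n i j h h' := C.δ_δ (n + 1) (i + 1) (j + 1) (by omega) (by omega)
  σ_δ_lt n i j h h' := C.σ_δ_lt (n + 1) (i + 1) (j + 1) (by omega) (by omega)
  σ_δ_self n i h := C.σ_δ_self (n + 1) (i + 1) (by omega)
  σ_δ_succ n i h := C.σ_δ_succ (n + 1) (i + 1) (by omega)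
  σ_δ_gt n i j h h' := C.σ_δ_gt (n + 1) (i + 1) (j + 1) (by omega) (by omega)
  σ_σ n i j h h' := C.σ_σ (n + 1) (i + 1) (j + 1) (by omega) (by omega)

/-- The alternating sum of the cofaces. -/
def b (C : Cosimplicial.{u, v} k) (n : ℕ) : C.X n →ₗ[k] C.X (n + 1) :=
  ∑ i ∈ Finset.range (n + 2), (-1 : k) ^ i • C.δ n i

theorem b_apply (C : Cosimplicial.{u, v} k) (n : ℕ) (x : C.X n) :
    C.b n x = ∑ i ∈ Finset.range (n + 2), (-1 : k) ^ i • C.δ n i x := by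
  simp [b, LinearMap.sum_apply]

/-- The identification of `C.X (n + 1)` with degree `n` of the décalage. -/
def shift (C : Cosimplicial.{u, v} k) (n : ℕ) : C.X (n + 1) ≃ₗ[k] C.dec.X n :=
  LinearEquiv.refl k (C.X (n + 1))

theorem dec_δ (C : Cosimplicial.{u, v} k) (n i : ℕ) (x : C.X (n + 1)) :
    C.dec.δ n i (C.shift n x) = C.shift (n + 1) (C.δ (n + 1) (i + 1) x) := rfl

theorem dec_σ (C : Cosimplicial.{u, v} k) (n i : ℕ) (x : C.X (n + 2)) :
    C.dec.σ n i (C.shift (n + 1) x) = C.shift n (C.σ (n + 1) (i + 1) x) := rfl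

theorem b_succ (C : Cosimplicial.{u, v} k) (n : ℕ) (x : C.X (n + 1)) :
    C.b (n + 1) x = C.δ (n + 1) 0 x - (C.shift (n + 1)).symm (C.dec.b n (C.shift n x)) := by
  rw [b_apply, b_apply, sub_eq_add_neg, map_sum, ← Finset.sum_neg_distrib]
  refine (Finset.sum_range_succ' _ (n + 2)).trans ?_
  simp [pow_succ, add_comm, dec_δ]

/-- Morphisms of cosimplicial modules. -/
structure Hom (C : Cosimplicial.{u, v} k) (D : Cosimplicial.{u, w} k) where
  f : ∀ n, C.X n →ₗ[k] D.X n
  f_δ : ∀ n i, i ≤ n + 1 → ∀ x, f (n + 1) (C.δ n i x) = D.δ n i (f n x)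
  f_σ : ∀ n i, i ≤ n → ∀ x, f n (C.σ n i x) = D.σ n i (f (n + 1) x)

/-- The identity morphism. -/
def Hom.id (C : Cosimplicial.{u, v} k) : Hom C C := ⟨fun _ => .id, by simp, by simp⟩

/-- The décalage of a morphism. -/
def Hom.dec {C : Cosimplicial.{u, v} k} {D : Cosimplicial.{u, w} k} (f : Hom C D) :
    Hom C.dec D.dec where
  f n := (D.shift n).toLinearMap ∘ₗ f.f (n + 1) ∘ₗ (C.shift n).symm.toLinearMap
  f_δ n i h := f.f_δ (n + 1) (i + 1) (by omega)
  f_σ n i h := f.f_σ (n + 1) (i + 1) (by omega)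

theorem Hom.dec_shift {C : Cosimplicial.{u, v} k} {D : Cosimplicial.{u, w} k} (f : Hom C D)
    (n : ℕ) (x : C.X (n + 1)) : f.dec.f n (C.shift n x) = D.shift n (f.f (n + 1) x) := rfl

/-- The coaugmentation `δ₀` of the décalage. -/
def decδ (C : Cosimplicial.{u, v} k) : Hom C C.dec where
  f n := (C.shift n).toLinearMap ∘ₗ C.δ n 0
  f_δ n i h x := (C.δ_δ n 0 i (by omega) (by omega) x).symm
  f_σ n i h x := (C.σ_δ_lt n 0 i (by omega) (by omega) x).symm

theorem decδ_apply (C : Cosimplicial.{u, v} k) (n : ℕ) (x : C.X n) :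
    C.decδ.f n x = C.shift n (C.δ n 0 x) := rfl

theorem Hom.id_apply (C : Cosimplicial.{u, v} k) (n : ℕ) (x : C.X n) :
    (Hom.id C).f n x = x := rfl

/-- The tensor product of cosimplicial modules, with diagonal operators. -/
abbrev diag (C : Cosimplicial.{u, v} k) (D : Cosimplicial.{u, w} k) :
    Cosimplicial.{u, max v w} k where
  X n := C.X n ⊗[k] D.X n
  δ n i := TensorProduct.map (C.δ n i) (D.δ n i)
  σ n i := TensorProduct.map (C.σ n i) (D.σ n i)
  δ_δ n i j h h' z := by
    simp only [← LinearMap.comp_apply, ← TensorProduct.map_comp]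
    congr 2 <;> ext x
    · exact C.δ_δ n i j h h' x
    · exact D.δ_δ n i j h h' x
  σ_δ_lt n i j h h' z := by
    simp only [← LinearMap.comp_apply, ← TensorProduct.map_comp]
    congr 2 <;> ext x
    · exact C.σ_δ_lt n i j h h' x
    · exact D.σ_δ_lt n i j h h' x
  σ_δ_self n i h z := by
    induction z with
    | zero => simp
    | add a b ha hb => simp only [map_add, ha, hb]
    | tmul x y => simp [C.σ_δ_self n i h, D.σ_δ_self n i h]
  σ_δ_succ n i h z := by
    induction z with
    | zero => simp
    | add a b ha hb => simp only [map_add, ha, hb]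
    | tmul x y => simp [C.σ_δ_succ n i h, D.σ_δ_succ n i h]
  σ_δ_gt n i j h h' z := by
    simp only [← LinearMap.comp_apply, ← TensorProduct.map_comp]
    congr 2 <;> ext x
    · exact C.σ_δ_gt n i j h h' x
    · exact D.σ_δ_gt n i j h h' x
  σ_σ n i j h h' z := by
    simp only [← LinearMap.comp_apply, ← TensorProduct.map_comp]
    congr 2 <;> ext x
    · exact C.σ_σ n i j h h' x
    · exact D.σ_σ n i j h h' x

/-- The total complex differential of `C ⊗ D`. -/
noncomputable abbrev dT (C : Cosimplicial.{u, v} k) (D : Cosimplicial.{u, w} k) (n : ℕ) :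
    KunnethSum k C.X D.X n →ₗ[k] KunnethSum k C.X D.X (n + 1) :=
  tensorDifferential C.b D.b n

section Shuffle

variable (C : Cosimplicial.{u, v} k) (D : Cosimplicial.{u, w} k)

/-- The part `i ≥ 1` of `⨁ Cⁱ ⊗ Dʲ` from the décalage of `C`. -/
noncomputable def incLeft (n : ℕ) :
    KunnethSum k C.dec.X D.X n →ₗ[k] KunnethSum k C.X D.X (n + 1) :=
  DirectSum.toModule k _ _ fun p =>
    KunnethSum.incl k C.X D.X (p.1.1 + 1) p.1.2 (by have := p.2; omega) ∘ₗ
      (C.shift p.1.1).symm.toLinearMap.rTensor (D.X p.1.2)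

/-- The part `j ≥ 1` of `⨁ Cⁱ ⊗ Dʲ` from the décalage of `D`, with sign `(-1)ⁱ`. -/
noncomputable def incRight (n : ℕ) :
    KunnethSum k C.X D.dec.X n →ₗ[k] KunnethSum k C.X D.X (n + 1) :=
  DirectSum.toModule k _ _ fun p =>
    (-1 : k) ^ p.1.1 • KunnethSum.incl k C.X D.X p.1.1 (p.1.2 + 1) (by have := p.2; omega) ∘ₗ
      (D.shift p.1.2).symm.toLinearMap.lTensor (C.X p.1.1)

theorem incLeft_incl {n : ℕ} (i j : ℕ) (h : i + j = n) (x : C.dec.X i) (y : D.X j) :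
    incLeft C D n (KunnethSum.incl k C.dec.X D.X i j h (x ⊗ₜ y)) =
      KunnethSum.incl k C.X D.X (i + 1) j (by omega) ((C.shift i).symm x ⊗ₜ y) := by
  simp [incLeft, KunnethSum.incl]

theorem incRight_incl {n : ℕ} (i j : ℕ) (h : i + j = n) (x : C.X i) (y : D.dec.X j) :
    incRight C D n (KunnethSum.incl k C.X D.dec.X i j h (x ⊗ₜ y)) =
      (-1 : k) ^ i • KunnethSum.incl k C.X D.X i (j + 1) (by omega) (x ⊗ₜ (D.shift j).symm y) := by
  simp [incRight, KunnethSum.incl]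

/-- `δ₀ ⊗ id`, into the décalage of the first factor. -/
noncomputable abbrev leftδ (n : ℕ) : KunnethSum k C.X D.X n →ₗ[k] KunnethSum k C.dec.X D.X n :=
  KunnethSum.map C.decδ.f (Hom.id D).f n

/-- `id ⊗ δ₀`, into the décalage of the second factor. -/
noncomputable abbrev rightδ (n : ℕ) : KunnethSum k C.X D.X n →ₗ[k] KunnethSum k C.X D.dec.X n :=
  KunnethSum.map (Hom.id C).f D.decδ.f n

theorem dT_incLeft (n : ℕ) (t : KunnethSum k C.dec.X D.X n) :
    dT C D (n + 1) (incLeft C D n t) =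
      incLeft C D (n + 1) (leftδ C D (n + 1) (incLeft C D n t)) -
        incLeft C D (n + 1) (dT C.dec D n t) := by
  induction t using KunnethSum.induction with
  | h0 => simp
  | hadd s t hs ht => simp only [map_add, hs, ht]; abel
  | h i j h x y =>
    obtain ⟨x, rfl⟩ := (C.shift i).surjective x
    simp only [incLeft_incl, tensorDifferential_incl, KunnethSum.map_incl,
      TensorProduct.map_tmul, map_add, map_smul, b_succ, TensorProduct.sub_tmul, map_sub, pow_succ,
      decδ_apply, Hom.id_apply, LinearEquiv.symm_apply_apply]
    module

theorem dT_incRight (n : ℕ) (t : KunnethSum k C.X D.dec.X n) :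
    dT C D (n + 1) (incRight C D n t) =
      incRight C D (n + 1) (rightδ C D (n + 1) (incRight C D n t)) -
        incRight C D (n + 1) (dT C D.dec n t) := by
  induction t using KunnethSum.induction with
  | h0 => simp
  | hadd s t hs ht => simp only [map_add, hs, ht]; abel
  | h i j h x y =>
    obtain ⟨y, rfl⟩ := (D.shift j).surjective y
    have e : (-1 : k) ^ i * (-1) ^ i = 1 := by rw [← mul_pow]; simp
    simp only [incRight_incl, tensorDifferential_incl, KunnethSum.map_incl,
      TensorProduct.map_tmul, map_add, map_smul, b_succ, TensorProduct.tmul_sub, map_sub, pow_succ,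
      decδ_apply, Hom.id_apply, LinearEquiv.symm_apply_apply, smul_add, smul_sub, smul_smul, e]
    module

theorem incRight_incLeft (n : ℕ) (t : KunnethSum k C.dec.X D.dec.X n) :
    incRight C D (n + 1) (incLeft C D.dec n t) =
      - incLeft C D (n + 1) (incRight C.dec D n t) := by
  induction t using KunnethSum.induction with
  | h0 => simp
  | hadd s t hs ht => simp only [map_add, hs, ht]; abel
  | h i j h x y =>
    simp only [incLeft_incl, incRight_incl, map_smul, pow_succ]
    module

theorem leftδ_incRight (n : ℕ) (t : KunnethSum k C.X D.dec.X n) :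
    leftδ C D (n + 1) (incRight C D n t) = incRight C.dec D n (leftδ C D.dec n t) := by
  induction t using KunnethSum.induction with
  | h0 => simp
  | hadd s t hs ht => simp only [map_add, hs, ht]
  | h i j h x y =>
    simp only [incRight_incl, KunnethSum.map_incl, map_smul, TensorProduct.map_tmul,
      Hom.id_apply]

theorem rightδ_incLeft (n : ℕ) (t : KunnethSum k C.dec.X D.X n) :
    rightδ C D (n + 1) (incLeft C D n t) = incLeft C D.dec n (rightδ C.dec D n t) := by
  induction t using KunnethSum.induction with
  | h0 => simp
  | hadd s t hs ht => simp only [map_add, hs, ht]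
  | h i j h x y =>
    simp only [incLeft_incl, KunnethSum.map_incl, TensorProduct.map_tmul, Hom.id_apply]

theorem map_incLeft {C' : Cosimplicial.{u, v'} k} {D' : Cosimplicial.{u, w'} k} (f : Hom C C')
    (g : Hom D D') (n : ℕ) (t : KunnethSum k C.dec.X D.X n) :
    KunnethSum.map f.f g.f (n + 1) (incLeft C D n t) =
      incLeft C' D' n (KunnethSum.map f.dec.f g.f n t) := by
  induction t using KunnethSum.induction with
  | h0 => simp
  | hadd s t hs ht => simp only [map_add, hs, ht]
  | h i j h x y =>
    obtain ⟨x, rfl⟩ := (C.shift i).surjective x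
    simp only [incLeft_incl, KunnethSum.map_incl, TensorProduct.map_tmul, Hom.dec_shift,
      LinearEquiv.symm_apply_apply]

theorem map_incRight {C' : Cosimplicial.{u, v'} k} {D' : Cosimplicial.{u, w'} k} (f : Hom C C')
    (g : Hom D D') (n : ℕ) (t : KunnethSum k C.X D.dec.X n) :
    KunnethSum.map f.f g.f (n + 1) (incRight C D n t) =
      incRight C' D' n (KunnethSum.map f.f g.dec.f n t) := by
  induction t using KunnethSum.induction with
  | h0 => simp
  | hadd s t hs ht => simp only [map_add, hs, ht]
  | h i j h x y =>
    obtain ⟨y, rfl⟩ := (D.shift j).surjective y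
    simp only [incRight_incl, KunnethSum.map_incl, TensorProduct.map_tmul, Hom.dec_shift,
      LinearEquiv.symm_apply_apply, map_smul]

end Shuffle

/-- The shuffle map `Cⁿ ⊗ Dⁿ → ⨁_{i + j = n} Cⁱ ⊗ Dʲ`. -/
noncomputable def shuffle : ∀ (n : ℕ) (C : Cosimplicial.{u, v} k) (D : Cosimplicial.{u, w} k),
    C.X n ⊗[k] D.X n →ₗ[k] KunnethSum k C.X D.X n
  | 0, C, D => KunnethSum.incl k C.X D.X 0 0 rfl
  | n + 1, C, D =>
      incLeft C D n ∘ₗ shuffle n C.dec D ∘ₗ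
          TensorProduct.map (C.shift n).toLinearMap (D.σ n 0) +
        incRight C D n ∘ₗ shuffle n C D.dec ∘ₗ
          TensorProduct.map (C.σ n 0) (D.shift n).toLinearMap

theorem shuffle_zero (C : Cosimplicial.{u, v} k) (D : Cosimplicial.{u, w} k)
    (x : C.X 0) (y : D.X 0) :
    shuffle 0 C D (x ⊗ₜ y) = KunnethSum.incl k C.X D.X 0 0 rfl (x ⊗ₜ y) := rfl

theorem shuffle_succ (n : ℕ) (C : Cosimplicial.{u, v} k) (D : Cosimplicial.{u, w} k)
    (x : C.X (n + 1)) (y : D.X (n + 1)) :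
    shuffle (n + 1) C D (x ⊗ₜ y) = incLeft C D n (shuffle n C.dec D (C.shift n x ⊗ₜ D.σ n 0 y)) +
      incRight C D n (shuffle n C D.dec (C.σ n 0 x ⊗ₜ D.shift n y)) := rfl

theorem shuffle_naturality : ∀ (n : ℕ) {C : Cosimplicial.{u, v} k} {D : Cosimplicial.{u, w} k}
    {C' : Cosimplicial.{u, v'} k} {D' : Cosimplicial.{u, w'} k} (f : Hom C C') (g : Hom D D')
    (z : C.X n ⊗[k] D.X n),
    shuffle n C' D' (TensorProduct.map (f.f n) (g.f n) z) =
      KunnethSum.map f.f g.f n (shuffle n C D z)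
  | 0, C, D, C', D', f, g, z => (KunnethSum.map_incl f.f g.f 0 0 rfl z).symm
  | n + 1, C, D, C', D', f, g, z => by
    induction z with
    | zero => simp
    | add a b ha hb => simp only [map_add, ha, hb]
    | tmul x y =>
      rw [TensorProduct.map_tmul, shuffle_succ, shuffle_succ, map_add, map_incLeft, map_incRight,
        ← shuffle_naturality n f.dec g, ← shuffle_naturality n f g.dec, TensorProduct.map_tmul,
        TensorProduct.map_tmul, g.f_σ n 0 (by omega), f.f_σ n 0 (by omega), Hom.dec_shift,
        Hom.dec_shift]

theorem shuffle_σ_zero_b (C : Cosimplicial.{u, v} k) (D : Cosimplicial.{u, w} k) (n : ℕ)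
    (x : C.X (n + 1)) (y : D.X (n + 1)) :
    TensorProduct.map (C.shift (n + 1)).toLinearMap (D.σ (n + 1) 0)
        ((diag C D).b (n + 1) (x ⊗ₜ y)) =
      C.shift (n + 1) (C.δ (n + 1) 0 x) ⊗ₜ y -
        C.shift (n + 1) (C.δ (n + 1) 1 x) ⊗ₜ (y - D.δ n 0 (D.σ n 0 y)) -
        (diag C.dec D).b n (C.shift n x ⊗ₜ D.σ n 0 y) := by
  rw [b_apply, b_apply, map_sum, Finset.sum_range_succ', Finset.sum_range_succ',
    Finset.sum_range_succ' (n := n + 1)]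
  have : ∀ i ∈ Finset.range (n + 1),
      TensorProduct.map (C.shift (n + 1)).toLinearMap (D.σ (n + 1) 0) ((-1 : k) ^ (i + 1 + 1) •
      (C.diag D).δ (n + 1) (i + 1 + 1) (x ⊗ₜ[k] y)) =
      - ((-1 : k) ^ (i + 1) • (C.dec.diag D).δ n (i + 1) (C.shift n x ⊗ₜ[k] D.σ n 0 y)) := by
    intro i hi
    rw [Finset.mem_range] at hi
    simp [D.σ_δ_gt n (i + 1) 0 (by omega) (by omega), pow_succ, dec_δ]
  rw [Finset.sum_congr rfl this, Finset.sum_neg_distrib]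
  have h := D.σ_δ_succ (n + 1) 0 (by omega) y
  rw [zero_add] at h
  simp [D.σ_δ_self, h, TensorProduct.tmul_sub, dec_δ]
  abel

theorem σ_zero_shuffle_b (C : Cosimplicial.{u, v} k) (D : Cosimplicial.{u, w} k) (n : ℕ)
    (x : C.X (n + 1)) (y : D.X (n + 1)) :
    TensorProduct.map (C.σ (n + 1) 0) (D.shift (n + 1)).toLinearMap
        ((diag C D).b (n + 1) (x ⊗ₜ y)) =
      x ⊗ₜ D.shift (n + 1) (D.δ (n + 1) 0 y) -
        (x - C.δ n 0 (C.σ n 0 x)) ⊗ₜ D.shift (n + 1) (D.δ (n + 1) 1 y) -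
        (diag C D.dec).b n (C.σ n 0 x ⊗ₜ D.shift n y) := by
  rw [b_apply, b_apply, map_sum, Finset.sum_range_succ', Finset.sum_range_succ',
    Finset.sum_range_succ' (n := n + 1)]
  have : ∀ i ∈ Finset.range (n + 1),
      TensorProduct.map (C.σ (n + 1) 0) (D.shift (n + 1)).toLinearMap ((-1 : k) ^ (i + 1 + 1) •
      (C.diag D).δ (n + 1) (i + 1 + 1) (x ⊗ₜ[k] y)) =
      - ((-1 : k) ^ (i + 1) • (C.diag D.dec).δ n (i + 1) (C.σ n 0 x ⊗ₜ[k] D.shift n y)) := by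
    intro i hi
    rw [Finset.mem_range] at hi
    simp [C.σ_δ_gt n (i + 1) 0 (by omega) (by omega), pow_succ, dec_δ]
  rw [Finset.sum_congr rfl this, Finset.sum_neg_distrib]
  have h := C.σ_δ_succ (n + 1) 0 (by omega) x
  rw [zero_add] at h
  simp [C.σ_δ_self, h, TensorProduct.sub_tmul, dec_δ]
  abel

/-- The shuffle map is a cochain map. -/
theorem shuffle_b : ∀ (n : ℕ) (C : Cosimplicial.{u, v} k) (D : Cosimplicial.{u, w} k)
    (z : C.X n ⊗[k] D.X n),
    shuffle (n + 1) C D ((diag C D).b n z) = dT C D n (shuffle n C D z)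
  | 0, C, D, z => by
    induction z with
    | zero => simp
    | add a b ha hb => simp only [map_add, ha, hb]
    | tmul x y =>
      have hC : C.σ 0 0 (C.δ 0 1 x) = x := C.σ_δ_succ 0 0 le_rfl x
      have hD : D.σ 0 0 (D.δ 0 1 y) = y := D.σ_δ_succ 0 0 le_rfl y
      rw [shuffle_zero, tensorDifferential_incl, b_apply, b_apply, b_apply]
      simp [Finset.sum_range_succ, shuffle_succ, shuffle_zero, incLeft_incl, incRight_incl,
        C.σ_δ_self, D.σ_δ_self, hC, hD, TensorProduct.add_tmul, TensorProduct.tmul_add,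
        TensorProduct.neg_tmul, TensorProduct.tmul_neg]
      abel
  | n + 1, C, D, z => by
    induction z with
    | zero => simp
    | add a b ha hb => simp only [map_add, ha, hb]
    | tmul x y =>
      have e1 : shuffle (n + 1) C.dec D (C.shift (n + 1) (C.δ (n + 1) 0 x) ⊗ₜ y) =
          leftδ C D (n + 1) (shuffle (n + 1) C D (x ⊗ₜ y)) :=
        shuffle_naturality (n + 1) C.decδ (Hom.id D) (x ⊗ₜ y)
      have e2 : shuffle (n + 1) C D.dec (x ⊗ₜ D.shift (n + 1) (D.δ (n + 1) 0 y)) =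
          rightδ C D (n + 1) (shuffle (n + 1) C D (x ⊗ₜ y)) :=
        shuffle_naturality (n + 1) (Hom.id C) D.decδ (x ⊗ₜ y)
      have e3 : shuffle n C.dec D.dec (C.shift n x ⊗ₜ D.shift n (D.δ n 0 (D.σ n 0 y))) =
          rightδ C.dec D n (shuffle n C.dec D (C.shift n x ⊗ₜ D.σ n 0 y)) :=
        shuffle_naturality n (Hom.id C.dec) D.decδ (C.shift n x ⊗ₜ D.σ n 0 y)
      have e4 : shuffle n C.dec D.dec (C.shift n (C.δ n 0 (C.σ n 0 x)) ⊗ₜ D.shift n y) =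
          leftδ C D.dec n (shuffle n C D.dec (C.σ n 0 x ⊗ₜ D.shift n y)) :=
        shuffle_naturality n C.decδ (Hom.id D.dec) (C.σ n 0 x ⊗ₜ D.shift n y)
      have e5 : shuffle (n + 1) C.dec D (C.shift (n + 1) (C.δ (n + 1) 1 x) ⊗ₜ
            (y - D.δ n 0 (D.σ n 0 y))) =
          incRight C.dec D n (shuffle n C.dec D.dec (C.shift n x ⊗ₜ D.shift n y) -
            rightδ C.dec D n (shuffle n C.dec D (C.shift n x ⊗ₜ D.σ n 0 y))) := by
        rw [shuffle_succ, map_sub, D.σ_δ_self _ _ (by omega), sub_self, TensorProduct.tmul_zero,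
          map_zero, map_zero, zero_add, ← e3, ← map_sub, ← TensorProduct.tmul_sub, ← map_sub,
          dec_σ, C.σ_δ_self _ _ (by omega)]
      have e6 : shuffle (n + 1) C D.dec ((x - C.δ n 0 (C.σ n 0 x)) ⊗ₜ
            D.shift (n + 1) (D.δ (n + 1) 1 y)) =
          incLeft C D.dec n (shuffle n C.dec D.dec (C.shift n x ⊗ₜ D.shift n y) -
            leftδ C D.dec n (shuffle n C D.dec (C.σ n 0 x ⊗ₜ D.shift n y))) := by
        rw [shuffle_succ, map_sub (C.σ n 0), C.σ_δ_self _ _ (by omega), sub_self, TensorProduct.zero_tmul,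
          map_zero, map_zero, add_zero, ← e4, ← map_sub, ← TensorProduct.sub_tmul, ← map_sub,
          dec_σ, D.σ_δ_self _ _ (by omega)]
      have e0 : shuffle (n + 2) C D ((diag C D).b (n + 1) (x ⊗ₜ y)) =
          incLeft C D (n + 1) (shuffle (n + 1) C.dec D
            (TensorProduct.map (C.shift (n + 1)).toLinearMap (D.σ (n + 1) 0)
              ((diag C D).b (n + 1) (x ⊗ₜ y)))) +
          incRight C D (n + 1) (shuffle (n + 1) C D.dec
            (TensorProduct.map (C.σ (n + 1) 0) (D.shift (n + 1)).toLinearMap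
              ((diag C D).b (n + 1) (x ⊗ₜ y)))) := rfl
      have i1 := shuffle_b n C.dec D (C.shift n x ⊗ₜ D.σ n 0 y)
      have i2 := shuffle_b n C D.dec (C.σ n 0 x ⊗ₜ D.shift n y)
      rw [e0, shuffle_σ_zero_b, σ_zero_shuffle_b]
      simp only [map_sub (shuffle _ _ _)]
      rw [e1, e2, e5, e6, i1, i2, shuffle_succ]
      generalize shuffle n C.dec D (C.shift n x ⊗ₜ D.σ n 0 y) = A
      generalize shuffle n C D.dec (C.σ n 0 x ⊗ₜ D.shift n y) = B
      generalize shuffle n C.dec D.dec (C.shift n x ⊗ₜ D.shift n y) = P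
      rw [map_add (dT C D (n + 1)), dT_incLeft, dT_incRight]
      simp only [map_add, map_sub, leftδ_incRight, rightδ_incLeft, incRight_incLeft]
      abel


section AlexanderWhitney

variable (C : Cosimplicial.{u, v} k) (D : Cosimplicial.{u, w} k)

/-- The iterated last coface `Cⁱ → Cⁿ`. -/
def lasts {i n : ℕ} (h : i ≤ n) : C.X i →ₗ[k] C.X n :=
  Nat.leRecOn (C := fun n => C.X i →ₗ[k] C.X n) h (fun {m} f => C.δ m (m + 1) ∘ₗ f) LinearMap.id

/-- The iterated zeroth coface `Cⁱ → Cⁿ`. -/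
def zeros {i n : ℕ} (h : i ≤ n) : C.X i →ₗ[k] C.X n :=
  Nat.leRecOn (C := fun n => C.X i →ₗ[k] C.X n) h (fun {m} f => C.δ m 0 ∘ₗ f) LinearMap.id

theorem lasts_self (i : ℕ) (x : C.X i) : C.lasts le_rfl x = x := by
  rw [lasts, Nat.leRecOn_self]; rfl

theorem zeros_self (i : ℕ) (x : C.X i) : C.zeros le_rfl x = x := by
  rw [zeros, Nat.leRecOn_self]; rfl

theorem lasts_succ {i n : ℕ} (h : i ≤ n) (h' : i ≤ n + 1) (x : C.X i) :
    C.lasts h' x = C.δ n (n + 1) (C.lasts h x) := by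
  rw [lasts, Nat.leRecOn_succ h]; rfl

theorem zeros_succ {i n : ℕ} (h : i ≤ n) (h' : i ≤ n + 1) (x : C.X i) :
    C.zeros h' x = C.δ n 0 (C.zeros h x) := by
  rw [zeros, Nat.leRecOn_succ h]; rfl

theorem lasts_δ {i n : ℕ} (h : i ≤ n) (j : ℕ) (hj : j ≤ i) (x : C.X i) :
    C.δ n j (C.lasts h x) = C.lasts (Nat.succ_le_succ h) (C.δ i j x) := by
  induction n, h using Nat.le_induction with
  | base => rw [lasts_self, lasts_self]
  | succ n h ih =>
    rw [C.lasts_succ h, C.lasts_succ (Nat.succ_le_succ h), ← ih]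
    exact (C.δ_δ n j (n + 1) (by omega) le_rfl _).symm

theorem δ_lasts {i n : ℕ} (h : i ≤ n) (j : ℕ) (hj : i < j) (hj' : j ≤ n + 1) (x : C.X i) :
    C.δ n j (C.lasts h x) = C.lasts (h.trans n.le_succ) x := by
  rw [C.lasts_succ h]
  induction n, h using Nat.le_induction generalizing j with
  | base => obtain rfl : j = i + 1 := by omega
            rfl
  | succ n h ih =>
    rcases hj'.eq_or_lt with rfl | hlt
    · rfl
    · rw [C.lasts_succ h, ← C.δ_δ n j (n + 1) (by omega) le_rfl, ih j hj (by omega)]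

theorem δ_zeros {i n : ℕ} (h : i ≤ n) (j : ℕ) (hj : i + j ≤ n) (x : C.X i) :
    C.δ n j (C.zeros h x) = C.zeros (h.trans n.le_succ) x := by
  rw [C.zeros_succ h]
  induction n, h using Nat.le_induction generalizing j with
  | base => obtain rfl : j = 0 := by omega
            rfl
  | succ n h ih =>
    cases j with
    | zero => rfl
    | succ j => rw [C.zeros_succ h, C.δ_δ n 0 j (by omega) (by omega), ih j (by omega)]

theorem zeros_δ {i n : ℕ} (h : i ≤ n) (j l : ℕ) (hl : n + j = i + l) (hj : j ≤ i + 1) (x : C.X i) :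
    C.δ n l (C.zeros h x) = C.zeros (Nat.succ_le_succ h) (C.δ i j x) := by
  induction n, h using Nat.le_induction generalizing l with
  | base => obtain rfl : j = l := by omega
            rw [zeros_self, zeros_self]
  | succ n h ih =>
    obtain ⟨l, rfl⟩ : ∃ l', l = l' + 1 := ⟨l - 1, by omega⟩
    rw [C.zeros_succ h, C.zeros_succ (Nat.succ_le_succ h), ← ih l (by omega),
      C.δ_δ n 0 l (by omega) (by omega)]

theorem lasts_δ_succ {i n : ℕ} (h : i + 1 ≤ n) (x : C.X i) :
    C.lasts h (C.δ i (i + 1) x) = C.lasts (Nat.le_of_succ_le h) x := by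
  induction n, h using Nat.le_induction with
  | base => rw [lasts_self, C.lasts_succ le_rfl, lasts_self]
  | succ n h ih => rw [C.lasts_succ h, ih, ← C.lasts_succ]

theorem zeros_δ_zero {i n : ℕ} (h : i + 1 ≤ n) (x : C.X i) :
    C.zeros h (C.δ i 0 x) = C.zeros (Nat.le_of_succ_le h) x := by
  induction n, h using Nat.le_induction with
  | base => rw [zeros_self, C.zeros_succ le_rfl, zeros_self]
  | succ n h ih => rw [C.zeros_succ h, ih, ← C.zeros_succ]

/-- The Alexander-Whitney map. -/
def aw (n : ℕ) : KunnethSum k C.X D.X n →ₗ[k] C.X n ⊗[k] D.X n :=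
  DirectSum.toModule k _ _ fun p =>
    TensorProduct.map (C.lasts (by have := p.2; omega)) (D.zeros (by have := p.2; omega))

theorem aw_incl {n : ℕ} (i j : ℕ) (h : i + j = n) (x : C.X i) (y : D.X j) :
    aw C D n (KunnethSum.incl k C.X D.X i j h (x ⊗ₜ y)) =
      C.lasts (show i ≤ n by omega) x ⊗ₜ D.zeros (show j ≤ n by omega) y := by
  simp [aw, KunnethSum.incl]

/-- The Alexander-Whitney map is a cochain map. -/
theorem b_aw (n : ℕ) (t : KunnethSum k C.X D.X n) :
    (diag C D).b n (aw C D n t) = aw C D (n + 1) (dT C D n t) := by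
  induction t using KunnethSum.induction with
  | h0 => simp
  | hadd s t hs ht => simp only [map_add, hs, ht]
  | h p q hpq x y =>
    cases hpq
    have e1 : ∀ i ∈ Finset.range (p + 1), (-1 : k) ^ i • C.δ (p + q) i (C.lasts (by omega) x) ⊗ₜ[k]
        D.δ (p + q) i (D.zeros (by omega) y) = (-1 : k) ^ i •
          C.lasts (Nat.succ_le_succ (by omega)) (C.δ p i x) ⊗ₜ D.zeros (by omega) y := by
      intro i hi
      rw [Finset.mem_range] at hi
      rw [C.lasts_δ _ _ (by omega), D.δ_zeros _ _ (by omega)]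
    have e2 : ∀ i ∈ Finset.range (q + 1), (-1 : k) ^ (p + 1 + i) •
        C.δ (p + q) (p + 1 + i) (C.lasts (by omega) x) ⊗ₜ[k]
          D.δ (p + q) (p + 1 + i) (D.zeros (by omega) y) = (-1 : k) ^ p • ((-1 : k) ^ (i + 1) •
          C.lasts (by omega) x ⊗ₜ D.zeros (Nat.succ_le_succ (by omega)) (D.δ q (i + 1) y)) := by
      intro i hi
      rw [Finset.mem_range] at hi
      rw [C.δ_lasts _ _ (by omega) (by omega), D.zeros_δ _ (i + 1) _ (by omega) (by omega),
        smul_smul, ← pow_add]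
      congr 2
      omega
    have e3 := C.lasts_δ (show p ≤ p + q by omega) p le_rfl x
    rw [aw_incl, tensorDifferential_incl, map_add, map_smul, aw_incl, aw_incl, b_apply, b_apply,
      b_apply, show p + q + 2 = (p + 1) + (q + 1) by omega, Finset.sum_range_add]
    simp only [TensorProduct.map_tmul]
    rw [Finset.sum_congr rfl e1, Finset.sum_congr rfl e2, Finset.sum_range_succ (n := p + 1),
      Finset.sum_range_succ' (n := q + 1)]
    simp only [map_add, map_sum, map_smul, TensorProduct.add_tmul, TensorProduct.tmul_add,
      TensorProduct.sum_tmul, TensorProduct.tmul_sum, ← TensorProduct.smul_tmul',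
      TensorProduct.tmul_smul, smul_add, Finset.smul_sum, pow_zero, one_smul]
    rw [C.lasts_δ_succ (show p + 1 ≤ p + q + 1 by omega),
      D.zeros_δ_zero (show q + 1 ≤ p + q + 1 by omega)]
    rw [pow_succ]
    module

theorem aw_naturality {C : Cosimplicial.{u, v} k} {D : Cosimplicial.{u, w} k}
    {C' : Cosimplicial.{u, v'} k} {D' : Cosimplicial.{u, w'} k} (f : Hom C C') (g : Hom D D')
    (n : ℕ) (t : KunnethSum k C.X D.X n) :
    aw C' D' n (KunnethSum.map f.f g.f n t) =
      TensorProduct.map (f.f n) (g.f n) (aw C D n t) := by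
  have hl : ∀ {i n : ℕ} (h : i ≤ n) (x : C.X i), f.f n (C.lasts h x) = C'.lasts h (f.f i x) := by
    intro i n h x
    induction n, h using Nat.le_induction with
    | base => rw [lasts_self, lasts_self]
    | succ n h ih => rw [C.lasts_succ h, C'.lasts_succ h, f.f_δ _ _ (by omega), ih]
  have hz : ∀ {i n : ℕ} (h : i ≤ n) (x : D.X i), g.f n (D.zeros h x) = D'.zeros h (g.f i x) := by
    intro i n h x
    induction n, h using Nat.le_induction with
    | base => rw [zeros_self, zeros_self]
    | succ n h ih => rw [D.zeros_succ h, D'.zeros_succ h, g.f_δ _ _ (by omega), ih]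
  induction t using KunnethSum.induction with
  | h0 => simp
  | hadd s t hs ht => simp only [map_add, hs, ht]
  | h p q h x y =>
    rw [KunnethSum.map_incl, TensorProduct.map_tmul, aw_incl, aw_incl, TensorProduct.map_tmul, hl,
      hz]

/-- The cochain endomorphism `AW ∘ shuffle` of the diagonal complex. -/
noncomputable def awSh (n : ℕ) : C.X n ⊗[k] D.X n →ₗ[k] C.X n ⊗[k] D.X n :=
  aw C D n ∘ₗ shuffle n C D

theorem awSh_b (n : ℕ) (z : C.X n ⊗[k] D.X n) :
    awSh C D (n + 1) ((diag C D).b n z) = (diag C D).b n (awSh C D n z) := by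
  rw [awSh, awSh, LinearMap.comp_apply, LinearMap.comp_apply, shuffle_b, b_aw]

theorem awSh_zero (z : C.X 0 ⊗[k] D.X 0) : awSh C D 0 z = z := by
  induction z with
  | zero => simp
  | add a b ha hb => simp only [map_add, ha, hb]
  | tmul x y => rw [awSh, LinearMap.comp_apply, shuffle_zero, aw_incl, lasts_self, zeros_self]

theorem awSh_naturality {C : Cosimplicial.{u, v} k} {D : Cosimplicial.{u, w} k}
    {C' : Cosimplicial.{u, v'} k} {D' : Cosimplicial.{u, w'} k} (f : Hom C C') (g : Hom D D')
    (n : ℕ) (z : C.X n ⊗[k] D.X n) :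
    awSh C' D' n (TensorProduct.map (f.f n) (g.f n) z) =
      TensorProduct.map (f.f n) (g.f n) (awSh C D n z) := by
  rw [awSh, LinearMap.comp_apply, shuffle_naturality, aw_naturality]; rfl

end AlexanderWhitney

/-- The diagonal identification with the décalage. -/
noncomputable abbrev shift₂ (C : Cosimplicial.{u, v} k) (D : Cosimplicial.{u, w} k) (n : ℕ) :
    C.X (n + 1) ⊗[k] D.X (n + 1) ≃ₗ[k] C.dec.X n ⊗[k] D.dec.X n :=
  TensorProduct.congr (C.shift n) (D.shift n)

/-- The natural homotopy from the identity to `AW ∘ shuffle`. -/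
noncomputable def homotopy : ∀ (n : ℕ) (C : Cosimplicial.{u, v} k) (D : Cosimplicial.{u, w} k),
    C.X (n + 1) ⊗[k] D.X (n + 1) →ₗ[k] C.X n ⊗[k] D.X n
  | 0, C, D => (diag C D).σ 0 0
  | n + 1, C, D =>
      (diag C D).σ (n + 1) 0 ∘ₗ (shift₂ C D (n + 1)).symm.toLinearMap ∘ₗ
        awSh C.dec D.dec (n + 1) ∘ₗ (shift₂ C D (n + 1)).toLinearMap -
      (shift₂ C D n).symm.toLinearMap ∘ₗ homotopy n C.dec D.dec ∘ₗ
        (shift₂ C D (n + 1)).toLinearMap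

theorem homotopy_succ (n : ℕ) (C : Cosimplicial.{u, v} k) (D : Cosimplicial.{u, w} k)
    (z : C.X (n + 2) ⊗[k] D.X (n + 2)) :
    homotopy (n + 1) C D z = (diag C D).σ (n + 1) 0 ((shift₂ C D (n + 1)).symm
        (awSh C.dec D.dec (n + 1) (shift₂ C D (n + 1) z))) -
      (shift₂ C D n).symm (homotopy n C.dec D.dec (shift₂ C D (n + 1) z)) := rfl

theorem homotopy_naturality : ∀ (n : ℕ) {C : Cosimplicial.{u, v} k} {D : Cosimplicial.{u, w} k}
    {C' : Cosimplicial.{u, v'} k} {D' : Cosimplicial.{u, w'} k} (f : Hom C C') (g : Hom D D')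
    (z : C.X (n + 1) ⊗[k] D.X (n + 1)),
    homotopy n C' D' (TensorProduct.map (f.f (n + 1)) (g.f (n + 1)) z) =
      TensorProduct.map (f.f n) (g.f n) (homotopy n C D z) := by
  have hσ : ∀ (n : ℕ) {C : Cosimplicial.{u, v} k} {D : Cosimplicial.{u, w} k}
    {C' : Cosimplicial.{u, v'} k} {D' : Cosimplicial.{u, w'} k} (f : Hom C C') (g : Hom D D')
    (z : C.X (n + 1) ⊗[k] D.X (n + 1)),
    (diag C' D').σ n 0 (TensorProduct.map (f.f (n + 1)) (g.f (n + 1)) z) =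
      TensorProduct.map (f.f n) (g.f n) ((diag C D).σ n 0 z) := by
    intro n C D C' D' f g z
    induction z with
    | zero => simp
    | add a b ha hb => simp only [map_add, ha, hb]
    | tmul x y => simp [f.f_σ, g.f_σ]
  have hs : ∀ (n : ℕ) {C : Cosimplicial.{u, v} k} {D : Cosimplicial.{u, w} k}
    {C' : Cosimplicial.{u, v'} k} {D' : Cosimplicial.{u, w'} k} (f : Hom C C') (g : Hom D D')
    (z : C.X (n + 1) ⊗[k] D.X (n + 1)),
    shift₂ C' D' n (TensorProduct.map (f.f (n + 1)) (g.f (n + 1)) z) =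
      TensorProduct.map (f.dec.f n) (g.dec.f n) (shift₂ C D n z) := by
    intro n C D C' D' f g z
    induction z with
    | zero => simp
    | add a b ha hb => simp only [map_add, ha, hb]
    | tmul x y => rfl
  have hs' : ∀ (n : ℕ) {C : Cosimplicial.{u, v} k} {D : Cosimplicial.{u, w} k}
    {C' : Cosimplicial.{u, v'} k} {D' : Cosimplicial.{u, w'} k} (f : Hom C C') (g : Hom D D')
    (z : C.dec.X n ⊗[k] D.dec.X n),
    (shift₂ C' D' n).symm (TensorProduct.map (f.dec.f n) (g.dec.f n) z) =
      TensorProduct.map (f.f (n + 1)) (g.f (n + 1)) ((shift₂ C D n).symm z) := by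
    intro n C D C' D' f g z
    rw [LinearEquiv.symm_apply_eq, hs, LinearEquiv.apply_symm_apply]
  intro n
  induction n with
  | zero => intro C D C' D' f g z; exact hσ 0 f g z
  | succ n ih =>
    intro C D C' D' f g z
    rw [homotopy_succ, homotopy_succ, hs, ih, awSh_naturality, hs', hs', hσ, map_sub]

theorem b_succ_diag (C : Cosimplicial.{u, v} k) (D : Cosimplicial.{u, w} k) (n : ℕ)
    (z : C.X (n + 1) ⊗[k] D.X (n + 1)) :
    shift₂ C D (n + 1) ((diag C D).b (n + 1) z) =
      TensorProduct.map (C.decδ.f (n + 1)) (D.decδ.f (n + 1)) z -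
        (diag C.dec D.dec).b n (shift₂ C D n z) := by
  induction z with
  | zero => simp
  | add a b ha hb => simp only [map_add, ha, hb]; abel
  | tmul x y =>
    rw [b_apply, b_apply, sub_eq_add_neg, map_sum, ← Finset.sum_neg_distrib]
    refine (Finset.sum_range_succ' _ (n + 2)).trans ?_
    simp [pow_succ, add_comm, dec_δ, decδ_apply]

theorem shift₂_symm_b (C : Cosimplicial.{u, v} k) (D : Cosimplicial.{u, w} k) (n : ℕ)
    (z : C.dec.X n ⊗[k] D.dec.X n) :
    (diag C D).b (n + 1) ((shift₂ C D n).symm z) =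
      (diag C D).δ (n + 1) 0 ((shift₂ C D n).symm z) -
        (shift₂ C D (n + 1)).symm ((diag C.dec D.dec).b n z) := by
  obtain ⟨t, rfl⟩ := (shift₂ C D n).surjective z
  have h : TensorProduct.map (C.decδ.f (n + 1)) (D.decδ.f (n + 1)) t =
      shift₂ C D (n + 1) ((diag C D).δ (n + 1) 0 t) := by
    induction t with
    | zero => simp
    | add a b ha hb => simp only [map_add, ha, hb]
    | tmul x y => rfl
  rw [LinearEquiv.symm_apply_apply, ← LinearEquiv.symm_apply_apply (shift₂ C D (n + 1))
    ((diag C D).b (n + 1) t), b_succ_diag, map_sub, h, LinearEquiv.symm_apply_apply]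

theorem σ_zero_b_add (E : Cosimplicial.{u, v} k) (n : ℕ) (t : E.X (n + 1)) :
    E.σ (n + 1) 0 (E.b (n + 1) t) + E.b n (E.σ n 0 t) = E.δ n 0 (E.σ n 0 t) := by
  rw [b_apply, b_apply, map_sum, Finset.sum_range_succ', Finset.sum_range_succ',
    Finset.sum_range_succ' (n := n + 1)]
  have : ∀ i ∈ Finset.range (n + 1), E.σ (n + 1) 0 ((-1 : k) ^ (i + 1 + 1) •
      E.δ (n + 1) (i + 1 + 1) t) = - ((-1 : k) ^ (i + 1) • E.δ n (i + 1) (E.σ n 0 t)) := by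
    intro i hi
    rw [Finset.mem_range] at hi
    simp [E.σ_δ_gt n (i + 1) 0 (by omega) (by omega), pow_succ]
  rw [Finset.sum_congr rfl this, Finset.sum_neg_distrib]
  have h := E.σ_δ_succ (n + 1) 0 (by omega) t
  rw [zero_add] at h
  simp [E.σ_δ_self, h]

theorem homotopy_b_zero (C : Cosimplicial.{u, v} k) (D : Cosimplicial.{u, w} k)
    (z : C.X 0 ⊗[k] D.X 0) : homotopy 0 C D ((diag C D).b 0 z) = 0 := by
  have h1 : (diag C D).σ 0 0 ((diag C D).δ 0 1 z) = z := (diag C D).σ_δ_succ 0 0 le_rfl z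
  have h2 : (diag C D).σ 0 0 ((diag C D).δ 0 0 z) = z := (diag C D).σ_δ_self 0 0 le_rfl z
  rw [homotopy, b_apply]
  simp only [Finset.sum_range_succ, Finset.sum_range_zero, map_add, map_smul, h1, h2]
  simp

theorem homotopy_succ_b (n : ℕ) (C : Cosimplicial.{u, v} k) (D : Cosimplicial.{u, w} k)
    (z : C.X (n + 1) ⊗[k] D.X (n + 1)) :
    homotopy (n + 1) C D ((diag C D).b (n + 1) z) =
      awSh C D (n + 1) z - (diag C D).δ n 0 (homotopy n C D z) -
        (diag C D).σ (n + 1) 0 ((diag C D).δ (n + 1) 0 ((shift₂ C D n).symm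
          (awSh C.dec D.dec n (shift₂ C D n z))) -
        (diag C D).b (n + 1) ((shift₂ C D n).symm (awSh C.dec D.dec n (shift₂ C D n z)))) +
        (shift₂ C D n).symm (homotopy n C.dec D.dec
          ((diag C.dec D.dec).b n (shift₂ C D n z))) := by
  have hm : ∀ (m : ℕ) (t : C.X m ⊗[k] D.X m),
      (shift₂ C D m).symm (TensorProduct.map (C.decδ.f m) (D.decδ.f m) t) =
      (diag C D).δ m 0 t := by
    intro m t
    rw [LinearEquiv.symm_apply_eq]
    induction t with
    | zero => simp
    | add a b ha hb => simp only [map_add, ha, hb]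
    | tmul x y => rfl
  rw [homotopy_succ, b_succ_diag, map_sub, map_sub (homotopy n C.dec D.dec),
    homotopy_naturality n C.decδ D.decδ, awSh_naturality C.decδ D.decδ, awSh_b,
    map_sub (shift₂ C D (n + 1)).symm, map_sub (shift₂ C D n).symm, hm, hm, map_sub,
    (diag C D).σ_δ_self _ _ (by omega), shift₂_symm_b, sub_sub_cancel]
  abel

/-- `h b + b h = AW ∘ shuffle - id`. -/
theorem homotopy_b : ∀ (n : ℕ) (C : Cosimplicial.{u, v} k) (D : Cosimplicial.{u, w} k)
    (z : C.X (n + 1) ⊗[k] D.X (n + 1)),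
    homotopy (n + 1) C D ((diag C D).b (n + 1) z) + (diag C D).b n (homotopy n C D z) =
      awSh C D (n + 1) z - z
  | 0, C, D, z => by
    have e := (diag C D).σ_zero_b_add 0 z
    rw [homotopy_succ_b, awSh_zero, LinearEquiv.symm_apply_apply, homotopy_b_zero, map_zero,
      map_sub, (diag C D).σ_δ_self _ _ (by omega), eq_sub_of_add_eq e]
    change _ - (diag C D).δ 0 0 ((diag C D).σ 0 0 z) - _ + 0 +
      (diag C D).b 0 ((diag C D).σ 0 0 z) = _
    abel
  | n + 1, C, D, z => by
    have ih := homotopy_b n C.dec D.dec (shift₂ C D (n + 1) z)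
    rw [homotopy_succ_b]
    conv_lhs => rw [homotopy_succ n C D z]
    generalize awSh C.dec D.dec (n + 1) (shift₂ C D (n + 1) z) = w at ih ⊢
    obtain ⟨t, rfl⟩ := (shift₂ C D (n + 1)).surjective w
    have e := (diag C D).σ_zero_b_add (n + 1) t
    have e2 := shift₂_symm_b C D n (homotopy n C.dec D.dec (shift₂ C D (n + 1) z))
    rw [eq_sub_of_add_eq ih, LinearEquiv.symm_apply_apply, map_sub (shift₂ C D (n + 1)).symm,
      map_sub (shift₂ C D (n + 1)).symm, LinearEquiv.symm_apply_apply,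
      LinearEquiv.symm_apply_apply, map_sub, map_sub, map_sub, e2,
      (diag C D).σ_δ_self _ _ (by omega), eq_sub_of_add_eq e]
    abel

end Cosimplicial


variable {k : Type u} [Field k]

theorem Cosimplicial.b_b : ∀ (n : ℕ) (C : Cosimplicial.{u, v} k) (x : C.X n),
    C.b (n + 1) (C.b n x) = 0
  | 0, C, x => by
    have h : C.δ 1 2 (C.δ 0 1 x) = C.δ 1 1 (C.δ 0 1 x) := C.δ_δ 0 1 1 le_rfl le_rfl x
    have h1 : C.δ 1 1 (C.δ 0 0 x) = C.δ 1 0 (C.δ 0 0 x) := C.δ_δ 0 0 0 le_rfl (by omega) x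
    have h2 : C.δ 1 2 (C.δ 0 0 x) = C.δ 1 0 (C.δ 0 1 x) := C.δ_δ 0 0 1 (by omega) le_rfl x
    simp [Cosimplicial.b_apply, Finset.sum_range_succ, h, h1, h2]
    abel
  | n + 1, C, x => by
    have h : C.dec.b (n + 1) (C.decδ.f (n + 1) x) = C.decδ.f (n + 2) (C.b (n + 1) x) := by
      simp only [Cosimplicial.b_apply, map_sum, map_smul]
      refine Finset.sum_congr rfl fun i hi => ?_
      rw [Finset.mem_range] at hi
      rw [C.decδ.f_δ _ _ (by omega)]
    rw [C.b_succ (n + 1)]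
    conv_lhs => 
      arg 2
      rw [C.b_succ n, map_sub, LinearEquiv.apply_symm_apply, map_sub, Cosimplicial.b_b n C.dec,
        sub_zero, ← Cosimplicial.decδ_apply, h, Cosimplicial.decδ_apply,
        LinearEquiv.symm_apply_apply]
    exact sub_self _

/-- The identities of a mixed complex. -/
structure MixedOperators.IsMixed (C : MixedOperators.{u, v} k) : Prop where
  b_b : ∀ n x, C.b (n + 1) (C.b n x) = 0
  B_B : ∀ n x, C.B n (C.B (n + 1) x) = 0
  b_B : ∀ n x, C.b n (C.B n x) + C.B (n + 1) (C.b (n + 1) x) = 0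
  B_b_zero : ∀ x, C.B 0 (C.b 0 x) = 0

namespace CocyclicOperators

variable (C : CocyclicOperators.{u, v} k)

/-- The cofaces, indexed by natural numbers. -/
def d (n i : ℕ) : C.X n →ₗ[k] C.X (n + 1) := if h : i < n + 2 then C.δ n ⟨i, h⟩ else 0

/-- The codegeneracies, indexed by natural numbers. -/
def s (n i : ℕ) : C.X (n + 1) →ₗ[k] C.X n := if h : i < n + 1 then C.σ n ⟨i, h⟩ else 0

/-- The identities of a cocyclic module. -/
structure IsCocyclic : Prop where
  δ_δ : ∀ n i j, i ≤ j → j ≤ n + 1 → ∀ x, C.d (n + 1) (j + 1) (C.d n i x) = C.d (n + 1) i (C.d n j x)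
  σ_δ_lt : ∀ n i j, i ≤ j → j ≤ n → ∀ x,
    C.s (n + 1) (j + 1) (C.d (n + 1) i x) = C.d n i (C.s n j x)
  σ_δ_self : ∀ n i, i ≤ n → ∀ x, C.s n i (C.d n i x) = x
  σ_δ_succ : ∀ n i, i ≤ n → ∀ x, C.s n i (C.d n (i + 1) x) = x
  σ_δ_gt : ∀ n i j, j < i → i ≤ n + 1 → ∀ x,
    C.s (n + 1) j (C.d (n + 1) (i + 1) x) = C.d n i (C.s n j x)
  σ_σ : ∀ n i j, i ≤ j → j ≤ n → ∀ x, C.s n j (C.s (n + 1) i x) = C.s n i (C.s (n + 1) (j + 1) x)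
  τ_δ : ∀ n i, i ≤ n → ∀ x, C.τ (n + 1) (C.d n (i + 1) x) = C.d n i (C.τ n x)
  τ_δ_zero : ∀ n x, C.τ (n + 1) (C.d n 0 x) = C.d n (n + 1) x
  τ_σ : ∀ n i, i + 1 ≤ n → ∀ x, C.τ n (C.s n (i + 1) x) = C.s n i (C.τ (n + 1) x)
  τ_σ_zero : ∀ n x, C.τ n (C.s n 0 x) = C.s n n (C.τ (n + 1) (C.τ (n + 1) x))
  τ_pow : ∀ n, C.τ n ^ (n + 1) = 1

variable {C}

/-- The underlying cosimplicial module. -/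
abbrev IsCocyclic.cos (hC : C.IsCocyclic) : Cosimplicial.{u, v} k where
  X := C.X
  δ := C.d
  σ := C.s
  δ_δ := hC.δ_δ
  σ_δ_lt := hC.σ_δ_lt
  σ_δ_self := hC.σ_δ_self
  σ_δ_succ := hC.σ_δ_succ
  σ_δ_gt := hC.σ_δ_gt
  σ_σ := hC.σ_σ

theorem hochschild_apply (n : ℕ) (x : C.X n) :
    C.hochschild n x = ∑ i ∈ Finset.range (n + 2), (-1 : k) ^ i • C.d n i x := by
  rw [hochschild, LinearMap.sum_apply, Finset.sum_range]
  refine Finset.sum_congr rfl fun i _ => ?_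
  simp [d, i.2]

theorem IsCocyclic.hochschild_eq (hC : C.IsCocyclic) (n : ℕ) : C.hochschild n = hC.cos.b n := by
  ext x
  rw [hochschild_apply, hC.cos.b_apply]

variable (C)

/-- The extra codegeneracy. -/
def extra (n : ℕ) : C.X (n + 1) →ₗ[k] C.X n := C.s n n ∘ₗ C.τ (n + 1)

theorem extra_apply (n : ℕ) (x : C.X (n + 1)) : C.extra n x = C.s n n (C.τ (n + 1) x) := rfl

/-- The norm operator. -/
noncomputable def norm (n : ℕ) : Module.End k (C.X n) := ∑ i ∈ Finset.range (n + 1), C.signedTau n ^ i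

/-- `∑ (-1)ⁱ δᵢ`, without the last coface. -/
noncomputable def b' (n : ℕ) : C.X n →ₗ[k] C.X (n + 1) := ∑ i ∈ Finset.range (n + 1), (-1 : k) ^ i • C.d n i

theorem b'_apply (n : ℕ) (x : C.X n) :
    C.b' n x = ∑ i ∈ Finset.range (n + 1), (-1 : k) ^ i • C.d n i x := by
  simp [b', LinearMap.sum_apply]

theorem connes_apply (n : ℕ) (x : C.X (n + 1)) :
    C.connes n x = C.norm n (C.extra n (x - C.signedTau (n + 1) x)) := by
  have : C.σ n (Fin.last n) = C.s n n := by simp [s, Fin.last]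
  rw [connes, this]
  rfl

theorem signedTau_apply (n : ℕ) (x : C.X n) : C.signedTau n x = (-1 : k) ^ n • C.τ n x := rfl

variable {C}

theorem hochschild_eq_add (n : ℕ) (x : C.X n) :
    C.hochschild n x = C.b' n x + (-1 : k) ^ (n + 1) • C.d n (n + 1) x := by
  rw [hochschild_apply, b'_apply, Finset.sum_range_succ]

theorem norm_of_fixed {n : ℕ} {x : C.X n} (hx : C.signedTau n x = x) :
    C.norm n x = (n + 1 : k) • x := by
  have : ∀ i, (C.signedTau n ^ i) x = x := by
    intro i
    induction i with
    | zero => rfl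
    | succ i ih => rw [pow_succ, Module.End.mul_apply, hx, ih]
  rw [norm, LinearMap.sum_apply, Finset.sum_congr rfl fun i _ => this i]
  simp [← Nat.cast_smul_eq_nsmul k]

namespace IsCocyclic

variable (hC : C.IsCocyclic)
include hC

theorem signedTau_pow (n : ℕ) : C.signedTau n ^ (n + 1) = 1 := by
  rw [signedTau, smul_pow, hC.τ_pow, ← pow_mul, (Nat.even_mul_succ_self n).neg_one_pow, one_smul]

theorem norm_signedTau (n : ℕ) (x : C.X n) : C.norm n (C.signedTau n x) = C.norm n x := by
  have h := geom_sum_mul (C.signedTau n) (n + 1)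
  rw [hC.signedTau_pow, sub_self, mul_sub, mul_one, sub_eq_zero] at h
  exact LinearMap.congr_fun h x

theorem signedTau_norm (n : ℕ) (x : C.X n) : C.signedTau n (C.norm n x) = C.norm n x := by
  have h := mul_geom_sum (C.signedTau n) (n + 1)
  rw [hC.signedTau_pow, sub_self, sub_mul, one_mul, sub_eq_zero] at h
  exact LinearMap.congr_fun h x

theorem signedTau_d (n i : ℕ) (hi : i ≤ n) (x : C.X n) :
    C.signedTau (n + 1) ((-1 : k) ^ (i + 1) • C.d n (i + 1) x) =
      (-1 : k) ^ i • C.d n i (C.signedTau n x) := by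
  rw [signedTau_apply, signedTau_apply, map_smul, map_smul, hC.τ_δ n i hi, smul_smul, smul_smul]
  congr 1
  ring

theorem signedTau_hochschild (n : ℕ) (x : C.X n) :
    C.signedTau (n + 1) (C.hochschild n x) =
      C.b' n (C.signedTau n x) + (-1 : k) ^ (n + 1) • C.d n (n + 1) x := by
  rw [hochschild_apply, b'_apply, Finset.sum_range_succ', map_add, map_sum]
  congr 1
  · refine Finset.sum_congr rfl fun i hi => ?_
    rw [Finset.mem_range] at hi
    rw [hC.signedTau_d n i (by omega)]
  · rw [pow_zero, one_smul, signedTau_apply, hC.τ_δ_zero]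

theorem sub_signedTau_hochschild (n : ℕ) (x : C.X n) :
    C.hochschild n x - C.signedTau (n + 1) (C.hochschild n x) =
      C.b' n (x - C.signedTau n x) := by
  rw [hC.signedTau_hochschild, hochschild_eq_add, map_sub]
  abel

theorem norm_b'_norm (n : ℕ) (x : C.X n) :
    C.norm (n + 1) (C.b' n (C.norm n x)) = (n + 1 : k) • C.norm (n + 1) (C.b' n x) := by
  have h : ∀ y, C.norm (n + 1) (C.b' n (C.signedTau n y)) = C.norm (n + 1) (C.b' n y) := by
    intro y
    have := congrArg (C.norm (n + 1)) (hC.sub_signedTau_hochschild n y)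
    rw [map_sub, hC.norm_signedTau, sub_self, map_sub, map_sub, eq_comm, sub_eq_zero] at this
    exact this.symm
  have h' : ∀ i, C.norm (n + 1) (C.b' n ((C.signedTau n ^ i) x)) = C.norm (n + 1) (C.b' n x) := by
    intro i
    induction i with
    | zero => rfl
    | succ i ih => rw [pow_succ', Module.End.mul_apply, h, ih]
  rw [norm.eq_def C n, LinearMap.sum_apply, map_sum, map_sum, Finset.sum_congr rfl fun i _ => h' i]
  simp [← Nat.cast_smul_eq_nsmul k]

theorem hochschild_norm [CharZero k] (n : ℕ) (x : C.X n) :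
    C.hochschild n (C.norm n x) = C.norm (n + 1) (C.b' n x) := by
  have hE : ∀ i ≤ n + 1, C.norm (n + 1) ((-1 : k) ^ i • C.d n i (C.norm n x)) =
      C.norm (n + 1) (C.d n 0 (C.norm n x)) := by
    intro i hi
    induction i with
    | zero => rw [pow_zero, one_smul]
    | succ i ih =>
      rw [← ih (by omega), ← hC.norm_signedTau, hC.signedTau_d n i (by omega), hC.signedTau_norm]
  have h1 : C.norm (n + 1) (C.hochschild n (C.norm n x)) =
      ((n + 1 : ℕ) + 1 : k) • C.norm (n + 1) (C.d n 0 (C.norm n x)) := by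
    rw [hochschild_apply, map_sum, Finset.sum_congr rfl fun i hi => hE i (by
      rw [Finset.mem_range] at hi; omega)]
    simp [← Nat.cast_smul_eq_nsmul k, add_assoc, one_add_one_eq_two]
  have h2 : C.norm (n + 1) (C.b' n (C.norm n x)) =
      (n + 1 : k) • C.norm (n + 1) (C.d n 0 (C.norm n x)) := by
    rw [b'_apply, map_sum, Finset.sum_congr rfl fun i hi => hE i (by
      rw [Finset.mem_range] at hi; omega)]
    simp [← Nat.cast_smul_eq_nsmul k]
  have h3 := norm_of_fixed (n := n + 1) (x := C.hochschild n (C.norm n x)) (by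
    have := hC.sub_signedTau_hochschild n (C.norm n x)
    rw [hC.signedTau_norm, sub_self, map_zero, sub_eq_zero] at this
    exact this.symm)
  rw [h3] at h1
  rw [hC.norm_b'_norm] at h2
  have e1 := smul_right_injective _ (Nat.cast_add_one_ne_zero (R := k) (n + 1)) h1
  have e2 := smul_right_injective _ (Nat.cast_add_one_ne_zero (R := k) n) h2
  rw [e1, e2]

theorem extra_d_zero (n : ℕ) (x : C.X n) : C.extra n (C.d n 0 x) = x := by
  rw [extra_apply, hC.τ_δ_zero, hC.σ_δ_succ n n le_rfl]

theorem extra_d_succ (n i : ℕ) (hi : i ≤ n) (x : C.X (n + 1)) :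
    C.extra (n + 1) (C.d (n + 1) (i + 1) x) = C.d n i (C.extra n x) := by
  rw [extra_apply, hC.τ_δ _ _ (by omega), hC.σ_δ_lt _ _ _ hi le_rfl, extra_apply]

theorem extra_d_last (n : ℕ) (x : C.X n) : C.extra n (C.d n (n + 1) x) = C.τ n x := by
  rw [extra_apply, hC.τ_δ _ _ le_rfl, hC.σ_δ_self _ _ le_rfl]

theorem extra_b' (n : ℕ) (x : C.X (n + 1)) :
    C.extra (n + 1) (C.b' (n + 1) x) + C.b' n (C.extra n x) = x := by
  rw [b'_apply, b'_apply, Finset.sum_range_succ', map_add, map_sum]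
  have : ∀ i ∈ Finset.range (n + 1), C.extra (n + 1) ((-1 : k) ^ (i + 1) • C.d (n + 1) (i + 1) x) =
      -((-1 : k) ^ i • C.d n i (C.extra n x)) := by
    intro i hi
    rw [Finset.mem_range] at hi
    rw [map_smul, hC.extra_d_succ n i (by omega), pow_succ]
    simp
  rw [Finset.sum_congr rfl this, Finset.sum_neg_distrib, pow_zero, one_smul, hC.extra_d_zero]
  abel

theorem extra_b'_zero (x : C.X 0) : C.extra 0 (C.b' 0 x) = x := by
  rw [b'_apply]
  simp [hC.extra_d_zero]

theorem isMixed [CharZero k] : C.toMixed.IsMixed where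
  b_b n x := by
    change C.hochschild (n + 1) (C.hochschild n x) = 0
    rw [hC.hochschild_eq, hC.hochschild_eq]
    exact hC.cos.b_b n x
  B_B n x := by
    change C.connes n (C.connes (n + 1) x) = 0
    rw [connes_apply, connes_apply, hC.signedTau_norm, sub_self, map_zero, map_zero]
  b_B n x := by
    change C.hochschild n (C.connes n x) + C.connes (n + 1) (C.hochschild (n + 1) x) = 0
    rw [connes_apply, connes_apply, hC.hochschild_norm, hC.sub_signedTau_hochschild, ← map_add,
      add_comm (C.b' n _), hC.extra_b', map_sub, hC.norm_signedTau, sub_self]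
  B_b_zero x := by
    change C.connes 0 (C.hochschild 0 x) = 0
    rw [connes_apply, hC.sub_signedTau_hochschild, hC.extra_b'_zero, map_sub, hC.norm_signedTau,
      sub_self]

end IsCocyclic

variable (C) (D : CocyclicOperators.{u, w} k)

/-- The diagonal tensor product. -/
noncomputable abbrev diag : CocyclicOperators.{u, max v w} k where
  X n := C.X n ⊗[k] D.X n
  δ n i := TensorProduct.map (C.δ n i) (D.δ n i)
  σ n i := TensorProduct.map (C.σ n i) (D.σ n i)
  τ n := TensorProduct.map (C.τ n) (D.τ n)

theorem diag_d (n i : ℕ) : (diag C D).d n i = TensorProduct.map (C.d n i) (D.d n i) := by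
  simp only [d]
  split_ifs <;> simp

theorem diag_s (n i : ℕ) : (diag C D).s n i = TensorProduct.map (C.s n i) (D.s n i) := by
  simp only [s]
  split_ifs <;> simp

variable {C D}

theorem IsCocyclic.diag (hC : C.IsCocyclic) (hD : D.IsCocyclic) : (diag C D).IsCocyclic where
  δ_δ n i j h h' z := by
    simp only [diag_d]
    exact (hC.cos.diag hD.cos).δ_δ n i j h h' z
  σ_δ_lt n i j h h' z := by
    simp only [diag_d, diag_s]
    exact (hC.cos.diag hD.cos).σ_δ_lt n i j h h' z
  σ_δ_self n i h z := by
    simp only [diag_d, diag_s]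
    exact (hC.cos.diag hD.cos).σ_δ_self n i h z
  σ_δ_succ n i h z := by
    simp only [diag_d, diag_s]
    exact (hC.cos.diag hD.cos).σ_δ_succ n i h z
  σ_δ_gt n i j h h' z := by
    simp only [diag_d, diag_s]
    exact (hC.cos.diag hD.cos).σ_δ_gt n i j h h' z
  σ_σ n i j h h' z := by
    simp only [diag_s]
    exact (hC.cos.diag hD.cos).σ_σ n i j h h' z
  τ_δ n i h z := by
    simp only [diag_d, ← LinearMap.comp_apply, ← TensorProduct.map_comp]
    congr 2 <;> ext x
    · exact hC.τ_δ n i h x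
    · exact hD.τ_δ n i h x
  τ_δ_zero n z := by
    simp only [diag_d, ← LinearMap.comp_apply, ← TensorProduct.map_comp]
    congr 2 <;> ext x
    · exact hC.τ_δ_zero n x
    · exact hD.τ_δ_zero n x
  τ_σ n i h z := by
    simp only [diag_s, ← LinearMap.comp_apply, ← TensorProduct.map_comp]
    congr 2 <;> ext x
    · exact hC.τ_σ n i h x
    · exact hD.τ_σ n i h x
  τ_σ_zero n z := by
    simp only [diag_s, ← LinearMap.comp_apply, ← TensorProduct.map_comp]
    congr 2 <;> ext x
    · exact hC.τ_σ_zero n x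
    · exact hD.τ_σ_zero n x
  τ_pow n := by
    rw [TensorProduct.map_pow, hC.τ_pow, hD.τ_pow]
    exact TensorProduct.map_id

theorem IsCocyclic.diag_hochschild (hC : C.IsCocyclic) (hD : D.IsCocyclic) (n : ℕ) :
    (CocyclicOperators.diag C D).hochschild n = (hC.cos.diag hD.cos).b n := by
  refine LinearMap.ext fun z => ?_
  rw [hochschild_apply, (hC.cos.diag hD.cos).b_apply]
  simp only [diag_d]

end CocyclicOperators


namespace Cosimplicial

variable {k : Type u} [Field k]

section Normalized

variable (C : Cosimplicial.{u, v} k)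

/-- The normalized cochains: the common kernel of the codegeneracies. -/
def normalized : ∀ n, Submodule k (C.X n)
  | 0 => ⊤
  | n + 1 => ⨅ i : Fin (n + 1), LinearMap.ker (C.σ n i)

theorem mem_normalized_succ {n : ℕ} {x : C.X (n + 1)} :
    x ∈ C.normalized (n + 1) ↔ ∀ i ≤ n, C.σ n i x = 0 := by
  simp only [normalized, Submodule.mem_iInf, LinearMap.mem_ker]
  exact ⟨fun h i hi => h ⟨i, by omega⟩, fun h i => h i (by omega)⟩

theorem σ_lasts {i n : ℕ} (h : i ≤ n) (j : ℕ) (hj : i ≤ j) (hj' : j ≤ n) (x : C.X i) :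
    C.σ n j (C.lasts (h.trans n.le_succ) x) = C.lasts h x := by
  rw [← C.δ_lasts h (j + 1) (by omega) (by omega), C.σ_δ_succ _ _ hj']

theorem σ_zeros {i n : ℕ} (h : i ≤ n) (j : ℕ) (hj : i + j ≤ n) (x : C.X i) :
    C.σ n j (C.zeros (h.trans n.le_succ) x) = C.zeros h x := by
  rw [← C.δ_zeros h j hj, C.σ_δ_self _ _ (by omega)]

theorem σ_lasts_eq_zero {i n : ℕ} (h : i ≤ n + 1) (j : ℕ) (hj : j < i) {x : C.X i}
    (hx : x ∈ C.normalized i) : C.σ n j (C.lasts h x) = 0 := by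
  obtain ⟨i, rfl⟩ : ∃ i', i = i' + 1 := ⟨i - 1, by omega⟩
  rw [mem_normalized_succ] at hx
  induction n, (Nat.succ_le_succ_iff.1 h) using Nat.le_induction with
  | base => rw [lasts_self, hx j (by omega)]
  | succ n h' ih =>
    rw [C.lasts_succ (Nat.succ_le_succ h'), C.σ_δ_gt n (n + 1) j (by omega) le_rfl, ih, map_zero]

theorem σ_zeros_eq_zero {i n : ℕ} (h : i ≤ n + 1) (j : ℕ) (hj : n + 1 ≤ j + i) (hj' : j ≤ n)
    {x : C.X i} (hx : x ∈ C.normalized i) : C.σ n j (C.zeros h x) = 0 := by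
  obtain ⟨i, rfl⟩ : ∃ i', i = i' + 1 := ⟨i - 1, by omega⟩
  rw [mem_normalized_succ] at hx
  induction n, (Nat.succ_le_succ_iff.1 h) using Nat.le_induction generalizing j with
  | base => rw [zeros_self, hx j (by omega)]
  | succ n h' ih =>
    obtain ⟨j, rfl⟩ : ∃ j', j = j' + 1 := ⟨j - 1, by omega⟩
    rw [C.zeros_succ (Nat.succ_le_succ h'), C.σ_δ_lt n 0 j (by omega) (by omega),
      ih j (by omega) (by omega) (by omega), map_zero]

end Normalized

section Evaluation

/-- A lattice path along which the shuffle map of `U ⊗ V` can be evaluated: `p` steps to the left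
and `q` steps to the right remain, starting from the offsets `i` and `j`; the last index is the
exponent of the sign. -/
inductive ShufflePath (C : Cosimplicial.{u, v} k) (D : Cosimplicial.{u, w} k)
    (U : ∀ N, C.X N) (V : ∀ N, D.X N) : ℕ → ℕ → ℕ → ℕ → ℕ → Prop
  | nil (i j : ℕ) : ShufflePath C D U V i j 0 0 0
  | left {i j p q e : ℕ} (hU : ∀ N, N = i + p + q → C.σ N i (U (N + 1)) = 0)
      (hV : ∀ N, N = j + p + q → D.σ N j (V (N + 1)) = V N)
      (h : ShufflePath C D U V (i + 1) j p q e) : ShufflePath C D U V i j (p + 1) q e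
  | right {i j p q e : ℕ} (hU : ∀ N, N = i + p + q → C.σ N i (U (N + 1)) = U N)
      (hV : ∀ N, N = j + p + q → D.σ N j (V (N + 1)) = 0)
      (h : ShufflePath C D U V i (j + 1) p q e) : ShufflePath C D U V i j p (q + 1) (e + p)

variable {C : Cosimplicial.{u, v} k} {D : Cosimplicial.{u, w} k}
  {U : ∀ N, C.X N} {V : ∀ N, D.X N}

theorem ShufflePath.dec_left {i i' j p q e : ℕ} (h : ShufflePath C D U V i' j p q e)
    (hi : i' = i + 1) :
    ShufflePath C.dec D (fun N => C.shift N (U (N + 1))) V i j p q e := by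
  induction h generalizing i with
  | nil => exact .nil _ _
  | left hU hV _ ih =>
    subst hi
    exact .left (fun N hN => (C.dec_σ _ _ _).trans (by rw [hU (N + 1) (by omega), map_zero])) hV
      (ih rfl)
  | right hU hV _ ih =>
    subst hi
    exact .right (fun N hN => (C.dec_σ _ _ _).trans (by rw [hU (N + 1) (by omega)])) hV (ih rfl)

theorem ShufflePath.dec_right {i j j' p q e : ℕ} (h : ShufflePath C D U V i j' p q e)
    (hj : j' = j + 1) :
    ShufflePath C D.dec U (fun N => D.shift N (V (N + 1))) i j p q e := by
  induction h generalizing j with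
  | nil => exact .nil _ _
  | left hU hV _ ih =>
    subst hj
    exact .left hU (fun N hN => (D.dec_σ _ _ _).trans (by rw [hV (N + 1) (by omega)])) (ih rfl)
  | right hU hV _ ih =>
    subst hj
    exact .right hU (fun N hN => (D.dec_σ _ _ _).trans (by rw [hV (N + 1) (by omega), map_zero]))
      (ih rfl)

theorem ShufflePath.shuffle_eq : ∀ {n : ℕ} {C : Cosimplicial.{u, v} k} {D : Cosimplicial.{u, w} k}
    {U : ∀ N, C.X N} {V : ∀ N, D.X N} {p q e : ℕ} (_ : ShufflePath C D U V 0 0 p q e)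
    (hn : p + q = n), shuffle n C D (U n ⊗ₜ V n) =
      (-1 : k) ^ e • KunnethSum.incl k C.X D.X p q hn (U p ⊗ₜ V q)
  | 0, C, D, U, V, p, q, e, h, hn => by
    cases h with
    | nil => rw [shuffle_zero, pow_zero, one_smul]
    | left => omega
    | right => omega
  | n + 1, C, D, U, V, p, q, e, h, hn => by
    cases h with
    | nil => omega
    | left hU hV h =>
      have ih := (h.dec_left rfl).shuffle_eq (n := n) (by omega)
      rw [shuffle_succ, hV n (by omega), hU n (by omega), TensorProduct.zero_tmul, map_zero,
        map_zero, add_zero]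
      beta_reduce at ih
      rw [ih, map_smul, incLeft_incl, LinearEquiv.symm_apply_apply]
    | @right _ _ p q e hU hV h =>
      have ih := (h.dec_right rfl).shuffle_eq (n := n) (by omega)
      rw [shuffle_succ, hV n (by omega), hU n (by omega), TensorProduct.tmul_zero, map_zero,
        map_zero, zero_add]
      beta_reduce at ih
      rw [ih, map_smul, incRight_incl, LinearEquiv.symm_apply_apply, smul_smul, pow_add]

theorem ShufflePath.lefts {p q e j : ℕ} : ∀ (a i : ℕ)
    (_ : ∀ N t, t < a → N + 1 = i + a + p + q → C.σ N (i + t) (U (N + 1)) = 0)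
    (_ : ∀ N, j + p + q ≤ N → N < j + a + p + q → D.σ N j (V (N + 1)) = V N)
    (_ : ShufflePath C D U V (i + a) j p q e), ShufflePath C D U V i j (p + a) q e
  | 0, _, _, _, h => h
  | a + 1, i, hU, hV, h => by
    refine .left (p := p + a) (fun N hN => hU N 0 (by omega) (by omega))
      (fun N hN => hV N (by omega) (by omega)) (.lefts a (i + 1) (fun N t ht hN => ?_)
        (fun N hN hN' => hV N hN (by omega)) ?_)
    · rw [show i + 1 + t = i + (t + 1) by omega]
      exact hU N (t + 1) (by omega) (by omega)
    · rwa [show i + 1 + a = i + (a + 1) by omega]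

theorem ShufflePath.rights {p q e i : ℕ} : ∀ (a j : ℕ)
    (_ : ∀ N, i + p + q ≤ N → N < i + a + p + q → C.σ N i (U (N + 1)) = U N)
    (_ : ∀ N t, t < a → N + 1 = j + a + p + q → D.σ N (j + t) (V (N + 1)) = 0)
    (_ : ShufflePath C D U V i (j + a) p q e), ShufflePath C D U V i j p (q + a) (e + a * p)
  | 0, _, _, _, h => by simpa using h
  | a + 1, j, hU, hV, h => by
    rw [add_mul, one_mul, ← add_assoc e]
    refine .right (q := q + a) (e := e + a * p) (fun N hN => hU N (by omega) (by omega))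
      (fun N hN => hV N 0 (by omega) (by omega)) (.rights a (j + 1)
        (fun N hN hN' => hU N hN (by omega)) (fun N t ht hN => ?_) ?_)
    · rw [show j + 1 + t = j + (t + 1) by omega]
      exact hV N (t + 1) (by omega) (by omega)
    · rwa [show j + 1 + a = j + (a + 1) by omega]

/-- On normalized cochains, the shuffle map is a left inverse of the Alexander-Whitney map. -/
theorem shuffle_aw_incl (C : Cosimplicial.{u, v} k) (D : Cosimplicial.{u, w} k) {n : ℕ} (p q : ℕ)
    (h : p + q = n) {x : C.X p} {y : D.X q} (hx : x ∈ C.normalized p) (hy : y ∈ D.normalized q) :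
    shuffle n C D (aw C D n (KunnethSum.incl k C.X D.X p q h (x ⊗ₜ y))) =
      KunnethSum.incl k C.X D.X p q h (x ⊗ₜ y) := by
  let U : ∀ N, C.X N := fun N => if h : p ≤ N then C.lasts h x else 0
  let V : ∀ N, D.X N := fun N => if h : q ≤ N then D.zeros h y else 0
  have hU : ∀ N (h : p ≤ N), U N = C.lasts h x := fun N h => dif_pos h
  have hV : ∀ N (h : q ≤ N), V N = D.zeros h y := fun N h => dif_pos h
  have hp : ShufflePath C D U V 0 0 (0 + p) (0 + q) (0 + q * 0) := by
    refine .lefts p 0 (fun N t ht hN => ?_) (fun N hN hN' => ?_)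
      (.rights q 0 (fun N hN hN' => ?_) (fun N t ht hN => ?_) (.nil _ _))
    · rw [hU _ (by omega), zero_add, C.σ_lasts_eq_zero _ _ ht hx]
    · rw [hV N (by omega), hV _ (by omega), D.σ_zeros _ _ (by omega)]
    · rw [hU N (by omega), hU _ (by omega), C.σ_lasts _ _ (by omega) (by omega)]
    · rw [hV _ (by omega), zero_add, D.σ_zeros_eq_zero _ _ (by omega) (by omega) hy]
  simp only [zero_add, mul_zero] at hp
  have := hp.shuffle_eq h
  rw [hU n (by omega), hV n (by omega), hU p le_rfl, hV q le_rfl, lasts_self, zeros_self, pow_zero,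
    one_smul] at this
  rw [aw_incl, this]

end Evaluation

end Cosimplicial

namespace CocyclicOperators.IsCocyclic

variable {k : Type u} [Field k] {C : CocyclicOperators.{u, v} k} (hC : C.IsCocyclic)
include hC

theorem extra_τ (n : ℕ) (x : C.X (n + 1)) : C.extra n (C.τ (n + 1) x) = C.τ n (C.s n 0 x) :=
  (hC.τ_σ_zero n x).symm

theorem s_τ_pow (n : ℕ) : ∀ (l i : ℕ) (_ : i + l ≤ n) (x : C.X (n + 1)),
    C.s n i ((C.τ (n + 1) ^ l) x) = (C.τ n ^ l) (C.s n (i + l) x)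
  | 0, _, _, _ => rfl
  | l + 1, i, h, x => by
    rw [pow_succ', Module.End.mul_apply, ← hC.τ_σ n i (by omega), s_τ_pow n l (i + 1) (by omega),
      pow_succ', Module.End.mul_apply, add_right_comm, add_assoc]

theorem s_τ_pow_eq_extra (n i l : ℕ) (h : i + l = n) (x : C.X (n + 1)) :
    C.s n i ((C.τ (n + 1) ^ (l + 1)) x) = (C.τ n ^ l) (C.extra n x) := by
  subst h
  rw [pow_succ, Module.End.mul_apply, hC.s_τ_pow _ _ _ le_rfl, extra_apply]

theorem s_τ_pow_wrap (n i l c : ℕ) (h : i + l = n + 1 + c) (hi : i ≤ n) (hl : c ≤ n)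
    (x : C.X (n + 1)) :
    C.s n i ((C.τ (n + 1) ^ (l + 1)) x) = (C.τ n ^ l) (C.s n c x) := by
  have e : l + 1 = (n - i) + (c + 2) := by omega
  have e' : l = (n - i) + (c + 1) := by omega
  rw [e, pow_add, Module.End.mul_apply, hC.s_τ_pow _ _ _ (by omega),
    show i + (n - i) = n by omega, pow_succ' _ (c + 1), Module.End.mul_apply, ← extra_apply,
    pow_succ' _ c, Module.End.mul_apply, hC.extra_τ, hC.s_τ_pow _ _ _ (by omega), zero_add,
    e', pow_add, Module.End.mul_apply, pow_succ', Module.End.mul_apply]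

theorem s_extra (n i : ℕ) (hi : i ≤ n) (x : C.X (n + 2)) :
    C.s n i (C.extra (n + 1) x) = C.extra n (C.s (n + 1) (i + 1) x) := by
  rw [extra_apply, ← hC.σ_σ n i n hi le_rfl, ← hC.τ_σ (n + 1) i (by omega), extra_apply]

theorem extra_extra (n : ℕ) (x : C.X (n + 2)) :
    C.extra n (C.extra (n + 1) x) = C.extra n (C.s (n + 1) 0 x) := by
  rw [extra_apply, extra_apply, extra_apply, hC.τ_σ (n + 1) n le_rfl, hC.τ_σ_zero,
    ← hC.σ_σ n n n le_rfl le_rfl]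

theorem s_τ_pow_extra (n i l : ℕ) (h : i + l ≤ n) (x : C.X (n + 2)) :
    C.s n i ((C.τ (n + 1) ^ l) (C.extra (n + 1) x)) =
      (C.τ n ^ l) (C.extra n (C.s (n + 1) (i + l + 1) x)) := by
  rw [hC.s_τ_pow _ _ _ h, hC.s_extra _ _ h]

theorem s_τ_pow_extra_wrap (n i l c : ℕ) (h : i + l = n + c) (hi : i ≤ n) (hc : c ≤ n + 1)
    (x : C.X (n + 2)) :
    C.s n i ((C.τ (n + 1) ^ (l + 1)) (C.extra (n + 1) x)) =
      (C.τ n ^ l) (C.extra n (C.s (n + 1) c x)) := by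
  cases c with
  | zero => rw [hC.s_τ_pow_eq_extra n i l (by omega), hC.extra_extra]
  | succ c => rw [hC.s_τ_pow_wrap n i l c (by omega) hi (by omega), hC.s_extra _ _ (by omega)]

end CocyclicOperators.IsCocyclic


theorem tensor_B_incl {k : Type u} [Field k] (C : MixedOperators.{u, v} k) (D : MixedOperators.{u, w} k) (n p q : ℕ)
    (h : p + q = n + 1) (z : C.X p ⊗[k] D.X q) :
    (C.tensor D).B n (KunnethSum.incl k C.X D.X p q h z) =
      tensorLowerLeft C.B n p q h z + tensorLowerRight D.B n p q h z := by
  simp [KunnethSum.incl]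

namespace CocyclicOperators

variable {k : Type u} [Field k] {C : CocyclicOperators.{u, v} k} {D : CocyclicOperators.{u, w} k}

theorem signedTau_pow_apply (n l : ℕ) (x : C.X n) :
    (C.signedTau n ^ l) x = (-1 : k) ^ (n * l) • (C.τ n ^ l) x := by
  rw [signedTau, smul_pow, ← pow_mul, LinearMap.smul_apply]

theorem norm_eq_sum (n : ℕ) (z : C.X n) :
    C.norm n z = ∑ l ∈ Finset.range (n + 1), (-1 : k) ^ (n * l) • (C.τ n ^ l) z := by
  rw [norm, LinearMap.sum_apply]
  exact Finset.sum_congr rfl fun l _ => signedTau_pow_apply n l z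

theorem diag_extra (n : ℕ) (x : C.X (n + 1)) (y : D.X (n + 1)) :
    (CocyclicOperators.diag C D).extra n (x ⊗ₜ y) = C.extra n x ⊗ₜ D.extra n y := by
  rw [extra, diag_s]
  rfl

end CocyclicOperators

namespace CocyclicOperators.IsCocyclic

variable {k : Type u} [Field k] {C : CocyclicOperators.{u, v} k} (hC : C.IsCocyclic)

section
include hC

theorem connes_of_s_zero (n : ℕ) (z : C.X (n + 1)) (hz : C.s n 0 z = 0) :
    C.connes n z = C.norm n (C.extra n z) := by
  rw [connes_apply, map_sub, signedTau_apply, map_smul, hC.extra_τ, hz, map_zero, smul_zero,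
    sub_zero]

theorem s_lasts {i n : ℕ} (h : i ≤ n) (h' : i ≤ n + 1) (j : ℕ) (hj : i ≤ j) (hj' : j ≤ n)
    (x : C.X i) : C.s n j (hC.cos.lasts h' x) = hC.cos.lasts h x :=
  hC.cos.σ_lasts h j hj hj' x

theorem s_zeros {i n : ℕ} (h : i ≤ n) (h' : i ≤ n + 1) (j : ℕ) (hj : i + j ≤ n) (x : C.X i) :
    C.s n j (hC.cos.zeros h' x) = hC.cos.zeros h x :=
  hC.cos.σ_zeros h j hj x

theorem s_lasts_eq_zero {i n : ℕ} (h : i ≤ n + 1) (j : ℕ) (hj : j < i) {x : C.X i}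
    (hx : x ∈ hC.cos.normalized i) : C.s n j (hC.cos.lasts h x) = 0 :=
  hC.cos.σ_lasts_eq_zero h j hj hx

theorem s_zeros_eq_zero {i n : ℕ} (h : i ≤ n + 1) (j : ℕ) (hj : n + 1 ≤ j + i) (hj' : j ≤ n)
    {x : C.X i} (hx : x ∈ hC.cos.normalized i) : C.s n j (hC.cos.zeros h x) = 0 :=
  hC.cos.σ_zeros_eq_zero h j hj hj' hx

theorem extra_zeros {i n : ℕ} (h : i ≤ n) (h' : i ≤ n + 1) (x : C.X i) :
    C.extra n (hC.cos.zeros h' x) = hC.cos.zeros h x := by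
  rw [hC.cos.zeros_succ h]
  exact hC.extra_d_zero n _

theorem extra_lasts {i n : ℕ} (h : i ≤ n) (h' : i ≤ n + 1) (x : C.X i) :
    C.extra n (hC.cos.lasts h' x) = C.τ n (hC.cos.lasts h x) := by
  rw [hC.cos.lasts_succ h]
  exact hC.extra_d_last n _

theorem normalized_s {n : ℕ} {x : C.X (n + 1)} (hx : x ∈ hC.cos.normalized (n + 1)) {i : ℕ}
    (hi : i ≤ n) : C.s n i x = 0 :=
  hC.cos.mem_normalized_succ.1 hx i hi

end

variable {D : CocyclicOperators.{u, w} k} (hD : D.IsCocyclic)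
include hC hD

theorem shuffle_connes_left (a l q : ℕ) {x : C.X (a + l + 1)} {y : D.X q}
    (hx : x ∈ hC.cos.normalized (a + l + 1)) (hy : y ∈ hD.cos.normalized q) :
    Cosimplicial.shuffle (a + l + q) hC.cos hD.cos
      ((C.τ _ ^ l) (C.extra _ (hC.cos.lasts (show a + l + 1 ≤ a + l + q + 1 by omega) x)) ⊗ₜ
        (D.τ _ ^ l) (D.extra _ (hD.cos.zeros (show q ≤ a + l + q + 1 by omega) y))) =
      (-1 : k) ^ (q * l) • KunnethSum.incl k C.X D.X (a + l) q rfl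
        ((C.τ _ ^ l) (C.extra _ x) ⊗ₜ y) := by
  let U : ∀ N, C.X N := fun N =>
    if h : a + l + 1 ≤ N + 1 then (C.τ N ^ l) (C.extra N (hC.cos.lasts h x)) else 0
  let V : ∀ N, D.X N := fun N =>
    if h : q ≤ N then (D.τ N ^ (min l (N - q))) (hD.cos.zeros h y) else 0
  have hU : ∀ N (h : a + l + 1 ≤ N + 1), U N = (C.τ N ^ l) (C.extra N (hC.cos.lasts h x)) :=
    fun N h => dif_pos h
  have hV : ∀ N r (h : q ≤ N), min l (N - q) = r → V N = (D.τ N ^ r) (hD.cos.zeros h y) := by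
    rintro N r h rfl
    exact dif_pos h
  have hp : Cosimplicial.ShufflePath hC.cos hD.cos U V 0 0 (0 + l + a) (0 + q)
      (0 + q * (0 + l)) := by
    refine .lefts a 0 (fun N t ht hN => ?_) (fun N hN hN' => ?_)
      (.rights q 0 (fun N hN hN' => ?_) (fun N t ht hN => ?_)
        (.lefts l _ (fun N t ht hN => ?_) (fun N hN hN' => ?_) (.nil _ _)))
    · change C.s N _ _ = 0
      rw [hU _ (by omega), hC.s_τ_pow_extra _ _ _ (by omega), hC.s_lasts_eq_zero _ _ (by omega) hx,
        map_zero, map_zero]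
    · change D.s N _ _ = _
      rw [hV _ l (by omega) (by omega), hV _ l (by omega) (by omega), hD.s_τ_pow _ _ _ (by omega),
        hD.s_zeros (by omega) _ _ (by omega)]
    · change C.s N _ _ = _
      rw [hU _ (by omega), hU _ (by omega), hC.s_τ_pow_extra _ _ _ (by omega),
        hC.s_lasts (by omega) _ _ (by omega) (by omega)]
    · change D.s N _ _ = _
      rw [hV _ l (by omega) (by omega), hD.s_τ_pow _ _ _ (by omega),
        hD.s_zeros_eq_zero _ _ (by omega) (by omega) hy, map_zero]
    · change C.s N _ _ = 0
      obtain ⟨l, rfl⟩ : ∃ l', l = l' + 1 := ⟨l - 1, by omega⟩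
      rw [hU _ (by omega), hC.s_τ_pow_extra_wrap _ _ _ t (by omega) (by omega) (by omega),
        hC.s_lasts_eq_zero _ _ (by omega) hx, map_zero, map_zero]
    · change D.s N _ _ = _
      rw [hV _ (N - q + 1) (by omega) (by omega), hV _ (N - q) (by omega) (by omega),
        hD.s_τ_pow_eq_extra _ _ _ (by omega), hD.extra_zeros (by omega)]
  rw [show 0 + l + a = a + l by omega, zero_add, zero_add, zero_add] at hp
  have := hp.shuffle_eq rfl
  rw [hU (a + l) le_rfl, hC.cos.lasts_self, hV q 0 le_rfl (by omega), hD.cos.zeros_self, hU _ (by omega),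
    hV (a + l + q) l (by omega) (by omega)] at this
  rw [hD.extra_zeros (by omega), this]
  rfl

theorem shuffle_connes_right (a c p : ℕ) {x : C.X p} {y : D.X (a + c + 1)}
    (hx : x ∈ hC.cos.normalized p) (hy : y ∈ hD.cos.normalized (a + c + 1)) :
    Cosimplicial.shuffle (p + (a + c)) hC.cos hD.cos
      ((C.τ _ ^ (p + c)) (C.extra _ (hC.cos.lasts (show p ≤ p + (a + c) + 1 by omega) x)) ⊗ₜ
        (D.τ _ ^ (p + c)) (D.extra _ (hD.cos.zeros
          (show a + c + 1 ≤ p + (a + c) + 1 by omega) y))) =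
      (-1 : k) ^ (a * p) • KunnethSum.incl k C.X D.X p (a + c) rfl
        (x ⊗ₜ (D.τ _ ^ c) (D.extra _ y)) := by
  let U : ∀ N, C.X N := fun N =>
    if h : p ≤ N then (C.τ N ^ (min (p + c) N + 1)) (hC.cos.lasts h x) else 0
  let V : ∀ N, D.X N := fun N =>
    if h : a + c + 1 ≤ N + 1 then
      (D.τ N ^ (min (p + c) (N - a))) (D.extra N (hD.cos.zeros h y)) else 0
  have hU : ∀ N r (h : p ≤ N), min (p + c) N = r →
      U N = (C.τ N ^ (r + 1)) (hC.cos.lasts h x) := by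
    rintro N r h rfl
    exact dif_pos h
  have hU' : ∀ N (h : p ≤ N), N ≤ p + c → U N = hC.cos.lasts h x := by
    intro N h h'
    rw [hU N N h (by omega), hC.τ_pow]
    rfl
  have hV : ∀ N r (h : a + c + 1 ≤ N + 1), min (p + c) (N - a) = r →
      V N = (D.τ N ^ r) (D.extra N (hD.cos.zeros h y)) := by
    rintro N r h rfl
    exact dif_pos h
  have hp : Cosimplicial.ShufflePath hC.cos hD.cos U V 0 0 (0 + p) (0 + c + a)
      (0 + c * 0 + a * (0 + p)) := by
    refine .rights a 0 (fun N hN hN' => ?_) (fun N t ht hN => ?_)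
      (.lefts p 0 (fun N t ht hN => ?_) (fun N hN hN' => ?_)
        (.rights c _ (fun N hN hN' => ?_) (fun N t ht hN => ?_) (.nil _ _)))
    · change C.s N _ _ = _
      rw [hU _ (p + c) (by omega) (by omega), hU _ (p + c) (by omega) (by omega)]
      rcases (show p + c ≤ N by omega).eq_or_lt with h | h
      · rw [hC.s_τ_pow_eq_extra _ _ _ (by omega), hC.extra_lasts (by omega), pow_succ]
        rfl
      · rw [hC.s_τ_pow _ _ _ (by omega), hC.s_lasts (by omega) _ _ (by omega) (by omega)]
    · change D.s N _ _ = _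
      rw [hV _ (p + c) (by omega) (by omega), hD.s_τ_pow_extra _ _ _ (by omega),
        hD.s_zeros_eq_zero _ _ (by omega) (by omega) hy, map_zero, map_zero]
    · change C.s N _ _ = _
      rw [hU' _ (by omega) (by omega), hC.s_lasts_eq_zero _ _ (by omega) hx]
    · change D.s N _ _ = _
      rw [hV _ (N - a + 1) (by omega) (by omega), hV _ (N - a) (by omega) (by omega),
        hD.s_τ_pow_extra_wrap _ _ _ 0 (by omega) (by omega) (by omega),
        hD.s_zeros (by omega) _ _ (by omega)]
    · change C.s N _ _ = _
      rw [hU' _ (by omega) (by omega), hU' _ (by omega) (by omega),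
        hC.s_lasts (by omega) _ _ (by omega) (by omega)]
    · change D.s N _ _ = _
      obtain ⟨c, rfl⟩ : ∃ l', c = l' + 1 := ⟨c - 1, by omega⟩
      rw [hV _ (c + 1) (by omega) (by omega),
        hD.s_τ_pow_extra_wrap _ _ _ t (by omega) (by omega) (by omega),
        hD.s_zeros_eq_zero _ _ (by omega) (by omega) hy, map_zero, map_zero]
  rw [show 0 + c + a = a + c by omega, zero_add, mul_zero, zero_add, zero_add] at hp
  have := hp.shuffle_eq rfl
  rw [hU' p le_rfl (by omega), hC.cos.lasts_self, hV (a + c) c le_rfl (by omega),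
    hD.cos.zeros_self, hU (p + (a + c)) (p + c) (by omega) (by omega),
    hV (p + (a + c)) (p + c) (by omega) (by omega)] at this
  rw [hC.extra_lasts (by omega), ← Module.End.mul_apply, ← pow_succ, this]

/-- On normalized cochains, the shuffle map transports Connes' operator of the diagonal complex
to that of the tensor product. -/
theorem shuffle_connes_aw {n : ℕ} (p q : ℕ) (h : p + q = n + 1) {x : C.X p} {y : D.X q}
    (hx : x ∈ hC.cos.normalized p) (hy : y ∈ hD.cos.normalized q) :
    Cosimplicial.shuffle n hC.cos hD.cos ((CocyclicOperators.diag C D).connes n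
      (Cosimplicial.aw hC.cos hD.cos (n + 1) (KunnethSum.incl k C.X D.X p q h (x ⊗ₜ y)))) =
    (C.toMixed.tensor D.toMixed).B n (KunnethSum.incl k C.X D.X p q h (x ⊗ₜ y)) := by
  have hz : (CocyclicOperators.diag C D).s n 0
      (Cosimplicial.aw hC.cos hD.cos (n + 1) (KunnethSum.incl k C.X D.X p q h (x ⊗ₜ y))) = 0 := by
    rw [Cosimplicial.aw_incl, diag_s, TensorProduct.map_tmul]
    rcases Nat.eq_zero_or_pos p with hp | hp
    · rw [hD.s_zeros_eq_zero _ _ (by omega) (by omega) hy, TensorProduct.tmul_zero]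
    · rw [hC.s_lasts_eq_zero _ _ hp hx, TensorProduct.zero_tmul]
  rw [(hC.diag hD).connes_of_s_zero n _ hz, norm_eq_sum, map_sum, Cosimplicial.aw_incl,
    diag_extra]
  simp only [map_smul, TensorProduct.map_pow, TensorProduct.map_tmul]
  rw [show Finset.range (n + 1) = Finset.range (p + q) from congrArg _ h.symm,
    Finset.sum_range_add]
  refine Eq.trans ?_ (tensor_B_incl C.toMixed D.toMixed n p q h (x ⊗ₜ y)).symm
  congr 1
  · cases p with
    | zero => simp [tensorLowerLeft]
    | succ p =>
      change _ = KunnethSum.incl k C.X D.X p q _ (C.connes p x ⊗ₜ y)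
      rw [hC.connes_of_s_zero p x (hC.normalized_s hx p.zero_le), norm_eq_sum,
        TensorProduct.sum_tmul, map_sum]
      refine Finset.sum_congr rfl fun l hl => ?_
      rw [Finset.mem_range] at hl
      obtain ⟨a, rfl⟩ : ∃ a, p = a + l := ⟨p - l, by omega⟩
      obtain rfl : n = a + l + q := by omega
      rw [shuffle_connes_left hC hD a l q hx hy, smul_smul, ← pow_add, ← TensorProduct.smul_tmul',
        map_smul]
      congr 1
      refine neg_one_pow_congr ?_
      simp only [parity_simps]
      tauto
  · cases q with
    | zero => simp [tensorLowerRight]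
    | succ q =>
      change _ = (-1 : k) ^ p • KunnethSum.incl k C.X D.X p q _ (x ⊗ₜ D.connes q y)
      rw [hD.connes_of_s_zero q y (hD.normalized_s hy q.zero_le), norm_eq_sum,
        TensorProduct.tmul_sum, map_sum, Finset.smul_sum]
      refine Finset.sum_congr rfl fun c hc => ?_
      rw [Finset.mem_range] at hc
      obtain ⟨a, rfl⟩ : ∃ a, q = a + c := ⟨q - c, by omega⟩
      obtain rfl : n = p + (a + c) := by omega
      rw [shuffle_connes_right hC hD a c p hx hy, smul_smul, ← pow_add, TensorProduct.tmul_smul,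
        map_smul, smul_smul, ← pow_add]
      congr 1
      refine neg_one_pow_congr ?_
      simp only [parity_simps]
      tauto

end CocyclicOperators.IsCocyclic


variable {k : Type u} [Field k]

namespace Cosimplicial

/-- The cosimplicial submodule on a family of subspaces stable under the operators. -/
abbrev sub (C : Cosimplicial.{u, v} k) (E : ∀ n, Submodule k (C.X n))
    (hδ : ∀ n i, ∀ x ∈ E n, C.δ n i x ∈ E (n + 1)) (hσ : ∀ n i, ∀ x ∈ E (n + 1), C.σ n i x ∈ E n) :
    Cosimplicial.{u, v} k where
  X n := E n
  δ n i := (C.δ n i).restrict (hδ n i)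
  σ n i := (C.σ n i).restrict (hσ n i)
  δ_δ n i j h h' x := Subtype.ext (C.δ_δ n i j h h' x)
  σ_δ_lt n i j h h' x := Subtype.ext (C.σ_δ_lt n i j h h' x)
  σ_δ_self n i h x := Subtype.ext (C.σ_δ_self n i h x)
  σ_δ_succ n i h x := Subtype.ext (C.σ_δ_succ n i h x)
  σ_δ_gt n i j h h' x := Subtype.ext (C.σ_δ_gt n i j h h' x)
  σ_σ n i j h h' x := Subtype.ext (C.σ_σ n i j h h' x)

/-- The inclusion of a cosimplicial submodule. -/
abbrev subtype (C : Cosimplicial.{u, v} k) (E : ∀ n, Submodule k (C.X n))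
    (hδ : ∀ n i, ∀ x ∈ E n, C.δ n i x ∈ E (n + 1)) (hσ : ∀ n i, ∀ x ∈ E (n + 1), C.σ n i x ∈ E n) :
    Hom (C.sub E hδ hσ) C where
  f n := (E n).subtype
  f_δ _ _ _ _ := rfl
  f_σ _ _ _ _ := rfl

theorem σ_δ_normalized (C : Cosimplicial.{u, v} k) {n i j : ℕ} (hi : i ≤ n + 1) (hj : j ≤ n)
    {x : C.X n} (hx : x ∈ C.normalized n) :
    C.σ n j (C.δ n i x) = if i = j ∨ i = j + 1 then x else 0 := by
  split_ifs with h
  · rcases h with rfl | rfl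
    · exact C.σ_δ_self n _ hj x
    · exact C.σ_δ_succ n _ hj x
  · obtain ⟨n, rfl⟩ : ∃ n', n = n' + 1 := ⟨n - 1, by omega⟩
    rw [mem_normalized_succ] at hx
    rcases lt_or_gt_of_ne (show i ≠ j by tauto) with h' | h'
    · obtain ⟨j, rfl⟩ : ∃ j', j = j' + 1 := ⟨j - 1, by omega⟩
      rw [C.σ_δ_lt n i j (by omega) (by omega), hx _ (by omega), map_zero]
    · obtain ⟨i, rfl⟩ : ∃ i', i = i' + 1 := ⟨i - 1, by omega⟩
      rw [C.σ_δ_gt n i j (by omega) (by omega), hx _ (by omega), map_zero]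

theorem b_mem_normalized (C : Cosimplicial.{u, v} k) {n : ℕ} {x : C.X n}
    (hx : x ∈ C.normalized n) : C.b n x ∈ C.normalized (n + 1) := by
  rw [mem_normalized_succ]
  intro j hj
  rw [b_apply, map_sum]
  have : ∀ i ∈ Finset.range (n + 2), C.σ n j ((-1 : k) ^ i • C.δ n i x) =
      (if i = j then (-1 : k) ^ i • x else 0) + (if i = j + 1 then (-1 : k) ^ i • x else 0) := by
    intro i hi
    rw [Finset.mem_range] at hi
    rw [map_smul, C.σ_δ_normalized (by omega) hj hx]
    by_cases h1 : i = j
    · subst h1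
      simp
    · simp [h1]
  rw [Finset.sum_congr rfl this, Finset.sum_add_distrib, Finset.sum_ite_eq', Finset.sum_ite_eq',
    if_pos (Finset.mem_range.2 (by omega)), if_pos (Finset.mem_range.2 (by omega)), pow_succ]
  simp

end Cosimplicial

theorem CocyclicOperators.s_of_lt (C : CocyclicOperators.{u, v} k) {n i : ℕ} (hi : n < i) (x : C.X (n + 1)) :
    C.s n i x = 0 := by
  rw [s, dif_neg (by omega), LinearMap.zero_apply]

namespace CocyclicOperators.IsCocyclic

variable {C : CocyclicOperators.{u, v} k} (hC : C.IsCocyclic)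

section
include hC

theorem τ_pow_mod (n l : ℕ) : C.τ n ^ l = C.τ n ^ (l % (n + 1)) := by
  conv_lhs => rw [← Nat.div_add_mod l (n + 1), pow_add, pow_mul, hC.τ_pow, one_pow, one_mul]

theorem s_τ_pow_normalized {n : ℕ} (i l : ℕ) {x : C.X (n + 1)}
    (hx : x ∈ hC.cos.normalized (n + 1)) :
    C.s n i ((C.τ (n + 1) ^ l) x) = 0 ∨
      ∃ l', C.s n i ((C.τ (n + 1) ^ l) x) = (C.τ n ^ l') (C.extra n x) := by
  rcases Nat.lt_or_ge n i with hi | hi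
  · exact .inl (C.s_of_lt hi _)
  rw [hC.τ_pow_mod]
  have := Nat.mod_lt l (show 0 < n + 1 + 1 by omega)
  generalize l % (n + 1 + 1) = r at this
  rcases Nat.lt_or_ge n (i + r) with h | h
  · obtain ⟨r, rfl⟩ : ∃ r', r = r' + 1 := ⟨r - 1, by omega⟩
    rcases (show n ≤ i + r by omega).eq_or_lt with h' | h'
    · exact .inr ⟨r, hC.s_τ_pow_eq_extra _ _ _ h'.symm x⟩
    · left
      rw [hC.s_τ_pow_wrap n i r (i + r - (n + 1)) (by omega) hi (by omega),
        hC.normalized_s hx (by omega), map_zero]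
  · left
    rw [hC.s_τ_pow _ _ _ h, hC.normalized_s hx h, map_zero]

theorem s_τ_pow_extra_normalized {n : ℕ} (i l : ℕ) {x : C.X (n + 2)}
    (hx : x ∈ hC.cos.normalized (n + 2)) :
    C.s n i ((C.τ (n + 1) ^ l) (C.extra (n + 1) x)) = 0 := by
  rcases Nat.lt_or_ge n i with hi | hi
  · exact C.s_of_lt hi _
  rw [hC.τ_pow_mod]
  have := Nat.mod_lt l (show 0 < n + 1 + 1 by omega)
  generalize l % (n + 1 + 1) = r at this
  rcases Nat.lt_or_ge n (i + r) with h | h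
  · obtain ⟨r, rfl⟩ : ∃ r', r = r' + 1 := ⟨r - 1, by omega⟩
    rw [hC.s_τ_pow_extra_wrap n i r (i + r - n) (by omega) hi (by omega),
      hC.normalized_s hx (by omega), map_zero, map_zero]
  · rw [hC.s_τ_pow_extra _ _ _ h, hC.normalized_s hx (by omega), map_zero, map_zero]

theorem connes_mem_normalized {n : ℕ} {x : C.X (n + 1)} (hx : x ∈ hC.cos.normalized (n + 1)) :
    C.connes n x ∈ hC.cos.normalized n := by
  rw [hC.connes_of_s_zero n x (hC.normalized_s hx n.zero_le), norm_eq_sum]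
  refine Submodule.sum_mem _ fun l _ => Submodule.smul_mem _ _ ?_
  cases n with
  | zero => exact Submodule.mem_top
  | succ n => exact hC.cos.mem_normalized_succ.2 fun i _ => hC.s_τ_pow_extra_normalized i l hx

theorem hochschild_mem_normalized {n : ℕ} {x : C.X n} (hx : x ∈ hC.cos.normalized n) :
    C.hochschild n x ∈ hC.cos.normalized (n + 1) := by
  rw [hC.hochschild_eq]
  exact hC.cos.b_mem_normalized hx

end

/-- The mixed complex of normalized cochains. -/
noncomputable abbrev normalizedMixed : MixedOperators.{u, v} k where
  X n := hC.cos.normalized n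
  b n := (C.hochschild n).restrict fun _ => hC.hochschild_mem_normalized
  B n := (C.connes n).restrict fun _ => hC.connes_mem_normalized

end CocyclicOperators.IsCocyclic

namespace CocyclicOperators

/-- An increasing filtration stable under `τ`, which cofaces raise and codegeneracies lower. -/
def filtration (C : CocyclicOperators.{u, v} k) : ℕ → ∀ n, Submodule k (C.X n)
  | 0, _ => ⊥
  | _ + 1, 0 => ⊤
  | r + 1, n + 1 => ⨅ (i : ℕ) (l : ℕ), (C.filtration r n).comap (C.s n i ∘ₗ C.τ (n + 1) ^ l)

theorem mem_filtration_succ {C : CocyclicOperators.{u, v} k} {r n : ℕ} {x : C.X (n + 1)} :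
    x ∈ C.filtration (r + 1) (n + 1) ↔
      ∀ i l, C.s n i ((C.τ (n + 1) ^ l) x) ∈ C.filtration r n := by
  simp [filtration]

theorem filtration_zero {C : CocyclicOperators.{u, v} k} {n : ℕ} {x : C.X n}
    (hx : x ∈ C.filtration 0 n) : x = 0 := by
  simpa [filtration] using hx

theorem filtration_eq_zero {C : CocyclicOperators.{u, v} k} {r n : ℕ} {x : C.X n} (hr : r = 0)
    (hx : x ∈ C.filtration r n) : x = 0 := by
  subst hr
  exact filtration_zero hx

theorem τ_pow_mem_filtration {C : CocyclicOperators.{u, v} k} {r n : ℕ} {x : C.X n}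
    (hx : x ∈ C.filtration r n) (l : ℕ) : (C.τ n ^ l) x ∈ C.filtration r n := by
  cases r with
  | zero => rw [filtration_zero hx, map_zero]; exact Submodule.zero_mem _
  | succ r =>
    cases n with
    | zero => exact Submodule.mem_top
    | succ n =>
      rw [mem_filtration_succ] at hx ⊢
      intro i l'
      rw [← Module.End.mul_apply, ← pow_add]
      exact hx _ _

theorem s_mem_filtration {C : CocyclicOperators.{u, v} k} {r n : ℕ} {x : C.X (n + 1)}
    (hx : x ∈ C.filtration (r + 1) (n + 1)) (i : ℕ) : C.s n i x ∈ C.filtration r n :=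
  mem_filtration_succ.1 hx i 0

namespace IsCocyclic

variable {C : CocyclicOperators.{u, v} k} (hC : C.IsCocyclic)

section
include hC

theorem τ_pow_d {n : ℕ} (x : C.X n) : ∀ (l i : ℕ) (_ : i ≤ n + 1), ∃ i' ≤ n + 1, ∃ l',
    (C.τ (n + 1) ^ l) (C.d n i x) = C.d n i' ((C.τ n ^ l') x)
  | 0, i, hi => ⟨i, hi, 0, rfl⟩
  | l + 1, i, hi => by
    obtain ⟨i', hi', l', h⟩ := τ_pow_d x l i hi
    rw [pow_succ', Module.End.mul_apply, h]
    cases i' with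
    | zero => exact ⟨n + 1, le_rfl, l', hC.τ_δ_zero n _⟩
    | succ i' =>
      refine ⟨i', by omega, l' + 1, ?_⟩
      rw [hC.τ_δ n i' (by omega), pow_succ', Module.End.mul_apply]

theorem d_mem_filtration : ∀ {n r : ℕ} {x : C.X n} (_ : x ∈ C.filtration r n) (i : ℕ),
    C.d n i x ∈ C.filtration (r + 1) (n + 1)
  | n, r, x, hx, i => by
    rcases Nat.lt_or_ge (n + 1) i with hi | hi
    · rw [d, dif_neg (by omega), LinearMap.zero_apply]
      exact Submodule.zero_mem _
    rw [mem_filtration_succ]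
    intro j l
    rcases Nat.lt_or_ge n j with hj | hj
    · rw [C.s_of_lt hj]
      exact Submodule.zero_mem _
    obtain ⟨i', hi', l', h⟩ := hC.τ_pow_d x l i hi
    rw [h]
    replace hx := τ_pow_mem_filtration hx l'
    generalize (C.τ n ^ l') x = y at hx
    rcases eq_or_ne i' j with rfl | h1
    · rwa [hC.σ_δ_self _ _ hj]
    rcases eq_or_ne i' (j + 1) with rfl | h2
    · rwa [hC.σ_δ_succ _ _ hj]
    cases r with
    | zero => rw [filtration_zero hx, map_zero, map_zero]; exact Submodule.zero_mem _
    | succ r =>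
      cases n with
      | zero => omega
      | succ n =>
        rcases lt_or_gt_of_ne h1 with h' | h'
        · obtain ⟨j, rfl⟩ : ∃ j', j = j' + 1 := ⟨j - 1, by omega⟩
          rw [hC.σ_δ_lt n i' j (by omega) (by omega)]
          exact d_mem_filtration (s_mem_filtration hx _) _
        · obtain ⟨i, rfl⟩ : ∃ i, i' = i + 1 := ⟨i' - 1, by omega⟩
          rw [hC.σ_δ_gt n i j (by omega) (by omega)]
          exact d_mem_filtration (s_mem_filtration hx _) _

theorem mem_filtration_of_normalized {n : ℕ} {x : C.X n} (hx : x ∈ hC.cos.normalized n) :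
    x ∈ C.filtration 2 n := by
  cases n with
  | zero => exact Submodule.mem_top
  | succ n =>
    rw [mem_filtration_succ]
    intro i l
    rcases hC.s_τ_pow_normalized i l hx with h | ⟨l', h⟩
    · rw [h]
      exact Submodule.zero_mem _
    · rw [h]
      cases n with
      | zero => exact Submodule.mem_top
      | succ n =>
        rw [mem_filtration_succ]
        intro j m
        rw [← Module.End.mul_apply, ← pow_add, hC.s_τ_pow_extra_normalized _ _ hx]
        exact Submodule.zero_mem _

theorem d_mem_filtration_sub (p n i : ℕ) (x : C.X n) (hx : x ∈ C.filtration (n + 2 - p) n) :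
    C.d n i x ∈ C.filtration (n + 1 + 2 - p) (n + 1) := by
  rcases Nat.lt_or_ge (n + 2) p with h | h
  · rw [show n + 2 - p = 0 by omega] at hx
    rw [filtration_zero hx, map_zero]
    exact Submodule.zero_mem _
  · rw [show n + 1 + 2 - p = n + 2 - p + 1 by omega]
    exact hC.d_mem_filtration hx i

omit hC in
theorem s_mem_filtration_sub (p n i : ℕ) (x : C.X (n + 1))
    (hx : x ∈ C.filtration (n + 1 + 2 - p) (n + 1)) : C.s n i x ∈ C.filtration (n + 2 - p) n := by
  rcases Nat.lt_or_ge (n + 2) p with h | h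
  · rw [show n + 1 + 2 - p = 0 by omega] at hx
    rw [filtration_zero hx, map_zero]
    exact Submodule.zero_mem _
  · rw [show n + 1 + 2 - p = n + 2 - p + 1 by omega] at hx
    exact s_mem_filtration hx i

end

/-- The cosimplicial submodule of elements which vanish in degrees below `p - 1`. -/
abbrev filtered (p : ℕ) : Cosimplicial.{u, v} k :=
  hC.cos.sub (fun n => C.filtration (n + 2 - p) n) (hC.d_mem_filtration_sub p)
    (s_mem_filtration_sub p)

/-- The inclusion of `filtered p`. -/
abbrev filteredSubtype (p : ℕ) : Cosimplicial.Hom (hC.filtered p) hC.cos :=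
  hC.cos.subtype (fun n => C.filtration (n + 2 - p) n) (hC.d_mem_filtration_sub p)
    (s_mem_filtration_sub p)

variable {D : CocyclicOperators.{u, w} k} (hD : D.IsCocyclic)

/-- The image of the tensor product of `filtered p` and `filtered q`. -/
abbrev filteredDiag (p q n : ℕ) : Submodule k (C.X n ⊗[k] D.X n) :=
  LinearMap.range (TensorProduct.map ((hC.filteredSubtype p).f n) ((hD.filteredSubtype q).f n))

theorem mem_filteredDiag_map {p q m n : ℕ} (f : C.X m →ₗ[k] C.X n) (g : D.X m →ₗ[k] D.X n)
    (hf : ∀ x ∈ C.filtration (m + 2 - p) m, f x ∈ C.filtration (n + 2 - p) n)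
    (hg : ∀ x ∈ D.filtration (m + 2 - q) m, g x ∈ D.filtration (n + 2 - q) n)
    {z : C.X m ⊗[k] D.X m} (hz : z ∈ filteredDiag hC hD p q m) :
    TensorProduct.map f g z ∈ filteredDiag hC hD p q n := by
  obtain ⟨z, rfl⟩ := hz
  refine ⟨TensorProduct.map (f.restrict hf) (g.restrict hg) z, ?_⟩
  induction z with
  | zero => simp
  | add a b ha hb => simp only [map_add, ha, hb]
  | tmul x y => rfl

theorem connes_mem_filteredDiag {p q n : ℕ} {z : C.X (n + 1) ⊗[k] D.X (n + 1)}
    (hz : z ∈ filteredDiag hC hD p q (n + 1)) :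
    (CocyclicOperators.diag C D).connes n z ∈ filteredDiag hC hD p q n := by
  rw [connes_apply, norm_eq_sum]
  have hτ : ∀ {m l} {z : C.X m ⊗[k] D.X m}, z ∈ filteredDiag hC hD p q m →
      ((CocyclicOperators.diag C D).τ m ^ l) z ∈ filteredDiag hC hD p q m := by
    intro m l z hz
    change (TensorProduct.map (C.τ m) (D.τ m) ^ l) z ∈ _
    rw [TensorProduct.map_pow]
    exact mem_filteredDiag_map hC hD _ _ (fun x hx => τ_pow_mem_filtration hx l)
      (fun x hx => τ_pow_mem_filtration hx l) hz
  refine Submodule.sum_mem _ fun l _ => Submodule.smul_mem _ _ (hτ ?_)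
  rw [extra_apply, diag_s]
  refine mem_filteredDiag_map hC hD _ _ (s_mem_filtration_sub p n n) (s_mem_filtration_sub q n n) ?_
  refine hτ (l := 1) (Submodule.sub_mem _ hz (Submodule.smul_mem _ _ (hτ (l := 1) hz)))

theorem homotopy_mem_filteredDiag {p q n : ℕ} {z : C.X (n + 1) ⊗[k] D.X (n + 1)}
    (hz : z ∈ filteredDiag hC hD p q (n + 1)) :
    Cosimplicial.homotopy n hC.cos hD.cos z ∈ filteredDiag hC hD p q n := by
  obtain ⟨z, rfl⟩ := hz
  rw [Cosimplicial.homotopy_naturality]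
  exact ⟨_, rfl⟩

theorem aw_mem_filteredDiag {p q n : ℕ} (h : p + q = n) {x : C.X p} {y : D.X q}
    (hx : x ∈ hC.cos.normalized p) (hy : y ∈ hD.cos.normalized q) :
    Cosimplicial.aw hC.cos hD.cos n (KunnethSum.incl k C.X D.X p q h (x ⊗ₜ y)) ∈
      filteredDiag hC hD p q n := by
  have hx' : x ∈ C.filtration (p + 2 - p) p := by
    rw [show p + 2 - p = 2 by omega]
    exact hC.mem_filtration_of_normalized hx
  have hy' : y ∈ D.filtration (q + 2 - q) q := by
    rw [show q + 2 - q = 2 by omega]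
    exact hD.mem_filtration_of_normalized hy
  have := Cosimplicial.aw_naturality (hC.filteredSubtype p) (hD.filteredSubtype q) n
    (KunnethSum.incl k (hC.filtered p).X (hD.filtered q).X p q h (⟨x, hx'⟩ ⊗ₜ ⟨y, hy'⟩))
  rw [KunnethSum.map_incl] at this
  exact ⟨_, this.symm⟩

theorem shuffle_filteredDiag {p q n : ℕ} (h : n + 3 ≤ p + q) {z : C.X n ⊗[k] D.X n}
    (hz : z ∈ filteredDiag hC hD p q n) : Cosimplicial.shuffle n hC.cos hD.cos z = 0 := by
  obtain ⟨z, rfl⟩ := hz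
  rw [Cosimplicial.shuffle_naturality]
  generalize Cosimplicial.shuffle n (hC.filtered p) (hD.filtered q) z = t
  induction t using KunnethSum.induction with
  | h0 => simp
  | hadd s t hs ht => rw [map_add, hs, ht, add_zero]
  | h i j hij x y =>
    rcases Nat.lt_or_ge (i + 1) p with h' | h'
    · obtain rfl : x = 0 := Subtype.ext (filtration_eq_zero (by omega) x.2)
      simp
    · obtain rfl : y = 0 := Subtype.ext (filtration_eq_zero (by omega) y.2)
      simp

end IsCocyclic

end CocyclicOperators


variable {k : Type u} [Field k]

section CohomologyMaps

variable {A A' B B' : Type*} [AddCommGroup A] [Module k A] [AddCommGroup A'] [Module k A']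
  [AddCommGroup B] [Module k B] [AddCommGroup B'] [Module k B']
  {g : A →ₗ[k] A'} {P : Submodule k A} {g' : B →ₗ[k] B'} {Q : Submodule k B}

/-- The class of a cocycle. -/
def Cohomology.mk (g : A →ₗ[k] A') (P : Submodule k A) (z : A) (hz : g z = 0) : Cohomology g P :=
  Submodule.Quotient.mk ⟨z, hz⟩

theorem Represents.ker {z : A} {x : Cohomology g P} (h : Represents z x) : g z = 0 := h.1

theorem represents_mk (z : A) (hz : g z = 0) : Represents z (Cohomology.mk g P z hz) := ⟨hz, rfl⟩

theorem exists_represents (x : Cohomology g P) : ∃ z, Represents z x := by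
  obtain ⟨⟨z, hz⟩, rfl⟩ := Submodule.Quotient.mk_surjective _ x
  exact ⟨z, hz, rfl⟩

theorem Represents.eq_iff {z z' : A} {x x' : Cohomology g P} (h : Represents z x)
    (h' : Represents z' x') : x = x' ↔ z - z' ∈ P := by
  obtain ⟨hz, rfl⟩ := h
  obtain ⟨hz', rfl⟩ := h'
  exact Submodule.Quotient.eq _

theorem Represents.congr {z z' : A} {x : Cohomology g P} (h : Represents z x) (hz' : g z' = 0)
    (h' : z' - z ∈ P) : Represents z' x :=
  ⟨hz', ((represents_mk z' hz').eq_iff h).2 h'⟩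

theorem Represents.eq {z : A} {x x' : Cohomology g P} (h : Represents z x)
    (h' : Represents z x') : x = x' :=
  (h.eq_iff h').2 (by simp)

theorem represents_zero : Represents 0 (0 : Cohomology g P) := ⟨map_zero g, rfl⟩

theorem Represents.eq_zero_iff {z : A} {x : Cohomology g P} (h : Represents z x) :
    x = 0 ↔ z ∈ P := by
  rw [h.eq_iff represents_zero, sub_zero]

theorem Represents.add {z z' : A} {x x' : Cohomology g P} (h : Represents z x)
    (h' : Represents z' x') : Represents (z + z') (x + x') := by
  obtain ⟨hz, rfl⟩ := h
  obtain ⟨hz', rfl⟩ := h'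
  exact ⟨Submodule.add_mem _ hz hz', rfl⟩

theorem Represents.sub {z z' : A} {x x' : Cohomology g P} (h : Represents z x)
    (h' : Represents z' x') : Represents (z - z') (x - x') := by
  obtain ⟨hz, rfl⟩ := h
  obtain ⟨hz', rfl⟩ := h'
  exact ⟨Submodule.sub_mem _ hz hz', rfl⟩

/-- The map on cohomology induced by a map of complexes. -/
def Cohomology.map (f : A →ₗ[k] B) (h1 : ∀ x, g x = 0 → g' (f x) = 0) (h2 : ∀ x ∈ P, f x ∈ Q) :
    Cohomology g P →ₗ[k] Cohomology g' Q :=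
  Submodule.mapQ _ _ (f.restrict (p := LinearMap.ker g) (q := LinearMap.ker g') h1)
    fun x hx => h2 x hx

theorem Represents.map {f : A →ₗ[k] B} {h1 : ∀ x, g x = 0 → g' (f x) = 0}
    {h2 : ∀ x ∈ P, f x ∈ Q} {z : A} {x : Cohomology g P} (h : Represents z x) :
    Represents (f z) (Cohomology.map f h1 h2 x) := by
  obtain ⟨hz, rfl⟩ := h
  exact ⟨h1 z hz, rfl⟩

/-- The isomorphism on cohomology induced by a quasi-isomorphism. -/
noncomputable def Cohomology.equiv (f : A →ₗ[k] B) (h1 : ∀ x, g x = 0 → g' (f x) = 0)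
    (h2 : ∀ x ∈ P, f x ∈ Q) (h3 : ∀ x, g x = 0 → f x ∈ Q → x ∈ P)
    (h4 : ∀ y, g' y = 0 → ∃ x, g x = 0 ∧ y - f x ∈ Q) :
    Cohomology g P ≃ₗ[k] Cohomology g' Q :=
  LinearEquiv.ofBijective (Cohomology.map f h1 h2) ⟨by
    rw [← LinearMap.ker_eq_bot, LinearMap.ker_eq_bot']
    intro x hx
    obtain ⟨z, hz⟩ := exists_represents x
    exact hz.eq_zero_iff.2 (h3 z hz.ker ((hz.map (h1 := h1) (h2 := h2)).eq_zero_iff.1 hx)), by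
    intro y
    obtain ⟨z, hz⟩ := exists_represents y
    obtain ⟨x, hx, hxz⟩ := h4 z hz.ker
    refine ⟨Cohomology.mk g P x hx, ?_⟩
    exact (hz.eq_iff (represents_mk x hx).map).2 hxz |>.symm⟩

theorem Represents.equiv {f : A →ₗ[k] B} {h1 : ∀ x, g x = 0 → g' (f x) = 0}
    {h2 : ∀ x ∈ P, f x ∈ Q} {h3 : ∀ x, g x = 0 → f x ∈ Q → x ∈ P}
    {h4 : ∀ y, g' y = 0 → ∃ x, g x = 0 ∧ y - f x ∈ Q} {z : A} {x : Cohomology g P}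
    (h : Represents z x) : Represents (f z) (Cohomology.equiv f h1 h2 h3 h4 x) :=
  h.map (h1 := h1) (h2 := h2)

end CohomologyMaps

section KunnethEquiv

variable {ι : Type*} [Add ι] [DecidableEq ι]
  {X : ι → Type*} [∀ i, AddCommGroup (X i)] [∀ i, Module k (X i)]
  {Y : ι → Type*} [∀ i, AddCommGroup (Y i)] [∀ i, Module k (Y i)]
  {X' : ι → Type*} [∀ i, AddCommGroup (X' i)] [∀ i, Module k (X' i)]
  {Y' : ι → Type*} [∀ i, AddCommGroup (Y' i)] [∀ i, Module k (Y' i)]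
  {X'' : ι → Type*} [∀ i, AddCommGroup (X'' i)] [∀ i, Module k (X'' i)]
  {Y'' : ι → Type*} [∀ i, AddCommGroup (Y'' i)] [∀ i, Module k (Y'' i)]

theorem KunnethSum.map_map (f : ∀ i, X i →ₗ[k] X' i) (g : ∀ i, Y i →ₗ[k] Y' i)
    (f' : ∀ i, X' i →ₗ[k] X'' i) (g' : ∀ i, Y' i →ₗ[k] Y'' i) (n : ι) (t : KunnethSum k X Y n) :
    KunnethSum.map f' g' n (KunnethSum.map f g n t) =
      KunnethSum.map (fun i => f' i ∘ₗ f i) (fun i => g' i ∘ₗ g i) n t := by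
  induction t using KunnethSum.induction with
  | h0 => simp
  | hadd s t hs ht => simp only [map_add, hs, ht]
  | h i j h x y => simp only [map_incl, TensorProduct.map_tmul, LinearMap.comp_apply]

theorem KunnethSum.map_id (n : ι) (t : KunnethSum k X Y n) :
    KunnethSum.map (fun _ => .id) (fun _ => .id) n t = t := by
  induction t using KunnethSum.induction with
  | h0 => simp
  | hadd s t hs ht => simp only [map_add, hs, ht]
  | h i j h x y => rw [map_incl, TensorProduct.map_id, LinearMap.id_apply]

/-- The isomorphism of Künneth sums induced by isomorphisms of the factors. -/
noncomputable def KunnethSum.equiv (f : ∀ i, X i ≃ₗ[k] X' i) (g : ∀ i, Y i ≃ₗ[k] Y' i) (n : ι) :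
    KunnethSum k X Y n ≃ₗ[k] KunnethSum k X' Y' n :=
  LinearEquiv.ofLinearMap (KunnethSum.map (fun i => (f i).toLinearMap) (fun i => (g i).toLinearMap) n)
    (KunnethSum.map (fun i => (f i).symm.toLinearMap) (fun i => (g i).symm.toLinearMap) n)
    (LinearMap.ext fun t => by
      rw [LinearMap.comp_apply, map_map]
      simpa using KunnethSum.map_id n t)
    (LinearMap.ext fun t => by
      rw [LinearMap.comp_apply, map_map]
      simpa using KunnethSum.map_id n t)

theorem KunnethSum.equiv_incl (f : ∀ i, X i ≃ₗ[k] X' i) (g : ∀ i, Y i ≃ₗ[k] Y' i) {n : ι} (i j : ι)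
    (h : i + j = n) (x : X i) (y : Y j) :
    KunnethSum.equiv f g n (KunnethSum.incl k X Y i j h (x ⊗ₜ y)) =
      KunnethSum.incl k X' Y' i j h (f i x ⊗ₜ g j y) := by
  rw [equiv, LinearEquiv.coe_ofLinearMap, map_incl, TensorProduct.map_tmul]
  rfl

end KunnethEquiv

/-- Cochain complexes over an index type with successor, with their coboundaries. -/
structure GradedComplex (k : Type u) [Field k] (ι : Type) [CommSemiring ι] where
  X : ι → Type v
  [addCommGroup : ∀ n, AddCommGroup (X n)]
  [module : ∀ n, Module k (X n)]
  d : ∀ i j, i + 1 = j → (X i →ₗ[k] X j)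
  bd : ∀ i, Submodule k (X i)
  d_d : ∀ i j l h h' x, d j l h' (d i j h x) = 0
  d_mem : ∀ i j h x, d i j h x ∈ bd j
  of_mem_bd : ∀ j, ∀ x ∈ bd j, x = 0 ∨ ∃ i h y, d i j h y = x

attribute [instance] GradedComplex.addCommGroup GradedComplex.module

namespace GradedComplex

variable {ι : Type} [CommSemiring ι] [IsRightCancelAdd ι] [DecidableEq ι]

section

variable (A : GradedComplex.{u, v} k ι)

/-- Cohomology of a graded complex. -/
abbrev H (i : ι) : Type v := Cohomology (A.d i (i + 1) rfl) (A.bd i)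

omit [IsRightCancelAdd ι] [DecidableEq ι] in
theorem d_bd {i j : ι} (h : i + 1 = j) {x : A.X i} (hx : x ∈ A.bd i) : A.d i j h x = 0 := by
  rcases A.of_mem_bd i x hx with rfl | ⟨l, hl, y, rfl⟩
  · exact map_zero _
  · exact A.d_d _ _ _ _ _ _

omit [DecidableEq ι] in
theorem exists_splitting : ∃ (e : ∀ i, A.X i →ₗ[k] A.X i)
    (s : ∀ i j, i + 1 = j → (A.X j →ₗ[k] A.X i)),
    (∀ i x, e i x ∈ A.bd i) ∧ (∀ i, ∀ x ∈ A.bd i, e i x = x) ∧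
    (∀ i j h x, A.d i j h (s i j h x) = e j x) ∧
    (∀ i, (∀ l, l + 1 ≠ i) → e i = 0) := by
  have he : ∀ i, ∃ e : A.X i →ₗ[k] A.X i, (∀ x, e x ∈ A.bd i) ∧ ∀ x ∈ A.bd i, e x = x := by
    intro i
    obtain ⟨p, hp⟩ := (A.bd i).subtype.exists_leftInverse_of_injective (A.bd i).ker_subtype
    refine ⟨(A.bd i).subtype ∘ₗ p, fun x => (p x).2, fun x hx => ?_⟩
    exact congrArg Subtype.val (LinearMap.congr_fun hp ⟨x, hx⟩)
  choose e he1 he2 using he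
  have hs : ∀ i j (h : i + 1 = j), ∃ s : A.X j →ₗ[k] A.X i, ∀ x, A.d i j h (s x) = e j x := by
    intro i j h
    obtain ⟨q, hq⟩ := (A.d i j h).rangeRestrict.exists_rightInverse_of_surjective
      (A.d i j h).range_rangeRestrict
    have hr : ∀ x, e j x ∈ LinearMap.range (A.d i j h) := by
      intro x
      rcases A.of_mem_bd j _ (he1 j x) with h0 | ⟨i', h', y, hy⟩
      · rw [h0]
        exact Submodule.zero_mem _
      · obtain rfl : i = i' := add_right_cancel (h.trans h'.symm)
        exact ⟨y, hy⟩
    refine ⟨q ∘ₗ (e j).codRestrict _ hr, fun x => ?_⟩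
    exact congrArg Subtype.val (LinearMap.congr_fun hq ⟨e j x, hr x⟩)
  choose s hs using hs
  refine ⟨e, s, he1, he2, hs, fun i hi => LinearMap.ext fun x => ?_⟩
  rcases A.of_mem_bd i _ (he1 i x) with h0 | ⟨i', h', y, hy⟩
  · exact h0
  · exact absurd h' (hi i')

end

section Lower

variable {X : ι → Type*} [∀ i, AddCommGroup (X i)] [∀ i, Module k (X i)]
  {Y : ι → Type*} [∀ i, AddCommGroup (Y i)] [∀ i, Module k (Y i)]

open Classical in
/-- `s ⊗ id`, for an operator `s` of degree `-1`. -/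
noncomputable def lowerLeft (s : ∀ i j, i + 1 = j → (X j →ₗ[k] X i)) (n n' : ι) (h : n + 1 = n') :
    KunnethSum k X Y n' →ₗ[k] KunnethSum k X Y n :=
  DirectSum.toModule k _ _ fun p =>
    if hp : ∃ i, i + 1 = p.1.1 then
      KunnethSum.incl k X Y hp.choose p.1.2 (by
        have h1 := p.2
        rw [← hp.choose_spec, add_right_comm] at h1
        exact add_right_cancel (h1.trans h.symm)) ∘ₗ (s _ _ hp.choose_spec).rTensor _
    else 0

open Classical in
/-- `±id ⊗ s`, for an operator `s` of degree `-1`. -/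
noncomputable def lowerRight (ε : ι → k) (s : ∀ i j, i + 1 = j → (Y j →ₗ[k] Y i)) (n n' : ι)
    (h : n + 1 = n') : KunnethSum k X Y n' →ₗ[k] KunnethSum k X Y n :=
  DirectSum.toModule k _ _ fun p =>
    if hp : ∃ j, j + 1 = p.1.2 then
      ε p.1.1 • KunnethSum.incl k X Y p.1.1 hp.choose (by
        have h1 := p.2
        rw [← hp.choose_spec, ← add_assoc] at h1
        exact add_right_cancel (h1.trans h.symm)) ∘ₗ (s _ _ hp.choose_spec).lTensor _
    else 0

theorem lowerLeft_incl (s : ∀ i j, i + 1 = j → (X j →ₗ[k] X i)) (n n' : ι) (h : n + 1 = n')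
    {i i' j : ι} (hi : i + 1 = i') (hij : i' + j = n') (hij' : i + j = n) (x : X i') (y : Y j) :
    lowerLeft s n n' h (KunnethSum.incl k X Y i' j hij (x ⊗ₜ y)) =
      KunnethSum.incl k X Y i j hij' (s i i' hi x ⊗ₜ y) := by
  have hp : ∃ i, i + 1 = i' := ⟨i, hi⟩
  simp only [lowerLeft, KunnethSum.incl, DirectSum.toModule_lof, dif_pos hp]
  have key : ∀ l (hl : l + 1 = i') (h4 : l + j = n),
      KunnethSum.incl k X Y l j h4 (s l i' hl x ⊗ₜ y) =
        KunnethSum.incl k X Y i j hij' (s i i' hi x ⊗ₜ y) := by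
    intro l hl h4
    obtain rfl : l = i := add_right_cancel (hl.trans hi.symm)
    rfl
  exact key _ hp.choose_spec _

theorem lowerLeft_incl_of_ne (s : ∀ i j, i + 1 = j → (X j →ₗ[k] X i)) (n n' : ι) (h : n + 1 = n')
    {i j : ι} (hi : ∀ l, l + 1 ≠ i) (hij : i + j = n') (x : X i) (y : Y j) :
    lowerLeft s n n' h (KunnethSum.incl k X Y i j hij (x ⊗ₜ y)) = 0 := by
  have hp : ¬ ∃ l, l + 1 = i := fun ⟨l, hl⟩ => hi l hl
  simp only [lowerLeft, KunnethSum.incl, DirectSum.toModule_lof, dif_neg hp, LinearMap.zero_apply]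

theorem lowerRight_incl (ε : ι → k) (s : ∀ i j, i + 1 = j → (Y j →ₗ[k] Y i)) (n n' : ι)
    (h : n + 1 = n') {i j j' : ι} (hj : j + 1 = j') (hij : i + j' = n') (hij' : i + j = n)
    (x : X i) (y : Y j') :
    lowerRight ε s n n' h (KunnethSum.incl k X Y i j' hij (x ⊗ₜ y)) =
      ε i • KunnethSum.incl k X Y i j hij' (x ⊗ₜ s j j' hj y) := by
  have hp : ∃ i, i + 1 = j' := ⟨j, hj⟩
  simp only [lowerRight, KunnethSum.incl, DirectSum.toModule_lof, dif_pos hp]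
  have key : ∀ l (hl : l + 1 = j') (h4 : i + l = n),
      ε i • KunnethSum.incl k X Y i l h4 (x ⊗ₜ s l j' hl y) =
        ε i • KunnethSum.incl k X Y i j hij' (x ⊗ₜ s j j' hj y) := by
    intro l hl h4
    obtain rfl : l = j := add_right_cancel (hl.trans hj.symm)
    rfl
  exact key _ hp.choose_spec _

theorem lowerRight_incl_of_ne (ε : ι → k) (s : ∀ i j, i + 1 = j → (Y j →ₗ[k] Y i)) (n n' : ι)
    (h : n + 1 = n') {i j : ι} (hj : ∀ l, l + 1 ≠ j) (hij : i + j = n') (x : X i) (y : Y j) :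
    lowerRight ε s n n' h (KunnethSum.incl k X Y i j hij (x ⊗ₜ y)) = 0 := by
  have hp : ¬ ∃ l, l + 1 = j := fun ⟨l, hl⟩ => hj l hl
  simp only [lowerRight, KunnethSum.incl, DirectSum.toModule_lof, dif_neg hp, LinearMap.zero_apply]

end Lower

section Kunneth

variable (ε : ι → k) (A : GradedComplex.{u, v} k ι) (B : GradedComplex.{u, w} k ι)

/-- The tensor product differential. -/
noncomputable def tensorD (n n' : ι) (h : n + 1 = n') :
    KunnethSum k A.X B.X n →ₗ[k] KunnethSum k A.X B.X n' :=
  DirectSum.toModule k _ _ fun p =>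
    KunnethSum.incl k A.X B.X (p.1.1 + 1) p.1.2 (by rw [add_right_comm, p.2, h]) ∘ₗ
        (A.d p.1.1 _ rfl).rTensor (B.X p.1.2) +
      ε p.1.1 • KunnethSum.incl k A.X B.X p.1.1 (p.1.2 + 1) (by rw [← add_assoc, p.2, h]) ∘ₗ
        (B.d p.1.2 _ rfl).lTensor (A.X p.1.1)

variable {A B}

omit [IsRightCancelAdd ι] in
theorem tensorD_incl {n n' : ι} (h : n + 1 = n') {i i' j j' : ι} (hi : i + 1 = i') (hj : j + 1 = j')
    (hij : i + j = n) (h1 : i' + j = n') (h2 : i + j' = n') (x : A.X i) (y : B.X j) :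
    tensorD ε A B n n' h (KunnethSum.incl k A.X B.X i j hij (x ⊗ₜ y)) =
      KunnethSum.incl k A.X B.X i' j h1 (A.d i i' hi x ⊗ₜ y) +
        ε i • KunnethSum.incl k A.X B.X i j' h2 (x ⊗ₜ B.d j j' hj y) := by
  subst hi hj
  simp [tensorD, KunnethSum.incl]

variable {ε} (hε : ∀ i, ε (i + 1) = -ε i) (hε' : ∀ i, ε i * ε i = 1)
  {bd : ∀ n, Submodule k (KunnethSum k A.X B.X n)}
  (hbd : ∀ n n' h t, tensorD ε A B n n' h t ∈ bd n')
  (hbd' : ∀ n, ∀ t ∈ bd n, t = 0 ∨ ∃ m h s, tensorD ε A B m n h s = t)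

include hε hbd in
theorem sub_map_left_mem {e : ∀ i, A.X i →ₗ[k] A.X i} {s : ∀ i j, i + 1 = j → (A.X j →ₗ[k] A.X i)}
    (hs : ∀ i j h x, A.d i j h (s i j h x) = e j x) (he : ∀ i, (∀ l, l + 1 ≠ i) → e i = 0) {n : ι}
    (t : KunnethSum k A.X B.X n) :
    t - KunnethSum.map (fun i => .id - e i - s i _ rfl ∘ₗ A.d i _ rfl) (fun _ => .id) n t -
      lowerLeft s n _ rfl (tensorD ε A B n _ rfl t) ∈ bd n := by
  induction t using KunnethSum.induction with
  | h0 => simp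
  | hadd a b ha hb =>
    simp only [map_add]
    convert Submodule.add_mem _ ha hb using 1
    abel
  | h i j h x y =>
    rw [KunnethSum.map_incl, TensorProduct.map_tmul, tensorD_incl ε rfl rfl rfl h (by rw [add_right_comm, h])
      (by rw [← add_assoc, h]), map_add, map_smul, lowerLeft_incl s n _ rfl rfl _ h]
    by_cases hi : ∃ l, l + 1 = i
    · obtain ⟨l, rfl⟩ := hi
      subst h
      have h1 := hbd (l + j) (l + 1 + j) (by rw [add_right_comm])
        (KunnethSum.incl k A.X B.X l j rfl (s l _ rfl x ⊗ₜ y))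
      rw [tensorD_incl ε _ rfl rfl rfl rfl (by rw [add_right_comm, add_assoc]), hs] at h1
      rw [lowerLeft_incl s _ _ rfl rfl _ (by rw [add_right_comm, add_assoc])]
      convert h1 using 1
      simp only [LinearMap.sub_apply, LinearMap.id_apply, LinearMap.comp_apply,
        TensorProduct.sub_tmul, map_sub, hε]
      module
    · push Not at hi
      rw [lowerLeft_incl_of_ne s _ _ rfl hi, smul_zero, he i hi]
      simp only [LinearMap.sub_apply, LinearMap.id_apply, LinearMap.comp_apply,
        TensorProduct.sub_tmul, map_sub, LinearMap.zero_apply, TensorProduct.zero_tmul, map_zero]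
      abel_nf
      exact Submodule.zero_mem _

include hε hε' hbd in
theorem sub_map_right_mem {e : ∀ i, B.X i →ₗ[k] B.X i}
    {s : ∀ i j, i + 1 = j → (B.X j →ₗ[k] B.X i)}
    (hs : ∀ i j h x, B.d i j h (s i j h x) = e j x) (he : ∀ i, (∀ l, l + 1 ≠ i) → e i = 0) {n : ι}
    (t : KunnethSum k A.X B.X n) :
    t - KunnethSum.map (fun _ => .id) (fun i => .id - e i - s i _ rfl ∘ₗ B.d i _ rfl) n t -
      lowerRight ε s n _ rfl (tensorD ε A B n _ rfl t) ∈ bd n := by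
  induction t using KunnethSum.induction with
  | h0 => simp
  | hadd a b ha hb =>
    simp only [map_add]
    convert Submodule.add_mem _ ha hb using 1
    abel
  | h i j h x y =>
    rw [KunnethSum.map_incl, TensorProduct.map_tmul, tensorD_incl ε rfl rfl rfl h (by rw [add_right_comm, h])
      (by rw [← add_assoc, h]), map_add, map_smul, lowerRight_incl ε s n _ rfl rfl _ h, smul_smul,
      hε', one_smul]
    by_cases hj : ∃ l, l + 1 = j
    · obtain ⟨l, rfl⟩ := hj
      subst h
      have h1 := Submodule.smul_mem _ (ε i) (hbd (i + l) (i + (l + 1)) (by rw [add_assoc])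
        (KunnethSum.incl k A.X B.X i l rfl (x ⊗ₜ s l _ rfl y)))
      rw [tensorD_incl ε _ rfl rfl rfl (by rw [add_right_comm, add_assoc]) rfl, hs, smul_add,
        smul_smul, hε', one_smul] at h1
      rw [lowerRight_incl ε s _ _ rfl rfl _ (by rw [add_right_comm, add_assoc])]
      convert h1 using 1
      simp only [LinearMap.sub_apply, LinearMap.id_apply, LinearMap.comp_apply,
        TensorProduct.tmul_sub, map_sub, hε]
      module
    · push Not at hj
      rw [lowerRight_incl_of_ne ε s _ _ rfl hj, he j hj]
      simp only [LinearMap.sub_apply, LinearMap.id_apply, LinearMap.comp_apply,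
        TensorProduct.tmul_sub, map_sub, LinearMap.zero_apply, TensorProduct.tmul_zero, map_zero]
      abel_nf
      exact Submodule.zero_mem _

end Kunneth

end GradedComplex


variable {k : Type u} [Field k]

namespace GradedComplex

section Projection

variable {ι : Type} [CommSemiring ι] (A : GradedComplex.{u, v} k ι) {e : ∀ i, A.X i →ₗ[k] A.X i}
  {s : ∀ i j, i + 1 = j → (A.X j →ₗ[k] A.X i)}

theorem d_proj (he1 : ∀ i x, e i x ∈ A.bd i) (he2 : ∀ i, ∀ x ∈ A.bd i, e i x = x)
    (hs : ∀ i j h x, A.d i j h (s i j h x) = e j x) (i : ι) (x : A.X i) :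
    A.d i _ rfl ((.id - e i - s i _ rfl ∘ₗ A.d i _ rfl : A.X i →ₗ[k] A.X i) x) = 0 := by
  simp only [LinearMap.sub_apply, LinearMap.id_apply, LinearMap.comp_apply, map_sub, hs,
    A.d_bd rfl (he1 i x), he2 _ _ (A.d_mem i _ rfl x)]
  abel

theorem proj_of_mem_bd (he2 : ∀ i, ∀ x ∈ A.bd i, e i x = x) (i : ι) (x : A.X i)
    (hx : x ∈ A.bd i) : (.id - e i - s i _ rfl ∘ₗ A.d i _ rfl : A.X i →ₗ[k] A.X i) x = 0 := by
  simp only [LinearMap.sub_apply, LinearMap.id_apply, LinearMap.comp_apply, A.d_bd rfl hx,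
    he2 i x hx, map_zero]
  abel

theorem sub_proj_mem_bd (he1 : ∀ i x, e i x ∈ A.bd i) (i : ι) (x : A.X i)
    (hx : A.d i _ rfl x = 0) :
    x - (.id - e i - s i _ rfl ∘ₗ A.d i _ rfl : A.X i →ₗ[k] A.X i) x ∈ A.bd i := by
  simp only [LinearMap.sub_apply, LinearMap.id_apply, LinearMap.comp_apply, hx, map_zero]
  convert he1 i x using 1
  abel

/-- The projection to cohomology given by a projection to cocycles. -/
def toH (φ : ∀ i, A.X i →ₗ[k] A.X i) (h : ∀ i x, A.d i _ rfl (φ i x) = 0) (i : ι) :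
    A.X i →ₗ[k] A.H i :=
  Submodule.mkQ _ ∘ₗ (φ i).codRestrict (LinearMap.ker (A.d i _ rfl)) (h i)

/-- The section of the projection to cohomology. -/
def ofH (φ : ∀ i, A.X i →ₗ[k] A.X i) (h : ∀ i, ∀ x ∈ A.bd i, φ i x = 0) (i : ι) :
    A.H i →ₗ[k] A.X i :=
  Submodule.liftQ _ (φ i ∘ₗ Submodule.subtype _) fun x hx => h i x hx

variable {φ : ∀ i, A.X i →ₗ[k] A.X i} (h : ∀ i x, A.d i _ rfl (φ i x) = 0)
  (h' : ∀ i, ∀ x ∈ A.bd i, φ i x = 0)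

theorem represents_toH (i : ι) (x : A.X i) : Represents (φ i x) (A.toH φ h i x) := ⟨h i x, rfl⟩

theorem toH_of_mem_bd (h' : ∀ i, ∀ x ∈ A.bd i, φ i x = 0) {i : ι} {x : A.X i}
    (hx : x ∈ A.bd i) : A.toH φ h i x = 0 := by
  refine (A.represents_toH h i x).eq_zero_iff.2 ?_
  rw [h' i x hx]
  exact Submodule.zero_mem _

theorem toH_eq (h2 : ∀ i x, A.d i _ rfl x = 0 → x - φ i x ∈ A.bd i) {i : ι} {z : A.X i}
    {x : A.H i} (hz : Represents z x) : A.toH φ h i z = x :=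
  ((hz.eq_iff (A.represents_toH h i z)).2 (h2 i z hz.ker)).symm

end Projection

section Kunneth

variable {ι : Type} [CommSemiring ι] [IsRightCancelAdd ι] [DecidableEq ι] {ε : ι → k}
  {A : GradedComplex.{u, v} k ι} {B : GradedComplex.{u, w} k ι} (hε : ∀ i, ε (i + 1) = -ε i)
  (hε' : ∀ i, ε i * ε i = 1) {bd : ∀ n, Submodule k (KunnethSum k A.X B.X n)}
  (hbd : ∀ n n' h t, tensorD ε A B n n' h t ∈ bd n')
  (hbd' : ∀ n, ∀ t ∈ bd n, t = 0 ∨ ∃ m h s, tensorD ε A B m n h s = t)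

include hε in
omit [IsRightCancelAdd ι] in
theorem tensorD_tensorD {n n' n'' : ι} (h : n + 1 = n') (h' : n' + 1 = n'')
    (t : KunnethSum k A.X B.X n) : tensorD ε A B n' n'' h' (tensorD ε A B n n' h t) = 0 := by
  subst h h'
  induction t using KunnethSum.induction with
  | h0 => simp
  | hadd a b ha hb => rw [map_add, map_add, ha, hb, add_zero]
  | h i j hij x y =>
    cases hij
    rw [tensorD_incl ε _ rfl rfl rfl (by rw [add_right_comm]) (by rw [add_assoc]), map_add, map_smul,
      tensorD_incl ε _ rfl rfl _ (by ring) (by ring),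
      tensorD_incl ε _ rfl rfl _ (by ring) (by ring),
      A.d_d, B.d_d, hε, TensorProduct.zero_tmul, TensorProduct.tmul_zero, map_zero, map_zero]
    module

omit [IsRightCancelAdd ι] in
theorem map_tensorD_eq_zero {X' : ι → Type*} [∀ i, AddCommGroup (X' i)] [∀ i, Module k (X' i)]
    {Y' : ι → Type*} [∀ i, AddCommGroup (Y' i)] [∀ i, Module k (Y' i)]
    {f : ∀ i, A.X i →ₗ[k] X' i} {g : ∀ i, B.X i →ₗ[k] Y' i}
    (hf : ∀ i, ∀ x ∈ A.bd i, f i x = 0) (hg : ∀ i, ∀ x ∈ B.bd i, g i x = 0) {n n' : ι}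
    (h : n + 1 = n') (t : KunnethSum k A.X B.X n) :
    KunnethSum.map f g n' (tensorD ε A B n n' h t) = 0 := by
  subst h
  induction t using KunnethSum.induction with
  | h0 => simp
  | hadd a b ha hb => rw [map_add, map_add, ha, hb, add_zero]
  | h i j hij x y =>
    cases hij
    rw [tensorD_incl ε _ rfl rfl rfl (by rw [add_right_comm]) (by rw [add_assoc]), map_add, map_smul,
      KunnethSum.map_incl, KunnethSum.map_incl, TensorProduct.map_tmul, TensorProduct.map_tmul,
      hf _ _ (A.d_mem _ _ _ x), hg _ _ (B.d_mem _ _ _ y)]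
    simp

include hε hε' hbd hbd' in
/-- The Künneth isomorphism over a field. -/
theorem exists_kunneth (n : ι) :
    ∃ e : KunnethSum k A.H B.H n ≃ₗ[k] Cohomology (tensorD ε A B n _ rfl) (bd n),
      ∀ (i j : ι) (h : i + j = n) (α : A.X i) (β : B.X j) (x : A.H i) (y : B.H j),
        Represents α x → Represents β y →
        Represents (KunnethSum.incl k A.X B.X i j h (α ⊗ₜ β))
          (e (KunnethSum.incl k A.H B.H i j h (x ⊗ₜ y))) := by
  obtain ⟨e, s, he1, he2, hs, he0⟩ := A.exists_splitting
  obtain ⟨e', s', he1', he2', hs', he0'⟩ := B.exists_splitting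
  obtain ⟨φ, hφ⟩ : ∃ φ : ∀ i, A.X i →ₗ[k] A.X i,
      φ = fun i => .id - e i - s i _ rfl ∘ₗ A.d i _ rfl := ⟨_, rfl⟩
  obtain ⟨ψ, hψ⟩ : ∃ ψ : ∀ i, B.X i →ₗ[k] B.X i,
      ψ = fun i => .id - e' i - s' i _ rfl ∘ₗ B.d i _ rfl := ⟨_, rfl⟩
  have a1 : ∀ i x, A.d i _ rfl (φ i x) = 0 := hφ ▸ A.d_proj he1 he2 hs
  have a2 : ∀ i, ∀ x ∈ A.bd i, φ i x = 0 := hφ ▸ A.proj_of_mem_bd (s := s) he2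
  have a3 : ∀ i x, A.d i _ rfl x = 0 → x - φ i x ∈ A.bd i :=
    hφ ▸ A.sub_proj_mem_bd (s := s) he1
  have b1 : ∀ i x, B.d i _ rfl (ψ i x) = 0 := hψ ▸ B.d_proj he1' he2' hs'
  have b2 : ∀ i, ∀ x ∈ B.bd i, ψ i x = 0 := hψ ▸ B.proj_of_mem_bd (s := s') he2'
  have b3 : ∀ i x, B.d i _ rfl x = 0 → x - ψ i x ∈ B.bd i :=
    hψ ▸ B.sub_proj_mem_bd (s := s') he1'
  have l1 : ∀ t : KunnethSum k A.X B.X n, t - KunnethSum.map φ (fun _ => .id) n t -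
      lowerLeft s n _ rfl (tensorD ε A B n _ rfl t) ∈ bd n :=
    hφ ▸ fun t => sub_map_left_mem hε hbd hs he0 t
  have l2 : ∀ t : KunnethSum k A.X B.X n, t - KunnethSum.map (fun _ => .id) ψ n t -
      lowerRight ε s' n _ rfl (tensorD ε A B n _ rfl t) ∈ bd n :=
    hψ ▸ fun t => sub_map_right_mem hε hε' hbd hs' he0' t
  clear hφ hψ he1 he2 hs he0 he1' he2' hs' he0'
  have hD : ∀ n, ∀ t ∈ bd n, tensorD ε A B n _ rfl t = 0 := by
    intro n t ht
    rcases hbd' n t ht with rfl | ⟨m, h, s, rfl⟩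
    · exact map_zero _
    · exact tensorD_tensorD hε _ _ _
  have key : ∀ t : KunnethSum k A.X B.X n, tensorD ε A B n _ rfl t = 0 →
      tensorD ε A B n _ rfl (KunnethSum.map φ ψ n t) = 0 ∧ t - KunnethSum.map φ ψ n t ∈ bd n := by
    intro t ht
    have h1 := l1 t
    rw [ht, map_zero, sub_zero] at h1
    have h2 := hD _ _ h1
    rw [map_sub, ht, zero_sub, neg_eq_zero] at h2
    have h3 := l2 (KunnethSum.map φ (fun _ => .id) n t)
    rw [h2, map_zero, sub_zero, KunnethSum.map_map] at h3
    have h4 := hD _ _ h3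
    rw [map_sub, h2, zero_sub, neg_eq_zero] at h4
    refine ⟨h4, ?_⟩
    convert Submodule.add_mem _ h1 h3 using 1
    exact (sub_add_sub_cancel _ _ _).symm
  let F : Cohomology (tensorD ε A B n _ rfl) (bd n) →ₗ[k] KunnethSum k A.H B.H n :=
    Submodule.liftQ _ (KunnethSum.map (A.toH φ a1) (B.toH ψ b1) n ∘ₗ Submodule.subtype _) (by
      rintro ⟨t, ht⟩ ht'
      change KunnethSum.map (A.toH φ a1) (B.toH ψ b1) n t = 0
      rcases hbd' n t ht' with rfl | ⟨m, h, s, rfl⟩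
      · exact map_zero _
      · exact map_tensorD_eq_zero (fun i x hx => A.toH_of_mem_bd a1 a2 hx)
          (fun i x hx => B.toH_of_mem_bd b1 b2 hx) _ _)
  have hF : ∀ t x, Represents t x → F x = KunnethSum.map (A.toH φ a1) (B.toH ψ b1) n t := by
    rintro t _ ⟨ht, rfl⟩
    rfl
  have hcyc : ∀ (i j : ι) (h : i + j = n) (α : A.X i) (β : B.X j) (x : A.H i) (y : B.H j),
      Represents α x → Represents β y →
      tensorD ε A B n _ rfl (KunnethSum.incl k A.X B.X i j h (α ⊗ₜ β)) = 0 := by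
    intro i j h α β x y hα hβ
    rw [tensorD_incl ε rfl rfl rfl h (by rw [add_right_comm, h])
      (by rw [← add_assoc, h]), hα.ker, hβ.ker]
    simp
  have hFi : ∀ (i j : ι) (h : i + j = n) (α : A.X i) (β : B.X j) (x : A.H i) (y : B.H j)
      (hα : Represents α x) (hβ : Represents β y),
      F (Cohomology.mk _ _ _ (hcyc i j h α β x y hα hβ)) =
        KunnethSum.incl k A.H B.H i j h (x ⊗ₜ y) := by
    intro i j h α β x y hα hβ
    rw [hF _ _ (represents_mk _ _), KunnethSum.map_incl, TensorProduct.map_tmul,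
      A.toH_eq a1 a3 hα, B.toH_eq b1 b3 hβ]
  have hinj : Function.Injective F := by
    rw [← LinearMap.ker_eq_bot, LinearMap.ker_eq_bot']
    intro c hc
    obtain ⟨t, ht⟩ := exists_represents c
    rw [hF t c ht] at hc
    have h1 := congrArg (KunnethSum.map (A.ofH φ a2) (B.ofH ψ b2) n) hc
    rw [map_zero, KunnethSum.map_map] at h1
    obtain ⟨h2, h3⟩ := key t ht.ker
    obtain ⟨h4, h5⟩ := key _ h2
    rw [KunnethSum.map_map] at h5
    have h6 : KunnethSum.map (fun i => φ i ∘ₗ φ i) (fun i => ψ i ∘ₗ ψ i) n t = 0 := by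
      rw [← h1]
      congr 2
    rw [h6, sub_zero] at h5
    rw [ht.eq_zero_iff]
    convert Submodule.add_mem _ h3 h5 using 1
    exact (sub_add_cancel _ _).symm
  have hsurj : Function.Surjective F := by
    intro t
    induction t using KunnethSum.induction with
    | h0 => exact ⟨0, map_zero _⟩
    | hadd a b ha hb =>
      obtain ⟨a, rfl⟩ := ha
      obtain ⟨b, rfl⟩ := hb
      exact ⟨a + b, map_add _ _ _⟩
    | h i j h x y =>
      obtain ⟨α, hα⟩ := exists_represents x
      obtain ⟨β, hβ⟩ := exists_represents y
      exact ⟨_, hFi i j h α β x y hα hβ⟩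
  refine ⟨(LinearEquiv.ofBijective F ⟨hinj, hsurj⟩).symm, fun i j h α β x y hα hβ => ?_⟩
  rw [← hFi i j h α β x y hα hβ]
  have := LinearEquiv.ofBijective_symm_apply_apply (f := F) (h := ⟨hinj, hsurj⟩)
    (Cohomology.mk _ _ _ (hcyc i j h α β x y hα hβ))
  rw [this]
  exact represents_mk _ _

end Kunneth

end GradedComplex

section NatComplex

variable {X : ℕ → Type v} [∀ n, AddCommGroup (X n)] [∀ n, Module k (X n)]
  {d : ∀ n, X n →ₗ[k] X (n + 1)}

theorem mem_coboundaries (n : ℕ) (x : X n) : d n x ∈ coboundaries d (n + 1) := ⟨x, rfl⟩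

/-- An `ℕ`-graded complex. -/
def GradedComplex.ofNat (d : ∀ n, X n →ₗ[k] X (n + 1)) (hd : ∀ n x, d (n + 1) (d n x) = 0) :
    GradedComplex.{u, v} k ℕ where
  X := X
  d i j h := h ▸ d i
  bd := coboundaries d
  d_d := by
    rintro i _ _ rfl rfl x
    exact hd i x
  d_mem := by
    rintro i _ rfl x
    exact ⟨x, rfl⟩
  of_mem_bd
    | 0, x, hx => .inl hx
    | n + 1, x, ⟨y, hy⟩ => .inr ⟨n, rfl, y, hy⟩

variable {Y : ℕ → Type w} [∀ n, AddCommGroup (Y n)] [∀ n, Module k (Y n)]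
  {d' : ∀ n, Y n →ₗ[k] Y (n + 1)}

/-- The Künneth isomorphism for cochain complexes. -/
theorem exists_kunneth_nat (hd : ∀ n x, d (n + 1) (d n x) = 0)
    (hd' : ∀ n x, d' (n + 1) (d' n x) = 0) (n : ℕ) :
    ∃ e : KunnethSum k (fun i => Cohomology (d i) (coboundaries d i))
        (fun i => Cohomology (d' i) (coboundaries d' i)) n ≃ₗ[k]
        Cohomology (tensorDifferential d d' n) (coboundaries (tensorDifferential d d') n),
      ∀ (i j : ℕ) (h : i + j = n) (α : X i) (β : Y j) (x : Cohomology (d i) (coboundaries d i))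
        (y : Cohomology (d' j) (coboundaries d' j)),
        Represents α x → Represents β y →
        Represents (KunnethSum.incl k X Y i j h (α ⊗ₜ β))
          (e (KunnethSum.incl k (fun i => Cohomology (d i) (coboundaries d i))
            (fun i => Cohomology (d' i) (coboundaries d' i)) i j h (x ⊗ₜ y))) :=
  GradedComplex.exists_kunneth (ε := fun i => (-1 : k) ^ i) (A := .ofNat d hd) (B := .ofNat d' hd')
    (bd := coboundaries (tensorDifferential d d')) (fun i => by simp [pow_succ])
    (fun i => by rw [← mul_pow]; simp) (by
      rintro n _ rfl t
      exact ⟨t, rfl⟩) (by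
      intro n t ht
      cases n with
      | zero => exact .inl ht
      | succ n =>
        obtain ⟨s, hs⟩ := ht
        exact .inr ⟨n, rfl, s, hs⟩) n

theorem tensorDifferential_tensorDifferential (hd : ∀ n x, d (n + 1) (d n x) = 0)
    (hd' : ∀ n x, d' (n + 1) (d' n x) = 0) (n : ℕ) (t : KunnethSum k X Y n) :
    tensorDifferential d d' (n + 1) (tensorDifferential d d' n t) = 0 :=
  GradedComplex.tensorD_tensorD (ε := fun i => (-1 : k) ^ i) (A := .ofNat d hd) (B := .ofNat d' hd')
    (fun i => by simp [pow_succ]) rfl rfl t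

end NatComplex


variable {k : Type u} [Field k]

namespace MixedOperators

section Tot

variable (C : MixedOperators.{u, v} k)

variable {C} in
theorem Tot.induction {n : ℕ} {P : C.Tot n → Prop} (h0 : P 0)
    (hadd : ∀ a b, P a → P b → P (a + b)) (h : ∀ i m h x, P (C.totIncl i m h x)) (z : C.Tot n) :
    P z :=
  DirectSum.induction_on z h0 (fun p x => h p.1.1 p.1.2 p.2 x) hadd

theorem totD_totIncl_zero {n : ℕ} (i : ℕ) (h : 2 * i + 0 = n) (x : C.X 0) :
    C.totD n (C.totIncl i 0 h x) = C.totIncl i 1 (by omega) (C.b 0 x) := by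
  rw [totD_totIncl, totLower, LinearMap.zero_apply, add_zero]

theorem totD_totIncl_succ {n : ℕ} (i m : ℕ) (h : 2 * i + (m + 1) = n) (x : C.X (m + 1)) :
    C.totD n (C.totIncl i (m + 1) h x) =
      C.totIncl i (m + 2) (by omega) (C.b (m + 1) x) +
        C.totIncl (i + 1) m (by omega) (C.B m x) := by
  rw [totD_totIncl, totLower, LinearMap.comp_apply]

theorem totTop_totIncl_zero (n : ℕ) (h : 2 * 0 + n = n) (x : C.X n) :
    C.totTop n (C.totIncl 0 n h x) = x := DirectSum.component.lof_self ..

theorem totTop_totIncl_succ {n : ℕ} (i m : ℕ) (h : 2 * (i + 1) + m = n) (x : C.X m) :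
    C.totTop n (C.totIncl (i + 1) m h x) = 0 := by
  rw [totTop, totIncl, DirectSum.component.of, dif_neg]
  simp

theorem totTop_totD (n : ℕ) (z : C.Tot n) :
    C.totTop (n + 1) (C.totD n z) = C.b n (C.totTop n z) := by
  induction z using Tot.induction with
  | h0 => simp
  | hadd a b ha hb => simp only [map_add, ha, hb]
  | h i m h x =>
    have hl : C.totTop (n + 1) (C.totLower n i m h x) = 0 := by
      cases m with
      | zero => simp [totLower]
      | succ m => exact C.totTop_totIncl_succ _ _ _ _
    rw [totD_totIncl, map_add, hl, add_zero]
    cases i with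
    | zero =>
      obtain rfl : m = n := by omega
      rw [totTop_totIncl_zero, totTop_totIncl_zero]
    | succ i => rw [totTop_totIncl_succ, totTop_totIncl_succ, map_zero]

theorem totD_totS (n : ℕ) (z : C.Tot n) : C.totD (n + 2) (C.totS n z) = C.totS (n + 1) (C.totD n z) :=
  LinearMap.congr_fun (C.totD_comp_totS n) z

/-- Division by `u`, which vanishes on the component of `u⁰`. -/
noncomputable def totSInvAux (n : ℕ) : ∀ i m : ℕ, 2 * i + m = n + 2 → (C.X m →ₗ[k] C.Tot n)
  | 0, _, _ => 0
  | i + 1, m, h => C.totIncl i m (by omega)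

/-- Division by `u`, which vanishes on the component of `u⁰`. -/
noncomputable def totSInv (n : ℕ) : C.Tot (n + 2) →ₗ[k] C.Tot n :=
  DirectSum.toModule k _ _ fun p => C.totSInvAux n p.1.1 p.1.2 p.2

theorem totSInv_totIncl {n : ℕ} (i m : ℕ) (h : 2 * i + m = n + 2) (x : C.X m) :
    C.totSInv n (C.totIncl i m h x) = C.totSInvAux n i m h x := by
  simp [totSInv, totIncl]

theorem totSInv_totS (n : ℕ) (z : C.Tot n) : C.totSInv n (C.totS n z) = z := by
  induction z using Tot.induction with
  | h0 => simp
  | hadd a b ha hb => rw [map_add, map_add, ha, hb]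
  | h i m h x => rw [totS_totIncl, totSInv_totIncl, totSInvAux]

theorem totS_injective (n : ℕ) : Function.Injective (C.totS n) :=
  Function.LeftInverse.injective (C.totSInv_totS n)

theorem totIncl_add_totS (n : ℕ) (z : C.Tot (n + 2)) :
    C.totIncl 0 (n + 2) (by omega) (C.totTop (n + 2) z) + C.totS n (C.totSInv n z) = z := by
  induction z using Tot.induction with
  | h0 => simp
  | hadd a b ha hb =>
    rw [map_add, map_add, map_add, map_add]
    conv_rhs => rw [← ha, ← hb]
    abel
  | h i m h x =>
    cases i with
    | zero =>
      obtain rfl : m = n + 2 := by omega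
      rw [totTop_totIncl_zero, totSInv_totIncl, totSInvAux, LinearMap.zero_apply, map_zero,
        add_zero]
    | succ i =>
      rw [totTop_totIncl_succ, totSInv_totIncl, totSInvAux, totS_totIncl, map_zero, zero_add]

theorem totIncl_totTop {n : ℕ} (hn : n < 2) (z : C.Tot n) :
    C.totIncl 0 n (by omega) (C.totTop n z) = z := by
  induction z using Tot.induction with
  | h0 => simp
  | hadd a b ha hb => rw [map_add, map_add, ha, hb]
  | h i m h x =>
    obtain rfl : i = 0 := by omega
    obtain rfl : m = n := by omega
    rw [totTop_totIncl_zero]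

theorem exists_totS {n : ℕ} {z : C.Tot (n + 2)} (hz : C.totTop (n + 2) z = 0) :
    ∃ w, C.totS n w = z := by
  have := C.totIncl_add_totS n z
  rw [hz, map_zero, zero_add] at this
  exact ⟨_, this⟩

theorem eq_zero_of_totTop {n : ℕ} (hn : n < 2) {z : C.Tot n} (hz : C.totTop n z = 0) : z = 0 := by
  rw [← C.totIncl_totTop hn z, hz, map_zero]

variable {C}

theorem IsMixed.totD_totD (hC : C.IsMixed) (n : ℕ) (z : C.Tot n) :
    C.totD (n + 1) (C.totD n z) = 0 := by
  induction z using Tot.induction with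
  | h0 => simp
  | hadd a b ha hb => rw [map_add, map_add, ha, hb, add_zero]
  | h i m h x =>
    cases m with
    | zero =>
      rw [totD_totIncl_zero, totD_totIncl_succ, hC.b_b, hC.B_b_zero, map_zero, map_zero, add_zero]
    | succ m =>
      rw [totD_totIncl_succ, map_add, totD_totIncl_succ, hC.b_b, map_zero, zero_add]
      cases m with
      | zero =>
        rw [totD_totIncl_zero, ← map_add, add_comm (C.B _ _), hC.b_B, map_zero]
      | succ m =>
        rw [totD_totIncl_succ, hC.B_B, map_zero, add_zero, ← map_add, add_comm (C.B _ _),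
          hC.b_B, map_zero]

theorem totS_mem_coboundaries {n : ℕ} {z : C.Tot n} (hz : z ∈ coboundaries C.totD n) :
    C.totS n z ∈ coboundaries C.totD (n + 2) := by
  cases n with
  | zero =>
    obtain rfl : z = 0 := hz
    rw [map_zero]
    exact Submodule.zero_mem _
  | succ n =>
    obtain ⟨y, rfl⟩ := hz
    exact ⟨C.totS n y, C.totD_totS n y⟩

end Tot

/-- A family of maps commuting with differentials is a quasi-isomorphism. -/
structure IsQuasiIso {X : ℕ → Type v} [∀ n, AddCommGroup (X n)] [∀ n, Module k (X n)]
    {Y : ℕ → Type w} [∀ n, AddCommGroup (Y n)] [∀ n, Module k (Y n)]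
    (d : ∀ n, X n →ₗ[k] X (n + 1)) (d' : ∀ n, Y n →ₗ[k] Y (n + 1))
    (F : ∀ n, X n →ₗ[k] Y n) : Prop where
  comm : ∀ n x, F (n + 1) (d n x) = d' n (F n x)
  lift : ∀ n (w : X (n + 1)) (z : Y n), d (n + 1) w = 0 → d' n z = F (n + 1) w →
    ∃ w', d n w' = w ∧ z - F n w' ∈ coboundaries d' n
  inj : ∀ w : X 0, d 0 w = 0 → F 0 w = 0 → w = 0

/-- Morphisms of total complexes over `k[u]`, with the induced maps `top` modulo `u`. -/
structure TotMap (C : MixedOperators.{u, v} k) (D : MixedOperators.{u, w} k) where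
  top : ∀ n, C.X n →ₗ[k] D.X n
  tot : ∀ n, C.Tot n →ₗ[k] D.Tot n
  totTop_tot : ∀ n z, D.totTop n (tot n z) = top n (C.totTop n z)
  tot_totS : ∀ n z, tot (n + 2) (C.totS n z) = D.totS n (tot n z)
  tot_totD : ∀ n z, tot (n + 1) (C.totD n z) = D.totD n (tot n z)

section QuasiIso

variable {C : MixedOperators.{u, v} k} {D : MixedOperators.{u, w} k}

theorem TotMap.lift (F : TotMap C D) (hC : C.IsMixed) (hD : D.IsMixed)
    (h : IsQuasiIso C.b D.b F.top) : ∀ (n : ℕ) (w : C.Tot (n + 1)) (z : D.Tot n),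
    C.totD (n + 1) w = 0 → D.totD n z = F.tot (n + 1) w →
    ∃ w', C.totD n w' = w ∧ z - F.tot n w' ∈ coboundaries D.totD n := by
  have key : ∀ (n : ℕ) (w : C.Tot (n + 1)) (z : D.Tot n), C.totD (n + 1) w = 0 →
      D.totD n z = F.tot (n + 1) w → ∃ w' v, v ∈ coboundaries D.totD n ∧
      C.totTop (n + 1) (w - C.totD n w') = 0 ∧ D.totTop n (z - F.tot n w' - v) = 0 ∧
      C.totD (n + 1) (w - C.totD n w') = 0 ∧
      D.totD n (z - F.tot n w' - v) = F.tot (n + 1) (w - C.totD n w') := by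
    intro n w z hw hz
    obtain ⟨w', hw', hz'⟩ := h.lift n (C.totTop (n + 1) w) (D.totTop n z)
      (by rw [← totTop_totD, hw, map_zero]) (by rw [← totTop_totD, hz, F.totTop_tot])
    have hv : ∃ v ∈ coboundaries D.totD n, D.totTop n v = D.totTop n z - F.top n w' := by
      cases n with
      | zero =>
        have h0 : D.totTop 0 z - F.top 0 w' = 0 := hz'
        exact ⟨0, Submodule.zero_mem _, by rw [map_zero, h0]⟩
      | succ n =>
        obtain ⟨v, hv⟩ := hz'
        refine ⟨_, mem_coboundaries n (D.totIncl 0 n (by omega) v), ?_⟩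
        rw [totTop_totD, totTop_totIncl_zero, hv]
    obtain ⟨v, hv, hv'⟩ := hv
    have hdv : D.totD n v = 0 := by
      cases n with
      | zero =>
        obtain rfl : v = 0 := hv
        exact map_zero _
      | succ n =>
        obtain ⟨y, rfl⟩ := hv
        exact hD.totD_totD _ _
    refine ⟨C.totIncl 0 n (by omega) w', v, hv, ?_, ?_, ?_, ?_⟩
    · rw [map_sub, totTop_totD, totTop_totIncl_zero, hw', sub_self]
    · rw [map_sub, map_sub, F.totTop_tot, totTop_totIncl_zero, hv', sub_self]
    · rw [map_sub, hw, hC.totD_totD, sub_zero]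
    · rw [map_sub, map_sub, map_sub, hz, hdv, F.tot_totD, sub_zero]
  intro n
  induction n using Nat.strong_induction_on with
  | _ n ih =>
    intro w z hw hz
    obtain ⟨w₀, v, hv, h1, h2, h3, h4⟩ := key n w z hw hz
    have fin : ∀ w₁, C.totD n w₁ = w - C.totD n w₀ →
        z - F.tot n w₀ - v - F.tot n w₁ ∈ coboundaries D.totD n →
        ∃ w', C.totD n w' = w ∧ z - F.tot n w' ∈ coboundaries D.totD n := by
      intro w₁ h5 h6
      refine ⟨w₀ + w₁, ?_, ?_⟩
      · rw [map_add, h5]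
        abel
      · convert Submodule.add_mem _ h6 hv using 1
        rw [map_add]
        abel
    match n, w, z, hw, hz, w₀, v, hv, h1, h2, h3, h4, fin, ih with
    | 0, w, z, hw, hz, w₀, v, hv, h1, h2, h3, h4, fin, ih =>
      refine fin 0 ?_ ?_
      · rw [map_zero, C.eq_zero_of_totTop (by omega) h1]
      · rw [map_zero, sub_zero, D.eq_zero_of_totTop (by omega) h2]
        exact Submodule.zero_mem _
    | 1, w, z, hw, hz, w₀, v, hv, h1, h2, h3, h4, fin, ih =>
      have hz0 := D.eq_zero_of_totTop (by omega) h2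
      refine fin 0 ?_ ?_
      · obtain ⟨y, hy⟩ := C.exists_totS h1
        rw [← hy] at h3 h4 ⊢
        rw [hz0, map_zero, F.tot_totS, eq_comm] at h4
        rw [totD_totS] at h3
        have h5 := D.totS_injective _ (h4.trans (map_zero _).symm)
        have h6 := C.totS_injective _ (h3.trans (map_zero _).symm)
        have h7 : C.totTop 0 y = 0 := h.inj _ (by rw [← totTop_totD, h6, map_zero])
          (by rw [← F.totTop_tot, h5, map_zero])
        rw [C.eq_zero_of_totTop (by omega) h7, map_zero, map_zero]
      · rw [map_zero, sub_zero, hz0]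
        exact Submodule.zero_mem _
    | n + 2, w, z, hw, hz, w₀, v, hv, h1, h2, h3, h4, fin, ih =>
      obtain ⟨y, hy⟩ := C.exists_totS h1
      obtain ⟨t, ht⟩ := D.exists_totS h2
      rw [← hy, totD_totS] at h3
      rw [← hy, ← ht, totD_totS, F.tot_totS] at h4
      obtain ⟨y', hy', ht'⟩ := ih n (by omega) y t (C.totS_injective _ (h3.trans (map_zero _).symm))
        (D.totS_injective _ h4)
      refine fin (C.totS n y') ?_ ?_
      · rw [totD_totS, hy', hy]
      · rw [← ht, F.tot_totS, ← map_sub]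
        exact totS_mem_coboundaries ht'

/-- A morphism of total complexes which is a quasi-isomorphism modulo `u` is a
quasi-isomorphism. -/
theorem TotMap.isQuasiIso (F : TotMap C D) (hC : C.IsMixed) (hD : D.IsMixed)
    (h : IsQuasiIso C.b D.b F.top) : IsQuasiIso C.totD D.totD F.tot where
  comm := F.tot_totD
  lift := F.lift hC hD h
  inj w hw hw' := C.eq_zero_of_totTop (by omega) <|
    h.inj _ (by rw [← totTop_totD, hw, map_zero]) (by rw [← F.totTop_tot, hw', map_zero])

section General

variable {X : ℕ → Type v} [∀ n, AddCommGroup (X n)] [∀ n, Module k (X n)]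
  {Y : ℕ → Type w} [∀ n, AddCommGroup (Y n)] [∀ n, Module k (Y n)]
  {d : ∀ n, X n →ₗ[k] X (n + 1)} {d' : ∀ n, Y n →ₗ[k] Y (n + 1)} {F : ∀ n, X n →ₗ[k] Y n}

theorem map_mem_coboundaries (h : ∀ n x, F (n + 1) (d n x) = d' n (F n x)) {n : ℕ} {x : X n}
    (hx : x ∈ coboundaries d n) : F n x ∈ coboundaries d' n := by
  cases n with
  | zero =>
    obtain rfl : x = 0 := hx
    rw [map_zero]
    exact Submodule.zero_mem _
  | succ n =>
    obtain ⟨y, rfl⟩ := hx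
    exact ⟨F n y, (h n y).symm⟩

theorem IsQuasiIso.mem_of_map_mem (h : IsQuasiIso d d' F) {n : ℕ} {x : X n} (hx : d n x = 0)
    (hx' : F n x ∈ coboundaries d' n) : x ∈ coboundaries d n := by
  cases n with
  | zero => exact h.inj x hx hx'
  | succ n =>
    obtain ⟨z, hz⟩ := hx'
    obtain ⟨w, hw, -⟩ := h.lift n x z hx hz
    exact ⟨w, hw⟩

theorem IsQuasiIso.exists_sub_mem (h : IsQuasiIso d d' F) {n : ℕ} {z : Y n} (hz : d' n z = 0) :
    ∃ x, d n x = 0 ∧ z - F n x ∈ coboundaries d' n := by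
  obtain ⟨w, hw, hw'⟩ := h.lift n 0 z (map_zero _) (by rw [hz, map_zero])
  exact ⟨w, hw, hw'⟩

/-- The isomorphism on cohomology induced by a quasi-isomorphism. -/
noncomputable def IsQuasiIso.equiv (h : IsQuasiIso d d' F) (n : ℕ) :
    Cohomology (d n) (coboundaries d n) ≃ₗ[k] Cohomology (d' n) (coboundaries d' n) :=
  Cohomology.equiv (F n) (fun x hx => by rw [← h.comm, hx, map_zero])
    (fun _ hx => map_mem_coboundaries h.comm hx) (fun _ hx hx' => h.mem_of_map_mem hx hx')
    fun _ hy => h.exists_sub_mem hy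

theorem IsQuasiIso.represents (h : IsQuasiIso d d' F) {n : ℕ} {z : X n}
    {x : Cohomology (d n) (coboundaries d n)} (hz : Represents z x) :
    Represents (F n z) (h.equiv n x) := hz.equiv

/-- A map which is bijective on cohomology is a quasi-isomorphism. -/
theorem isQuasiIso_of_cohomology (comm : ∀ n x, F (n + 1) (d n x) = d' n (F n x))
    (inj : ∀ n x, d n x = 0 → F n x ∈ coboundaries d' n → x ∈ coboundaries d n)
    (surj : ∀ n z, d' n z = 0 → ∃ x, d n x = 0 ∧ z - F n x ∈ coboundaries d' n) :
    IsQuasiIso d d' F where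
  comm := comm
  lift n w z hw hz := by
    obtain ⟨w₁, hw₁⟩ : w ∈ LinearMap.range (d n) := inj (n + 1) w hw ⟨z, hz⟩
    obtain ⟨w₂, hw₂, h⟩ := surj n (z - F n w₁) (by rw [map_sub, hz, ← comm, hw₁, sub_self])
    refine ⟨w₁ + w₂, by rw [map_add, hw₁, hw₂, add_zero], ?_⟩
    rwa [map_add, ← sub_sub]
  inj w hw hw' := inj 0 w hw (by rw [hw']; exact Submodule.zero_mem _)

end General

end QuasiIso

end MixedOperators


variable {k : Type u} [Field k]

namespace MixedOperators

section Per

variable (C : MixedOperators.{u, v} k)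

variable {C} in
theorem Per.induction {p : ZMod 2} {P : C.Per p → Prop} (h0 : P 0)
    (hadd : ∀ a b, P a → P b → P (a + b)) (h : ∀ m h x, P (C.perIncl m h x)) (z : C.Per p) :
    P z :=
  DirectSum.induction_on z h0 (fun p x => h p.1 p.2 x) hadd

/-- `totToPer`, with a variable parity. -/
noncomputable def totPer (n : ℕ) (p : ZMod 2) (h : (n : ZMod 2) = p) : C.Tot n →ₗ[k] C.Per p :=
  h ▸ C.totToPer n

theorem cast_of_two_mul_add {n i m : ℕ} {p : ZMod 2} (hp : (n : ZMod 2) = p)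
    (h : 2 * i + m = n) : (m : ZMod 2) = p := by
  have h2 : (2 : ZMod 2) = 0 := rfl
  rw [← hp, ← h, Nat.cast_add, Nat.cast_mul, Nat.cast_ofNat, h2, zero_mul, zero_add]

theorem totPer_totIncl {n : ℕ} {p : ZMod 2} (hp : (n : ZMod 2) = p) (i m : ℕ) (h : 2 * i + m = n)
    (x : C.X m) : C.totPer n p hp (C.totIncl i m h x) =
      C.perIncl m (cast_of_two_mul_add hp h) x := by
  subst hp
  simp [totPer, totToPer, totIncl]

theorem perD_perIncl {p q : ZMod 2} (hq : q = p + 1) (m : ℕ) (h : (m : ZMod 2) = p) (x : C.X m) :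
    C.perD p q hq (C.perIncl m h x) =
      C.perIncl (m + 1) (by rw [Nat.cast_add, h, hq, Nat.cast_one]) (C.b m x) +
        C.perLower p q hq m h x := by
  simp [perD, perIncl]

theorem perD_totPer {n : ℕ} {p q : ZMod 2} (hp : (n : ZMod 2) = p) (hq : q = p + 1)
    (hq' : ((n + 1 : ℕ) : ZMod 2) = q) (z : C.Tot n) :
    C.perD p q hq (C.totPer n p hp z) = C.totPer (n + 1) q hq' (C.totD n z) := by
  induction z using Tot.induction with
  | h0 => simp
  | hadd a b ha hb => simp only [map_add, ha, hb]
  | h i m h x =>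
    rw [totPer_totIncl, perD_perIncl]
    cases m with
    | zero =>
      rw [totD_totIncl_zero, totPer_totIncl, perLower, LinearMap.zero_apply, add_zero]
    | succ m =>
      rw [totD_totIncl_succ, map_add, totPer_totIncl, totPer_totIncl]
      rfl

theorem totPer_totS {n : ℕ} {p : ZMod 2} (hp : (n : ZMod 2) = p)
    (hp' : ((n + 2 : ℕ) : ZMod 2) = p) (z : C.Tot n) :
    C.totPer (n + 2) p hp' (C.totS n z) = C.totPer n p hp z := by
  induction z using Tot.induction with
  | h0 => simp
  | hadd a b ha hb => simp only [map_add, ha, hb]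
  | h i m h x => rw [totS_totIncl, totPer_totIncl, totPer_totIncl]

theorem two_mul_half_add {n m : ℕ} {p : ZMod 2} (hp : (n : ZMod 2) = p) (hm : (m : ZMod 2) = p)
    (h : m ≤ n) : 2 * ((n - m) / 2) + m = n := by
  have := (ZMod.natCast_eq_natCast_iff' m n 2).1 (hm.trans hp.symm)
  omega

/-- The left inverse of `totPer`. -/
noncomputable def perToTot (n : ℕ) (p : ZMod 2) (hp : (n : ZMod 2) = p) : C.Per p →ₗ[k] C.Tot n :=
  DirectSum.toModule k _ _ fun m =>
    if h : m.1 ≤ n then C.totIncl ((n - m.1) / 2) m.1 (two_mul_half_add hp m.2 h) else 0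

theorem perToTot_perIncl {n : ℕ} {p : ZMod 2} (hp : (n : ZMod 2) = p) (m : ℕ)
    (hm : (m : ZMod 2) = p) (h : m ≤ n) (x : C.X m) :
    C.perToTot n p hp (C.perIncl m hm x) =
      C.totIncl ((n - m) / 2) m (two_mul_half_add hp hm h) x := by
  simp [perToTot, perIncl, h]

theorem perToTot_totPer {n : ℕ} {p : ZMod 2} (hp : (n : ZMod 2) = p) (z : C.Tot n) :
    C.perToTot n p hp (C.totPer n p hp z) = z := by
  induction z using Tot.induction with
  | h0 => simp
  | hadd a b ha hb => simp only [map_add, ha, hb]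
  | h i m h x =>
    rw [totPer_totIncl, perToTot_perIncl _ _ _ _ (by omega)]
    obtain rfl : i = (n - m) / 2 := by omega
    rfl

theorem totPer_injective {n : ℕ} {p : ZMod 2} (hp : (n : ZMod 2) = p) :
    Function.Injective (C.totPer n p hp) :=
  Function.LeftInverse.injective (C.perToTot_totPer hp)

theorem exists_totPer {p : ZMod 2} (z : C.Per p) :
    ∃ N : ℕ, ∀ n : ℕ, N ≤ n → ∀ hp : (n : ZMod 2) = p, C.totPer n p hp (C.perToTot n p hp z) = z := by
  induction z using Per.induction with
  | h0 => exact ⟨0, fun n _ hp => by simp⟩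
  | hadd a b ha hb =>
    obtain ⟨N, hN⟩ := ha
    obtain ⟨N', hN'⟩ := hb
    refine ⟨max N N', fun n hn hp => ?_⟩
    rw [map_add, map_add, hN n (le_of_max_le_left hn), hN' n (le_of_max_le_right hn)]
  | h m hm x =>
    exact ⟨m, fun n hn hp => by rw [perToTot_perIncl _ _ _ _ hn, totPer_totIncl]⟩

theorem exists_parity (p : ZMod 2) (N : ℕ) : ∃ n : ℕ, N ≤ n ∧ (n : ZMod 2) = p := by
  refine ⟨2 * N + p.val, by omega, ?_⟩
  rw [Nat.cast_add, ZMod.natCast_zmod_val, Nat.cast_mul]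
  have h2 : ((2 : ℕ) : ZMod 2) = 0 := rfl
  rw [h2, zero_mul, zero_add]

end Per

section PerMap

variable {C : MixedOperators.{u, v} k} {D : MixedOperators.{u, w} k} (F : TotMap C D)

/-- The map of periodic complexes given by a map of total complexes. -/
noncomputable def TotMap.per (p : ZMod 2) : C.Per p →ₗ[k] D.Per p :=
  DirectSum.toModule k _ _ fun m =>
    D.totPer m.1 p m.2 ∘ₗ F.tot m.1 ∘ₗ C.totIncl 0 m.1 (by omega)

theorem TotMap.per_perIncl {p : ZMod 2} (m : ℕ) (h : (m : ZMod 2) = p) (x : C.X m) :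
    F.per p (C.perIncl m h x) = D.totPer m p h (F.tot m (C.totIncl 0 m (by omega) x)) := by
  simp [TotMap.per, perIncl]

theorem TotMap.per_totPer {n : ℕ} {p : ZMod 2} (hp : (n : ZMod 2) = p) (z : C.Tot n) :
    F.per p (C.totPer n p hp z) = D.totPer n p hp (F.tot n z) := by
  induction z using Tot.induction with
  | h0 => simp
  | hadd a b ha hb => simp only [map_add, ha, hb]
  | h i m h x =>
    induction i generalizing n with
    | zero =>
      obtain rfl : m = n := by omega
      rw [totPer_totIncl, F.per_perIncl]
    | succ i ih =>
      obtain ⟨n, rfl⟩ : ∃ n', n = n' + 2 := ⟨n - 2, by omega⟩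
      have hp' : (n : ZMod 2) = p := by
        rw [← hp, Nat.cast_add]
        exact (add_zero _).symm
      have := C.totS_totIncl i m (n := n) (by omega) x
      rw [← this, totPer_totS _ hp', F.tot_totS, totPer_totS _ hp', ih]

theorem TotMap.per_perD {p q : ZMod 2} (hq : q = p + 1) (z : C.Per p) :
    F.per q (C.perD p q hq z) = D.perD p q hq (F.per p z) := by
  obtain ⟨N, hN⟩ := C.exists_totPer z
  obtain ⟨n, hn, hp⟩ := exists_parity p N
  have hq' : ((n + 1 : ℕ) : ZMod 2) = q := by rw [Nat.cast_add, hp, hq, Nat.cast_one]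
  rw [← hN n hn hp, perD_totPer _ hp hq hq', F.per_totPer, F.tot_totD, F.per_totPer,
    perD_totPer _ hp hq hq']

theorem TotMap.per_lift (hC : C.IsMixed) (hD : D.IsMixed) (h : IsQuasiIso C.b D.b F.top)
    {p q : ZMod 2} (hq : q = p + 1) (hp : p = q + 1) (w : C.Per q) (z : D.Per p)
    (hw : C.perD q p hp w = 0) (hz : D.perD p q hq z = F.per q w) :
    ∃ w', C.perD p q hq w' = w ∧ z - F.per p w' ∈ LinearMap.range (D.perD q p hp) := by
  obtain ⟨N, hN⟩ := C.exists_totPer w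
  obtain ⟨N', hN'⟩ := D.exists_totPer z
  obtain ⟨n, hn, hp1⟩ := exists_parity q (max N N')
  have hp2 : ((n + 1 : ℕ) : ZMod 2) = p := by rw [Nat.cast_add, hp1, hp, Nat.cast_one]
  have hp3 : ((n + 2 : ℕ) : ZMod 2) = q := by
    rw [← hp1, Nat.cast_add]
    exact add_zero _
  have hp4 : ((n + 3 : ℕ) : ZMod 2) = p := by
    rw [← hp2, Nat.cast_add, Nat.cast_add]
    rfl
  have ew := hN (n + 2) (by omega) hp3
  have ez := hN' (n + 1) (by omega) hp2
  rw [← ew] at hw hz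
  rw [← ez] at hz
  rw [perD_totPer _ hp3 hp hp4] at hw
  rw [perD_totPer _ hp2 hq hp3, F.per_totPer] at hz
  obtain ⟨w', hw', y, hy⟩ := F.lift hC hD h (n + 1) _ _
    (C.totPer_injective hp4 (hw.trans (map_zero _).symm)) (D.totPer_injective hp3 hz)
  refine ⟨C.totPer (n + 1) p hp2 w', ?_, D.totPer n q hp1 y, ?_⟩
  · rw [perD_totPer _ hp2 hq hp3, hw', ew]
  · rw [perD_totPer _ hp1 hp hp2, hy, map_sub, ez, F.per_totPer]

/-- The isomorphism on periodic cohomology induced by a quasi-isomorphism. -/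
noncomputable def TotMap.perEquiv (hC : C.IsMixed) (hD : D.IsMixed)
    (h : IsQuasiIso C.b D.b F.top) (p : ZMod 2) : C.HP p ≃ₗ[k] D.HP p :=
  Cohomology.equiv (F.per p) (fun x hx => by rw [← F.per_perD, hx, map_zero])
    (fun x ⟨y, hy⟩ => ⟨F.per _ y, by rw [← F.per_perD, hy]⟩)
    (fun x hx ⟨y, hy⟩ => by
      obtain ⟨w', hw', -⟩ := F.per_lift hC hD h (zmod_two_add_two p).symm rfl x y hx hy
      exact ⟨w', hw'⟩)
    (fun y hy => by
      obtain ⟨w', hw', h'⟩ := F.per_lift hC hD h rfl (zmod_two_add_two p).symm 0 y (map_zero _)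
        (by rw [hy, map_zero])
      exact ⟨w', hw', h'⟩)

theorem TotMap.represents_perEquiv (hC : C.IsMixed) (hD : D.IsMixed)
    (h : IsQuasiIso C.b D.b F.top) {p : ZMod 2} {z : C.Per p} {x : C.HP p} (hz : Represents z x) :
    Represents (F.per p z) (F.perEquiv hC hD h p x) := hz.equiv

end PerMap

section Constructions

variable {C : MixedOperators.{u, v} k} {D : MixedOperators.{u, w} k}

/-- The map of total complexes given by a map of mixed complexes. -/
noncomputable def TotMap.ofHom (f : ∀ n, C.X n →ₗ[k] D.X n)
    (hb : ∀ n x, f (n + 1) (C.b n x) = D.b n (f n x))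
    (hB : ∀ n x, f n (C.B n x) = D.B n (f (n + 1) x)) : TotMap C D where
  top := f
  tot n := DirectSum.toModule k _ _ fun p => D.totIncl p.1.1 p.1.2 p.2 ∘ₗ f p.1.2
  totTop_tot n z := by
    induction z using Tot.induction with
    | h0 => simp
    | hadd a b ha hb => simp only [map_add, ha, hb]
    | h i m h x =>
      rw [totIncl, DirectSum.toModule_lof, ← totIncl, LinearMap.comp_apply]
      cases i with
      | zero =>
        obtain rfl : m = n := by omega
        rw [totTop_totIncl_zero, totTop_totIncl_zero]
      | succ i => rw [totTop_totIncl_succ, totTop_totIncl_succ, map_zero]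
  tot_totS n z := by
    induction z using Tot.induction with
    | h0 => simp
    | hadd a b ha hb => simp only [map_add, ha, hb]
    | h i m h x =>
      rw [totS_totIncl]
      simp only [totIncl, DirectSum.toModule_lof, LinearMap.comp_apply]
      exact (D.totS_totIncl i m h (f m x)).symm
  tot_totD n z := by
    have ht : ∀ {n} i m (h : 2 * i + m = n) (x : C.X m),
        DirectSum.toModule k {p : ℕ × ℕ // 2 * p.1 + p.2 = n} (D.Tot n)
          (fun p => D.totIncl p.1.1 p.1.2 p.2 ∘ₗ f p.1.2) (C.totIncl i m h x) =
          D.totIncl i m h (f m x) := by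
      intro n i m h x
      simp [totIncl]
    induction z using Tot.induction with
    | h0 => simp
    | hadd a b ha hb => simp only [map_add, ha, hb]
    | h i m h x =>
      rw [ht]
      cases m with
      | zero => rw [totD_totIncl_zero, totD_totIncl_zero, ht, hb]
      | succ m => rw [totD_totIncl_succ, totD_totIncl_succ, map_add, ht, ht, hb, hB]

end Constructions

end MixedOperators


variable {k : Type u} [Field k]

namespace MixedOperators

section TensorMixed

variable {C : MixedOperators.{u, v} k} {D : MixedOperators.{u, w} k}

theorem tensor_B_zero_succ {n j : ℕ} (h : 0 + (j + 1) = n + 1) (x : C.X 0) (y : D.X (j + 1)) :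
    (C.tensor D).B n (KunnethSum.incl k C.X D.X 0 (j + 1) h (x ⊗ₜ y)) =
      KunnethSum.incl k C.X D.X 0 j (by omega) (x ⊗ₜ D.B j y) := by
  rw [tensor_B_incl]
  simp [tensorLowerLeft, tensorLowerRight]

theorem tensor_B_succ_zero {n i : ℕ} (h : i + 1 + 0 = n + 1) (x : C.X (i + 1)) (y : D.X 0) :
    (C.tensor D).B n (KunnethSum.incl k C.X D.X (i + 1) 0 h (x ⊗ₜ y)) =
      KunnethSum.incl k C.X D.X i 0 (by omega) (C.B i x ⊗ₜ y) := by
  rw [tensor_B_incl]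
  simp [tensorLowerLeft, tensorLowerRight]

theorem tensor_B_succ_succ {n i j : ℕ} (h : i + 1 + (j + 1) = n + 1) (x : C.X (i + 1))
    (y : D.X (j + 1)) :
    (C.tensor D).B n (KunnethSum.incl k C.X D.X (i + 1) (j + 1) h (x ⊗ₜ y)) =
      KunnethSum.incl k C.X D.X i (j + 1) (by omega) (C.B i x ⊗ₜ y) +
        (-1 : k) ^ (i + 1) •
          KunnethSum.incl k C.X D.X (i + 1) j (by omega) (x ⊗ₜ D.B j y) := by
  rw [tensor_B_incl]
  simp [tensorLowerLeft, tensorLowerRight]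

theorem tensor_b_incl {n : ℕ} (i j : ℕ) (h : i + j = n) (x : C.X i) (y : D.X j) :
    (C.tensor D).b n (KunnethSum.incl k C.X D.X i j h (x ⊗ₜ y)) =
      KunnethSum.incl k C.X D.X (i + 1) j (by omega) (C.b i x ⊗ₜ y) +
        (-1 : k) ^ i • KunnethSum.incl k C.X D.X i (j + 1) (by omega) (x ⊗ₜ D.b j y) :=
  tensorDifferential_incl C.b D.b i j h x y

theorem IsMixed.tensor (hC : C.IsMixed) (hD : D.IsMixed) : (C.tensor D).IsMixed where
  b_b n t := tensorDifferential_tensorDifferential hC.b_b hD.b_b n t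
  B_B n t := by
    induction t using KunnethSum.induction with
    | h0 => rw [map_zero, map_zero]
    | hadd a b ha hb => rw [map_add, map_add, ha, hb, add_zero]
    | h i j h x y =>
      match i, j, h, x, y with
      | 0, j + 2, h, x, y =>
        rw [tensor_B_zero_succ, tensor_B_zero_succ, hD.B_B, TensorProduct.tmul_zero, map_zero]
      | 1, 1, h, x, y =>
        rw [tensor_B_succ_succ, map_add, map_smul, tensor_B_zero_succ, tensor_B_succ_zero]
        module
      | 1, j + 2, h, x, y =>
        rw [tensor_B_succ_succ, map_add, map_smul, tensor_B_zero_succ, tensor_B_succ_succ,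
          hD.B_B, TensorProduct.tmul_zero, map_zero]
        module
      | i + 2, 0, h, x, y =>
        rw [tensor_B_succ_zero, tensor_B_succ_zero, hC.B_B, TensorProduct.zero_tmul, map_zero]
      | i + 2, 1, h, x, y =>
        rw [tensor_B_succ_succ, map_add, map_smul, tensor_B_succ_succ, tensor_B_succ_zero,
          hC.B_B, TensorProduct.zero_tmul, map_zero]
        module
      | i + 2, j + 2, h, x, y =>
        rw [tensor_B_succ_succ, map_add, map_smul, tensor_B_succ_succ, tensor_B_succ_succ,
          hC.B_B, hD.B_B, TensorProduct.zero_tmul, TensorProduct.tmul_zero, map_zero, map_zero]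
        module
  b_B n t := by
    induction t using KunnethSum.induction with
    | h0 => simp only [map_zero, add_zero]
    | hadd a b ha hb =>
      simp only [map_add]
      rw [add_add_add_comm, ha, hb, add_zero]
    | h i j h x y =>
      match i, j, h, x, y with
      | 0, j + 1, h, x, y =>
        rw [tensor_B_zero_succ, tensor_b_incl, tensor_b_incl, map_add, map_smul,
          tensor_B_succ_succ, tensor_B_zero_succ, hC.B_b_zero, TensorProduct.zero_tmul, map_zero,
          eq_neg_of_add_eq_zero_right (hD.b_B j y), TensorProduct.tmul_neg, map_neg]
        module
      | i + 1, 0, h, x, y =>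
        rw [tensor_B_succ_zero, tensor_b_incl, tensor_b_incl, map_add, map_smul,
          tensor_B_succ_zero, tensor_B_succ_succ, hD.B_b_zero, TensorProduct.tmul_zero, map_zero,
          eq_neg_of_add_eq_zero_right (hC.b_B i x), TensorProduct.neg_tmul, map_neg]
        module
      | i + 1, j + 1, h, x, y =>
        rw [tensor_B_succ_succ, map_add, map_smul, tensor_b_incl, tensor_b_incl, tensor_b_incl,
          map_add, map_smul, tensor_B_succ_succ, tensor_B_succ_succ,
          eq_neg_of_add_eq_zero_right (hC.b_B i x), eq_neg_of_add_eq_zero_right (hD.b_B j y),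
          TensorProduct.neg_tmul, TensorProduct.tmul_neg, map_neg, map_neg]
        have h1 : ((-1 : k) ^ i) * (-1) ^ i = 1 := by rw [← mul_pow]; simp
        simp only [pow_succ]
        module
  B_b_zero t := by
    induction t using KunnethSum.induction with
    | h0 => rw [map_zero, map_zero]
    | hadd a b ha hb => rw [map_add, map_add, ha, hb, add_zero]
    | h i j h x y =>
      obtain rfl : i = 0 := by omega
      obtain rfl : j = 0 := by omega
      rw [tensor_b_incl, map_add, map_smul, tensor_B_succ_zero, tensor_B_zero_succ,
        hC.B_b_zero, hD.B_b_zero]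
      simp

end TensorMixed

section MapTensor

variable {C : MixedOperators.{u, v} k} {D : MixedOperators.{u, w} k}
  {C' : MixedOperators.{u, v'} k} {D' : MixedOperators.{u, w'} k}
  {f : ∀ n, C.X n →ₗ[k] C'.X n} {g : ∀ n, D.X n →ₗ[k] D'.X n}

theorem map_tensor_b (hf : ∀ n x, f (n + 1) (C.b n x) = C'.b n (f n x))
    (hg : ∀ n x, g (n + 1) (D.b n x) = D'.b n (g n x)) (n : ℕ) (t : (C.tensor D).X n) :
    KunnethSum.map f g (n + 1) ((C.tensor D).b n t) =
      (C'.tensor D').b n (KunnethSum.map f g n t) := by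
  induction t using KunnethSum.induction with
  | h0 => simp only [map_zero]
  | hadd a b ha hb => simp only [map_add, ha, hb]
  | h i j h x y =>
    rw [tensor_b_incl, map_add, map_smul, KunnethSum.map_incl, KunnethSum.map_incl,
      KunnethSum.map_incl, TensorProduct.map_tmul, TensorProduct.map_tmul, TensorProduct.map_tmul,
      tensor_b_incl, hf, hg]

theorem map_tensor_B (hf : ∀ n x, f n (C.B n x) = C'.B n (f (n + 1) x))
    (hg : ∀ n x, g n (D.B n x) = D'.B n (g (n + 1) x)) (n : ℕ) (t : (C.tensor D).X (n + 1)) :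
    KunnethSum.map f g n ((C.tensor D).B n t) =
      (C'.tensor D').B n (KunnethSum.map f g (n + 1) t) := by
  induction t using KunnethSum.induction with
  | h0 => simp only [map_zero]
  | hadd a b ha hb => simp only [map_add, ha, hb]
  | h i j h x y =>
    match i, j, h, x, y with
    | 0, j + 1, h, x, y =>
      rw [tensor_B_zero_succ, KunnethSum.map_incl, KunnethSum.map_incl, TensorProduct.map_tmul,
        TensorProduct.map_tmul, tensor_B_zero_succ, hg]
    | i + 1, 0, h, x, y =>
      rw [tensor_B_succ_zero, KunnethSum.map_incl, KunnethSum.map_incl, TensorProduct.map_tmul,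
        TensorProduct.map_tmul, tensor_B_succ_zero, hf]
    | i + 1, j + 1, h, x, y =>
      rw [tensor_B_succ_succ, map_add, map_smul, KunnethSum.map_incl, KunnethSum.map_incl,
        KunnethSum.map_incl, TensorProduct.map_tmul, TensorProduct.map_tmul,
        TensorProduct.map_tmul, tensor_B_succ_succ, hf, hg]

end MapTensor

section Perturbation

variable {A : MixedOperators.{u, v} k} (h : ∀ n, A.X (n + 1) →ₗ[k] A.X n)

/-- The perturbed inclusion `z ↦ ∑ uⁱ⁺ʳ (h B)ʳ z`. -/
noncomputable def perturb : ∀ m i n : ℕ, 2 * i + m = n → (A.X m →ₗ[k] A.Tot n)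
  | 0, i, _, e => A.totIncl i 0 e
  | 1, i, _, e => A.totIncl i 1 e
  | m + 2, i, n, e =>
      A.totIncl i (m + 2) e + perturb m (i + 1) n (by omega) ∘ₗ h m ∘ₗ A.B (m + 1)

theorem perturb_zero {i n : ℕ} (e : 2 * i + 0 = n) (z : A.X 0) :
    perturb h 0 i n e z = A.totIncl i 0 e z := by rw [perturb]

theorem perturb_one {i n : ℕ} (e : 2 * i + 1 = n) (z : A.X 1) :
    perturb h 1 i n e z = A.totIncl i 1 e z := by rw [perturb]

theorem perturb_add_two {m i n : ℕ} (e : 2 * i + (m + 2) = n) (z : A.X (m + 2)) :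
    perturb h (m + 2) i n e z = A.totIncl i (m + 2) e z +
      perturb h m (i + 1) n (by omega) (h m (A.B (m + 1) z)) := by
  rw [perturb]
  rfl

theorem totTop_perturb_succ : ∀ {m i n : ℕ} (e : 2 * (i + 1) + m = n) (z : A.X m),
    A.totTop n (perturb h m (i + 1) n e z) = 0
  | 0, i, n, e, z => by rw [perturb_zero, totTop_totIncl_succ]
  | 1, i, n, e, z => by rw [perturb_one, totTop_totIncl_succ]
  | m + 2, i, n, e, z => by
    rw [perturb_add_two, map_add, totTop_totIncl_succ, totTop_perturb_succ, add_zero]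

theorem totTop_perturb_zero : ∀ {n : ℕ} (e : 2 * 0 + n = n) (z : A.X n),
    A.totTop n (perturb h n 0 n e z) = z
  | 0, e, z => by rw [perturb_zero, totTop_totIncl_zero]
  | 1, e, z => by rw [perturb_one, totTop_totIncl_zero]
  | n + 2, e, z => by
    rw [perturb_add_two, map_add, totTop_totIncl_zero, totTop_perturb_succ, add_zero]

theorem totS_perturb : ∀ {m i n : ℕ} (e : 2 * i + m = n) (z : A.X m),
    A.totS n (perturb h m i n e z) = perturb h m (i + 1) (n + 2) (by omega) z
  | 0, i, n, e, z => by rw [perturb_zero, perturb_zero, totS_totIncl]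
  | 1, i, n, e, z => by rw [perturb_one, perturb_one, totS_totIncl]
  | m + 2, i, n, e, z => by
    rw [perturb_add_two, perturb_add_two, map_add, totS_totIncl, totS_perturb]

variable {h} (hA : A.IsMixed)
  {G : ∀ n, A.X n →ₗ[k] A.X n}
  (hG : ∀ n z, h (n + 1) (A.b (n + 1) z) + A.b n (h n z) = G (n + 1) z - z)
  (hG₀ : ∀ z, G 0 z = z) (h₀ : ∀ z, h 0 (A.b 0 z) = 0)
  {W : ∀ n, Submodule k (A.X n)} {N : ℕ} (hW : ∀ m, ∀ z ∈ W (m + 2), h m (A.B (m + 1) z) ∈ W m)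
  (hW' : ∀ m, m + 3 ≤ N → ∀ z ∈ W (m + 1), G m (A.B m z) = 0)

include hA

theorem perturb_B {m i n : ℕ} (e : 2 * i + m = n) (z : A.X (m + 1)) :
    perturb h m i n e (A.B m z) = A.totIncl i m e (A.B m z) := by
  match m, e, z with
  | 0, e, z => rw [perturb_zero]
  | 1, e, z => rw [perturb_one]
  | m + 2, e, z => rw [perturb_add_two, hA.B_B, map_zero, map_zero, add_zero]

omit hA in
theorem totD_perturb_zero {i n : ℕ} (e : 2 * i + 0 = n) (z : A.X 0) :
    A.totD n (perturb h 0 i n e z) = perturb h 1 i (n + 1) (by omega) (A.b 0 z) := by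
  rw [perturb_zero, totD_totIncl_zero, perturb_one]

include hG hG₀ h₀ hW hW' in
theorem totD_perturb_succ : ∀ {m i n : ℕ} (e : 2 * i + (m + 1) = n) (z : A.X (m + 1)),
    z ∈ W (m + 1) → m + 1 ≤ N →
    A.totD n (perturb h (m + 1) i n e z) =
      perturb h (m + 2) i (n + 1) (by omega) (A.b (m + 1) z) +
        perturb h m (i + 1) (n + 1) (by omega) (G m (A.B m z))
  | 0, i, n, e, z, hz, hN => by
    rw [perturb_one, totD_totIncl_succ, perturb_add_two, perturb_zero, perturb_zero, hG₀,
      eq_neg_of_add_eq_zero_right (hA.b_B 0 z), map_neg, h₀, neg_zero, map_zero]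
    abel
  | m + 1, i, n, e, z, hz, hN => by
    have h1 : A.totD n (perturb h m (i + 1) n (by omega) (h m (A.B (m + 1) z))) =
        perturb h (m + 1) (i + 1) (n + 1) (by omega) (A.b m (h m (A.B (m + 1) z))) := by
      match m, e, z, hz, hN with
      | 0, e, z, hz, hN => rw [totD_perturb_zero]
      | m + 1, e, z, hz, hN =>
        rw [totD_perturb_succ _ _ (hW _ _ hz) (by omega), hW' m (by omega) _ (hW _ _ hz),
          map_zero, add_zero]
    have h2 := hG m (A.B (m + 1) z)
    rw [← eq_sub_iff_add_eq] at h2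
    rw [perturb_add_two, map_add, totD_totIncl_succ, perturb_add_two, h1,
      eq_neg_of_add_eq_zero_right (hA.b_B (m + 1) z), map_neg, h2, map_neg, map_sub, map_sub,
      perturb_B hA]
    abel

end Perturbation

end MixedOperators


variable {k : Type u} [Field k]

namespace Cosimplicial

variable (C : Cosimplicial.{u, v} k)

theorem σ_b_of_σ_eq_zero {m i j : ℕ} (hij : i < j) (hj : j ≤ m + 1) {y : C.X (m + 1)}
    (hy : ∀ l < j, l ≤ m → C.σ m l y = 0) : C.σ (m + 1) i (C.b (m + 1) y) = 0 := by
  have h1 : ∀ l ∈ Finset.range (m + 1 + 2), l ≠ i → l ≠ i + 1 →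
      C.σ (m + 1) i ((-1 : k) ^ l • C.δ (m + 1) l y) = 0 := by
    intro l hl h1 h2
    rw [Finset.mem_range] at hl
    rw [map_smul]
    rcases Nat.lt_or_ge l i with h | h
    · obtain ⟨i, rfl⟩ : ∃ i', i = i' + 1 := ⟨i - 1, by omega⟩
      rw [C.σ_δ_lt m l i (by omega) (by omega), hy i (by omega) (by omega), map_zero, smul_zero]
    · obtain ⟨l, rfl⟩ : ∃ l', l = l' + 1 := ⟨l - 1, by omega⟩
      rw [C.σ_δ_gt m l i (by omega) (by omega), hy i (by omega) (by omega), map_zero, smul_zero]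
  rw [b_apply, map_sum, Finset.sum_eq_add_of_mem i (i + 1) (by simp; omega) (by simp; omega)
    (by omega) (fun l hl h => h1 l hl h.1 h.2), map_smul, map_smul, C.σ_δ_self _ _ (by omega),
    C.σ_δ_succ _ _ (by omega), pow_succ]
  module

theorem σ_b_eq_zero_iff {n j : ℕ} (hj : j ≤ n) {z : C.X (n + 1)}
    (hz : ∀ l < j, C.σ n l z = 0) (hbz : C.σ (n + 1) j (C.b (n + 1) z) = 0) :
    ∑ l ∈ Finset.range (n + 1 - j), (-1 : k) ^ l • C.δ n (j + 1 + l) (C.σ n j z) = 0 := by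
  rw [b_apply, map_sum, show n + 1 + 2 = j + (1 + 1 + (n + 1 - j)) by omega,
    Finset.sum_range_add, Finset.sum_range_add, Finset.sum_range_succ, Finset.sum_range_one] at hbz
  rw [Finset.sum_eq_zero, zero_add] at hbz
  · simp only [map_smul, add_zero] at hbz
    rw [C.σ_δ_self _ _ (by omega), C.σ_δ_succ _ _ (by omega), pow_succ] at hbz
    have h1 : ∀ x : C.X (n + 1), (-1 : k) ^ j • x + ((-1 : k) ^ j * -1) • x = 0 := by
      intro x
      module
    rw [h1, zero_add] at hbz
    have h2 : (-1 : k) ^ j • ∑ l ∈ Finset.range (n + 1 - j),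
        (-1 : k) ^ l • C.δ n (j + 1 + l) (C.σ n j z) = 0 := by
      rw [← hbz, Finset.smul_sum]
      refine Finset.sum_congr rfl fun l hl => ?_
      rw [Finset.mem_range] at hl
      rw [show j + (1 + 1 + l) = j + 1 + l + 1 by omega, C.σ_δ_gt _ _ _ (by omega) (by omega),
        smul_smul]
      congr 1
      ring
    exact (smul_eq_zero_iff_right (pow_ne_zero _ (by simp))).1 h2
  · intro l hl
    rw [Finset.mem_range] at hl
    obtain ⟨j, rfl⟩ : ∃ j', j = j' + 1 := ⟨j - 1, by omega⟩
    rw [map_smul, C.σ_δ_lt _ _ _ (by omega) (by omega), hz j (by omega), map_zero, smul_zero]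

theorem σ_b_σ {n j : ℕ} (hj : j ≤ n) {z : C.X (n + 1)}
    (hz : ∀ l < j, C.σ n l z = 0) (hbz : C.σ (n + 1) j (C.b (n + 1) z) = 0) :
    C.σ n j (C.b n (C.σ n j z)) = (-1 : k) ^ j • C.σ n j z := by
  have h := congrArg (C.σ n j) (C.σ_b_eq_zero_iff hj hz hbz)
  rw [map_sum, map_zero] at h
  rw [b_apply, map_sum, show n + 2 = j + (1 + (n + 1 - j)) by omega, Finset.sum_range_add,
    Finset.sum_range_add, Finset.sum_range_one, Finset.sum_eq_zero, zero_add, add_zero, map_smul,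
    C.σ_δ_self _ _ hj, add_eq_left]
  · refine Eq.trans ?_ ((congrArg (fun y => (-1 : k) ^ (j + 1) • y) h).trans (smul_zero _))
    rw [Finset.smul_sum]
    refine Finset.sum_congr rfl fun l _ => ?_
    rw [map_smul, map_smul, smul_smul, ← pow_add, add_assoc]
  · intro l hl
    rw [Finset.mem_range] at hl
    obtain ⟨j, rfl⟩ : ∃ j', j = j' + 1 := ⟨j - 1, by omega⟩
    obtain ⟨n, rfl⟩ : ∃ n', n = n' + 1 := ⟨n - 1, by omega⟩
    rw [map_smul, C.σ_δ_lt _ _ _ (by omega) (by omega), ← C.σ_σ n j j le_rfl (by omega), hz j (by omega), map_zero, map_zero, smul_zero]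

theorem exists_sub_b_normalized {n : ℕ} {z : C.X (n + 1)}
    (hbz : C.b (n + 1) z ∈ C.normalized (n + 2)) :
    ∃ y, z - C.b n y ∈ C.normalized (n + 1) := by
  have key : ∀ j ≤ n + 1, ∃ y, ∀ l < j, C.σ n l (z - C.b n y) = 0 := by
    intro j
    induction j with
    | zero => exact fun _ => ⟨0, fun l hl => absurd hl (by omega)⟩
    | succ j ih =>
      intro hj
      obtain ⟨y, hy⟩ := ih (by omega)
      have hb : C.b (n + 1) (z - C.b n y) = C.b (n + 1) z := by rw [map_sub, C.b_b, sub_zero]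
      have hs := C.σ_b_σ (by omega) hy (by rw [hb]; exact C.mem_normalized_succ.1 hbz j (by omega))
      refine ⟨y + (-1 : k) ^ j • C.σ n j (z - C.b n y), fun l hl => ?_⟩
      rw [map_add, ← sub_sub, map_sub, map_smul, map_smul]
      rcases Nat.lt_or_ge l j with h | h
      · cases n with
        | zero => omega
        | succ m =>
          rw [hy l h, C.σ_b_of_σ_eq_zero h (by omega), smul_zero, sub_zero]
          intro i hi hm
          obtain ⟨j, rfl⟩ : ∃ j', j = j' + 1 := ⟨j - 1, by omega⟩
          rw [← C.σ_σ m i j (by omega) (by omega), hy i hi, map_zero]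
      · obtain rfl : l = j := by omega
        rw [hs, smul_smul, ← mul_pow]
        simp
  obtain ⟨y, hy⟩ := key (n + 1) le_rfl
  exact ⟨y, C.mem_normalized_succ.2 fun i hi => hy i (by omega)⟩

end Cosimplicial

namespace MixedOperators

section KunnethQuasiIso

variable {X : ℕ → Type v} [∀ n, AddCommGroup (X n)] [∀ n, Module k (X n)]
  {Y : ℕ → Type w} [∀ n, AddCommGroup (Y n)] [∀ n, Module k (Y n)]
  {X' : ℕ → Type v'} [∀ n, AddCommGroup (X' n)] [∀ n, Module k (X' n)]
  {Y' : ℕ → Type w'} [∀ n, AddCommGroup (Y' n)] [∀ n, Module k (Y' n)]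
  {dX : ∀ n, X n →ₗ[k] X (n + 1)} {dY : ∀ n, Y n →ₗ[k] Y (n + 1)}
  {dX' : ∀ n, X' n →ₗ[k] X' (n + 1)} {dY' : ∀ n, Y' n →ₗ[k] Y' (n + 1)}
  {f : ∀ n, X n →ₗ[k] X' n} {g : ∀ n, Y n →ₗ[k] Y' n}

theorem map_tensorDifferential (hf : ∀ n x, f (n + 1) (dX n x) = dX' n (f n x))
    (hg : ∀ n x, g (n + 1) (dY n x) = dY' n (g n x)) (n : ℕ) (t : KunnethSum k X Y n) :
    KunnethSum.map f g (n + 1) (tensorDifferential dX dY n t) =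
      tensorDifferential dX' dY' n (KunnethSum.map f g n t) := by
  induction t using KunnethSum.induction with
  | h0 => simp only [map_zero]
  | hadd a b ha hb => simp only [map_add, ha, hb]
  | h i j h x y =>
    rw [tensorDifferential_incl, map_add, map_smul, KunnethSum.map_incl, KunnethSum.map_incl,
      KunnethSum.map_incl, TensorProduct.map_tmul, TensorProduct.map_tmul, TensorProduct.map_tmul,
      tensorDifferential_incl, hf, hg]

/-- The tensor product of two quasi-isomorphisms is a quasi-isomorphism. -/
theorem IsQuasiIso.tensor (hf : IsQuasiIso dX dX' f) (hg : IsQuasiIso dY dY' g)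
    (hX : ∀ n x, dX (n + 1) (dX n x) = 0) (hY : ∀ n x, dY (n + 1) (dY n x) = 0)
    (hX' : ∀ n x, dX' (n + 1) (dX' n x) = 0) (hY' : ∀ n x, dY' (n + 1) (dY' n x) = 0) :
    IsQuasiIso (tensorDifferential dX dY) (tensorDifferential dX' dY')
      (KunnethSum.map f g) := by
  have comm := map_tensorDifferential hf.comm hg.comm
  have key : ∀ n, ∃ Φ : Cohomology (tensorDifferential dX dY n)
      (coboundaries (tensorDifferential dX dY) n) ≃ₗ[k]
      Cohomology (tensorDifferential dX' dY' n) (coboundaries (tensorDifferential dX' dY') n),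
      ∀ t c, Represents t c → Represents (KunnethSum.map f g n t) (Φ c) := by
    intro n
    obtain ⟨e, he⟩ := exists_kunneth_nat hX hY n
    obtain ⟨e', he'⟩ := exists_kunneth_nat hX' hY' n
    let E := KunnethSum.equiv (fun i => hf.equiv i) (fun i => hg.equiv i) n
    refine ⟨e.symm ≪≫ₗ E ≪≫ₗ e', fun t c htc => ?_⟩
    let F : Cohomology (tensorDifferential dX dY n)
      (coboundaries (tensorDifferential dX dY) n) →ₗ[k]
      Cohomology (tensorDifferential dX' dY' n) (coboundaries (tensorDifferential dX' dY') n) :=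
      Cohomology.map (KunnethSum.map f g n) (fun x hx => by rw [← comm, hx, map_zero])
        (fun x hx => map_mem_coboundaries comm hx)
    have h1 : F ∘ₗ e.toLinearMap = e'.toLinearMap ∘ₗ E.toLinearMap := by
      refine KunnethSum.ext fun i j hij x y => ?_
      obtain ⟨α, hα⟩ := exists_represents x
      obtain ⟨β, hβ⟩ := exists_represents y
      have h2 : Represents _ (F (e _)) := (he i j hij α β x y hα hβ).map
      rw [KunnethSum.map_incl, TensorProduct.map_tmul] at h2
      have h3 := he' i j hij (f i α) (g j β) _ _ (hf.represents hα) (hg.represents hβ)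
      rw [← KunnethSum.equiv_incl (fun i => hf.equiv i) (fun i => hg.equiv i)] at h3
      exact h2.eq h3
    have h2 := LinearMap.congr_fun h1 (e.symm c)
    simp only [LinearMap.comp_apply, LinearEquiv.coe_coe, LinearEquiv.apply_symm_apply] at h2
    have h3 : Represents (KunnethSum.map f g n t) (F c) := htc.map
    rw [h2] at h3
    exact h3
  refine isQuasiIso_of_cohomology comm (fun n x hx hx' => ?_) fun n z hz => ?_
  · obtain ⟨Φ, hΦ⟩ := key n
    have h1 := represents_mk (P := coboundaries (tensorDifferential dX dY) n) x hx
    have h2 := (hΦ _ _ h1).eq_zero_iff.2 hx'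
    rw [LinearEquiv.map_eq_zero_iff] at h2
    exact h1.eq_zero_iff.1 h2
  · obtain ⟨Φ, hΦ⟩ := key n
    obtain ⟨x, hx⟩ := exists_represents
      (Φ.symm (Cohomology.mk _ (coboundaries (tensorDifferential dX' dY') n) z hz))
    have h1 := hΦ _ _ hx
    rw [LinearEquiv.apply_symm_apply] at h1
    exact ⟨x, hx.ker, ((represents_mk z hz).eq_iff h1).1 rfl⟩

end KunnethQuasiIso

end MixedOperators

namespace CocyclicOperators.IsCocyclic

open MixedOperators

variable {C : CocyclicOperators.{u, v} k} (hC : C.IsCocyclic)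

theorem normalizedMixed_isMixed [CharZero k] : hC.normalizedMixed.IsMixed where
  b_b n x := Subtype.ext (hC.isMixed.b_b n x)
  B_B n x := Subtype.ext (hC.isMixed.B_B n x)
  b_B n x := Subtype.ext (hC.isMixed.b_B n x)
  B_b_zero x := Subtype.ext (hC.isMixed.B_b_zero x)

/-- The inclusion of the normalized cochains. -/
abbrev normalizedSubtype (n : ℕ) : hC.normalizedMixed.X n →ₗ[k] C.X n :=
  (hC.cos.normalized n).subtype

theorem isQuasiIso_normalized :
    IsQuasiIso hC.normalizedMixed.b C.toMixed.b hC.normalizedSubtype where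
  comm n x := rfl
  lift n w z hw hz := by
    rw [show C.toMixed.b = C.hochschild from rfl] at hz
    match n, w, z, hw, hz with
    | 0, w, z, hw, hz =>
      refine ⟨⟨z, trivial⟩, Subtype.ext hz, ?_⟩
      change z - z ∈ _
      rw [sub_self]
      exact Submodule.zero_mem _
    | n + 1, w, z, hw, hz =>
      rw [hC.hochschild_eq] at hz
      obtain ⟨y, hy⟩ := hC.cos.exists_sub_b_normalized (z := z) (by rw [hz]; exact w.2)
      refine ⟨⟨_, hy⟩, Subtype.ext ?_, y, ?_⟩
      · change C.hochschild (n + 1) (z - hC.cos.b n y) = w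
        rw [hC.hochschild_eq, map_sub, hC.cos.b_b, hz, sub_zero]
        rfl
      · change C.hochschild n y = z - (z - hC.cos.b n y)
        rw [hC.hochschild_eq, sub_sub_cancel]
  inj w hw hw' := Subtype.ext hw'

variable {D : CocyclicOperators.{u, w} k} (hD : D.IsCocyclic)

/-- The inclusion of the tensor product of the normalized mixed complexes. -/
noncomputable def normalizedTensor :
    TotMap (hC.normalizedMixed.tensor hD.normalizedMixed) (C.toMixed.tensor D.toMixed) :=
  TotMap.ofHom (KunnethSum.map hC.normalizedSubtype hD.normalizedSubtype)
    (map_tensor_b (fun _ _ => rfl) fun _ _ => rfl) (map_tensor_B (fun _ _ => rfl) fun _ _ => rfl)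

theorem isQuasiIso_normalizedTensor [CharZero k] :
    IsQuasiIso (hC.normalizedMixed.tensor hD.normalizedMixed).b (C.toMixed.tensor D.toMixed).b
      (normalizedTensor hC hD).top :=
  hC.isQuasiIso_normalized.tensor hD.isQuasiIso_normalized hC.normalizedMixed_isMixed.b_b
    hD.normalizedMixed_isMixed.b_b hC.isMixed.b_b hD.isMixed.b_b

end CocyclicOperators.IsCocyclic


variable {k : Type u} [Field k]

namespace CocyclicOperators.IsCocyclic

open MixedOperators

variable {C : CocyclicOperators.{u, v} k} (hC : C.IsCocyclic) {D : CocyclicOperators.{u, w} k}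
  (hD : D.IsCocyclic)

/-- The Alexander–Whitney map on normalized cochains. -/
noncomputable abbrev normalizedAW (n : ℕ) :
    (hC.normalizedMixed.tensor hD.normalizedMixed).X n →ₗ[k] C.X n ⊗[k] D.X n :=
  Cosimplicial.aw hC.cos hD.cos n ∘ₗ
    KunnethSum.map hC.normalizedSubtype hD.normalizedSubtype n

theorem normalizedAW_b (n : ℕ) (t : (hC.normalizedMixed.tensor hD.normalizedMixed).X n) :
    normalizedAW hC hD (n + 1) ((hC.normalizedMixed.tensor hD.normalizedMixed).b n t) =
      (CocyclicOperators.diag C D).hochschild n (normalizedAW hC hD n t) := by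
  rw [hC.diag_hochschild hD, LinearMap.comp_apply, LinearMap.comp_apply, Cosimplicial.b_aw,
    map_tensorDifferential (dX' := hC.cos.b) (dY' := hD.cos.b)]
  · intro n x
    exact LinearMap.congr_fun (hC.hochschild_eq n) x.1
  · intro n x
    exact LinearMap.congr_fun (hD.hochschild_eq n) x.1

theorem shuffle_normalizedAW (n : ℕ)
    (t : (hC.normalizedMixed.tensor hD.normalizedMixed).X n) :
    Cosimplicial.shuffle n hC.cos hD.cos (normalizedAW hC hD n t) =
      KunnethSum.map hC.normalizedSubtype hD.normalizedSubtype n t := by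
  induction t using KunnethSum.induction with
  | h0 => simp only [map_zero]
  | hadd a b ha hb => simp only [map_add, ha, hb]
  | h i j h x y =>
    rw [LinearMap.comp_apply, KunnethSum.map_incl, TensorProduct.map_tmul]
    exact Cosimplicial.shuffle_aw_incl hC.cos hD.cos i j h x.2 y.2

theorem awSh_connes_normalizedAW (n : ℕ)
    (t : (hC.normalizedMixed.tensor hD.normalizedMixed).X (n + 1)) :
    Cosimplicial.awSh hC.cos hD.cos n
      ((CocyclicOperators.diag C D).connes n (normalizedAW hC hD (n + 1) t)) =
      normalizedAW hC hD n ((hC.normalizedMixed.tensor hD.normalizedMixed).B n t) := by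
  have h1 := map_tensor_B (C := hC.normalizedMixed) (D := hD.normalizedMixed) (C' := C.toMixed)
    (D' := D.toMixed) (f := hC.normalizedSubtype) (g := hD.normalizedSubtype) (fun _ _ => rfl)
    (fun _ _ => rfl) n t
  rw [LinearMap.comp_apply _ _ ((hC.normalizedMixed.tensor hD.normalizedMixed).B n t), h1,
    Cosimplicial.awSh, LinearMap.comp_apply]
  congr 1
  induction t using KunnethSum.induction with
  | h0 => simp only [map_zero]
  | hadd a b ha hb =>
    simp only [map_add]
    rw [ha, hb]
    · exact map_tensor_B (C := hC.normalizedMixed) (D := hD.normalizedMixed) (C' := C.toMixed)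
        (D' := D.toMixed) (fun _ _ => rfl) (fun _ _ => rfl) n b
    · exact map_tensor_B (C := hC.normalizedMixed) (D := hD.normalizedMixed) (C' := C.toMixed)
        (D' := D.toMixed) (fun _ _ => rfl) (fun _ _ => rfl) n a
  | h i j h x y =>
    rw [LinearMap.comp_apply, KunnethSum.map_incl, TensorProduct.map_tmul]
    exact shuffle_connes_aw hC hD i j h x.2 y.2

theorem homotopy_hochschild (n : ℕ) (z : C.X (n + 1) ⊗[k] D.X (n + 1)) :
    Cosimplicial.homotopy (n + 1) hC.cos hD.cos
        ((CocyclicOperators.diag C D).hochschild (n + 1) z) +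
      (CocyclicOperators.diag C D).hochschild n (Cosimplicial.homotopy n hC.cos hD.cos z) =
      Cosimplicial.awSh hC.cos hD.cos (n + 1) z - z := by
  rw [hC.diag_hochschild hD, hC.diag_hochschild hD]
  exact Cosimplicial.homotopy_b n hC.cos hD.cos z

theorem homotopy_hochschild_zero (z : C.X 0 ⊗[k] D.X 0) :
    Cosimplicial.homotopy 0 hC.cos hD.cos
      ((CocyclicOperators.diag C D).hochschild 0 z) = 0 := by
  rw [hC.diag_hochschild hD]
  exact Cosimplicial.homotopy_b_zero hC.cos hD.cos z

theorem isQuasiIso_normalizedAW [CharZero k] :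
    IsQuasiIso (hC.normalizedMixed.tensor hD.normalizedMixed).b
      (CocyclicOperators.diag C D).toMixed.b (normalizedAW hC hD) where
  comm := normalizedAW_b hC hD
  lift n w z hw hz := by
    have q := isQuasiIso_normalizedTensor hC hD
    have hsh : ∀ n (z : C.X n ⊗[k] D.X n), (C.toMixed.tensor D.toMixed).b n
        (Cosimplicial.shuffle n hC.cos hD.cos z) = Cosimplicial.shuffle (n + 1) hC.cos hD.cos
          ((CocyclicOperators.diag C D).hochschild n z) := by
      intro n z
      rw [hC.diag_hochschild hD, Cosimplicial.shuffle_b, Cosimplicial.dT,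
        show hC.cos.b = C.hochschild from funext fun n => (hC.hochschild_eq n).symm,
        show hD.cos.b = D.hochschild from funext fun n => (hD.hochschild_eq n).symm]
    obtain ⟨w', hw', h'⟩ := q.lift n w (Cosimplicial.shuffle n hC.cos hD.cos z) hw (by
      rw [hsh]
      refine (congrArg _ hz).trans ?_
      exact shuffle_normalizedAW hC hD (n + 1) w)
    refine ⟨w', hw', ?_⟩
    have e1 : Cosimplicial.shuffle n hC.cos hD.cos (z - normalizedAW hC hD n w') =
        Cosimplicial.shuffle n hC.cos hD.cos z - (normalizedTensor hC hD).top n w' := by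
      rw [map_sub, shuffle_normalizedAW]
      rfl
    rw [← e1] at h'
    have e2 : (CocyclicOperators.diag C D).hochschild n (z - normalizedAW hC hD n w') = 0 := by
      rw [map_sub, ← normalizedAW_b, hw', sub_eq_zero]
      exact hz
    generalize z - normalizedAW hC hD n w' = z₁ at h' e2
    have e3 : Cosimplicial.awSh hC.cos hD.cos n z₁ ∈
        coboundaries (CocyclicOperators.diag C D).hochschild n := by
      refine map_mem_coboundaries (d := (C.toMixed.tensor D.toMixed).b)
        (F := Cosimplicial.aw hC.cos hD.cos) (fun n t => ?_) h'
      rw [hC.diag_hochschild hD, Cosimplicial.b_aw, Cosimplicial.dT,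
        show hC.cos.b = C.hochschild from funext fun n => (hC.hochschild_eq n).symm,
        show hD.cos.b = D.hochschild from funext fun n => (hD.hochschild_eq n).symm]
    match n, z₁, e2, e3 with
    | 0, z₁, e2, e3 => rwa [Cosimplicial.awSh_zero] at e3
    | n + 1, z₁, e2, e3 =>
      have h1 := homotopy_hochschild hC hD n z₁
      rw [e2, map_zero, zero_add, eq_sub_iff_add_eq, ← eq_sub_iff_add_eq'] at h1
      rw [h1]
      exact Submodule.sub_mem _ e3 ⟨_, rfl⟩
  inj w hw hw' := by
    refine (isQuasiIso_normalizedTensor hC hD).inj w hw ?_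
    have h1 := shuffle_normalizedAW hC hD 0 w
    rw [hw', map_zero] at h1
    exact h1.symm

/-- The perturbed Alexander–Whitney map of total complexes. -/
noncomputable def totAW [CharZero k] :
    TotMap (hC.normalizedMixed.tensor hD.normalizedMixed)
      (CocyclicOperators.diag C D).toMixed where
  top := normalizedAW hC hD
  tot n := DirectSum.toModule k _ _ fun p =>
    perturb (A := (CocyclicOperators.diag C D).toMixed)
      (fun n => Cosimplicial.homotopy n hC.cos hD.cos) p.1.2 p.1.1 n p.2 ∘ₗ
        normalizedAW hC hD p.1.2
  totTop_tot n z := by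
    induction z using Tot.induction with
    | h0 => simp only [map_zero]
    | hadd a b ha hb => simp only [map_add, ha, hb]
    | h i m h t =>
      rw [totIncl, DirectSum.toModule_lof, ← totIncl, LinearMap.comp_apply]
      cases i with
      | zero =>
        obtain rfl : m = n := by omega
        rw [totTop_totIncl_zero, totTop_perturb_zero]
      | succ i => rw [totTop_totIncl_succ, totTop_perturb_succ, map_zero]
  tot_totS n z := by
    induction z using Tot.induction with
    | h0 => simp only [map_zero]
    | hadd a b ha hb => simp only [map_add, ha, hb]
    | h i m h t =>
      rw [totS_totIncl, totIncl, totIncl, DirectSum.toModule_lof, DirectSum.toModule_lof]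
      exact (totS_perturb _ h _).symm
  tot_totD n z := by
    have ht : ∀ {n} i m (h : 2 * i + m = n)
        (x : (hC.normalizedMixed.tensor hD.normalizedMixed).X m),
        DirectSum.toModule k {p : ℕ × ℕ // 2 * p.1 + p.2 = n} _
          (fun p => perturb (A := (CocyclicOperators.diag C D).toMixed)
            (fun n => Cosimplicial.homotopy n hC.cos hD.cos) p.1.2 p.1.1 n p.2 ∘ₗ
              normalizedAW hC hD p.1.2)
          ((hC.normalizedMixed.tensor hD.normalizedMixed).totIncl i m h x) =
          perturb (A := (CocyclicOperators.diag C D).toMixed)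
            (fun n => Cosimplicial.homotopy n hC.cos hD.cos) m i n h
              (normalizedAW hC hD m x) := by
      intro n i m h x
      rw [totIncl, DirectSum.toModule_lof]
      rfl
    induction z using Tot.induction with
    | h0 => simp only [map_zero]
    | hadd a b ha hb => simp only [map_add, ha, hb]
    | h i m h t =>
      rw [ht]
      cases m with
      | zero =>
        rw [totD_totIncl_zero, ht, totD_perturb_zero, normalizedAW_b]
      | succ m =>
        rw [totD_totIncl_succ, map_add, ht, ht, normalizedAW_b]
        induction t using KunnethSum.induction with
        | h0 => simp only [map_zero, add_zero]
        | hadd a b ha hb =>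
          simp only [map_add] at ha hb ⊢
          rw [← ha, ← hb]
          exact add_add_add_comm _ _ _ _
        | h p q hpq x y =>
          refine Eq.trans ?_ (totD_perturb_succ (A := (CocyclicOperators.diag C D).toMixed)
            (hC.diag hD).isMixed (homotopy_hochschild hC hD)
            (Cosimplicial.awSh_zero hC.cos hD.cos) (homotopy_hochschild_zero hC hD)
            (W := filteredDiag hC hD p q) (N := p + q)
            (fun m z hz => homotopy_mem_filteredDiag hC hD (connes_mem_filteredDiag hC hD hz))
            (fun m hm z hz => ?_) h _ ?_ hpq.ge).symm
          · rw [awSh_connes_normalizedAW]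
          · rw [Cosimplicial.awSh, LinearMap.comp_apply,
              shuffle_filteredDiag hC hD hm (connes_mem_filteredDiag hC hD hz), map_zero]
          · rw [LinearMap.comp_apply, KunnethSum.map_incl, TensorProduct.map_tmul]
            exact aw_mem_filteredDiag hC hD hpq x.2 y.2

end CocyclicOperators.IsCocyclic


variable {k : Type u} [Field k]

section ZModComplex

variable {X : ZMod 2 → Type v} [∀ p, AddCommGroup (X p)] [∀ p, Module k (X p)]
  {Y : ZMod 2 → Type w} [∀ p, AddCommGroup (Y p)] [∀ p, Module k (Y p)]
  {d : ∀ p q : ZMod 2, q = p + 1 → (X p →ₗ[k] X q)}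
  {d' : ∀ p q : ZMod 2, q = p + 1 → (Y p →ₗ[k] Y q)}


/-- A `ℤ/2`-graded complex. -/
def GradedComplex.ofZMod (d : ∀ p q : ZMod 2, q = p + 1 → (X p →ₗ[k] X q))
    (hd : ∀ p q r hq hr x, d q r hr (d p q hq x) = 0) : GradedComplex.{u, v} k (ZMod 2) where
  X := X
  d i j h := d i j h.symm
  bd i := LinearMap.range (d (i + 1) i (MixedOperators.zmod_two_add_two i).symm)
  d_d _ _ _ h h' x := hd _ _ _ h.symm h'.symm x
  d_mem := by
    rintro i _ rfl x
    have h' : ∀ j (hj : j = i), d i (i + 1) rfl x ∈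
        LinearMap.range (d j (i + 1) (by rw [hj])) := by
      rintro _ rfl
      exact ⟨x, rfl⟩
    exact h' _ (MixedOperators.zmod_two_add_two i)
  of_mem_bd j x hx := .inr ⟨j + 1, MixedOperators.zmod_two_add_two j, hx⟩

/-- The Koszul sign on `ZMod 2`-graded complexes. -/
noncomputable def perSign (k : Type u) [Field k] (i : ZMod 2) : k := (-1) ^ i.val

theorem perSign_natCast (i : ℕ) : perSign k (i : ZMod 2) = (-1) ^ i := by
  rw [perSign, ZMod.val_natCast]
  exact (neg_one_pow_eq_pow_mod_two i).symm

theorem perSign_add_one (i : ZMod 2) : perSign k (i + 1) = -perSign k i := by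
  obtain ⟨n, -, rfl⟩ := MixedOperators.exists_parity i 0
  rw [← Nat.cast_one, ← Nat.cast_add, perSign_natCast, perSign_natCast, pow_succ, mul_neg_one]

theorem perSign_mul_self (i : ZMod 2) : perSign k i * perSign k i = 1 := by
  rw [perSign, ← mul_pow]
  simp

/-- The tensor product differential on `ℤ/2`-graded complexes. -/
noncomputable def tensorDifferentialZMod (d : ∀ p q : ZMod 2, q = p + 1 → (X p →ₗ[k] X q))
    (d' : ∀ p q : ZMod 2, q = p + 1 → (Y p →ₗ[k] Y q)) (n n' : ZMod 2) (h : n' = n + 1) :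
    KunnethSum k X Y n →ₗ[k] KunnethSum k X Y n' :=
  DirectSum.toModule k _ _ fun p =>
    KunnethSum.incl k X Y (p.1.1 + 1) p.1.2 (by rw [add_right_comm, p.2, h]) ∘ₗ
        (d p.1.1 _ rfl).rTensor (Y p.1.2) +
      perSign k p.1.1 • KunnethSum.incl k X Y p.1.1 (p.1.2 + 1) (by rw [← add_assoc, p.2, h]) ∘ₗ
        (d' p.1.2 _ rfl).lTensor (X p.1.1)

theorem tensorDifferentialZMod_incl {n n' : ZMod 2} (h : n' = n + 1) (p q : ZMod 2)
    (hpq : p + q = n) (x : X p) (y : Y q) :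
    tensorDifferentialZMod d d' n n' h (KunnethSum.incl k X Y p q hpq (x ⊗ₜ y)) =
      KunnethSum.incl k X Y (p + 1) q (by rw [add_right_comm, hpq, h]) (d p _ rfl x ⊗ₜ y) +
        perSign k p • KunnethSum.incl k X Y p (q + 1) (by rw [← add_assoc, hpq, h])
          (x ⊗ₜ d' q _ rfl y) := by
  simp [tensorDifferentialZMod, KunnethSum.incl]

theorem exists_kunneth_zmod (hd : ∀ p q r hq hr x, d q r hr (d p q hq x) = 0)
    (hd' : ∀ p q r hq hr x, d' q r hr (d' p q hq x) = 0) (n : ZMod 2) :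
    ∃ e : KunnethSum k
        (fun p => Cohomology (d p (p + 1) rfl)
          (LinearMap.range (d (p + 1) p (MixedOperators.zmod_two_add_two p).symm)))
        (fun p => Cohomology (d' p (p + 1) rfl)
          (LinearMap.range (d' (p + 1) p (MixedOperators.zmod_two_add_two p).symm))) n ≃ₗ[k]
        Cohomology (tensorDifferentialZMod d d' n (n + 1) rfl)
          (LinearMap.range (tensorDifferentialZMod d d' (n + 1) n (MixedOperators.zmod_two_add_two n).symm)),
      ∀ (i j : ZMod 2) (h : i + j = n) (α : X i) (β : Y j)
        (x : Cohomology (d i (i + 1) rfl)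
          (LinearMap.range (d (i + 1) i (MixedOperators.zmod_two_add_two i).symm)))
        (y : Cohomology (d' j (j + 1) rfl)
          (LinearMap.range (d' (j + 1) j (MixedOperators.zmod_two_add_two j).symm))),
        Represents α x → Represents β y →
        Represents (KunnethSum.incl k X Y i j h (α ⊗ₜ β))
          (e (KunnethSum.incl k
            (fun p => Cohomology (d p (p + 1) rfl)
              (LinearMap.range (d (p + 1) p (MixedOperators.zmod_two_add_two p).symm)))
            (fun p => Cohomology (d' p (p + 1) rfl)
              (LinearMap.range (d' (p + 1) p (MixedOperators.zmod_two_add_two p).symm))) i j h (x ⊗ₜ y))) :=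
  GradedComplex.exists_kunneth (A := .ofZMod d hd) (B := .ofZMod d' hd')
    (bd := fun n => LinearMap.range
      (tensorDifferentialZMod d d' (n + 1) n (MixedOperators.zmod_two_add_two n).symm))
    perSign_add_one perSign_mul_self
    (by
      rintro n _ rfl t
      have h : ∀ j (hj : j = n), tensorDifferentialZMod d d' n (n + 1) rfl t ∈
          LinearMap.range (tensorDifferentialZMod d d' j (n + 1) (by rw [hj])) := by
        rintro _ rfl
        exact ⟨t, rfl⟩
      exact h _ (MixedOperators.zmod_two_add_two n))
    (fun n t ht => .inr ⟨n + 1, MixedOperators.zmod_two_add_two n, ht⟩) n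

end ZModComplex

namespace MixedOperators

variable {C : MixedOperators.{u, v} k} {D : MixedOperators.{u, w} k}

theorem IsMixed.perD_perD (hC : C.IsMixed) {p q r : ZMod 2} (hq : q = p + 1) (hr : r = q + 1)
    (z : C.Per p) : C.perD q r hr (C.perD p q hq z) = 0 := by
  obtain ⟨N, hN⟩ := C.exists_totPer z
  obtain ⟨n, hn, hp⟩ := exists_parity p N
  have hq' : ((n + 1 : ℕ) : ZMod 2) = q := by rw [Nat.cast_add, hp, hq, Nat.cast_one]
  have hr' : ((n + 2 : ℕ) : ZMod 2) = r := by
    rw [hr, ← hq', Nat.cast_add, Nat.cast_add, add_assoc]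
    rfl
  rw [← hN n hn hp, perD_totPer _ hp hq hq', perD_totPer _ hq' hr hr', hC.totD_totD, map_zero]

theorem perMul_perIncl {n p q : ZMod 2} (h : p + q = n) (i j : ℕ) (hi : (i : ZMod 2) = p)
    (hj : (j : ZMod 2) = q) (x : C.X i) (y : D.X j) :
    perMul p q h (C.perIncl i hi x) (D.perIncl j hj y) =
      (C.tensor D).perIncl (i + j) (by rw [← h, Nat.cast_add, hi, hj])
        (KunnethSum.incl k C.X D.X i j rfl (x ⊗ₜ y)) := by
  simp [perMul, perIncl]

variable (C D) in
/-- The product map from the tensor product of the periodic complexes. -/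
noncomputable def perMu (n : ZMod 2) : KunnethSum k C.Per D.Per n →ₗ[k] (C.tensor D).Per n :=
  DirectSum.toModule k _ _ fun p => TensorProduct.lift (perMul p.1.1 p.1.2 p.2)

theorem perMu_incl {n : ZMod 2} (p q : ZMod 2) (h : p + q = n) (x : C.Per p) (y : D.Per q) :
    perMu C D n (KunnethSum.incl k C.Per D.Per p q h (x ⊗ₜ y)) = perMul p q h x y := by
  simp [perMu, KunnethSum.incl]

variable (C D) in
/-- The inverse of `perMu`. -/
noncomputable def perMuInv (n : ZMod 2) : (C.tensor D).Per n →ₗ[k] KunnethSum k C.Per D.Per n :=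
  DirectSum.toModule k _ _ fun m => DirectSum.toModule k _ _ fun p =>
    KunnethSum.incl k C.Per D.Per p.1.1 p.1.2 (by
      have h := m.2
      rw [← p.2, Nat.cast_add] at h
      exact h) ∘ₗ
    TensorProduct.map (C.perIncl p.1.1 rfl) (D.perIncl p.1.2 rfl)

theorem perMuInv_perIncl {n : ZMod 2} (i j m : ℕ) (hm : (m : ZMod 2) = n) (h : i + j = m)
    (x : C.X i) (y : D.X j) :
    perMuInv C D n ((C.tensor D).perIncl m hm (KunnethSum.incl k C.X D.X i j h (x ⊗ₜ y))) =
      KunnethSum.incl k C.Per D.Per (i : ZMod 2) (j : ZMod 2)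
        (by rw [← hm, ← h, Nat.cast_add]) (C.perIncl i rfl x ⊗ₜ D.perIncl j rfl y) := by
  rw [perMuInv, perIncl, DirectSum.toModule_lof, KunnethSum.incl, DirectSum.toModule_lof]
  rfl

theorem perMuInv_perMu (n : ZMod 2) (t : KunnethSum k C.Per D.Per n) :
    perMuInv C D n (perMu C D n t) = t := by
  induction t using KunnethSum.induction with
  | h0 => simp only [map_zero]
  | hadd a b ha hb => simp only [map_add, ha, hb]
  | h p q h x y =>
    rw [perMu_incl]
    induction x using Per.induction with
    | h0 => simp only [map_zero, LinearMap.zero_apply, TensorProduct.zero_tmul]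
    | hadd a b ha hb => simp only [map_add, LinearMap.add_apply, TensorProduct.add_tmul, ha, hb]
    | h i hi x =>
    induction y using Per.induction with
    | h0 => simp only [map_zero, TensorProduct.tmul_zero]
    | hadd a b ha hb => simp only [map_add, TensorProduct.tmul_add, ha, hb]
    | h j hj y =>
    cases hi
    cases hj
    rw [perMul_perIncl, perMuInv_perIncl]

theorem perMu_perMuInv (n : ZMod 2) (t : (C.tensor D).Per n) :
    perMu C D n (perMuInv C D n t) = t := by
  induction t using Per.induction with
  | h0 => simp only [map_zero]
  | hadd a b ha hb => simp only [map_add, ha, hb]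
  | h m hm t =>
    induction t using KunnethSum.induction with
    | h0 => simp only [map_zero]
    | hadd a b ha hb => simp only [map_add, ha, hb]
    | h i j h x y =>
      cases h
      rw [perMuInv_perIncl, perMu_incl, perMul_perIncl]

theorem perD_perIncl_zero {p q : ZMod 2} (hq : q = p + 1) (h : ((0 : ℕ) : ZMod 2) = p)
    (x : C.X 0) : C.perD p q hq (C.perIncl 0 h x) =
      C.perIncl 1 (by rw [hq, ← h, Nat.cast_zero, zero_add, Nat.cast_one]) (C.b 0 x) := by
  rw [perD_perIncl, perLower, LinearMap.zero_apply, add_zero]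

theorem perD_perIncl_succ {p q : ZMod 2} (hq : q = p + 1) (m : ℕ)
    (h : ((m + 1 : ℕ) : ZMod 2) = p) (x : C.X (m + 1)) :
    C.perD p q hq (C.perIncl (m + 1) h x) =
      C.perIncl (m + 2) (by rw [hq, ← h]; exact Nat.cast_add (m + 1) 1) (C.b (m + 1) x) +
        C.perIncl m (by rw [hq, ← h, Nat.cast_add, Nat.cast_one, zmod_two_add_two])
          (C.B m x) := by
  rw [perD_perIncl, perLower]
  rfl

theorem perIncl_incl_congr {m m' : ℕ} {r : ZMod 2} (hm : (m : ZMod 2) = r) (e : m = m')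
    (a b : ℕ) (hab : a + b = m) (x : C.X a) (y : D.X b) :
    (C.tensor D).perIncl m hm (KunnethSum.incl k C.X D.X a b hab (x ⊗ₜ y)) =
      (C.tensor D).perIncl m' (e ▸ hm)
        (KunnethSum.incl k C.X D.X a b (hab.trans e) (x ⊗ₜ y)) := by
  subst e
  rfl

theorem perD_perMul_perIncl (i j : ℕ) (x : C.X i) (y : D.X j) {p q r : ZMod 2}
    (hi : (i : ZMod 2) = p) (hj : (j : ZMod 2) = q) (h1 : p + 1 + q = r) (h2 : p + (q + 1) = r)
    (h3 : r = p + q + 1) :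
    perMul (p + 1) q h1 (C.perD p (p + 1) rfl (C.perIncl i hi x)) (D.perIncl j hj y) +
      perSign k p • perMul p (q + 1) h2 (C.perIncl i hi x)
        (D.perD q (q + 1) rfl (D.perIncl j hj y)) =
      (C.tensor D).perD (p + q) r h3 (perMul p q rfl (C.perIncl i hi x) (D.perIncl j hj y)) := by
  have hs : perSign k p = (-1) ^ i := by rw [← hi, perSign_natCast]
  rw [perMul_perIncl, hs]
  match i, j, x, y with
  | 0, 0, x, y =>
    rw [perD_perIncl_zero, perD_perIncl_zero, perD_perIncl_zero, perMul_perIncl,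
      perMul_perIncl, tensor_b_incl, map_add, map_smul]
  | 0, j + 1, x, y =>
    rw [perD_perIncl_zero, perD_perIncl_succ]
    rw [perIncl_incl_congr _ (show 0 + (j + 1) = j + 1 by omega), perD_perIncl_succ, map_add, perMul_perIncl,
      perMul_perIncl, perMul_perIncl, tensor_b_incl, tensor_B_zero_succ, map_add, map_smul,
      perIncl_incl_congr _ (show 0 + 1 + (j + 1) = j + 1 + 1 by omega),
      perIncl_incl_congr _ (show 0 + (j + 2) = j + 1 + 1 by omega), perIncl_incl_congr _ (show 0 + j = j by omega)]
    module
  | i + 1, 0, x, y =>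
    rw [perD_perIncl_zero, perD_perIncl_succ]
    rw [perIncl_incl_congr _ (show i + 1 + 0 = i + 1 by omega), perD_perIncl_succ, map_add,
      LinearMap.add_apply, perMul_perIncl,
      perMul_perIncl, perMul_perIncl, tensor_b_incl, tensor_B_succ_zero, map_add, map_smul]
    rw [add_right_comm]
    rfl
  | i + 1, j + 1, x, y =>
    rw [perD_perIncl_succ, perD_perIncl_succ]
    rw [perIncl_incl_congr _ (show i + 1 + (j + 1) = i + j + 1 + 1 by omega), perD_perIncl_succ, map_add,
      map_add, LinearMap.add_apply, perMul_perIncl, perMul_perIncl,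
      perMul_perIncl, perMul_perIncl, tensor_b_incl, tensor_B_succ_succ, map_add, map_smul,
      map_add, map_smul,
      perIncl_incl_congr _ (show i + 2 + (j + 1) = i + j + 1 + 2 by omega),
      perIncl_incl_congr _ (show i + 1 + (j + 2) = i + j + 1 + 2 by omega),
      perIncl_incl_congr _ (show i + (j + 1) = i + j + 1 by omega),
      perIncl_incl_congr _ (show i + 1 + j = i + j + 1 by omega)]
    module

theorem perD_perMul (p q : ZMod 2) (x : C.Per p) (y : D.Per q) {r : ZMod 2}
    (h1 : p + 1 + q = r) (h2 : p + (q + 1) = r) (h3 : r = p + q + 1) :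
    perMul (p + 1) q h1 (C.perD p (p + 1) rfl x) y +
      perSign k p • perMul p (q + 1) h2 x (D.perD q (q + 1) rfl y) =
      (C.tensor D).perD (p + q) r h3 (perMul p q rfl x y) := by
  induction x using Per.induction with
  | h0 => simp only [map_zero, LinearMap.zero_apply, smul_zero, add_zero]
  | hadd a b ha hb =>
    simp only [map_add, LinearMap.add_apply, smul_add]
    rw [← ha, ← hb, add_add_add_comm]
  | h i hi x =>
  induction y using Per.induction with
  | h0 => simp only [map_zero, LinearMap.zero_apply, smul_zero, add_zero]
  | hadd a b ha hb =>
    simp only [map_add, LinearMap.add_apply, smul_add]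
    rw [← ha, ← hb, add_add_add_comm]
  | h j hj y => exact perD_perMul_perIncl i j x y hi hj h1 h2 h3

theorem perMu_tensorDifferential {n n' : ZMod 2} (h : n' = n + 1)
    (t : KunnethSum k C.Per D.Per n) :
    perMu C D n' (tensorDifferentialZMod C.perD D.perD n n' h t) =
      (C.tensor D).perD n n' h (perMu C D n t) := by
  subst h
  induction t using KunnethSum.induction with
  | h0 => simp only [map_zero]
  | hadd a b ha hb => simp only [map_add, ha, hb]
  | h p q h x y =>
    cases h
    rw [tensorDifferentialZMod_incl, map_add, map_smul, perMu_incl, perMu_incl, perMu_incl]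
    exact perD_perMul p q x y _ _ rfl

theorem perMu_injective (n : ZMod 2) : Function.Injective (perMu C D n) :=
  Function.LeftInverse.injective (perMuInv_perMu n)

/-- The isomorphism on cohomology induced by `perMu`. -/
noncomputable def perMuEquiv (C : MixedOperators.{u, v} k) (D : MixedOperators.{u, w} k)
    (p : ZMod 2) : Cohomology (tensorDifferentialZMod C.perD D.perD p (p + 1) rfl)
      (LinearMap.range (tensorDifferentialZMod C.perD D.perD (p + 1) p
        (zmod_two_add_two p).symm)) ≃ₗ[k] (C.tensor D).HP p :=
  Cohomology.equiv (perMu C D p)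
    (fun x hx => by rw [← perMu_tensorDifferential, hx, map_zero])
    (fun _ ⟨y, hy⟩ => ⟨perMu C D (p + 1) y, by rw [← hy, perMu_tensorDifferential]⟩)
    (fun x hx ⟨y, hy⟩ => ⟨perMuInv C D _ y, perMu_injective _ (by
      rw [perMu_tensorDifferential, perMu_perMuInv, hy])⟩)
    (fun y hy => ⟨perMuInv C D p y, perMu_injective _ (by
      rw [perMu_tensorDifferential, perMu_perMuInv, hy, map_zero]), by
        rw [perMu_perMuInv, sub_self]
        exact Submodule.zero_mem _⟩)

theorem represents_perMuEquiv {p : ZMod 2} {z : KunnethSum k C.Per D.Per p}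
    {x : Cohomology (tensorDifferentialZMod C.perD D.perD p (p + 1) rfl)
      (LinearMap.range (tensorDifferentialZMod C.perD D.perD (p + 1) p
        (zmod_two_add_two p).symm))} (hz : Represents z x) :
    Represents (perMu C D p z) (perMuEquiv C D p x) := hz.equiv

/-- The Künneth isomorphism for periodic cyclic cohomology. -/
theorem exists_kunneth_per (hC : C.IsMixed) (hD : D.IsMixed) (p : ZMod 2) :
    ∃ e : KunnethSum k C.HP D.HP p ≃ₗ[k] (C.tensor D).HP p,
      ∀ (i j : ZMod 2) (h : i + j = p) (α : C.Per i) (β : D.Per j) (x : C.HP i) (y : D.HP j),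
        Represents α x → Represents β y →
        Represents (perMul i j h α β) (e (KunnethSum.incl k C.HP D.HP i j h (x ⊗ₜ y))) := by
  obtain ⟨e, he⟩ := exists_kunneth_zmod (d := C.perD) (d' := D.perD)
    (fun p q r hq hr x => hC.perD_perD hq hr x) (fun p q r hq hr x => hD.perD_perD hq hr x) p
  refine ⟨e ≪≫ₗ perMuEquiv C D p, fun i j h α β x y hα hβ => ?_⟩
  have h1 := represents_perMuEquiv (he i j h α β x y hα hβ)
  rw [perMu_incl] at h1
  exact h1

end MixedOperators


variable {k : Type u} [Field k]

section DegreeTwoSequence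

variable {A : ℕ → Type v} [∀ n, AddCommGroup (A n)] [∀ n, Module k (A n)]
  {T : ℕ → Type w} [∀ n, AddCommGroup (T n)] [∀ n, Module k (T n)]

/-- A degreewise split short exact sequence of cochain complexes
`0 → Aⁿ⁻² → Aⁿ → Tⁿ → 0`, where the terms of negative degree vanish. -/
structure DegreeTwoSequence (dA : ∀ n, A n →ₗ[k] A (n + 1)) (dT : ∀ n, T n →ₗ[k] T (n + 1)) where
  s : ∀ n, A n →ₗ[k] A (n + 2)
  μ : ∀ n, A n →ₗ[k] T n
  ρ : ∀ n, A (n + 2) →ₗ[k] A n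
  sec : ∀ n, T n →ₗ[k] A n
  dA_dA : ∀ n x, dA (n + 1) (dA n x) = 0
  s_dA : ∀ n x, dA (n + 2) (s n x) = s (n + 1) (dA n x)
  μ_dA : ∀ n x, μ (n + 1) (dA n x) = dT n (μ n x)
  ρ_s : ∀ n x, ρ n (s n x) = x
  s_ρ : ∀ n x, s n (ρ n x) + sec (n + 2) (μ (n + 2) x) = x
  μ_sec : ∀ n x, μ n (sec n x) = x
  sec_μ : ∀ n, n < 2 → ∀ x, sec n (μ n x) = x

namespace DegreeTwoSequence

variable {dA : ∀ n, A n →ₗ[k] A (n + 1)} {dT : ∀ n, T n →ₗ[k] T (n + 1)}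
  (E : DegreeTwoSequence dA dT)

theorem s_injective (n : ℕ) : Function.Injective (E.s n) :=
  Function.LeftInverse.injective (E.ρ_s n)

theorem μ_s (n : ℕ) (x : A n) : E.μ (n + 2) (E.s n x) = 0 := by
  have h := E.s_ρ n (E.s n x)
  rw [E.ρ_s, add_eq_left] at h
  rw [← E.μ_sec _ (E.μ (n + 2) (E.s n x)), h, map_zero]

theorem s_ρ_of_μ {n : ℕ} {x : A (n + 2)} (hx : E.μ (n + 2) x = 0) : E.s n (E.ρ n x) = x := by
  simpa [hx] using E.s_ρ n x

theorem eq_zero_of_μ {n : ℕ} (hn : n < 2) {x : A n} (hx : E.μ n x = 0) : x = 0 := by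
  rw [← E.sec_μ n hn x, hx, map_zero]

theorem s_mem {n : ℕ} {x : A n} (hx : x ∈ coboundaries dA n) :
    E.s n x ∈ coboundaries dA (n + 2) := by
  cases n with
  | zero =>
    obtain rfl : x = 0 := hx
    rw [map_zero]
    exact Submodule.zero_mem _
  | succ n =>
    obtain ⟨y, rfl⟩ := hx
    exact ⟨E.s n y, E.s_dA n y⟩

/-- The cochain level connecting map. -/
def con (n : ℕ) : T (n + 1) →ₗ[k] A n := E.ρ n ∘ₗ dA (n + 1) ∘ₗ E.sec (n + 1)

theorem s_con {n : ℕ} {t : T (n + 1)} (ht : dT (n + 1) t = 0) :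
    E.s n (E.con n t) = dA (n + 1) (E.sec (n + 1) t) :=
  E.s_ρ_of_μ (x := dA (n + 1) (E.sec (n + 1) t)) (by rw [E.μ_dA, E.μ_sec, ht])

theorem dA_con {n : ℕ} {t : T (n + 1)} (ht : dT (n + 1) t = 0) : dA n (E.con n t) = 0 :=
  E.s_injective _ (by rw [← E.s_dA, E.s_con ht, E.dA_dA, map_zero])

theorem con_μ {n : ℕ} {c : A n} {t : A (n + 1)} (h : dA (n + 1) t = E.s n c) :
    c - E.con n (E.μ (n + 1) t) ∈ coboundaries dA n := by
  have ht : dT (n + 1) (E.μ (n + 1) t) = 0 := by rw [← E.μ_dA, h, E.μ_s]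
  have h1 := E.s_con ht
  cases n with
  | zero =>
    rw [E.sec_μ 1 (by omega), h] at h1
    rw [E.s_injective _ h1, sub_self]
    exact Submodule.zero_mem _
  | succ n =>
    refine ⟨E.ρ n t, E.s_injective _ ?_⟩
    rw [map_sub, h1, ← h, ← map_sub, ← E.s_dA]
    congr 1
    rw [eq_sub_iff_add_eq]
    exact E.s_ρ n t

theorem con_mem {n : ℕ} {t : T (n + 1)} (ht : t ∈ coboundaries dT (n + 1)) :
    E.con n t ∈ coboundaries dA n := by
  obtain ⟨y, rfl⟩ := ht
  have h := E.con_μ (c := 0) (t := dA n (E.sec n y)) (by rw [E.dA_dA, map_zero])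
  rw [E.μ_dA, E.μ_sec, zero_sub] at h
  exact neg_mem_iff.1 h

/-- The map on cohomology induced by `s`. -/
def sH (n : ℕ) : Cohomology (dA n) (coboundaries dA n) →ₗ[k]
    Cohomology (dA (n + 2)) (coboundaries dA (n + 2)) :=
  Cohomology.map (E.s n) (fun x hx => by rw [E.s_dA, hx, map_zero]) fun _ hx => E.s_mem hx

/-- The map on cohomology induced by `μ`. -/
def μH (n : ℕ) : Cohomology (dA n) (coboundaries dA n) →ₗ[k]
    Cohomology (dT n) (coboundaries dT n) :=
  Cohomology.map (E.μ n) (fun x hx => by rw [← E.μ_dA, hx, map_zero])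
    fun _ hx => MixedOperators.map_mem_coboundaries E.μ_dA hx

/-- The connecting homomorphism. -/
def bdH (n : ℕ) : Cohomology (dT (n + 1)) (coboundaries dT (n + 1)) →ₗ[k]
    Cohomology (dA n) (coboundaries dA n) :=
  Cohomology.map (E.con n) (fun _ hx => E.dA_con hx) fun _ hx => E.con_mem hx

theorem represents_sH {n : ℕ} {z : A n} {x : Cohomology (dA n) (coboundaries dA n)}
    (h : Represents z x) : Represents (E.s n z) (E.sH n x) := h.map

theorem represents_μH {n : ℕ} {z : A n} {x : Cohomology (dA n) (coboundaries dA n)}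
    (h : Represents z x) : Represents (E.μ n z) (E.μH n x) := h.map

theorem represents_bdH {n : ℕ} {z : T (n + 1)}
    {x : Cohomology (dT (n + 1)) (coboundaries dT (n + 1))}
    (h : Represents z x) : Represents (E.con n z) (E.bdH n x) := h.map

theorem μH_injective {n : ℕ} (hn : n < 2) : Function.Injective (E.μH n) := by
  rw [← LinearMap.ker_eq_bot, LinearMap.ker_eq_bot']
  intro x hx
  obtain ⟨z, hz⟩ := exists_represents x
  have h1 := (E.represents_μH hz).eq_zero_iff.1 hx
  rw [hz.eq_zero_iff]
  match n, hn, z, h1 with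
  | 0, _, z, h1 => exact E.eq_zero_of_μ (by omega) h1
  | 1, _, z, ⟨y, hy⟩ =>
    refine ⟨E.sec 0 y, ?_⟩
    rw [← sub_eq_zero]
    refine E.eq_zero_of_μ (n := 1) (by omega) ?_
    rw [map_sub, E.μ_dA, E.μ_sec, hy, sub_self]

theorem μH_zero_surjective : Function.Surjective (E.μH 0) := by
  intro y
  obtain ⟨z, hz⟩ := exists_represents y
  have h : dA 0 (E.sec 0 z) = 0 :=
    E.eq_zero_of_μ (n := 1) (by omega) (by rw [E.μ_dA, E.μ_sec, hz.ker])
  refine ⟨Cohomology.mk _ _ _ h, ?_⟩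
  have h1 := E.represents_μH (represents_mk (P := coboundaries dA 0) _ h)
  rw [E.μ_sec] at h1
  exact h1.eq hz

theorem exact_sH_μH (n : ℕ) : Function.Exact (E.sH n) (E.μH (n + 2)) := by
  intro x
  constructor
  · intro hx
    obtain ⟨z, hz⟩ := exists_represents x
    obtain ⟨y, hy⟩ := (E.represents_μH hz).eq_zero_iff.1 hx
    have h1 : E.μ (n + 2) (z - dA (n + 1) (E.sec (n + 1) y)) = 0 := by
      rw [map_sub, E.μ_dA, E.μ_sec, hy, sub_self]
    have h2 := E.s_ρ_of_μ h1
    have h3 : dA n (E.ρ n (z - dA (n + 1) (E.sec (n + 1) y))) = 0 :=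
      E.s_injective _ (by rw [← E.s_dA, h2, map_sub, E.dA_dA, hz.ker, sub_zero, map_zero])
    refine ⟨Cohomology.mk _ _ _ h3, ?_⟩
    have h4 := E.represents_sH (represents_mk (P := coboundaries dA n) _ h3)
    rw [h2] at h4
    refine ((hz.eq_iff h4).2 ?_).symm
    rw [sub_sub_cancel]
    exact ⟨_, rfl⟩
  · rintro ⟨y, rfl⟩
    obtain ⟨z, hz⟩ := exists_represents y
    have h := E.represents_μH (E.represents_sH hz)
    rw [E.μ_s] at h
    exact h.eq represents_zero

theorem exact_μH_bdH (n : ℕ) : Function.Exact (E.μH (n + 1)) (E.bdH n) := by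
  intro x
  constructor
  · intro hx
    obtain ⟨z, hz⟩ := exists_represents x
    have h1 := (E.represents_bdH hz).eq_zero_iff.1 hx
    have h2 := E.s_con hz.ker
    have h3 : ∃ a, dA (n + 1) a = 0 ∧ E.μ (n + 1) a = z := by
      match n, z, h1, h2 with
      | 0, z, h1, h2 =>
        refine ⟨E.sec 1 z, ?_, E.μ_sec 1 z⟩
        rw [← h2, show E.con 0 z = 0 from h1, map_zero]
      | n + 1, z, ⟨w, hw⟩, h2 =>
        refine ⟨E.sec (n + 2) z - E.s n w, ?_, ?_⟩
        · rw [map_sub, E.s_dA, hw, h2, sub_self]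
        · rw [map_sub, E.μ_s, E.μ_sec, sub_zero]
    obtain ⟨a, ha, rfl⟩ := h3
    exact ⟨Cohomology.mk _ _ _ ha,
      (E.represents_μH (represents_mk (P := coboundaries dA (n + 1)) _ ha)).eq hz⟩
  · rintro ⟨y, rfl⟩
    obtain ⟨z, hz⟩ := exists_represents y
    have h := E.represents_bdH (E.represents_μH hz)
    rw [h.eq_zero_iff]
    have h1 := E.con_μ (c := 0) (t := z) (by rw [hz.ker, map_zero])
    rw [zero_sub] at h1
    exact neg_mem_iff.1 h1

theorem exact_bdH_sH (n : ℕ) : Function.Exact (E.bdH n) (E.sH n) := by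
  intro x
  constructor
  · intro hx
    obtain ⟨z, hz⟩ := exists_represents x
    obtain ⟨t, ht⟩ := (E.represents_sH hz).eq_zero_iff.1 hx
    have h1 : dT (n + 1) (E.μ (n + 1) t) = 0 := by rw [← E.μ_dA, ht, E.μ_s]
    refine ⟨Cohomology.mk _ _ _ h1, ?_⟩
    exact ((hz.eq_iff (E.represents_bdH (represents_mk _ h1))).2 (E.con_μ ht)).symm
  · rintro ⟨y, rfl⟩
    obtain ⟨z, hz⟩ := exists_represents y
    have h := E.represents_sH (E.represents_bdH hz)
    rw [h.eq_zero_iff, E.s_con hz.ker]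
    exact ⟨_, rfl⟩

theorem bdH_of_dA {n : ℕ} {c : A n} {t : A (n + 1)} {x : Cohomology (dA n) (coboundaries dA n)}
    (hc : Represents c x) (h : dA (n + 1) t = E.s n c) :
    ∃ y, Represents (E.μ (n + 1) t) y ∧ E.bdH n y = x := by
  have h1 : dT (n + 1) (E.μ (n + 1) t) = 0 := by rw [← E.μ_dA, h, E.μ_s]
  refine ⟨Cohomology.mk _ _ _ h1, represents_mk _ h1, ?_⟩
  exact ((hc.eq_iff (E.represents_bdH (represents_mk _ h1))).2 (E.con_μ h)).symm

end DegreeTwoSequence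

end DegreeTwoSequence

namespace MixedOperators

variable {C : MixedOperators.{u, v} k} {D : MixedOperators.{u, w} k}

theorem kunnethTot_induction {n : ℕ} {P : KunnethSum k C.Tot D.Tot n → Prop}
    (t : KunnethSum k C.Tot D.Tot n) (h0 : P 0) (hadd : ∀ s t, P s → P t → P (s + t))
    (h : ∀ b a i j r s (hr : 2 * a + i = r) (hs : 2 * b + j = s) (hrs : r + s = n) (x : C.X i)
      (y : D.X j), P (KunnethSum.incl k C.Tot D.Tot r s hrs
        (C.totIncl a i hr x ⊗ₜ D.totIncl b j hs y))) : P t := by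
  induction t using KunnethSum.induction with
  | h0 => exact h0
  | hadd a b ha hb => exact hadd _ _ ha hb
  | h r s hrs x y =>
    induction x using Tot.induction with
    | h0 => simpa using h0
    | hadd a b ha hb =>
      rw [TensorProduct.add_tmul, map_add]
      exact hadd _ _ ha hb
    | h a i hr x =>
    induction y using Tot.induction with
    | h0 => simpa using h0
    | hadd a b ha hb =>
      rw [TensorProduct.tmul_add, map_add]
      exact hadd _ _ ha hb
    | h b j hs y => exact h b a i j r s hr hs hrs x y

theorem totMul_totIncl {n r s : ℕ} (h : r + s = n) (a i b j : ℕ) (hr : 2 * a + i = r)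
    (hs : 2 * b + j = s) (x : C.X i) (y : D.X j) :
    totMul r s h (C.totIncl a i hr x) (D.totIncl b j hs y) =
      (C.tensor D).totIncl (a + b) (i + j) (by omega)
        (KunnethSum.incl k C.X D.X i j rfl (x ⊗ₜ y)) := by
  simp [totMul, totIncl]

theorem totMu_incl {n r s : ℕ} (h : r + s = n) (x : C.Tot r) (y : D.Tot s) :
    totMu C D n (KunnethSum.incl k C.Tot D.Tot r s h (x ⊗ₜ y)) = totMul r s h x y := by
  simp [totMu, KunnethSum.incl]

theorem tensor_totIncl_congr {n a a' m m' : ℕ} (e : m = m') (e' : a = a') (hm : 2 * a + m = n)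
    (i j : ℕ) (hij : i + j = m) (x : C.X i) (y : D.X j) :
    (C.tensor D).totIncl a m hm (KunnethSum.incl k C.X D.X i j hij (x ⊗ₜ y)) =
      (C.tensor D).totIncl a' m' (by omega)
        (KunnethSum.incl k C.X D.X i j (hij.trans e) (x ⊗ₜ y)) := by
  subst e e'
  rfl

theorem totMu_generator {n r s a i b j c m : ℕ} (h : r + s = n) (hr : 2 * a + i = r)
    (hs : 2 * b + j = s) (x : C.X i) (y : D.X j) (hc : a + b = c) (hm : i + j = m) :
    totMu C D n (KunnethSum.incl k C.Tot D.Tot r s h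
      (C.totIncl a i hr x ⊗ₜ D.totIncl b j hs y)) =
      (C.tensor D).totIncl c m (by omega) (KunnethSum.incl k C.X D.X i j hm (x ⊗ₜ y)) := by
  rw [totMu_incl, totMul_totIncl, tensor_totIncl_congr hm hc]

theorem totMu_tensorDifferential (n : ℕ) (t : KunnethSum k C.Tot D.Tot n) :
    totMu C D (n + 1) (tensorDifferential C.totD D.totD n t) =
      (C.tensor D).totD n (totMu C D n t) := by
  induction t using kunnethTot_induction with
  | h0 => simp only [map_zero]
  | hadd a b ha hb => simp only [map_add, ha, hb]
  | h b a i j r s hr hs hrs x y =>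
    have e : (-1 : k) ^ r = (-1) ^ i := by rw [← hr, pow_add, pow_mul]; simp
    rw [tensorDifferential_incl, map_add, map_smul, e]
    match i, j, x, y with
    | 0, 0, x, y =>
      rw [totD_totIncl_zero, totD_totIncl_zero, totMu_generator _ _ _ _ _ rfl rfl,
        totMu_generator _ _ _ _ _ rfl rfl, totMu_generator _ _ _ _ _ rfl rfl, totD_totIncl_zero,
        tensor_b_incl, map_add, map_smul]
    | 0, j + 1, x, y =>
      rw [totD_totIncl_zero, totD_totIncl_succ, TensorProduct.tmul_add, map_add, map_add,
        totMu_generator _ _ _ _ _ rfl (zero_add (j + 1)), totD_totIncl_succ,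
        totMu_generator _ _ _ _ _ rfl (show 0 + 1 + (j + 1) = j + 2 by omega),
        totMu_generator _ _ _ _ _ rfl (show 0 + (j + 2) = j + 2 by omega),
        totMu_generator _ _ _ _ _ (add_assoc a b 1).symm (zero_add j), tensor_b_incl,
        tensor_B_zero_succ, map_add, map_smul]
      module
    | i + 1, 0, x, y =>
      rw [totD_totIncl_zero, totD_totIncl_succ, TensorProduct.add_tmul, map_add, map_add,
        totMu_generator _ _ _ _ _ rfl (add_zero (i + 1)), totD_totIncl_succ,
        totMu_generator _ _ _ _ _ rfl (show i + 2 + 0 = i + 2 by omega),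
        totMu_generator _ _ _ _ _ rfl (show i + 1 + 1 = i + 2 by omega),
        totMu_generator _ _ _ _ _ (add_right_comm a 1 b) (add_zero i), tensor_b_incl,
        tensor_B_succ_zero, map_add, map_smul]
      rw [add_right_comm]
    | i + 1, j + 1, x, y =>
      rw [totD_totIncl_succ, totD_totIncl_succ, TensorProduct.add_tmul, TensorProduct.tmul_add,
        map_add, map_add, map_add, map_add,
        totMu_generator _ _ _ _ _ rfl (show i + 1 + (j + 1) = i + j + 1 + 1 by omega),
        totD_totIncl_succ,
        totMu_generator _ _ _ _ _ rfl (show i + 2 + (j + 1) = i + j + 1 + 2 by omega),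
        totMu_generator _ _ _ _ _ rfl (show i + 1 + (j + 2) = i + j + 1 + 2 by omega),
        totMu_generator _ _ _ _ _ (add_right_comm a 1 b)
          (show i + (j + 1) = i + j + 1 by omega),
        totMu_generator _ _ _ _ _ (add_assoc a b 1).symm
          (show i + 1 + j = i + j + 1 by omega), tensor_b_incl,
        tensor_B_succ_succ, map_add, map_smul, map_add, map_smul]
      module

end MixedOperators


variable {k : Type u} [Field k]

theorem differenceS_incl {X : ℕ → Type*} [∀ n, AddCommGroup (X n)] [∀ n, Module k (X n)]
    {Y : ℕ → Type*} [∀ n, AddCommGroup (Y n)] [∀ n, Module k (Y n)]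
    (s : ∀ n, X n →ₗ[k] X (n + 2)) (s' : ∀ n, Y n →ₗ[k] Y (n + 2)) {n : ℕ} (i j : ℕ)
    (h : i + j = n) (x : X i) (y : Y j) :
    differenceS s s' n (KunnethSum.incl k X Y i j h (x ⊗ₜ y)) =
      KunnethSum.incl k X Y (i + 2) j (by omega) (s i x ⊗ₜ y) -
        KunnethSum.incl k X Y i (j + 2) (by omega) (x ⊗ₜ s' j y) := by
  simp [differenceS, KunnethSum.incl]

section LongExactSequence

section ExactTransfer

variable {V V' A A' B : Type*} [AddCommGroup V] [Module k V] [AddCommGroup V'] [Module k V']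
  [AddCommGroup A] [Module k A] [AddCommGroup A'] [Module k A'] [AddCommGroup B] [Module k B]

theorem exact_comp_equiv_of_comm {f : A →ₗ[k] A'} {g : A' →ₗ[k] B} (h : Function.Exact f g)
    (e : V ≃ₗ[k] A) (e' : V' ≃ₗ[k] A') {s : V →ₗ[k] V'} (comm : ∀ x, e' (s x) = f (e x)) :
    Function.Exact s (g ∘ₗ e'.toLinearMap) := by
  intro x
  refine (h (e' x)).trans ⟨?_, ?_⟩
  · rintro ⟨y, hy⟩
    exact ⟨e.symm y, e'.injective (by rw [comm, LinearEquiv.apply_symm_apply, hy])⟩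
  · rintro ⟨y, rfl⟩
    exact ⟨e y, (comm y).symm⟩

theorem exact_comp_equiv_symm_comp {f : A →ₗ[k] B} {g : B →ₗ[k] A'} (h : Function.Exact f g)
    (e : V ≃ₗ[k] A) (e' : V' ≃ₗ[k] A') :
    Function.Exact (f ∘ₗ e.toLinearMap) (e'.symm.toLinearMap ∘ₗ g) := by
  intro x
  refine Iff.trans (e'.symm.map_eq_zero_iff) ((h x).trans ⟨?_, ?_⟩)
  · rintro ⟨y, hy⟩
    exact ⟨e.symm y, by simp [hy]⟩
  · rintro ⟨y, rfl⟩
    exact ⟨_, rfl⟩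

theorem exact_symm_comp_of_comm {f : B →ₗ[k] A} {g : A →ₗ[k] A'} (h : Function.Exact f g)
    (e : V ≃ₗ[k] A) (e' : V' ≃ₗ[k] A') {s : V →ₗ[k] V'} (comm : ∀ x, e' (s x) = g (e x)) :
    Function.Exact (e.symm.toLinearMap ∘ₗ f) s := by
  intro x
  rw [← e'.map_eq_zero_iff, comm]
  refine (h (e x)).trans ⟨?_, ?_⟩
  · rintro ⟨y, hy⟩
    exact ⟨y, by simp [hy]⟩
  · rintro ⟨y, rfl⟩
    exact ⟨y, by simp⟩

end ExactTransfer

/-- The cohomology of a cochain complex concentrated in degrees `≥ 0`. -/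
abbrev CochainH {X : ℕ → Type v} [∀ n, AddCommGroup (X n)] [∀ n, Module k (X n)]
    (d : ∀ n, X n →ₗ[k] X (n + 1)) (n : ℕ) : Type v := Cohomology (d n) (coboundaries d n)

set_option maxHeartbeats 1000000 in
/-- The long exact cohomology sequence of
`0 → (X ⊗ Y)ⁿ⁻² → (X ⊗ Y)ⁿ → Tⁿ → 0`, with Künneth sums of cohomology groups. -/
theorem DegreeTwoSequence.exists_exact_sequence
    {X : ℕ → Type v} [∀ n, AddCommGroup (X n)] [∀ n, Module k (X n)]
    {Y : ℕ → Type w} [∀ n, AddCommGroup (Y n)] [∀ n, Module k (Y n)]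
    {T : ℕ → Type w'} [∀ n, AddCommGroup (T n)] [∀ n, Module k (T n)]
    {dX : ∀ n, X n →ₗ[k] X (n + 1)} {dY : ∀ n, Y n →ₗ[k] Y (n + 1)}
    {dT : ∀ n, T n →ₗ[k] T (n + 1)} (E : DegreeTwoSequence (tensorDifferential dX dY) dT)
    {sX : ∀ n, X n →ₗ[k] X (n + 2)} {sY : ∀ n, Y n →ₗ[k] Y (n + 2)}
    (hE : ∀ n, E.s n = differenceS sX sY n)
    (hX : ∀ n x, dX (n + 1) (dX n x) = 0) (hY : ∀ n x, dY (n + 1) (dY n x) = 0)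
    {SX : ∀ n, CochainH dX n →ₗ[k] CochainH dX (n + 2)}
    {SY : ∀ n, CochainH dY n →ₗ[k] CochainH dY (n + 2)}
    (hSX : ∀ n z (x : CochainH dX n), Represents z x → Represents (sX n z) (SX n x))
    (hSY : ∀ n z (x : CochainH dY n), Represents z x → Represents (sY n z) (SY n x)) :
    ∃ (μ : ∀ n : ℕ, KunnethSum k (CochainH dX) (CochainH dY) n →ₗ[k] CochainH dT n)
      (bd : ∀ n : ℕ, CochainH dT (n + 1) →ₗ[k] KunnethSum k (CochainH dX) (CochainH dY) n),
      (∀ (n i j : ℕ) (h : i + j = n) (α : X i) (β : Y j) (x : CochainH dX i) (y : CochainH dY j),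
        Represents α x → Represents β y →
        Represents (E.μ n (KunnethSum.incl k X Y i j h (α ⊗ₜ β)))
          (μ n (KunnethSum.incl k (CochainH dX) (CochainH dY) i j h (x ⊗ₜ[k] y)))) ∧
      (∀ (n : ℕ) (c : KunnethSum k (fun i => LinearMap.ker (dX i))
          (fun j => LinearMap.ker (dY j)) n) (t : KunnethSum k X Y (n + 1)),
        tensorDifferential dX dY (n + 1) t = differenceS sX sY n
          (KunnethSum.map (fun i => (LinearMap.ker (dX i)).subtype)
            (fun j => (LinearMap.ker (dY j)).subtype) n c) →
        ∃ y : CochainH dT (n + 1), Represents (E.μ (n + 1) t) y ∧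
          bd n y = KunnethSum.map (X' := CochainH dX) (Y' := CochainH dY)
            (fun _ => Submodule.mkQ _) (fun _ => Submodule.mkQ _) n c) ∧
      Function.Bijective (μ 0) ∧ Function.Injective (μ 1) ∧
      (∀ n : ℕ, Function.Exact (differenceS SX SY n) (μ (n + 2))) ∧
      (∀ n : ℕ, Function.Exact (μ (n + 1)) (bd n)) ∧
      (∀ n : ℕ, Function.Exact (bd n) (differenceS SX SY n)) := by
  have hκ := fun n => exists_kunneth_nat hX hY n
  choose κ hκ using hκ
  have comm : ∀ (n : ℕ) (c : KunnethSum k (CochainH dX) (CochainH dY) n),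
      κ (n + 2) (differenceS SX SY n c) = E.sH n (κ n c) := by
    intro n c
    induction c using KunnethSum.induction with
    | h0 => simp only [map_zero]
    | hadd a b ha hb => simp only [map_add, ha, hb]
    | h i j h x y =>
      obtain ⟨α, hα⟩ := exists_represents x
      obtain ⟨β, hβ⟩ := exists_represents y
      have h1 := E.represents_sH (hκ n i j h α β x y hα hβ)
      rw [hE, differenceS_incl] at h1
      have h2 := (hκ (n + 2) (i + 2) j (by omega) _ _ _ _ (hSX _ _ _ hα) hβ).sub
        (hκ (n + 2) i (j + 2) (by omega) _ _ _ _ hα (hSY _ _ _ hβ))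
      rw [differenceS_incl, map_sub]
      exact h2.eq h1
  have hker : ∀ (n : ℕ) (c : KunnethSum k (fun i => LinearMap.ker (dX i))
      (fun j => LinearMap.ker (dY j)) n),
      Represents (KunnethSum.map (fun i => (LinearMap.ker (dX i)).subtype)
        (fun j => (LinearMap.ker (dY j)).subtype) n c)
        (κ n (KunnethSum.map (X' := CochainH dX) (Y' := CochainH dY)
          (fun _ => Submodule.mkQ _) (fun _ => Submodule.mkQ _) n c)) := by
    intro n c
    induction c using KunnethSum.induction with
    | h0 =>
      simp only [map_zero]
      exact represents_zero
    | hadd a b ha hb =>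
      simp only [map_add]
      exact ha.add hb
    | h i j h x y =>
      rw [KunnethSum.map_incl, KunnethSum.map_incl, TensorProduct.map_tmul,
        TensorProduct.map_tmul]
      exact hκ n i j h _ _ _ _ ⟨x.2, rfl⟩ ⟨y.2, rfl⟩
  refine ⟨fun n => E.μH n ∘ₗ (κ n).toLinearMap, fun n => (κ n).symm.toLinearMap ∘ₗ E.bdH n,
    ?_, ?_, ?_, ?_, ?_, ?_, ?_⟩
  · intro n i j h α β x y hα hβ
    have h1 := E.represents_μH (hκ n i j h α β x y hα hβ)
    exact h1
  · intro n c t ht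
    obtain ⟨y, hy, hy'⟩ := E.bdH_of_dA (hker n c) (ht.trans (LinearMap.congr_fun (hE n) _).symm)
    refine ⟨y, hy, ?_⟩
    rw [LinearMap.comp_apply, hy']
    exact (κ n).symm_apply_apply _
  · exact ⟨(E.μH_injective (by omega)).comp (κ 0).injective,
      E.μH_zero_surjective.comp (κ 0).surjective⟩
  · exact (E.μH_injective (by omega)).comp (κ 1).injective
  · exact fun n => exact_comp_equiv_of_comm (E.exact_sH_μH n) (κ n) (κ (n + 2)) (comm n)
  · exact fun n => exact_comp_equiv_symm_comp (E.exact_μH_bdH n) (κ (n + 1)) (κ n)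
  · exact fun n => exact_symm_comp_of_comm (E.exact_bdH_sH n) (κ n) (κ (n + 2)) (comm n)

end LongExactSequence

namespace MixedOperators

section Splitting

variable (C : MixedOperators.{u, v} k) (D : MixedOperators.{u, w} k)

/-- `uᵃ x ⊗ uᵇ y`, linearly in `x ⊗ y`. -/
noncomputable def totTensor {n : ℕ} (a i b j : ℕ) (h : 2 * a + i + (2 * b + j) = n) :
    C.X i ⊗[k] D.X j →ₗ[k] KunnethSum k C.Tot D.Tot n :=
  KunnethSum.incl k C.Tot D.Tot (2 * a + i) (2 * b + j) h ∘ₗ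
    TensorProduct.map (C.totIncl a i rfl) (D.totIncl b j rfl)

variable {C D} in
theorem totTensor_tmul {n r s a i b j : ℕ} (h : 2 * a + i + (2 * b + j) = n)
    (hr : 2 * a + i = r) (hs : 2 * b + j = s) (x : C.X i) (y : D.X j) :
    totTensor C D a i b j h (x ⊗ₜ y) = KunnethSum.incl k C.Tot D.Tot r s (by omega)
      (C.totIncl a i hr x ⊗ₜ D.totIncl b j hs y) := by
  subst hr hs
  rfl

/-- A left inverse of `S ⊗ id - id ⊗ S` on the summand with indices `a`, `i`, `b`, `j`. -/
noncomputable def totRhoAux (n : ℕ) : ∀ b a i j : ℕ, 2 * a + i + (2 * b + j) = n + 2 →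
    (C.X i ⊗[k] D.X j →ₗ[k] KunnethSum k C.Tot D.Tot n)
  | 0, _, _, _, _ => 0
  | b + 1, a, i, j, h =>
      totRhoAux n b (a + 1) i j (by omega) - totTensor C D a i b j (by omega)

/-- A left inverse of `S ⊗ id - id ⊗ S`. -/
noncomputable def totRho (n : ℕ) :
    KunnethSum k C.Tot D.Tot (n + 2) →ₗ[k] KunnethSum k C.Tot D.Tot n :=
  DirectSum.toModule k _ _ fun p => TensorProduct.lift <|
    DirectSum.toModule k _ _ fun r => LinearMap.flip <|
      DirectSum.toModule k _ _ fun s => LinearMap.flip <|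
        (TensorProduct.mk k (C.X r.1.2) (D.X s.1.2)).compr₂
          (totRhoAux C D n s.1.1 r.1.1 r.1.2 s.1.2
            (by have := p.2; have := r.2; have := s.2; omega))

/-- A section of the product of total complexes. -/
noncomputable def totSec (n : ℕ) : (C.tensor D).Tot n →ₗ[k] KunnethSum k C.Tot D.Tot n :=
  DirectSum.toModule k _ _ fun p => DirectSum.toModule k _ _ fun q =>
    totTensor C D p.1.1 q.1.1 0 q.1.2 (by have := p.2; have := q.2; omega)

variable {C D}

theorem totRho_generator {n r s a i b j : ℕ} (h : r + s = n + 2) (hr : 2 * a + i = r)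
    (hs : 2 * b + j = s) (x : C.X i) (y : D.X j) :
    totRho C D n (KunnethSum.incl k C.Tot D.Tot r s h
      (C.totIncl a i hr x ⊗ₜ D.totIncl b j hs y)) =
      totRhoAux C D n b a i j (by omega) (x ⊗ₜ y) := by
  simp [totRho, totIncl, KunnethSum.incl]

theorem totSec_totIncl {n a m i j : ℕ} (h : 2 * a + m = n) (hm : i + j = m) (x : C.X i)
    (y : D.X j) :
    totSec C D n ((C.tensor D).totIncl a m h (KunnethSum.incl k C.X D.X i j hm (x ⊗ₜ y))) =
      totTensor C D a i 0 j (by omega) (x ⊗ₜ y) := by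
  rw [totSec, totIncl, DirectSum.toModule_lof, KunnethSum.incl, DirectSum.toModule_lof]

theorem differenceS_totTensor {n a i b j : ℕ} (h : 2 * a + i + (2 * b + j) = n) (x : C.X i)
    (y : D.X j) :
    differenceS C.totS D.totS n (totTensor C D a i b j h (x ⊗ₜ y)) =
      totTensor C D (a + 1) i b j (by omega) (x ⊗ₜ y) -
        totTensor C D a i (b + 1) j (by omega) (x ⊗ₜ y) := by
  rw [totTensor_tmul _ rfl rfl, differenceS_incl, totS_totIncl, totS_totIncl,
    totTensor_tmul _ (show 2 * (a + 1) + i = 2 * a + i + 2 by omega) rfl,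
    totTensor_tmul _ rfl (show 2 * (b + 1) + j = 2 * b + j + 2 by omega)]

theorem totMu_totTensor {n a i b j c m : ℕ} (h : 2 * a + i + (2 * b + j) = n) (x : C.X i)
    (y : D.X j) (hc : a + b = c) (hm : i + j = m) :
    totMu C D n (totTensor C D a i b j h (x ⊗ₜ y)) =
      (C.tensor D).totIncl c m (by omega) (KunnethSum.incl k C.X D.X i j hm (x ⊗ₜ y)) := by
  rw [totTensor_tmul _ rfl rfl, totMu_generator _ _ _ _ _ hc hm]

theorem totRho_differenceS (n : ℕ) (t : KunnethSum k C.Tot D.Tot n) :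
    totRho C D n (differenceS C.totS D.totS n t) = t := by
  induction t using kunnethTot_induction with
  | h0 => simp only [map_zero]
  | hadd a b ha hb => simp only [map_add, ha, hb]
  | h b a i j r s hr hs hrs x y =>
    rw [← totTensor_tmul (by omega) hr hs, differenceS_totTensor, totTensor_tmul _ rfl rfl,
      totTensor_tmul _ rfl rfl, map_sub, totRho_generator, totRho_generator, totRhoAux,
      LinearMap.sub_apply, sub_sub_cancel]

theorem differenceS_totRhoAux (n : ℕ) : ∀ (b a i j : ℕ) (h : 2 * a + i + (2 * b + j) = n + 2)
    (x : C.X i) (y : D.X j),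
    differenceS C.totS D.totS n (totRhoAux C D n b a i j h (x ⊗ₜ y)) =
      totTensor C D a i b j h (x ⊗ₜ y) - totTensor C D (a + b) i 0 j (by omega) (x ⊗ₜ y)
  | 0, a, i, j, h, x, y => by
    rw [totRhoAux, LinearMap.zero_apply, map_zero]
    exact (sub_self _).symm
  | b + 1, a, i, j, h, x, y => by
    have e : ∀ {a a' : ℕ} (ha : a = a') (h : 2 * a + i + (2 * 0 + j) = n + 2),
        totTensor C D a i 0 j h (x ⊗ₜ y) = totTensor C D a' i 0 j (ha ▸ h) (x ⊗ₜ y) := by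
      rintro a _ rfl h
      rfl
    rw [totRhoAux, LinearMap.sub_apply, map_sub, differenceS_totRhoAux n b, differenceS_totTensor,
      e (show a + 1 + b = a + (b + 1) by omega)]
    abel

theorem differenceS_totRho (n : ℕ) (t : KunnethSum k C.Tot D.Tot (n + 2)) :
    differenceS C.totS D.totS n (totRho C D n t) +
      totSec C D (n + 2) (totMu C D (n + 2) t) = t := by
  induction t using kunnethTot_induction with
  | h0 => simp only [map_zero, add_zero]
  | hadd a b ha hb =>
    simp only [map_add]
    rw [add_add_add_comm, ha, hb]
  | h b a i j r s hr hs hrs x y =>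
    rw [totRho_generator, totMu_generator _ _ _ _ _ rfl rfl, totSec_totIncl,
      differenceS_totRhoAux, sub_add_cancel, totTensor_tmul _ hr hs]

theorem totMu_totSec (n : ℕ) (t : (C.tensor D).Tot n) : totMu C D n (totSec C D n t) = t := by
  induction t using Tot.induction with
  | h0 => simp only [map_zero]
  | hadd a b ha hb => simp only [map_add, ha, hb]
  | h a m h t =>
    induction t using KunnethSum.induction with
    | h0 => simp only [map_zero]
    | hadd a b ha hb => simp only [map_add, ha, hb]
    | h i j hm x y => rw [totSec_totIncl, totMu_totTensor _ _ _ (add_zero a) hm]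

theorem totSec_totMu {n : ℕ} (hn : n < 2) (t : KunnethSum k C.Tot D.Tot n) :
    totSec C D n (totMu C D n t) = t := by
  induction t using kunnethTot_induction with
  | h0 => simp only [map_zero]
  | hadd a b ha hb => simp only [map_add, ha, hb]
  | h b a i j r s hr hs hrs x y =>
    obtain rfl : b = 0 := by omega
    rw [totMu_generator _ _ _ _ _ (add_zero a) rfl, totSec_totIncl, totTensor_tmul _ hr hs]

theorem differenceS_tensorDifferential (n : ℕ) (t : KunnethSum k C.Tot D.Tot n) :
    tensorDifferential C.totD D.totD (n + 2) (differenceS C.totS D.totS n t) =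
      differenceS C.totS D.totS (n + 1) (tensorDifferential C.totD D.totD n t) := by
  induction t using KunnethSum.induction with
  | h0 => simp only [map_zero]
  | hadd a b ha hb => simp only [map_add, ha, hb]
  | h i j h x y =>
    rw [differenceS_incl, map_sub, tensorDifferential_incl, tensorDifferential_incl,
      tensorDifferential_incl, map_add, map_smul, differenceS_incl, differenceS_incl, totD_totS,
      totD_totS]
    have e : (-1 : k) ^ (i + 2) = (-1) ^ i := by rw [pow_add]; simp
    rw [e]
    module

/-- The short exact sequence of the product of total complexes. -/
noncomputable def totSequence (hC : C.IsMixed) (hD : D.IsMixed) :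
    DegreeTwoSequence (tensorDifferential C.totD D.totD) (C.tensor D).totD where
  s := differenceS C.totS D.totS
  μ := totMu C D
  ρ := totRho C D
  sec := totSec C D
  dA_dA := tensorDifferential_tensorDifferential hC.totD_totD hD.totD_totD
  s_dA := differenceS_tensorDifferential
  μ_dA := totMu_tensorDifferential
  ρ_s := totRho_differenceS
  s_ρ := differenceS_totRho
  μ_sec := totMu_totSec
  sec_μ _ hn := totSec_totMu hn

end Splitting

section TotSequence

variable {C : MixedOperators.{u, v} k} {D : MixedOperators.{u, w} k}

theorem represents_S {n : ℕ} {z : C.Tot n} {x : C.HC n} (h : Represents z x) :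
    Represents (C.totS n z) (C.S n x) := by
  obtain ⟨hz, rfl⟩ := h
  exact ⟨_, rfl⟩

end TotSequence

end MixedOperators


section TensorPowers

variable {k : Type u} [Field k] {H : Type v} [Ring H] [HopfAlgebra k H]

theorem cons_induction {n : ℕ} {P : tpow k H (n + 1) → Prop} (h0 : P 0)
    (ht : ∀ y t, P (cons k H n (y ⊗ₜ t))) (ha : ∀ x y, P x → P y → P (x + y))
    (x : tpow k H (n + 1)) : P x := by
  obtain ⟨x, rfl⟩ := (cons k H n).surjective x
  induction x with
  | zero => rwa [map_zero]
  | add a b iha ihb => rw [map_add]; exact ha _ _ iha ihb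
  | tmul y t => exact ht y t

theorem single_induction {P : tpow k H 0 → Prop} (h : ∀ y, P (single k H y)) (x : tpow k H 0) :
    P x := by
  obtain ⟨x, rfl⟩ := (single k H).surjective x
  exact h x

variable (k H) in
/-- `comulAt`, indexed by natural numbers. -/
noncomputable def comulNat (n i : ℕ) : tpow k H n →ₗ[k] tpow k H (n + 1) :=
  if h : i < n + 1 then comulAt k H n ⟨i, h⟩ else 0

variable (k H) in
/-- `counitAt`, indexed by natural numbers. -/
noncomputable def counitNat (n i : ℕ) : tpow k H (n + 1) →ₗ[k] tpow k H n :=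
  if h : i < n + 1 then counitAt k H n ⟨i, h⟩ else 0

variable (k H) in
/-- `(a ⊗ b) ⊗ t ↦ a ⊗ b ⊗ t`. -/
noncomputable def consTwo (n : ℕ) (t : tpow k H n) : H ⊗[k] H →ₗ[k] tpow k H (n + 1 + 1) :=
  (cons k H (n + 1)).toLinearMap ∘ₗ
    ((cons k H n).toLinearMap ∘ₗ (TensorProduct.mk k H (tpow k H n)).flip t).lTensor H

theorem consTwo_tmul (n : ℕ) (t : tpow k H n) (a b : H) :
    consTwo k H n t (a ⊗ₜ b) = cons k H (n + 1) (a ⊗ₜ cons k H n (b ⊗ₜ t)) := by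
  simp [consTwo]

variable (k H) in
/-- `a ⊗ b ↦ a ⊗ b`. -/
noncomputable def pair : H ⊗[k] H →ₗ[k] tpow k H 1 :=
  (cons k H 0).toLinearMap ∘ₗ (single k H).toLinearMap.lTensor H

theorem pair_tmul (a b : H) : pair k H (a ⊗ₜ b) = cons k H 0 (a ⊗ₜ single k H b) := by
  simp [pair]

theorem comulNat_of_lt {n i : ℕ} (h : n < i) : comulNat k H n i = 0 := dif_neg (by omega)

theorem counitNat_of_lt {n i : ℕ} (h : n < i) : counitNat k H n i = 0 := dif_neg (by omega)

theorem comulNat_zero (y : H) : comulNat k H 0 0 (single k H y) =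
    pair k H (Coalgebra.comul (R := k) y) := comulAt_zero y 0

theorem comulNat_cons_zero (n : ℕ) (y : H) (t : tpow k H n) :
    comulNat k H (n + 1) 0 (cons k H n (y ⊗ₜ t)) = consTwo k H n t (Coalgebra.comul (R := k) y) := by
  refine (comulAt_cons_zero n y t).trans ?_
  generalize (Coalgebra.comul (R := k) y) = U
  induction U with
  | zero => simp
  | add a b ha hb => simp only [map_add, TensorProduct.add_tmul, ha, hb]
  | tmul a b => simp [consTwo_tmul]

theorem comulNat_cons_succ (n i : ℕ) (y : H) (t : tpow k H n) :
    comulNat k H (n + 1) (i + 1) (cons k H n (y ⊗ₜ t)) =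
      cons k H (n + 1) (y ⊗ₜ comulNat k H n i t) := by
  by_cases h : i < n + 1
  · rw [comulNat, comulNat, dif_pos h, dif_pos (by omega : i + 1 < n + 1 + 1)]
    exact comulAt_cons_succ n ⟨i, h⟩ y t
  · rw [comulNat, comulNat, dif_neg h, dif_neg (by omega : ¬ i + 1 < n + 1 + 1)]
    simp

theorem counitNat_zero (y z : H) :
    counitNat k H 0 0 (cons k H 0 (y ⊗ₜ single k H z)) =
      Coalgebra.counit (R := k) z • single k H y := counitAt_zero y z 0

theorem counitNat_cons_zero (n : ℕ) (y z : H) (t : tpow k H n) :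
    counitNat k H (n + 1) 0 (cons k H (n + 1) (y ⊗ₜ cons k H n (z ⊗ₜ t))) =
      Coalgebra.counit (R := k) z • cons k H n (y ⊗ₜ t) := counitAt_cons_zero n y z t

theorem counitNat_cons_succ (n i : ℕ) (y : H) (t : tpow k H (n + 1)) :
    counitNat k H (n + 1) (i + 1) (cons k H (n + 1) (y ⊗ₜ t)) =
      cons k H n (y ⊗ₜ counitNat k H n i t) := by
  by_cases h : i < n + 1
  · rw [counitNat, counitNat, dif_pos h, dif_pos (by omega : i + 1 < n + 1 + 1)]
    exact counitAt_cons_succ n ⟨i, h⟩ y t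
  · rw [counitNat, counitNat, dif_neg h, dif_neg (by omega : ¬ i + 1 < n + 1 + 1)]
    simp

variable (k H) in
/-- `a ⊗ (b ⊗ c) ⊗ t ↦ a ⊗ b ⊗ c ⊗ t`. -/
noncomputable def consThree (n : ℕ) (t : tpow k H n) :
    H ⊗[k] (H ⊗[k] H) →ₗ[k] tpow k H (n + 1 + 1 + 1) :=
  (cons k H (n + 2)).toLinearMap ∘ₗ (consTwo k H n t).lTensor H

theorem comul_comul_aux {V : Type*} [AddCommGroup V] [Module k V]
    (F : H ⊗[k] (H ⊗[k] H) →ₗ[k] V) (L R : H ⊗[k] H →ₗ[k] V)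
    (hL : ∀ a b, L (a ⊗ₜ b) = F (a ⊗ₜ Coalgebra.comul (R := k) b))
    (hR : ∀ a b, R (a ⊗ₜ b) =
      F (TensorProduct.assoc k H H H (Coalgebra.comul (R := k) a ⊗ₜ b))) (y : H) :
    L (Coalgebra.comul (R := k) y) = R (Coalgebra.comul (R := k) y) := by
  have h1 : L = F ∘ₗ (Coalgebra.comul (R := k) (A := H)).lTensor H :=
    TensorProduct.ext' fun a b => by simp [hL]
  have h2 : R = F ∘ₗ (TensorProduct.assoc k H H H).toLinearMap ∘ₗ
      (Coalgebra.comul (R := k) (A := H)).rTensor H :=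
    TensorProduct.ext' fun a b => by simp [hR]
  rw [h1, h2]
  simp only [LinearMap.comp_apply, LinearEquiv.coe_coe]
  rw [Coalgebra.coassoc_apply]

theorem comulNat_comulNat : ∀ (n i j : ℕ), i ≤ j → ∀ x,
    comulNat k H (n + 1) (j + 1) (comulNat k H n i x) =
      comulNat k H (n + 1) i (comulNat k H n j x)
  | 0, i, j, hij, x => by
    rcases Nat.eq_zero_or_pos j with rfl | hj
    · obtain rfl : i = 0 := by omega
      induction x using single_induction with
      | h y =>
      rw [comulNat_zero]
      refine comul_comul_aux ((cons k H 1).toLinearMap ∘ₗ (pair k H).lTensor H)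
        (comulNat k H 1 1 ∘ₗ pair k H) (comulNat k H 1 0 ∘ₗ pair k H) (fun a b => ?_)
        (fun a b => ?_) y
      · simp [pair_tmul, comulNat_cons_succ, comulNat_zero]
      · simp only [pair_tmul, comulNat_cons_zero, LinearMap.comp_apply]
        generalize (Coalgebra.comul (R := k) a) = U
        induction U with
        | zero => simp
        | add a b ha hb => simp only [map_add, TensorProduct.add_tmul, ha, hb]
        | tmul a c => simp [consTwo_tmul, pair_tmul]
    · rw [comulNat_of_lt hj, comulNat_of_lt (show 0 + 1 < j + 1 by omega)]
      simp
  | n + 1, i, j, hij, x => by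
    induction x using cons_induction with
    | h0 => simp
    | ha x y hx hy => simp only [map_add, hx, hy]
    | ht y t =>
    rcases i with _ | i <;> rcases j with _ | j
    · rw [comulNat_cons_zero]
      refine comul_comul_aux (consThree k H n t)
        (comulNat k H (n + 1 + 1) 1 ∘ₗ consTwo k H n t)
        (comulNat k H (n + 1 + 1) 0 ∘ₗ consTwo k H n t) (fun a b => ?_) (fun a b => ?_) y
      · simp [consTwo_tmul, consThree, comulNat_cons_succ, comulNat_cons_zero]
      · simp only [consTwo_tmul, comulNat_cons_zero, LinearMap.comp_apply]
        generalize (Coalgebra.comul (R := k) a) = U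
        induction U with
        | zero => simp
        | add a b ha hb => simp only [map_add, TensorProduct.add_tmul, ha, hb]
        | tmul a c => simp [consTwo_tmul, consThree]
    · rw [comulNat_cons_succ, comulNat_cons_zero, comulNat_cons_zero]
      generalize (Coalgebra.comul (R := k) y) = U
      induction U with
      | zero => simp
      | add a b ha hb => simp only [map_add, ha, hb]
      | tmul a c => simp [consTwo_tmul, comulNat_cons_succ]
    · omega
    · simp only [comulNat_cons_succ, comulNat_comulNat n i j (by omega)]

theorem counitNat_counitNat : ∀ (n i j : ℕ), i ≤ j → ∀ x,
    counitNat k H n j (counitNat k H (n + 1) i x) =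
      counitNat k H n i (counitNat k H (n + 1) (j + 1) x)
  | 0, i, j, hij, x => by
    rcases Nat.eq_zero_or_pos j with rfl | hj
    · obtain rfl : i = 0 := by omega
      induction x using cons_induction with
      | h0 => simp
      | ha x y hx hy => simp only [map_add, hx, hy]
      | ht y t =>
      induction t using cons_induction with
      | h0 => simp
      | ha x y hx hy => simp only [map_add, TensorProduct.tmul_add, hx, hy]
      | ht z t =>
      induction t using single_induction with
      | h t =>
      simp [counitNat_cons_zero, counitNat_cons_succ, counitNat_zero, smul_smul, mul_comm]
    · rw [counitNat_of_lt hj, counitNat_of_lt (show 0 + 1 < j + 1 by omega)]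
      simp
  | n + 1, i, j, hij, x => by
    induction x using cons_induction with
    | h0 => simp
    | ha x y hx hy => simp only [map_add, hx, hy]
    | ht y t =>
    rcases i with _ | i <;> rcases j with _ | j
    · induction t using cons_induction with
      | h0 => simp
      | ha x y hx hy => simp only [map_add, TensorProduct.tmul_add, hx, hy]
      | ht z t =>
      induction t using cons_induction with
      | h0 => simp
      | ha x y hx hy => simp only [map_add, TensorProduct.tmul_add, hx, hy]
      | ht a t =>
      simp [counitNat_cons_zero, counitNat_cons_succ, smul_smul, mul_comm]
    · induction t using cons_induction with
      | h0 => simp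
      | ha x y hx hy => simp only [map_add, TensorProduct.tmul_add, hx, hy]
      | ht z t =>
      simp [counitNat_cons_zero, counitNat_cons_succ]
    · omega
    · simp only [counitNat_cons_succ, counitNat_counitNat n i j (by omega)]

theorem counitNat_comulNat_lt : ∀ (n i j : ℕ), i ≤ j → ∀ x,
    counitNat k H (n + 1) (j + 1) (comulNat k H (n + 1) i x) =
      comulNat k H n i (counitNat k H n j x)
  | 0, i, j, hij, x => by
    rcases Nat.eq_zero_or_pos j with rfl | hj
    · obtain rfl : i = 0 := by omega
      induction x using cons_induction with
      | h0 => simp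
      | ha x y hx hy => simp only [map_add, hx, hy]
      | ht y t =>
      induction t using single_induction with
      | h t =>
      rw [comulNat_cons_zero, counitNat_zero, map_smul, comulNat_zero]
      generalize (Coalgebra.comul (R := k) y) = U
      induction U with
      | zero => simp
      | add a b ha hb => simp only [map_add, smul_add, ha, hb]
      | tmul a c => simp [consTwo_tmul, counitNat_cons_succ, counitNat_zero, pair_tmul]
    · rw [counitNat_of_lt hj, counitNat_of_lt (show 0 + 1 < j + 1 by omega)]
      simp
  | n + 1, i, j, hij, x => by
    induction x using cons_induction with
    | h0 => simp
    | ha x y hx hy => simp only [map_add, hx, hy]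
    | ht y t =>
    rcases i with _ | i <;> rcases j with _ | j
    · induction t using cons_induction with
      | h0 => simp
      | ha x y hx hy => simp only [map_add, TensorProduct.tmul_add, hx, hy]
      | ht z t =>
      rw [comulNat_cons_zero, counitNat_cons_zero, map_smul, comulNat_cons_zero]
      generalize (Coalgebra.comul (R := k) y) = U
      induction U with
      | zero => simp
      | add a b ha hb => simp only [map_add, smul_add, ha, hb]
      | tmul a c => simp [consTwo_tmul, counitNat_cons_succ, counitNat_cons_zero]
    · rw [comulNat_cons_zero, counitNat_cons_succ, comulNat_cons_zero]
      generalize (Coalgebra.comul (R := k) y) = U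
      induction U with
      | zero => simp
      | add a b ha hb => simp only [map_add, smul_add, ha, hb]
      | tmul a c => simp [consTwo_tmul, counitNat_cons_succ]
    · omega
    · simp only [counitNat_cons_succ, comulNat_cons_succ,
        counitNat_comulNat_lt n i j (by omega)]

theorem comul_counit_left {V : Type*} [AddCommGroup V] [Module k V] (F : H →ₗ[k] V)
    (L : H ⊗[k] H →ₗ[k] V) (hL : ∀ a b, L (a ⊗ₜ b) = Coalgebra.counit (R := k) a • F b) (y : H) :
    L (Coalgebra.comul (R := k) y) = F y := by
  have : L = F ∘ₗ (TensorProduct.lid k H).toLinearMap ∘ₗ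
      (Coalgebra.counit (R := k) (A := H)).rTensor H :=
    TensorProduct.ext' fun a b => by simp [hL]
  rw [this]
  simp

theorem comul_counit_right {V : Type*} [AddCommGroup V] [Module k V] (F : H →ₗ[k] V)
    (L : H ⊗[k] H →ₗ[k] V) (hL : ∀ a b, L (a ⊗ₜ b) = Coalgebra.counit (R := k) b • F a) (y : H) :
    L (Coalgebra.comul (R := k) y) = F y := by
  have : L = F ∘ₗ (TensorProduct.rid k H).toLinearMap ∘ₗ
      (Coalgebra.counit (R := k) (A := H)).lTensor H :=
    TensorProduct.ext' fun a b => by simp [hL]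
  rw [this]
  simp

theorem counitNat_comulNat_self : ∀ (n i : ℕ), i ≤ n → ∀ x,
    counitNat k H n i (comulNat k H n i x) = x
  | 0, i, hi, x => by
    obtain rfl : i = 0 := by omega
    induction x using single_induction with
    | h y =>
    rw [comulNat_zero]
    refine comul_counit_right (single k H).toLinearMap (counitNat k H 0 0 ∘ₗ pair k H)
      (fun a b => ?_) y
    simp [pair_tmul, counitNat_zero]
  | n + 1, i, hi, x => by
    induction x using cons_induction with
    | h0 => simp
    | ha x y hx hy => simp only [map_add, hx, hy]
    | ht y t =>
    rcases i with _ | i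
    · rw [comulNat_cons_zero]
      refine comul_counit_right ((cons k H n).toLinearMap ∘ₗ
        (TensorProduct.mk k H (tpow k H n)).flip t) (counitNat k H (n + 1) 0 ∘ₗ consTwo k H n t)
        (fun a b => ?_) y
      simp [consTwo_tmul, counitNat_cons_zero]
    · rw [comulNat_cons_succ, counitNat_cons_succ, counitNat_comulNat_self n i (by omega)]

theorem counitNat_comulNat_succ : ∀ (n i : ℕ), i ≤ n → ∀ x,
    counitNat k H (n + 1) i (comulNat k H (n + 1) (i + 1) x) = x
  | 0, i, hi, x => by
    obtain rfl : i = 0 := by omega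
    induction x using cons_induction with
    | h0 => simp
    | ha x y hx hy => simp only [map_add, hx, hy]
    | ht y t =>
    induction t using single_induction with
    | h z =>
    rw [comulNat_cons_succ, comulNat_zero]
    refine comul_counit_left ((cons k H 0).toLinearMap ∘ₗ
      (TensorProduct.mk k H (tpow k H 0)) y ∘ₗ (single k H).toLinearMap)
      (counitNat k H (0 + 1) 0 ∘ₗ (cons k H (0 + 1)).toLinearMap ∘ₗ
        (TensorProduct.mk k H (tpow k H (0 + 1))) y ∘ₗ pair k H) (fun a b => ?_) z
    simp [pair_tmul, counitNat_cons_zero]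
  | n + 1, i, hi, x => by
    induction x using cons_induction with
    | h0 => simp
    | ha x y hx hy => simp only [map_add, hx, hy]
    | ht y t =>
    rcases i with _ | i
    · induction t using cons_induction with
      | h0 => simp
      | ha x y hx hy => simp only [map_add, TensorProduct.tmul_add, hx, hy]
      | ht z t =>
      rw [comulNat_cons_succ, comulNat_cons_zero]
      refine comul_counit_left ((cons k H (n + 1)).toLinearMap ∘ₗ
        (TensorProduct.mk k H (tpow k H (n + 1))) y ∘ₗ (cons k H n).toLinearMap ∘ₗ
          (TensorProduct.mk k H (tpow k H n)).flip t)
        (counitNat k H (n + 1 + 1) 0 ∘ₗ (cons k H (n + 1 + 1)).toLinearMap ∘ₗ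
          (TensorProduct.mk k H (tpow k H (n + 1 + 1))) y ∘ₗ consTwo k H n t) (fun a b => ?_) z
      simp [consTwo_tmul, counitNat_cons_zero]
    · rw [comulNat_cons_succ, counitNat_cons_succ, counitNat_comulNat_succ n i (by omega)]

theorem counitNat_comulNat_gt : ∀ (n i j : ℕ), j < i → ∀ x,
    counitNat k H (n + 1) j (comulNat k H (n + 1) (i + 1) x) =
      comulNat k H n i (counitNat k H n j x)
  | 0, i, j, hij, x => by
    rw [comulNat_of_lt (show 0 < i by omega), comulNat_of_lt (show 0 + 1 < i + 1 by omega)]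
    simp
  | n + 1, i, j, hij, x => by
    induction x using cons_induction with
    | h0 => simp
    | ha x y hx hy => simp only [map_add, hx, hy]
    | ht y t =>
    rcases i with _ | i
    · omega
    rcases j with _ | j
    · induction t using cons_induction with
      | h0 => simp
      | ha x y hx hy => simp only [map_add, TensorProduct.tmul_add, hx, hy]
      | ht z t =>
      simp [comulNat_cons_succ, counitNat_cons_zero]
    · simp only [counitNat_cons_succ, comulNat_cons_succ,
        counitNat_comulNat_gt n i j (by omega)]

end TensorPowers


section Rotation

variable {k : Type u} [Field k] {H : Type v} [Ring H] [HopfAlgebra k H]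

theorem comulNat_snoc : ∀ (n i : ℕ), i ≤ n → ∀ (t : tpow k H n) (z : H),
    comulNat k H (n + 1) i (snoc k H n (t ⊗ₜ z)) = snoc k H (n + 1) (comulNat k H n i t ⊗ₜ z)
  | 0, i, hi, t, z => by
    obtain rfl : i = 0 := by omega
    induction t using single_induction with
    | h y =>
    rw [snoc_single, comulNat_cons_zero, comulNat_zero]
    generalize (Coalgebra.comul (R := k) y) = U
    induction U with
    | zero => simp
    | add a b ha hb => simp only [map_add, TensorProduct.add_tmul, ha, hb]
    | tmul a c => simp [consTwo_tmul, pair_tmul, snoc_cons, snoc_single]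
  | n + 1, i, hi, t, z => by
    induction t using cons_induction with
    | h0 => simp
    | ha x y hx hy => simp only [map_add, TensorProduct.add_tmul, hx, hy]
    | ht y t =>
    rcases i with _ | i
    · rw [snoc_cons, comulNat_cons_zero, comulNat_cons_zero]
      generalize (Coalgebra.comul (R := k) y) = U
      induction U with
      | zero => simp
      | add a b ha hb => simp only [map_add, TensorProduct.add_tmul, ha, hb]
      | tmul a c => simp [consTwo_tmul, snoc_cons]
    · rw [snoc_cons, comulNat_cons_succ, comulNat_cons_succ, snoc_cons,
        comulNat_snoc n i (by omega)]

variable (k H) in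
/-- `b ⊗ c ↦ t ⊗ b ⊗ c`. -/
noncomputable def snocTwo (n : ℕ) (t : tpow k H n) : H ⊗[k] H →ₗ[k] tpow k H (n + 1 + 1) :=
  snoc k H (n + 1) ∘ₗ (snoc k H n ∘ₗ TensorProduct.mk k (tpow k H n) H t).rTensor H

theorem snocTwo_tmul (n : ℕ) (t : tpow k H n) (b c : H) :
    snocTwo k H n t (b ⊗ₜ c) = snoc k H (n + 1) (snoc k H n (t ⊗ₜ b) ⊗ₜ c) := by
  simp [snocTwo]

theorem snocTwo_cons (n : ℕ) (y : H) (t : tpow k H n) (U : H ⊗[k] H) :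
    snocTwo k H (n + 1) (cons k H n (y ⊗ₜ t)) U =
      cons k H (n + 1 + 1) (y ⊗ₜ snocTwo k H n t U) := by
  induction U with
  | zero => simp
  | add a b ha hb => simp only [map_add, TensorProduct.tmul_add, ha, hb]
  | tmul a c => simp [snocTwo_tmul, snoc_cons]

theorem snocTwo_single (y : H) (U : H ⊗[k] H) :
    snocTwo k H 0 (single k H y) U = cons k H 1 (y ⊗ₜ pair k H U) := by
  induction U with
  | zero => simp
  | add a b ha hb => simp only [map_add, TensorProduct.tmul_add, ha, hb]
  | tmul a c => simp [snocTwo_tmul, snoc_cons, snoc_single, pair_tmul]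

theorem comulNat_snoc_last : ∀ (n : ℕ) (t : tpow k H n) (z : H),
    comulNat k H (n + 1) (n + 1) (snoc k H n (t ⊗ₜ z)) =
      snocTwo k H n t (Coalgebra.comul (R := k) z)
  | 0, t, z => by
    induction t using single_induction with
    | h y => rw [snoc_single, comulNat_cons_succ, comulNat_zero, snocTwo_single]
  | n + 1, t, z => by
    induction t using cons_induction with
    | h0 => simp [snocTwo]
    | ha x y hx hy =>
      have : snocTwo k H (n + 1) (x + y) = snocTwo k H (n + 1) x + snocTwo k H (n + 1) y := by
        ext a b
        simp [snocTwo, TensorProduct.add_tmul]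
      simp only [map_add, TensorProduct.add_tmul, hx, hy, this, LinearMap.add_apply]
    | ht y t => rw [snoc_cons, comulNat_cons_succ, comulNat_snoc_last n, snocTwo_cons]

theorem counitNat_snoc : ∀ (n i : ℕ), i ≤ n → ∀ (t : tpow k H (n + 1)) (z : H),
    counitNat k H (n + 1) i (snoc k H (n + 1) (t ⊗ₜ z)) = snoc k H n (counitNat k H n i t ⊗ₜ z)
  | 0, i, hi, t, z => by
    obtain rfl : i = 0 := by omega
    induction t using cons_induction with
    | h0 => simp
    | ha x y hx hy => simp only [map_add, TensorProduct.add_tmul, hx, hy]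
    | ht y t =>
    induction t using single_induction with
    | h t =>
    rw [snoc_cons, snoc_single, counitNat_cons_zero, counitNat_zero,
      ← TensorProduct.smul_tmul', map_smul, snoc_single]
  | n + 1, i, hi, t, z => by
    induction t using cons_induction with
    | h0 => simp
    | ha x y hx hy => simp only [map_add, TensorProduct.add_tmul, hx, hy]
    | ht y t =>
    rcases i with _ | i
    · induction t using cons_induction with
      | h0 => simp
      | ha x y hx hy =>
        simp only [map_add, TensorProduct.add_tmul, TensorProduct.tmul_add, hx, hy]
      | ht a t =>
        rw [snoc_cons, snoc_cons, counitNat_cons_zero, counitNat_cons_zero,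
          ← TensorProduct.smul_tmul', map_smul, snoc_cons]
    · rw [snoc_cons, counitNat_cons_succ, counitNat_cons_succ, snoc_cons,
        counitNat_snoc n i (by omega)]

theorem counitNat_snoc_last : ∀ (n : ℕ) (t : tpow k H n) (z : H),
    counitNat k H n n (snoc k H n (t ⊗ₜ z)) = Coalgebra.counit (R := k) z • t
  | 0, t, z => by
    induction t using single_induction with
    | h y => rw [snoc_single, counitNat_zero]
  | n + 1, t, z => by
    induction t using cons_induction with
    | h0 => simp
    | ha x y hx hy => simp only [map_add, TensorProduct.add_tmul, hx, hy, smul_add]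
    | ht y t => rw [snoc_cons, counitNat_cons_succ, counitNat_snoc_last n]; simp

theorem rotate_comulNat_succ (n i : ℕ) (hi : i < n) (g : H) (x : tpow k H n) :
    rotate k H (n + 1) (g ⊗ₜ comulNat k H n (i + 1) x) =
      comulNat k H n i (rotate k H n (g ⊗ₜ x)) := by
  rcases n with _ | n
  · omega
  induction x using cons_induction with
  | h0 => simp
  | ha x y hx hy => simp only [map_add, TensorProduct.tmul_add, hx, hy]
  | ht y t => rw [comulNat_cons_succ, rotate_cons, rotate_cons, comulNat_snoc n i (by omega)]

theorem rotate_counitNat_succ (n i : ℕ) (hi : i < n) (g : H) (x : tpow k H (n + 1)) :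
    rotate k H n (g ⊗ₜ counitNat k H n (i + 1) x) =
      counitNat k H n i (rotate k H (n + 1) (g ⊗ₜ x)) := by
  rcases n with _ | n
  · omega
  induction x using cons_induction with
  | h0 => simp
  | ha x y hx hy => simp only [map_add, TensorProduct.tmul_add, hx, hy]
  | ht y t => rw [counitNat_cons_succ, rotate_cons, rotate_cons, counitNat_snoc n i (by omega)]

variable (k H) in
/-- `a ⊗ b ↦ rotate (b ⊗ rotate (a ⊗ x))`. -/
noncomputable def rotateTwo (n : ℕ) (x : tpow k H n) : H ⊗[k] H →ₗ[k] tpow k H n :=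
  rotate k H n ∘ₗ (TensorProduct.comm k (tpow k H n) H).toLinearMap ∘ₗ
    (rotate k H n ∘ₗ (TensorProduct.mk k H (tpow k H n)).flip x).rTensor H

theorem rotateTwo_tmul (n : ℕ) (x : tpow k H n) (a b : H) :
    rotateTwo k H n x (a ⊗ₜ b) = rotate k H n (b ⊗ₜ rotate k H n (a ⊗ₜ x)) := by
  simp [rotateTwo]

theorem rotateTwo_add (n : ℕ) (x y : tpow k H n) :
    rotateTwo k H n (x + y) = rotateTwo k H n x + rotateTwo k H n y := by
  ext a b
  simp [rotateTwo, TensorProduct.tmul_add]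

theorem rotateTwo_zero (n : ℕ) : rotateTwo k H n 0 = 0 := by
  ext a b
  simp [rotateTwo]

theorem rotateTwo_pair (U V : H ⊗[k] H) :
    rotateTwo k H 1 (pair k H V) U = pair k H (U * V) := by
  induction V with
  | zero => simp [rotateTwo_zero]
  | add a b ha hb => simp only [map_add, rotateTwo_add, LinearMap.add_apply, mul_add, ha, hb]
  | tmul y z =>
    induction U with
    | zero => simp
    | add a b ha hb => simp only [map_add, add_mul, ha, hb]
    | tmul a b => simp [rotateTwo_tmul, pair_tmul, rotate_cons, snoc_single]

theorem rotateTwo_consTwo (n : ℕ) (t : tpow k H n) (U V : H ⊗[k] H) :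
    rotateTwo k H (n + 1 + 1) (consTwo k H n t V) U = snocTwo k H n t (U * V) := by
  induction V with
  | zero => simp [rotateTwo_zero]
  | add a b ha hb => simp only [map_add, rotateTwo_add, LinearMap.add_apply, mul_add, ha, hb]
  | tmul y z =>
    induction U with
    | zero => simp
    | add a b ha hb => simp only [map_add, add_mul, ha, hb]
    | tmul a b => simp [rotateTwo_tmul, consTwo_tmul, snocTwo_tmul, rotate_cons, snoc_cons]

theorem rotateTwo_comulNat_zero (n : ℕ) (g : H) (x : tpow k H n) :
    rotateTwo k H (n + 1) (comulNat k H n 0 x) (Coalgebra.comul (R := k) g) =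
      comulNat k H n n (rotate k H n (g ⊗ₜ x)) := by
  rcases n with _ | n
  · induction x using single_induction with
    | h y =>
    rw [comulNat_zero, rotateTwo_pair, rotate_single, comulNat_zero, Bialgebra.comul_mul]
  · induction x using cons_induction with
    | h0 => simp [rotateTwo_zero]
    | ha x y hx hy =>
      simp only [map_add, rotateTwo_add, LinearMap.add_apply, TensorProduct.tmul_add, hx, hy]
    | ht y t =>
      rw [comulNat_cons_zero, rotateTwo_consTwo, rotate_cons, comulNat_snoc_last,
        Bialgebra.comul_mul]

theorem counitNat_rotateTwo (n : ℕ) (g : H) (x : tpow k H (n + 1)) :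
    counitNat k H n n (rotateTwo k H (n + 1) x (Coalgebra.comul (R := k) g)) =
      rotate k H n (g ⊗ₜ counitNat k H n 0 x) := by
  refine comul_counit_right (rotate k H n ∘ₗ
    (TensorProduct.mk k H (tpow k H n)).flip (counitNat k H n 0 x))
    (counitNat k H n n ∘ₗ rotateTwo k H (n + 1) x) (fun a b => ?_) g
  simp only [LinearMap.comp_apply, rotateTwo_tmul, LinearMap.flip_apply, TensorProduct.mk_apply]
  induction x using cons_induction with
  | h0 => simp
  | ha x y hx hy => simp only [map_add, TensorProduct.tmul_add, smul_add, hx, hy]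
  | ht y t =>
  rcases n with _ | n
  · induction t using single_induction with
    | h z =>
    rw [rotate_cons, snoc_single, rotate_cons, counitNat_snoc_last, counitNat_zero]
    simp [rotate_single, smul_smul, mul_comm]
  · induction t using cons_induction with
    | h0 => simp
    | ha x y hx hy => simp only [map_add, TensorProduct.tmul_add, smul_add, hx, hy]
    | ht z t =>
    rw [rotate_cons, snoc_cons, rotate_cons, counitNat_snoc_last, counitNat_cons_zero]
    simp [rotate_cons, smul_smul, mul_comm]

theorem diagAct_one : ∀ (n : ℕ) (x : tpow k H n), diagAct k H n 1 x = x
  | 0, x => by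
    induction x using single_induction with
    | h y => rw [diagAct_single, one_mul]
  | n + 1, x => by
    induction x using cons_induction with
    | h0 => simp
    | ha x y hx hy => simp only [map_add, hx, hy]
    | ht y t =>
      rw [diagAct_cons, Bialgebra.comul_one, Algebra.TensorProduct.one_def, TensorProduct.map_tmul,
        LinearMap.flip_apply, diagAct_one n]
      simp

variable (k H) in
/-- `(a₀ ⊗ ⋯ ⊗ aₚ) ⊗ (b₀ ⊗ ⋯ ⊗ b_q) ↦ a₀ ⊗ ⋯ ⊗ aₚ ⊗ b₀ ⊗ ⋯ ⊗ b_q`. -/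
noncomputable def appendAux (q : ℕ) : ∀ p, tpow k H p ⊗[k] tpow k H q →ₗ[k] tpow k H (q + p + 1)
  | 0 => (cons k H q).toLinearMap ∘ₗ (single k H).symm.toLinearMap.rTensor (tpow k H q)
  | p + 1 => (cons k H (q + p + 1)).toLinearMap ∘ₗ (appendAux q p).lTensor H ∘ₗ
      (TensorProduct.assoc k H (tpow k H p) (tpow k H q)).toLinearMap ∘ₗ
        (cons k H p).symm.toLinearMap.rTensor (tpow k H q)

variable (k H) in
/-- `appendAux`, with the degree of the target up to equality. -/
noncomputable def append (p q n : ℕ) (h : q + p + 1 = n) :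
    tpow k H p ⊗[k] tpow k H q →ₗ[k] tpow k H n := h ▸ appendAux k H q p

theorem append_single (q : ℕ) (y : H) (b : tpow k H q) :
    append k H 0 q (q + 1) rfl (single k H y ⊗ₜ b) = cons k H q (y ⊗ₜ b) := by
  simp [append, appendAux]

theorem append_cons {p q n : ℕ} (h : q + p + 1 = n) (y : H) (a : tpow k H p) (b : tpow k H q) :
    append k H (p + 1) q (n + 1) (congrArg (· + 1) h) (cons k H p (y ⊗ₜ a) ⊗ₜ b) =
      cons k H n (y ⊗ₜ append k H p q n h (a ⊗ₜ b)) := by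
  subst h
  simp [append, appendAux]

theorem snoc_append : ∀ {p q n : ℕ} (h : q + p + 1 = n) (a : tpow k H p) (b : tpow k H q) (z : H),
    snoc k H n (append k H p q n h (a ⊗ₜ b) ⊗ₜ z) =
      append k H p (q + 1) (n + 1) (by omega) (a ⊗ₜ snoc k H q (b ⊗ₜ z))
  | 0, q, n, h, a, b, z => by
    subst h
    induction a using single_induction with
    | h y => rw [append_single, append_single, snoc_cons]
  | p + 1, q, 0, h, a, b, z => by omega
  | p + 1, q, n + 1, h, a, b, z => by
    induction a using cons_induction with
    | h0 => simp
    | ha x y hx hy => simp only [map_add, TensorProduct.add_tmul, hx, hy]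
    | ht y a => rw [append_cons (by omega), snoc_cons, append_cons (by omega), snoc_append]

theorem append_snoc : ∀ {p q n : ℕ} (h : q + (p + 1) + 1 = n) (a : tpow k H p) (b : tpow k H q)
    (z : H), append k H (p + 1) q n h (snoc k H p (a ⊗ₜ z) ⊗ₜ b) =
      append k H p (q + 1) n (by omega) (a ⊗ₜ cons k H q (z ⊗ₜ b))
  | 0, q, n, h, a, b, z => by
    subst h
    induction a using single_induction with
    | h y =>
      rw [snoc_single, append_cons (n := q + 1) rfl, append_single]
      exact (append_single _ _ _).symm
  | p + 1, q, 0, h, a, b, z => by omega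
  | p + 1, q, n + 1, h, a, b, z => by
    induction a using cons_induction with
    | h0 => simp
    | ha x y hx hy => simp only [map_add, TensorProduct.add_tmul, hx, hy]
    | ht y a => rw [snoc_cons, append_cons (by omega), append_cons (by omega), append_snoc]

theorem append_single_right (n : ℕ) (t : tpow k H n) (z : H) :
    append k H n 0 (n + 1) (by omega) (t ⊗ₜ single k H z) = snoc k H n (t ⊗ₜ z) := by
  induction n with
  | zero =>
    induction t using single_induction with
    | h y => rw [snoc_single]; exact append_single 0 y _
  | succ n ih =>
    induction t using cons_induction with
    | h0 => simp
    | ha x y hx hy => simp only [map_add, TensorProduct.add_tmul, hx, hy]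
    | ht y a => rw [snoc_cons, append_cons (by omega), ih]

end Rotation


section FlipOver

variable {k : Type u} [Field k] {C : CocyclicOperators.{u, v} k}

/-- A cocyclic structure from the identities between the inner cofaces, the codegeneracies and the
cyclic operators. -/
theorem CocyclicOperators.isCocyclic_of_inner
    (δ_δ : ∀ n i j, i ≤ j → j ≤ n → ∀ x,
      C.d (n + 1) (j + 1) (C.d n i x) = C.d (n + 1) i (C.d n j x))
    (σ_δ_lt : ∀ n i j, i ≤ j → j ≤ n → ∀ x,
      C.s (n + 1) (j + 1) (C.d (n + 1) i x) = C.d n i (C.s n j x))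
    (σ_δ_self : ∀ n i, i ≤ n → ∀ x, C.s n i (C.d n i x) = x)
    (σ_δ_succ : ∀ n i, i + 1 ≤ n → ∀ x, C.s n i (C.d n (i + 1) x) = x)
    (σ_δ_gt : ∀ n i j, j < i → i ≤ n → ∀ x,
      C.s (n + 1) j (C.d (n + 1) (i + 1) x) = C.d n i (C.s n j x))
    (σ_σ : ∀ n i j, i ≤ j → j ≤ n → ∀ x,
      C.s n j (C.s (n + 1) i x) = C.s n i (C.s (n + 1) (j + 1) x))
    (τ_δ : ∀ n i, i + 1 ≤ n → ∀ x, C.τ (n + 1) (C.d n (i + 1) x) = C.d n i (C.τ n x))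
    (τ_τ_δ : ∀ n x, C.τ (n + 1) (C.τ (n + 1) (C.d n 0 x)) = C.d n n (C.τ n x))
    (τ_δ_zero : ∀ n x, C.τ (n + 1) (C.d n 0 x) = C.d n (n + 1) x)
    (σ_τ_δ : ∀ x, C.s 0 0 (C.τ 1 (C.d 0 0 x)) = x)
    (τ_σ : ∀ n i, i + 1 ≤ n → ∀ x, C.τ n (C.s n (i + 1) x) = C.s n i (C.τ (n + 1) x))
    (τ_σ_zero : ∀ n x, C.τ n (C.s n 0 x) = C.s n n (C.τ (n + 1) (C.τ (n + 1) x)))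
    (τ_pow : ∀ n, C.τ n ^ (n + 1) = 1) : C.IsCocyclic := by
  have τ_δ' : ∀ n i, i ≤ n → ∀ x, C.τ (n + 1) (C.d n (i + 1) x) = C.d n i (C.τ n x) := by
    intro n i hi x
    rcases hi.lt_or_eq with hi | rfl
    · exact τ_δ n i hi x
    · rw [← τ_δ_zero, τ_τ_δ]
  have τ_surj : ∀ n x, ∃ y, C.τ n y = x := fun n x => ⟨(C.τ n ^ n) x, by
    have := LinearMap.congr_fun (τ_pow n) x
    rwa [pow_succ'] at this⟩
  have last : ∀ n i, i ≤ n → ∀ x,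
      C.d (n + 1) (n + 2) (C.d n i x) = C.d (n + 1) i (C.d n (n + 1) x) := by
    intro n i hi x
    rw [← τ_δ_zero, ← δ_δ n 0 i (by omega) hi, τ_δ' _ _ (by omega), τ_δ_zero]
  refine ⟨?_, σ_δ_lt, σ_δ_self, ?_, ?_, σ_σ, τ_δ', τ_δ_zero, τ_σ, τ_σ_zero, τ_pow⟩
  · intro n i j hij hj x
    rcases hj.lt_or_eq with hj | rfl
    · exact δ_δ n i j hij (by omega) x
    rcases hij.lt_or_eq with hi | rfl
    · exact last n i (by omega) x
    · rw [← τ_δ_zero n, ← τ_δ' (n + 1) (n + 1) le_rfl, last n 0 (by omega), ← τ_δ_zero n,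
        ← τ_δ_zero (n + 1), ← τ_δ' (n + 1) 0 (by omega)]
  · intro n i hi x
    rcases hi.lt_or_eq with hi | rfl
    · exact σ_δ_succ n i hi x
    obtain ⟨y, rfl⟩ := τ_surj i x
    rw [← τ_δ_zero, ← τ_δ' _ _ (by omega), ← τ_σ_zero]
    rcases Nat.eq_zero_or_pos i with rfl | hi
    · exact congrArg (C.τ 0) ((congrArg (C.s 0 0) (τ_δ_zero 0 y).symm).trans (σ_τ_δ y))
    · rw [σ_δ_succ i 0 hi y]
  · intro n i j hij hi x
    rcases hi.lt_or_eq with hi | rfl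
    · exact σ_δ_gt n i j hij (by omega) x
    · rw [← τ_δ_zero, ← τ_σ _ _ (by omega), σ_δ_lt n 0 j (by omega) (by omega), τ_δ_zero]

end FlipOver

section SAYD

variable {k : Type u} [Field k] {H : Type v} [Ring H] [HopfAlgebra k H]
  {M : Type w} [AddCommGroup M] [Module k M] (S : SAYDModule k H M)

/-- `p ⊗ m ↦ m ⊗ L p`. -/
noncomputable def swapMap {P Q : Type*} [AddCommGroup P] [Module k P] [AddCommGroup Q] [Module k Q]
    (L : P →ₗ[k] Q) : P ⊗[k] M →ₗ[k] M ⊗[k] Q :=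
  (TensorProduct.comm k Q M).toLinearMap ∘ₗ L.rTensor M

theorem swapMap_tmul {P Q : Type*} [AddCommGroup P] [Module k P] [AddCommGroup Q] [Module k Q]
    (L : P →ₗ[k] Q) (p : P) (m : M) : swapMap L (p ⊗ₜ m) = m ⊗ₜ L p := by
  simp [swapMap]

theorem preTau_tmul (n : ℕ) (m : M) (x : tpow k H n) : preTau S n (m ⊗ₜ x) =
    swapMap (rotate k H n ∘ₗ (TensorProduct.mk k H (tpow k H n)).flip x) (S.coact m) := by
  change ((rotate k H n).lTensor M ∘ₗ (TensorProduct.leftComm k H M (tpow k H n)).toLinearMap ∘ₗ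
      (TensorProduct.assoc k H M (tpow k H n)).toLinearMap) (S.coact m ⊗ₜ x) = _
  generalize S.coact m = U
  induction U with
  | zero => simp
  | add a b ha hb => simp only [map_add, TensorProduct.add_tmul, ha, hb]
  | tmul g m => simp [swapMap_tmul]

/-- `∑ Q(m⁽⁰⁾ ⊗ L(m⁽⁻¹⁾)) = ∑ m⁽⁰⁾ ⊗ Ψ(m⁽⁻²⁾ ⊗ m⁽⁻¹⁾)` if `Q(m ⊗ L g) = m⁽⁰⁾ ⊗ Ψ(g ⊗ m⁽⁻¹⁾)`. -/
theorem coact_coact {P Q : Type*} [AddCommGroup P] [Module k P] [AddCommGroup Q] [Module k Q]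
    (q : M ⊗[k] P →ₗ[k] M ⊗[k] Q) (L : H →ₗ[k] P) (Ψ : H ⊗[k] H →ₗ[k] Q)
    (h : ∀ g m, q (m ⊗ₜ L g) = swapMap (Ψ ∘ₗ TensorProduct.mk k H H g) (S.coact m)) (m : M) :
    q (swapMap L (S.coact m)) =
      swapMap (Ψ ∘ₗ Coalgebra.comul (R := k) (A := H)) (S.coact m) := by
  have h1 : q ∘ₗ swapMap L = swapMap Ψ ∘ₗ (TensorProduct.assoc k H H M).symm.toLinearMap ∘ₗ
      S.coact.lTensor H := by
    refine TensorProduct.ext' fun g m => ?_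
    simp only [LinearMap.comp_apply, swapMap_tmul, h, LinearMap.lTensor_tmul, LinearEquiv.coe_coe]
    generalize S.coact m = U
    induction U with
    | zero => simp
    | add a b ha hb => simp only [map_add, TensorProduct.tmul_add, ha, hb]
    | tmul g m => simp [swapMap_tmul]
  have h2 : swapMap (Ψ ∘ₗ Coalgebra.comul (R := k) (A := H)) =
      swapMap (M := M) Ψ ∘ₗ (Coalgebra.comul (R := k) (A := H)).rTensor M :=
    TensorProduct.ext' fun g m => by simp [swapMap_tmul]
  have h3 := LinearMap.congr_fun h1 (S.coact m)
  simp only [LinearMap.comp_apply, LinearEquiv.coe_coe] at h3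
  rw [h3, h2, ← S.coact_coassoc, LinearEquiv.symm_apply_apply]
  rfl

theorem preTau_preTau (n : ℕ) (m : M) (x : tpow k H n) : preTau S n (preTau S n (m ⊗ₜ x)) =
    swapMap (rotateTwo k H n x ∘ₗ Coalgebra.comul (R := k) (A := H)) (S.coact m) := by
  rw [preTau_tmul]
  refine coact_coact S _ _ _ (fun g m => ?_) m
  rw [preTau_tmul]
  congr 2

theorem preTau_pow_append : ∀ {p q n : ℕ} (h : q + p + 1 = n) (m : M) (a : tpow k H p)
    (b : tpow k H q), (preTau S n ^ (p + 1)) (m ⊗ₜ append k H p q n h (a ⊗ₜ b)) =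
      swapMap (append k H q p n (by omega) ∘ₗ TensorProduct.mk k _ _ b ∘ₗ
        (diagAct k H p).flip a) (S.coact m)
  | 0, q, n, h, m, a, b => by
    subst h
    induction a using single_induction with
    | h y =>
    rw [append_single, zero_add, pow_one, preTau_tmul]
    congr 2
    ext g
    simp only [LinearMap.comp_apply, LinearMap.flip_apply, TensorProduct.mk_apply, rotate_cons,
      diagAct_single]
    exact (append_single_right _ _ _).symm
  | p + 1, q, 0, h, m, a, b => by omega
  | p + 1, q, n + 1, h, m, a, b => by
    induction a using cons_induction with
    | h0 =>
      simp only [TensorProduct.zero_tmul, map_zero, TensorProduct.tmul_zero, LinearMap.comp_zero]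
      simp [swapMap]
    | ha x y hx hy =>
      simp only [TensorProduct.add_tmul, map_add, TensorProduct.tmul_add, hx, hy,
        LinearMap.comp_add]
      simp [swapMap, LinearMap.rTensor_add]
    | ht y a =>
    rw [append_cons (by omega), pow_succ, Module.End.mul_apply, preTau_tmul]
    refine (coact_coact S _ _ (append k H q (p + 1) (n + 1) (by omega) ∘ₗ
      TensorProduct.mk k _ _ b ∘ₗ (cons k H p).toLinearMap ∘ₗ
        TensorProduct.map (LinearMap.mulRight k y) ((diagAct k H p).flip a))
        (fun g m => ?_) m).trans ?_
    · rw [LinearMap.comp_apply, LinearMap.flip_apply, TensorProduct.mk_apply, rotate_cons,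
        snoc_append (by omega), preTau_pow_append (by omega)]
      congr 2
      ext g'
      simp [append_snoc]
    · congr 2
      ext g
      simp [diagAct_cons]

theorem preTau_pow (n : ℕ) (m : M) (x : tpow k H n) : (preTau S n ^ (n + 1)) (m ⊗ₜ x) =
    swapMap ((diagAct k H n).flip x) (S.coact m) := by
  rcases n with _ | n
  · induction x using single_induction with
    | h y =>
    rw [zero_add, pow_one, preTau_tmul]
    congr 2
  · induction x using cons_induction with
    | h0 => simp [swapMap]
    | ha x y hx hy =>
      simp only [map_add, TensorProduct.tmul_add, hx, hy]
      simp [swapMap, LinearMap.rTensor_add]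
    | ht y t =>
    rw [pow_succ, Module.End.mul_apply, preTau_tmul]
    refine (coact_coact S _ _ ((cons k H n).toLinearMap ∘ₗ
        TensorProduct.map (LinearMap.mulRight k y) ((diagAct k H n).flip t))
        (fun g m => ?_) m).trans ?_
    · rw [LinearMap.comp_apply, LinearMap.flip_apply, TensorProduct.mk_apply, rotate_cons,
        ← append_single_right, preTau_pow_append]
      congr 2
    · congr 2
      ext g
      simp [diagAct_cons]

end SAYD


section HopfCocyclic

variable {k : Type u} [Field k] {H : Type v} [Ring H] [HopfAlgebra k H]
  {M : Type w} [AddCommGroup M] [Module k M] (S : SAYDModule k H M)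

/-- The class of `m ⊗ x`. -/
noncomputable abbrev hopfMk (n : ℕ) : M ⊗[k] tpow k H n →ₗ[k] HopfCochain S n :=
  (balancing S n).mkQ

variable {S} in
theorem hopfCochain_induction {n : ℕ} {P : HopfCochain S n → Prop} (h0 : P 0)
    (h : ∀ m x, P (hopfMk S n (m ⊗ₜ x))) (ha : ∀ x y, P x → P y → P (x + y))
    (x : HopfCochain S n) : P x := by
  obtain ⟨x, rfl⟩ := Submodule.mkQ_surjective _ x
  induction x with
  | zero => rwa [map_zero]
  | add a b iha ihb => rw [map_add]; exact ha _ _ iha ihb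
  | tmul m x => exact h m x

theorem hopfMk_act (n : ℕ) (m : M) (h : H) (x : tpow k H n) :
    hopfMk S n (S.act m h ⊗ₜ x) = hopfMk S n (m ⊗ₜ diagAct k H n h x) :=
  (Submodule.Quotient.eq _).2 (Submodule.subset_span ⟨m, h, x, rfl⟩)

theorem cocyclic_d {n i : ℕ} (hi : i ≤ n) (m : M) (x : tpow k H n) :
    S.cocyclic.d n i (hopfMk S n (m ⊗ₜ x)) = hopfMk S (n + 1) (m ⊗ₜ comulNat k H n i x) := by
  have h : S.cocyclic.d n i = cochainMap S (comulAt k H n ⟨i, by omega⟩) (comulAt_diagAct n _) := by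
    rw [CocyclicOperators.d, dif_pos (by omega)]
    exact Fin.lastCases_castSucc (n := n + 1) (motive := fun _ => _)
      (⟨i, by omega⟩ : Fin (n + 1))
  rw [h, comulNat, dif_pos (by omega)]
  rfl

theorem cocyclic_s {n i : ℕ} (hi : i ≤ n) (m : M) (x : tpow k H (n + 1)) :
    S.cocyclic.s n i (hopfMk S (n + 1) (m ⊗ₜ x)) = hopfMk S n (m ⊗ₜ counitNat k H n i x) := by
  rw [CocyclicOperators.s, dif_pos (by omega), counitNat, dif_pos (by omega)]
  rfl

theorem cocyclic_τ (n : ℕ) (z : M ⊗[k] tpow k H n) :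
    S.cocyclic.τ n (hopfMk S n z) = hopfMk S n (preTau S n z) := rfl

theorem cocyclic_d_last (n : ℕ) (x : HopfCochain S n) :
    S.cocyclic.d n (n + 1) x = S.cocyclic.τ (n + 1) (S.cocyclic.d n 0 x) := by
  have h : S.cocyclic.d n (n + 1) =
      cochainTau S (n + 1) ∘ₗ cochainMap S (comulAt k H n 0) (comulAt_diagAct n 0) := by
    rw [CocyclicOperators.d, dif_pos (by omega)]
    exact Fin.lastCases_last (n := n + 1) (motive := fun _ => _)
  have h0 : S.cocyclic.d n 0 = cochainMap S (comulAt k H n 0) (comulAt_diagAct n 0) := by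
    rw [CocyclicOperators.d, dif_pos (by omega)]
    exact Fin.lastCases_castSucc (n := n + 1) (motive := fun _ => _)
      (last := cochainTau S (n + 1) ∘ₗ cochainMap S (comulAt k H n 0) (comulAt_diagAct n 0)) (0 : Fin (n + 1))
  rw [h, h0]
  rfl

theorem swapMap_counit (n : ℕ) (m : M) (x : tpow k H n) (L : H →ₗ[k] tpow k H n)
    (hL : ∀ g, L g = Coalgebra.counit (R := k) g • x) : swapMap L (S.coact m) = m ⊗ₜ x := by
  have : swapMap L = (TensorProduct.mk k M (tpow k H n)).flip x ∘ₗ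
      (TensorProduct.lid k M).toLinearMap ∘ₗ (Coalgebra.counit (R := k) (A := H)).rTensor M :=
    TensorProduct.ext' fun g m => by simp [swapMap_tmul, hL, TensorProduct.smul_tmul']
  rw [this]
  simp only [LinearMap.comp_apply, LinearEquiv.coe_coe, S.coact_counit]
  rfl

theorem lTensor_swapMap {P Q Q' : Type*} [AddCommGroup P] [Module k P] [AddCommGroup Q]
    [Module k Q] [AddCommGroup Q'] [Module k Q'] (f : Q →ₗ[k] Q') (L : P →ₗ[k] Q) (U : P ⊗[k] M) :
    f.lTensor M (swapMap L U) = swapMap (f ∘ₗ L) U := by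
  induction U with
  | zero => simp
  | add a b ha hb => simp only [map_add, ha, hb]
  | tmul g m => simp [swapMap_tmul]

theorem cocyclic_d_hopfMk {n i : ℕ} (hi : i ≤ n) (z : M ⊗[k] tpow k H n) :
    S.cocyclic.d n i (hopfMk S n z) = hopfMk S (n + 1) ((comulNat k H n i).lTensor M z) := by
  induction z with
  | zero => simp
  | add a b ha hb => simp only [map_add, ha, hb]
  | tmul m x => exact cocyclic_d S hi m x

theorem cocyclic_s_hopfMk {n i : ℕ} (hi : i ≤ n) (z : M ⊗[k] tpow k H (n + 1)) :
    S.cocyclic.s n i (hopfMk S (n + 1) z) = hopfMk S n ((counitNat k H n i).lTensor M z) := by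
  induction z with
  | zero => simp
  | add a b ha hb => simp only [map_add, ha, hb]
  | tmul m x => exact cocyclic_s S hi m x

theorem cocyclic_τ_pow (n : ℕ) (x : HopfCochain S n) : (S.cocyclic.τ n ^ (n + 1)) x = x := by
  have hpow : ∀ (r : ℕ) (z : M ⊗[k] tpow k H n),
      (S.cocyclic.τ n ^ r) (hopfMk S n z) = hopfMk S n ((preTau S n ^ r) z) := by
    intro r
    induction r with
    | zero => intro z; rfl
    | succ r ih =>
      intro z
      rw [pow_succ, pow_succ, Module.End.mul_apply, Module.End.mul_apply, cocyclic_τ, ih]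
  induction x using hopfCochain_induction with
  | h0 => simp
  | ha x y hx hy => simp only [map_add, hx, hy]
  | h m x =>
    rw [hpow, preTau_pow]
    have : hopfMk S n ∘ₗ swapMap ((diagAct k H n).flip x) =
        hopfMk S n ∘ₗ (TensorProduct.mk k M (tpow k H n)).flip x ∘ₗ
          TensorProduct.lift S.act.flip :=
      TensorProduct.ext' fun g m => by
        simp only [LinearMap.comp_apply, swapMap_tmul, LinearMap.flip_apply,
          TensorProduct.lift.tmul, TensorProduct.mk_apply, hopfMk_act]
    have h2 := LinearMap.congr_fun this (S.coact m)
    simp only [LinearMap.comp_apply, S.stable, LinearMap.flip_apply, TensorProduct.mk_apply] at h2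
    exact h2

/-- `C(H, M)` is a cocyclic module. -/
theorem SAYDModule.isCocyclic : S.cocyclic.IsCocyclic := by
  refine CocyclicOperators.isCocyclic_of_inner ?_ ?_ ?_ ?_ ?_ ?_ ?_ ?_ ?_ ?_ ?_ ?_ ?_
  · intro n i j hij hj x
    induction x using hopfCochain_induction with
    | h0 => simp only [map_zero]
    | ha x y hx hy => simp only [map_add, hx, hy]
    | h m x =>
      rw [cocyclic_d S (by omega), cocyclic_d S (by omega), cocyclic_d S (by omega),
        cocyclic_d S (by omega), comulNat_comulNat n i j hij]
  · intro n i j hij hj x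
    induction x using hopfCochain_induction with
    | h0 => simp only [map_zero]
    | ha x y hx hy => simp only [map_add, hx, hy]
    | h m x =>
      rw [cocyclic_d S (by omega), cocyclic_s S (by omega), cocyclic_s S (by omega),
        cocyclic_d S (by omega), counitNat_comulNat_lt n i j hij]
  · intro n i hi x
    induction x using hopfCochain_induction with
    | h0 => simp only [map_zero]
    | ha x y hx hy => simp only [map_add, hx, hy]
    | h m x =>
      rw [cocyclic_d S (by omega), cocyclic_s S (by omega), counitNat_comulNat_self n i hi]
  · intro n i hi x
    induction x using hopfCochain_induction with
    | h0 => simp only [map_zero]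
    | ha x y hx hy => simp only [map_add, hx, hy]
    | h m x =>
      rcases n with _ | n
      · omega
      rw [cocyclic_d S (by omega), cocyclic_s S (by omega),
        counitNat_comulNat_succ n i (by omega)]
  · intro n i j hij hi x
    induction x using hopfCochain_induction with
    | h0 => simp only [map_zero]
    | ha x y hx hy => simp only [map_add, hx, hy]
    | h m x =>
      rw [cocyclic_d S (by omega), cocyclic_s S (by omega), cocyclic_s S (by omega),
        cocyclic_d S (by omega), counitNat_comulNat_gt n i j hij]
  · intro n i j hij hj x
    induction x using hopfCochain_induction with
    | h0 => simp only [map_zero]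
    | ha x y hx hy => simp only [map_add, hx, hy]
    | h m x =>
      rw [cocyclic_s S (by omega), cocyclic_s S (by omega), cocyclic_s S (by omega),
        cocyclic_s S (by omega), counitNat_counitNat n i j hij]
  · intro n i hi x
    induction x using hopfCochain_induction with
    | h0 => simp only [map_zero]
    | ha x y hx hy => simp only [map_add, hx, hy]
    | h m x =>
      rw [cocyclic_d S (by omega), cocyclic_τ, cocyclic_τ, cocyclic_d_hopfMk S (by omega),
        preTau_tmul, preTau_tmul, lTensor_swapMap]
      congr 3
      ext g
      simp [rotate_comulNat_succ n i (by omega)]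
  · intro n x
    induction x using hopfCochain_induction with
    | h0 => simp only [map_zero]
    | ha x y hx hy => simp only [map_add, hx, hy]
    | h m x =>
      rw [cocyclic_d S (by omega), cocyclic_τ, cocyclic_τ, cocyclic_τ,
        cocyclic_d_hopfMk S (by omega), preTau_preTau, preTau_tmul, lTensor_swapMap]
      congr 3
      ext g
      simp [rotateTwo_comulNat_zero]
  · exact fun n x => (cocyclic_d_last S n x).symm
  · intro x
    induction x using hopfCochain_induction with
    | h0 => simp only [map_zero]
    | ha x y hx hy => simp only [map_add, hx, hy]
    | h m x =>
      induction x using single_induction with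
      | h y =>
      rw [cocyclic_d S (by omega), cocyclic_τ, cocyclic_s_hopfMk S (by omega), preTau_tmul,
        lTensor_swapMap]
      congr 1
      refine swapMap_counit S 0 m _ _ fun g => ?_
      simp only [LinearMap.comp_apply, LinearMap.flip_apply, TensorProduct.mk_apply, comulNat_zero]
      refine comul_counit_left (Coalgebra.counit (R := k) g • (single k H).toLinearMap)
        (counitNat k H 0 0 ∘ₗ rotate k H 1 ∘ₗ TensorProduct.mk k H (tpow k H 1) g ∘ₗ pair k H)
        (fun a b => ?_) y
      simp [pair_tmul, rotate_cons, snoc_single, counitNat_zero, smul_smul, mul_comm]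
  · intro n i hi x
    induction x using hopfCochain_induction with
    | h0 => simp only [map_zero]
    | ha x y hx hy => simp only [map_add, hx, hy]
    | h m x =>
      rw [cocyclic_s S (by omega), cocyclic_τ, cocyclic_τ, cocyclic_s_hopfMk S (by omega),
        preTau_tmul, preTau_tmul, lTensor_swapMap]
      congr 3
      ext g
      simp [rotate_counitNat_succ n i (by omega)]
  · intro n x
    induction x using hopfCochain_induction with
    | h0 => simp only [map_zero]
    | ha x y hx hy => simp only [map_add, hx, hy]
    | h m x =>
      rw [cocyclic_s S (by omega), cocyclic_τ, cocyclic_τ, cocyclic_τ,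
        cocyclic_s_hopfMk S (by omega), preTau_preTau, preTau_tmul, lTensor_swapMap]
      congr 3
      ext g
      simp [counitNat_rotateTwo]
  · exact fun n => LinearMap.ext (cocyclic_τ_pow S n)

end HopfCocyclic


section Split

variable {k : Type u} [Field k] {H : Type v} [Ring H] [HopfAlgebra k H]
  {K : Type v'} [Ring K] [HopfAlgebra k K]

variable (k) in
/-- `t ↦ y ⊗ t`. -/
noncomputable def consMap (n : ℕ) (y : H) : tpow k H n →ₗ[k] tpow k H (n + 1) :=
  (cons k H n).toLinearMap ∘ₗ TensorProduct.mk k H (tpow k H n) y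

variable (k) in
/-- `t ↦ t ⊗ z`. -/
noncomputable def snocMap (n : ℕ) (z : H) : tpow k H n →ₗ[k] tpow k H (n + 1) :=
  snoc k H n ∘ₗ (TensorProduct.mk k (tpow k H n) H).flip z

theorem consMap_apply (n : ℕ) (y : H) (t : tpow k H n) :
    consMap k n y t = cons k H n (y ⊗ₜ t) := rfl

theorem snocMap_apply (n : ℕ) (z : H) (t : tpow k H n) :
    snocMap k n z t = snoc k H n (t ⊗ₜ z) := rfl

theorem single_tensor_induction {P : tpow k (H ⊗[k] K) 0 → Prop} (h0 : P 0)
    (ht : ∀ y y', P (single k (H ⊗[k] K) (y ⊗ₜ y'))) (ha : ∀ x y, P x → P y → P (x + y))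
    (x : tpow k (H ⊗[k] K) 0) : P x := by
  obtain ⟨x, rfl⟩ := (single k (H ⊗[k] K)).surjective x
  induction x with
  | zero => rwa [map_zero]
  | add a b iha ihb => rw [map_add]; exact ha _ _ iha ihb
  | tmul y t => exact ht y t

theorem cons_tensor_induction {n : ℕ} {P : tpow k (H ⊗[k] K) (n + 1) → Prop} (h0 : P 0)
    (ht : ∀ y y' t, P (cons k (H ⊗[k] K) n ((y ⊗ₜ y') ⊗ₜ t))) (ha : ∀ x y, P x → P y → P (x + y))
    (x : tpow k (H ⊗[k] K) (n + 1)) : P x := by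
  induction x using cons_induction with
  | h0 => exact h0
  | ha x y hx hy => exact ha x y hx hy
  | ht y t =>
    induction y with
    | zero => simpa using h0
    | add a b iha ihb => rw [TensorProduct.add_tmul, map_add]; exact ha _ _ iha ihb
    | tmul y y' => exact ht y y' t

theorem tpowSplit_single_tmul (y : H) (y' : K) :
    tpowSplit k H K 0 (single k (H ⊗[k] K) (y ⊗ₜ y')) = single k H y ⊗ₜ single k K y' := by
  simp [consMap_apply, snocMap_apply, tpowSplit_single]

theorem tpowSplit_cons_tmul (n : ℕ) (y : H) (y' : K) (t : tpow k (H ⊗[k] K) n) :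
    tpowSplit k H K (n + 1) (cons k (H ⊗[k] K) n ((y ⊗ₜ y') ⊗ₜ t)) =
      TensorProduct.map (consMap k n y) (consMap k n y') (tpowSplit k H K n t) := by
  rw [tpowSplit_cons]
  generalize tpowSplit k H K n t = s
  induction s with
  | zero => simp
  | add a b ha hb => simp only [map_add, TensorProduct.tmul_add, ha, hb]
  | tmul p q => simp [consMap_apply]

theorem tpowSplit_pair (U : H ⊗[k] H) (V : K ⊗[k] K) :
    tpowSplit k H K 1 (pair k (H ⊗[k] K) (TensorProduct.tensorTensorTensorComm k H H K K
      (U ⊗ₜ V))) = pair k H U ⊗ₜ pair k K V := by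
  induction U with
  | zero => simp
  | add a b ha hb => simp only [map_add, TensorProduct.add_tmul, ha, hb]
  | tmul a b =>
    induction V with
    | zero => simp
    | add a b ha hb => simp only [map_add, TensorProduct.tmul_add, ha, hb]
    | tmul a' b' => simp [consMap_apply, snocMap_apply, pair_tmul, tpowSplit_cons_tmul, tpowSplit_single_tmul]

variable (k) in
/-- `t ↦ a ⊗ b ⊗ t`, linearly in `a ⊗ b`. -/
noncomputable def consTwoMap (n : ℕ) :
    H ⊗[k] H →ₗ[k] tpow k H n →ₗ[k] tpow k H (n + 1 + 1) :=
  TensorProduct.lift ((LinearMap.llcomp k (tpow k H n) (tpow k H (n + 1)) _).compl₁₂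
    ((TensorProduct.mk k H (tpow k H (n + 1))).compr₂ (cons k H (n + 1)).toLinearMap)
    ((TensorProduct.mk k H (tpow k H n)).compr₂ (cons k H n).toLinearMap))

theorem consTwoMap_tmul (n : ℕ) (a b : H) :
    consTwoMap k n (a ⊗ₜ b) = consMap k (n + 1) a ∘ₗ consMap k n b := by
  ext t
  simp [consMap_apply, consTwoMap]

theorem consTwo_eq (n : ℕ) (t : tpow k H n) (U : H ⊗[k] H) :
    consTwo k H n t U = consTwoMap k n U t := by
  induction U with
  | zero => simp
  | add a b ha hb => simp only [map_add, LinearMap.add_apply, ha, hb]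
  | tmul a b => simp [consMap_apply, snocMap_apply, consTwoMap_tmul, consTwo_tmul]

theorem tpowSplit_consTwo (n : ℕ) (t : tpow k (H ⊗[k] K) n) (U : H ⊗[k] H) (V : K ⊗[k] K) :
    tpowSplit k H K (n + 1 + 1) (consTwo k (H ⊗[k] K) n t
      (TensorProduct.tensorTensorTensorComm k H H K K (U ⊗ₜ V))) =
      TensorProduct.map (consTwoMap k n U) (consTwoMap k n V) (tpowSplit k H K n t) := by
  induction U with
  | zero => simp
  | add a b ha hb =>
    simp only [map_add, TensorProduct.add_tmul, TensorProduct.map_add_left, LinearMap.add_apply,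
      ha, hb]
  | tmul a b =>
    induction V with
    | zero => simp
    | add a b ha hb =>
      simp only [map_add, TensorProduct.tmul_add, TensorProduct.map_add_right,
        LinearMap.add_apply, ha, hb]
    | tmul a' b' =>
      rw [TensorProduct.tensorTensorTensorComm_tmul, consTwo_tmul, tpowSplit_cons_tmul,
        tpowSplit_cons_tmul, consTwoMap_tmul, consTwoMap_tmul, TensorProduct.map_comp]
      rfl

theorem comulNat_comp_consMap_zero (n : ℕ) (y : H) :
    comulNat k H (n + 1) 0 ∘ₗ consMap k n y =
      consTwoMap k n (Coalgebra.comul (R := k) y) := by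
  ext t
  simp [consMap_apply, snocMap_apply, comulNat_cons_zero, consTwo_eq]

theorem comulNat_comp_consMap_succ (n i : ℕ) (y : H) :
    comulNat k H (n + 1) (i + 1) ∘ₗ consMap k n y =
      consMap k (n + 1) y ∘ₗ comulNat k H n i := by
  ext t
  simp [consMap_apply, snocMap_apply, comulNat_cons_succ]

theorem counitNat_comp_consMap_succ (n i : ℕ) (y : H) :
    counitNat k H (n + 1) (i + 1) ∘ₗ consMap k (n + 1) y =
      consMap k n y ∘ₗ counitNat k H n i := by
  ext t
  simp [consMap_apply, snocMap_apply, counitNat_cons_succ]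

theorem counitNat_comp_consMap_zero (n : ℕ) (y z : H) :
    counitNat k H (n + 1) 0 ∘ₗ consMap k (n + 1) y ∘ₗ consMap k n z =
      Coalgebra.counit (R := k) z • consMap k n y := by
  ext t
  simp [consMap_apply, snocMap_apply, counitNat_cons_zero]

theorem map_map_apply {P P' P'' Q Q' Q'' : Type*} [AddCommGroup P] [Module k P]
    [AddCommGroup P'] [Module k P'] [AddCommGroup P''] [Module k P''] [AddCommGroup Q]
    [Module k Q] [AddCommGroup Q'] [Module k Q'] [AddCommGroup Q''] [Module k Q'']
    (f : P →ₗ[k] P') (f' : P' →ₗ[k] P'') (g : Q →ₗ[k] Q') (g' : Q' →ₗ[k] Q'') (s : P ⊗[k] Q) :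
    TensorProduct.map f' g' (TensorProduct.map f g s) =
      TensorProduct.map (f' ∘ₗ f) (g' ∘ₗ g) s := by
  rw [TensorProduct.map_comp]
  rfl

theorem tpowSplit_comulNat : ∀ (n i : ℕ) (x : tpow k (H ⊗[k] K) n),
    tpowSplit k H K (n + 1) (comulNat k (H ⊗[k] K) n i x) =
      TensorProduct.map (comulNat k H n i) (comulNat k K n i) (tpowSplit k H K n x)
  | 0, 0, x => by
    induction x using single_tensor_induction with
    | h0 => simp
    | ha x y hx hy => simp only [map_add, hx, hy]
    | ht y y' =>
      rw [comulNat_zero, TensorProduct.comul_tmul, tpowSplit_single_tmul, TensorProduct.map_tmul,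
        comulNat_zero, comulNat_zero]
      exact tpowSplit_pair _ _
  | 0, i + 1, x => by
    rw [comulNat_of_lt (by omega), comulNat_of_lt (by omega)]
    simp
  | n + 1, 0, x => by
    induction x using cons_tensor_induction with
    | h0 => simp
    | ha x y hx hy => simp only [map_add, hx, hy]
    | ht y y' t =>
      rw [comulNat_cons_zero, TensorProduct.comul_tmul, tpowSplit_cons_tmul, map_map_apply,
        comulNat_comp_consMap_zero, comulNat_comp_consMap_zero]
      exact tpowSplit_consTwo n t _ _
  | n + 1, i + 1, x => by
    induction x using cons_tensor_induction with
    | h0 => simp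
    | ha x y hx hy => simp only [map_add, hx, hy]
    | ht y y' t =>
      rw [comulNat_cons_succ, tpowSplit_cons_tmul, tpowSplit_cons_tmul, map_map_apply,
        comulNat_comp_consMap_succ, comulNat_comp_consMap_succ, tpowSplit_comulNat n i,
        map_map_apply]

theorem tpowSplit_counitNat : ∀ (n i : ℕ) (x : tpow k (H ⊗[k] K) (n + 1)),
    tpowSplit k H K n (counitNat k (H ⊗[k] K) n i x) =
      TensorProduct.map (counitNat k H n i) (counitNat k K n i) (tpowSplit k H K (n + 1) x)
  | 0, 0, x => by
    induction x using cons_tensor_induction with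
    | h0 => simp
    | ha x y hx hy => simp only [map_add, hx, hy]
    | ht y y' t =>
      induction t using single_tensor_induction with
      | h0 => simp
      | ha x y hx hy => simp only [map_add, TensorProduct.tmul_add, hx, hy]
      | ht z z' =>
        rw [counitNat_zero, tpowSplit_cons_tmul, tpowSplit_single_tmul, map_map_apply,
          TensorProduct.map_tmul, map_smul, tpowSplit_single_tmul]
        simp [consMap_apply, snocMap_apply, counitNat_zero, TensorProduct.smul_tmul', TensorProduct.tmul_smul,
          smul_smul, mul_comm]
  | 0, i + 1, x => by
    rw [counitNat_of_lt (by omega), counitNat_of_lt (by omega)]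
    simp
  | n + 1, 0, x => by
    induction x using cons_tensor_induction with
    | h0 => simp
    | ha x y hx hy => simp only [map_add, hx, hy]
    | ht y y' t =>
      induction t using cons_tensor_induction with
      | h0 => simp
      | ha x y hx hy => simp only [map_add, TensorProduct.tmul_add, hx, hy]
      | ht z z' t =>
        rw [counitNat_cons_zero, tpowSplit_cons_tmul, tpowSplit_cons_tmul, map_map_apply,
          map_map_apply, LinearMap.comp_assoc, LinearMap.comp_assoc,
          counitNat_comp_consMap_zero, counitNat_comp_consMap_zero, map_smul,
          tpowSplit_cons_tmul, TensorProduct.map_smul_left, TensorProduct.map_smul_right,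
          smul_smul]
        simp [consMap_apply, snocMap_apply, mul_comm]
  | n + 1, i + 1, x => by
    induction x using cons_tensor_induction with
    | h0 => simp
    | ha x y hx hy => simp only [map_add, hx, hy]
    | ht y y' t =>
      rw [counitNat_cons_succ, tpowSplit_cons_tmul, tpowSplit_cons_tmul, map_map_apply,
        counitNat_comp_consMap_succ, counitNat_comp_consMap_succ, tpowSplit_counitNat n i,
        map_map_apply]

theorem tpowSplit_snoc : ∀ (n : ℕ) (t : tpow k (H ⊗[k] K) n) (z : H) (z' : K),
    tpowSplit k H K (n + 1) (snoc k (H ⊗[k] K) n (t ⊗ₜ (z ⊗ₜ z'))) =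
      TensorProduct.map (snocMap k n z) (snocMap k n z') (tpowSplit k H K n t)
  | 0, t, z, z' => by
    induction t using single_tensor_induction with
    | h0 => simp
    | ha x y hx hy => simp only [map_add, TensorProduct.add_tmul, hx, hy]
    | ht y y' =>
      rw [snoc_single, tpowSplit_cons_tmul, tpowSplit_single_tmul, tpowSplit_single_tmul]
      simp [consMap_apply, snocMap_apply, snoc_single]
  | n + 1, t, z, z' => by
    induction t using cons_tensor_induction with
    | h0 => simp
    | ha x y hx hy => simp only [map_add, TensorProduct.add_tmul, hx, hy]
    | ht y y' t =>
      rw [snoc_cons, tpowSplit_cons_tmul, tpowSplit_cons_tmul, tpowSplit_snoc n, map_map_apply,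
        map_map_apply]
      congr 2

theorem tpowSplit_rotate (n : ℕ) (g : H) (g' : K) (x : tpow k (H ⊗[k] K) n) :
    tpowSplit k H K n (rotate k (H ⊗[k] K) n ((g ⊗ₜ g') ⊗ₜ x)) =
      TensorProduct.map (rotate k H n ∘ₗ TensorProduct.mk k _ _ g)
        (rotate k K n ∘ₗ TensorProduct.mk k _ _ g') (tpowSplit k H K n x) := by
  rcases n with _ | n
  · induction x using single_tensor_induction with
    | h0 => simp
    | ha x y hx hy => simp only [map_add, TensorProduct.tmul_add, hx, hy]
    | ht y y' =>
      rw [rotate_single, Algebra.TensorProduct.tmul_mul_tmul, tpowSplit_single_tmul,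
        tpowSplit_single_tmul]
      simp [consMap_apply, snocMap_apply, rotate_single]
  · induction x using cons_tensor_induction with
    | h0 => simp
    | ha x y hx hy => simp only [map_add, TensorProduct.tmul_add, hx, hy]
    | ht y y' t =>
      rw [rotate_cons, Algebra.TensorProduct.tmul_mul_tmul, tpowSplit_cons_tmul, tpowSplit_snoc,
        map_map_apply]
      congr 2

theorem tpowSplit_bijective : ∀ n, Function.Bijective (tpowSplit k H K n)
  | 0 => by
    have : tpowSplit k H K 0 = ((single k (H ⊗[k] K)).symm.trans
        (TensorProduct.congr (single k H) (single k K))).toLinearMap := rfl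
    rw [this]
    exact LinearEquiv.bijective _
  | n + 1 => by
    have : tpowSplit k H K (n + 1) = ((cons k (H ⊗[k] K) n).symm.trans
        (((LinearEquiv.ofBijective _ (tpowSplit_bijective n)).lTensor (H ⊗[k] K)).trans
          ((TensorProduct.tensorTensorTensorComm k H K (tpow k H n) (tpow k K n)).trans
            (TensorProduct.congr (cons k H n) (cons k K n))))).toLinearMap := rfl
    rw [this]
    exact LinearEquiv.bijective _
end Split


section OmegaIso

variable {k : Type u} [Field k] {H : Type v} [Ring H] [HopfAlgebra k H]
  {M : Type w} [AddCommGroup M] [Module k M]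
  {K : Type v'} [Ring K] [HopfAlgebra k K]
  {N : Type w'} [AddCommGroup N] [Module k N]
  (S : SAYDModule k H M) (T : SAYDModule k K N)

/-- `x ↦ [m ⊗ x]`. -/
noncomputable def classMap (n : ℕ) (m : M) : tpow k H n →ₗ[k] HopfCochain S n :=
  hopfMk S n ∘ₗ TensorProduct.mk k M (tpow k H n) m

theorem classMap_apply (n : ℕ) (m : M) (x : tpow k H n) :
    classMap S n m x = hopfMk S n (m ⊗ₜ x) := rfl

theorem omega_hopfMk (n : ℕ) (z : (M ⊗[k] N) ⊗[k] tpow k (H ⊗[k] K) n) :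
    omega S T n (hopfMk (S.tensor T) n z) = preOmega S T n z := rfl

theorem preOmega_tmul (n : ℕ) (m : M) (m' : N) (x : tpow k (H ⊗[k] K) n) :
    preOmega S T n ((m ⊗ₜ m') ⊗ₜ x) =
      TensorProduct.map (classMap S n m) (classMap T n m') (tpowSplit k H K n x) := by
  simp only [preOmega, LinearMap.comp_apply, LinearMap.lTensor_tmul, LinearEquiv.coe_coe]
  generalize tpowSplit k H K n x = s
  induction s with
  | zero => simp
  | add a b ha hb => simp only [map_add, TensorProduct.tmul_add, ha, hb]
  | tmul p q => simp [classMap_apply]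

theorem hopfCochain_tensor_induction {n : ℕ} {P : HopfCochain (S.tensor T) n → Prop} (h0 : P 0)
    (h : ∀ m m' x, P (hopfMk (S.tensor T) n ((m ⊗ₜ m') ⊗ₜ x)))
    (ha : ∀ x y, P x → P y → P (x + y)) (x : HopfCochain (S.tensor T) n) : P x := by
  induction x using hopfCochain_induction with
  | h0 => exact h0
  | ha x y hx hy => exact ha x y hx hy
  | h m x =>
    induction m with
    | zero => simpa using h0
    | add a b iha ihb => rw [TensorProduct.add_tmul, map_add]; exact ha _ _ iha ihb
    | tmul m m' => exact h m m' x

theorem omega_d {n i : ℕ} (hi : i ≤ n) (z : HopfCochain (S.tensor T) n) :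
    omega S T (n + 1) ((S.tensor T).cocyclic.d n i z) =
      (CocyclicOperators.diag S.cocyclic T.cocyclic).d n i (omega S T n z) := by
  rw [CocyclicOperators.diag_d]
  induction z using hopfCochain_tensor_induction with
  | h0 => simp only [map_zero]
  | ha x y hx hy => simp only [map_add, hx, hy]
  | h m m' x =>
    rw [cocyclic_d _ hi, omega_hopfMk, omega_hopfMk, preOmega_tmul, preOmega_tmul,
      tpowSplit_comulNat, map_map_apply]
    refine Eq.trans ?_ (map_map_apply _ _ _ _ _).symm
    congr 2
    · exact LinearMap.ext fun x => (cocyclic_d S hi m x).symm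
    · exact LinearMap.ext fun x => (cocyclic_d T hi m' x).symm

theorem omega_s {n i : ℕ} (hi : i ≤ n) (z : HopfCochain (S.tensor T) (n + 1)) :
    omega S T n ((S.tensor T).cocyclic.s n i z) =
      (CocyclicOperators.diag S.cocyclic T.cocyclic).s n i (omega S T (n + 1) z) := by
  rw [CocyclicOperators.diag_s]
  induction z using hopfCochain_tensor_induction with
  | h0 => simp only [map_zero]
  | ha x y hx hy => simp only [map_add, hx, hy]
  | h m m' x =>
    rw [cocyclic_s _ hi, omega_hopfMk, omega_hopfMk, preOmega_tmul, preOmega_tmul,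
      tpowSplit_counitNat, map_map_apply]
    refine Eq.trans ?_ (map_map_apply _ _ _ _ _).symm
    congr 2
    · exact LinearMap.ext fun x => (cocyclic_s S hi m x).symm
    · exact LinearMap.ext fun x => (cocyclic_s T hi m' x).symm

theorem omega_τ (n : ℕ) (z : HopfCochain (S.tensor T) n) :
    omega S T n ((S.tensor T).cocyclic.τ n z) =
      (CocyclicOperators.diag S.cocyclic T.cocyclic).τ n (omega S T n z) := by
  change _ = TensorProduct.map (S.cocyclic.τ n) (T.cocyclic.τ n) _
  induction z using hopfCochain_tensor_induction with
  | h0 => simp only [map_zero]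
  | ha x y hx hy => simp only [map_add, hx, hy]
  | h m m' x =>
    rw [cocyclic_τ, omega_hopfMk, omega_hopfMk, preOmega_tmul, preTau_tmul]
    have h1 : ∀ (U : H ⊗[k] M) (V : K ⊗[k] N),
        preOmega S T n (swapMap (rotate k (H ⊗[k] K) n ∘ₗ
          (TensorProduct.mk k (H ⊗[k] K) (tpow k (H ⊗[k] K) n)).flip x)
          (TensorProduct.tensorTensorTensorComm k H M K N (U ⊗ₜ V))) =
        TensorProduct.map
          (hopfMk S n ∘ₗ (rotate k H n).lTensor M ∘ₗ
            (TensorProduct.leftComm k H M (tpow k H n)).toLinearMap ∘ₗ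
              (TensorProduct.assoc k H M (tpow k H n)).toLinearMap ∘ₗ
                TensorProduct.mk k (H ⊗[k] M) (tpow k H n) U)
          (hopfMk T n ∘ₗ (rotate k K n).lTensor N ∘ₗ
            (TensorProduct.leftComm k K N (tpow k K n)).toLinearMap ∘ₗ
              (TensorProduct.assoc k K N (tpow k K n)).toLinearMap ∘ₗ
                TensorProduct.mk k (K ⊗[k] N) (tpow k K n) V) (tpowSplit k H K n x) := by
      intro U V
      induction U with
      | zero => simp
      | add a b ha hb =>
        simp only [map_add, TensorProduct.add_tmul, LinearMap.comp_add,
          TensorProduct.map_add_left, LinearMap.add_apply, ha, hb]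
      | tmul g m =>
        induction V with
        | zero => simp
        | add a b ha hb =>
          simp only [map_add, TensorProduct.tmul_add, LinearMap.comp_add,
            TensorProduct.map_add_right, LinearMap.add_apply, ha, hb]
        | tmul g' m' =>
          rw [TensorProduct.tensorTensorTensorComm_tmul, swapMap_tmul, preOmega_tmul,
            LinearMap.comp_apply, LinearMap.flip_apply, TensorProduct.mk_apply, tpowSplit_rotate,
            map_map_apply]
          congr 2
    exact (h1 (S.coact m) (T.coact m')).trans (map_map_apply (classMap S n m) (S.cocyclic.τ n)
      (classMap T n m') (T.cocyclic.τ n) _).symm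

theorem omega_hochschild (n : ℕ) (z : HopfCochain (S.tensor T) n) :
    omega S T (n + 1) ((S.tensor T).cocyclic.hochschild n z) =
      (CocyclicOperators.diag S.cocyclic T.cocyclic).hochschild n (omega S T n z) := by
  rw [CocyclicOperators.hochschild_apply, CocyclicOperators.hochschild_apply, map_sum]
  refine Finset.sum_congr rfl fun i hi => ?_
  rw [Finset.mem_range] at hi
  rw [map_smul]
  congr 1
  rcases Nat.lt_or_ge i (n + 1) with hi' | hi'
  · exact omega_d S T (by omega) z
  · obtain rfl : i = n + 1 := by omega
    rw [cocyclic_d_last, omega_τ, omega_d S T (by omega)]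
    exact (S.isCocyclic.diag T.isCocyclic).τ_δ_zero n _

theorem omega_connes (n : ℕ) (z : HopfCochain (S.tensor T) (n + 1)) :
    omega S T n ((S.tensor T).cocyclic.connes n z) =
      (CocyclicOperators.diag S.cocyclic T.cocyclic).connes n (omega S T (n + 1) z) := by
  have hsgn : ∀ n z, omega S T n ((S.tensor T).cocyclic.signedTau n z) =
      (CocyclicOperators.diag S.cocyclic T.cocyclic).signedTau n (omega S T n z) := by
    intro n z
    rw [CocyclicOperators.signedTau, CocyclicOperators.signedTau, LinearMap.smul_apply,
      LinearMap.smul_apply, map_smul, omega_τ]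
  have hpow : ∀ i n z, omega S T n (((S.tensor T).cocyclic.signedTau n ^ i) z) =
      ((CocyclicOperators.diag S.cocyclic T.cocyclic).signedTau n ^ i) (omega S T n z) := by
    intro i
    induction i with
    | zero => intro n z; rfl
    | succ i ih =>
      intro n z
      rw [pow_succ, pow_succ, Module.End.mul_apply, Module.End.mul_apply, ih, hsgn]
  have hσ : ∀ z, omega S T n ((S.tensor T).cocyclic.σ n (Fin.last n) z) =
      (CocyclicOperators.diag S.cocyclic T.cocyclic).σ n (Fin.last n) (omega S T (n + 1) z) := by
    intro z
    have h := omega_s S T (le_refl n) z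
    rw [CocyclicOperators.s, CocyclicOperators.s, dif_pos (by omega), dif_pos (by omega)] at h
    exact h
  rw [CocyclicOperators.connes, CocyclicOperators.connes]
  simp only [LinearMap.comp_apply, LinearMap.sub_apply, LinearMap.id_apply, LinearMap.sum_apply,
    map_sum, hpow]
  refine Finset.sum_congr rfl fun i _ => ?_
  rw [hσ, omega_τ, map_sub, hsgn]

theorem omega_surjective (n : ℕ) : Function.Surjective (omega S T n) := by
  have h : Function.Surjective (preOmega S T n) :=
    (TensorProduct.map_surjective (Submodule.mkQ_surjective (balancing S n))
      (Submodule.mkQ_surjective (balancing T n))).comp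
      ((TensorProduct.tensorTensorTensorComm k M N (tpow k H n) (tpow k K n)).surjective.comp
        (LinearMap.lTensor_surjective (M ⊗[k] N)
          (tpowSplit_bijective (k := k) (H := H) (K := K) n).surjective))
  intro y
  obtain ⟨x, rfl⟩ := h y
  exact ⟨hopfMk (S.tensor T) n x, rfl⟩

/-- The inverse of the identification of `(M ⊗ N) ⊗ (H ⊗ K)^{⊗(n+1)}` with
`(M ⊗ H^{⊗(n+1)}) ⊗ (N ⊗ K^{⊗(n+1)})`. -/
noncomputable def splitEquiv (n : ℕ) : (M ⊗[k] N) ⊗[k] tpow k (H ⊗[k] K) n ≃ₗ[k]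
    (M ⊗[k] tpow k H n) ⊗[k] (N ⊗[k] tpow k K n) :=
  ((LinearEquiv.ofBijective _ (tpowSplit_bijective n)).lTensor (M ⊗[k] N)).trans
    (TensorProduct.tensorTensorTensorComm k M N (tpow k H n) (tpow k K n))

variable {S} {T} in
theorem splitEquiv_symm_mem_left {n : ℕ} (a : M ⊗[k] tpow k H n) (b : N ⊗[k] tpow k K n)
    (h : a ∈ balancing S n) : (splitEquiv (K := K) (N := N) n).symm (a ⊗ₜ b) ∈
      balancing (S.tensor T) n := by
  induction h using Submodule.span_induction with
  | zero => simp
  | add x y _ _ hx hy => rw [TensorProduct.add_tmul, map_add]; exact add_mem hx hy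
  | smul c x _ hx => rw [← TensorProduct.smul_tmul', map_smul]; exact Submodule.smul_mem _ c hx
  | mem x hx =>
    obtain ⟨m, h, x, rfl⟩ := hx
    induction b with
    | zero => simp
    | add x y hx hy => rw [TensorProduct.tmul_add, map_add]; exact add_mem hx hy
    | tmul m' y =>
      obtain ⟨z, hz⟩ := (tpowSplit_bijective (k := k) (H := H) (K := K) n).surjective (x ⊗ₜ y)
      have e : (splitEquiv n).symm ((S.act m h ⊗ₜ[k] x - m ⊗ₜ[k] diagAct k H n h x) ⊗ₜ[k]
          (m' ⊗ₜ[k] y)) = (S.tensor T).act (m ⊗ₜ m') (h ⊗ₜ 1) ⊗ₜ z -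
            (m ⊗ₜ m') ⊗ₜ diagAct k (H ⊗[k] K) n (h ⊗ₜ 1) z := by
        rw [LinearEquiv.symm_apply_eq, map_sub, TensorProduct.sub_tmul]
        congr 1
        · change _ = TensorProduct.tensorTensorTensorComm k M N _ _
            (tensorAct S.act T.act (m ⊗ₜ m') (h ⊗ₜ 1) ⊗ₜ tpowSplit k H K n z)
          rw [hz, tensorAct_tmul, T.act_one, TensorProduct.tensorTensorTensorComm_tmul]
        · change _ = TensorProduct.tensorTensorTensorComm k M N _ _
            ((m ⊗ₜ m') ⊗ₜ tpowSplit k H K n (diagAct k (H ⊗[k] K) n (h ⊗ₜ 1) z))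
          rw [tpowSplit_diagAct, hz, TensorProduct.map_tmul, diagAct_one,
            TensorProduct.tensorTensorTensorComm_tmul]
      rw [e]
      exact Submodule.subset_span ⟨_, _, _, rfl⟩

variable {S} {T} in
theorem splitEquiv_symm_mem_right {n : ℕ} (a : M ⊗[k] tpow k H n) (b : N ⊗[k] tpow k K n)
    (h : b ∈ balancing T n) : (splitEquiv (H := H) (M := M) n).symm (a ⊗ₜ b) ∈
      balancing (S.tensor T) n := by
  induction h using Submodule.span_induction with
  | zero => simp
  | add x y _ _ hx hy => rw [TensorProduct.tmul_add, map_add]; exact add_mem hx hy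
  | smul c x _ hx => rw [TensorProduct.tmul_smul, map_smul]; exact Submodule.smul_mem _ c hx
  | mem y hy =>
    obtain ⟨m', h, y, rfl⟩ := hy
    induction a with
    | zero => simp
    | add x y hx hy => rw [TensorProduct.add_tmul, map_add]; exact add_mem hx hy
    | tmul m x =>
      obtain ⟨z, hz⟩ := (tpowSplit_bijective (k := k) (H := H) (K := K) n).surjective (x ⊗ₜ y)
      have e : (splitEquiv n).symm ((m ⊗ₜ[k] x) ⊗ₜ[k]
          (T.act m' h ⊗ₜ[k] y - m' ⊗ₜ[k] diagAct k K n h y)) =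
            (S.tensor T).act (m ⊗ₜ m') (1 ⊗ₜ h) ⊗ₜ z -
            (m ⊗ₜ m') ⊗ₜ diagAct k (H ⊗[k] K) n (1 ⊗ₜ h) z := by
        rw [LinearEquiv.symm_apply_eq, map_sub, TensorProduct.tmul_sub]
        congr 1
        · change _ = TensorProduct.tensorTensorTensorComm k M N _ _
            (tensorAct S.act T.act (m ⊗ₜ m') (1 ⊗ₜ h) ⊗ₜ tpowSplit k H K n z)
          rw [hz, tensorAct_tmul, S.act_one, TensorProduct.tensorTensorTensorComm_tmul]
        · change _ = TensorProduct.tensorTensorTensorComm k M N _ _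
            ((m ⊗ₜ m') ⊗ₜ tpowSplit k H K n (diagAct k (H ⊗[k] K) n (1 ⊗ₜ h) z))
          rw [tpowSplit_diagAct, hz, TensorProduct.map_tmul, diagAct_one,
            TensorProduct.tensorTensorTensorComm_tmul]
      rw [e]
      exact Submodule.subset_span ⟨_, _, _, rfl⟩

theorem omega_injective (n : ℕ) : Function.Injective (omega S T n) := by
  rw [← LinearMap.ker_eq_bot, LinearMap.ker_eq_bot']
  intro z hz
  obtain ⟨z, rfl⟩ := Submodule.mkQ_surjective _ z
  have h1 : TensorProduct.map (balancing S n).mkQ (balancing T n).mkQ (splitEquiv n z) = 0 := hz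
  have h2 : splitEquiv n z ∈ LinearMap.ker
      (TensorProduct.map (balancing S n).mkQ (balancing T n).mkQ) := h1
  rw [TensorProduct.map_ker (LinearMap.exact_subtype_mkQ _) (Submodule.mkQ_surjective _)
    (LinearMap.exact_subtype_mkQ _) (Submodule.mkQ_surjective _)] at h2
  refine (Submodule.Quotient.mk_eq_zero _).2 ?_
  rw [← (splitEquiv n).symm_apply_apply z]
  obtain ⟨_, ⟨a, rfl⟩, _, ⟨b, rfl⟩, hab⟩ := Submodule.mem_sup.1 h2
  rw [← hab, map_add]
  clear hab
  refine add_mem ?_ ?_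
  · induction a with
    | zero => simp
    | add x y hx hy => rw [map_add, map_add]; exact add_mem hx hy
    | tmul x y => exact splitEquiv_symm_mem_right _ _ y.2
  · induction b with
    | zero => simp
    | add x y hx hy => rw [map_add, map_add]; exact add_mem hx hy
    | tmul x y => exact splitEquiv_symm_mem_left _ _ x.2

end OmegaIso


variable {k : Type u} [Field k]

namespace MixedOperators

section Zigzag

theorem totToPer_mem_range {C : MixedOperators.{u, v} k} {n : ℕ} {z : C.Tot n}
    (hz : z ∈ coboundaries C.totD n) :
    C.totToPer n z ∈ LinearMap.range
      (C.perD ((n : ZMod 2) + 1) (n : ZMod 2) (zmod_two_add_two _).symm) := by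
  cases n with
  | zero =>
    obtain rfl : z = 0 := hz
    rw [map_zero]
    exact zero_mem _
  | succ n =>
    obtain ⟨y, rfl⟩ := hz
    have hp : (n : ZMod 2) = ((n + 1 : ℕ) : ZMod 2) + 1 := by
      rw [Nat.cast_add, Nat.cast_one, zmod_two_add_two]
    exact ⟨C.totPer n _ hp y, C.perD_totPer hp _ rfl y⟩

theorem represents_totToPer {C : MixedOperators.{u, v} k} {n : ℕ} {z : C.Tot n} {x : C.HC n}
    (hz : Represents z x) : ∃ y : C.HP (n : ZMod 2), Represents (C.totToPer n z) y := by
  have h : C.perD (n : ZMod 2) ((n : ZMod 2) + 1) rfl (C.totToPer n z) = 0 := by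
    have h := C.perD_totPer (n := n) rfl (rfl : (n : ZMod 2) + 1 = _) (by push_cast; rfl) z
    rw [hz.ker, map_zero] at h
    exact h
  exact ⟨_, represents_mk _ h⟩

theorem TotMap.per_totToPer {C : MixedOperators.{u, v} k} {D : MixedOperators.{u, w} k}
    (F : TotMap C D) {n : ℕ} (z : C.Tot n) :
    F.per (n : ZMod 2) (C.totToPer n z) = D.totToPer n (F.tot n z) := F.per_totPer rfl z

theorem TotMap.equiv_S {C : MixedOperators.{u, v} k} {D : MixedOperators.{u, w} k}
    (F : TotMap C D) (h : IsQuasiIso C.totD D.totD F.tot) (n : ℕ) (x : C.HC n) :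
    h.equiv (n + 2) (C.S n x) = D.S n (h.equiv n x) := by
  obtain ⟨z, hz⟩ := exists_represents x
  have h1 := h.represents (represents_S hz)
  rw [F.tot_totS] at h1
  exact h1.eq (represents_S (h.represents hz))

/-- Maps of total complexes relating a mixed complex `E` to `T`, through `N` and `G`, such that
`E → G` is an isomorphism on the components of `u⁰` and `aw` restricts to `N → G`. -/
structure Zigzag (E : MixedOperators.{u, v} k) (G : MixedOperators.{u, w} k)
    (N : MixedOperators.{u, w'} k) (T : MixedOperators.{u, v'} k) where
  isMixed_E : E.IsMixed
  isMixed_G : G.IsMixed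
  isMixed_N : N.IsMixed
  isMixed_T : T.IsMixed
  toG : TotMap E G
  ofN : TotMap N G
  toT : TotMap N T
  aw : ∀ n, T.X n →ₗ[k] G.X n
  bijective_toG : ∀ n, Function.Bijective (toG.top n)
  isQuasiIso_ofN : IsQuasiIso N.b G.b ofN.top
  isQuasiIso_toT : IsQuasiIso N.b T.b toT.top
  toG_b : ∀ n x, toG.top (n + 1) (E.b n x) = G.b n (toG.top n x)
  aw_b : ∀ n x, aw (n + 1) (T.b n x) = G.b n (aw n x)
  aw_toT : ∀ n x, aw n (toT.top n x) = ofN.top n x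

namespace Zigzag

variable {E : MixedOperators.{u, v} k} {G : MixedOperators.{u, w} k}
    {N : MixedOperators.{u, w'} k} {T : MixedOperators.{u, v'} k} (Z : Zigzag E G N T)

include Z

theorem isQuasiIso_toG : IsQuasiIso E.b G.b Z.toG.top :=
  isQuasiIso_of_cohomology Z.toG_b
    (by
      intro n x hx h
      cases n with
      | zero =>
        have h' : Z.toG.top 0 x = 0 := h
        rw [(Z.bijective_toG 0).injective (h'.trans (map_zero _).symm)]
        exact zero_mem _
      | succ n =>
        obtain ⟨y, hy⟩ := h
        obtain ⟨y, rfl⟩ := (Z.bijective_toG n).surjective y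
        rw [← Z.toG_b] at hy
        exact ⟨y, (Z.bijective_toG (n + 1)).injective hy⟩)
    (by
      intro n z hz
      obtain ⟨x, rfl⟩ := (Z.bijective_toG n).surjective z
      rw [← Z.toG_b] at hz
      refine ⟨x, (Z.bijective_toG (n + 1)).injective (hz.trans (map_zero _).symm), ?_⟩
      rw [sub_self]
      exact zero_mem _)

theorem tot_toG : IsQuasiIso E.totD G.totD Z.toG.tot :=
  Z.toG.isQuasiIso Z.isMixed_E Z.isMixed_G Z.isQuasiIso_toG

theorem tot_ofN : IsQuasiIso N.totD G.totD Z.ofN.tot :=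
  Z.ofN.isQuasiIso Z.isMixed_N Z.isMixed_G Z.isQuasiIso_ofN

theorem tot_toT : IsQuasiIso N.totD T.totD Z.toT.tot :=
  Z.toT.isQuasiIso Z.isMixed_N Z.isMixed_T Z.isQuasiIso_toT

/-- The isomorphism on cyclic cohomology. -/
noncomputable def hc (n : ℕ) : E.HC n ≃ₗ[k] T.HC n :=
  (Z.tot_toG.equiv n).trans ((Z.tot_ofN.equiv n).symm.trans (Z.tot_toT.equiv n))

/-- The isomorphism on periodic cyclic cohomology. -/
noncomputable def hp (p : ZMod 2) : E.HP p ≃ₗ[k] T.HP p :=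
  (Z.toG.perEquiv Z.isMixed_E Z.isMixed_G Z.isQuasiIso_toG p).trans
    ((Z.ofN.perEquiv Z.isMixed_N Z.isMixed_G Z.isQuasiIso_ofN p).symm.trans
      (Z.toT.perEquiv Z.isMixed_N Z.isMixed_T Z.isQuasiIso_toT p))

omit Z in
theorem trans_symm_trans_apply {A B C D : Type*} [AddCommGroup A] [AddCommGroup B]
    [AddCommGroup C] [AddCommGroup D] [Module k A] [Module k B] [Module k C] [Module k D]
    (e : A ≃ₗ[k] B) (e' : C ≃ₗ[k] B) (e'' : C ≃ₗ[k] D) {a : A} {c : C} (h : e a = e' c) :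
    e.trans (e'.symm.trans e'') a = e'' c := by
  simp [h]

theorem hc_S (n : ℕ) (x : E.HC n) : Z.hc (n + 2) (E.S n x) = T.S n (Z.hc n x) := by
  change Z.tot_toT.equiv (n + 2) ((Z.tot_ofN.equiv (n + 2)).symm
    (Z.tot_toG.equiv (n + 2) (E.S n x))) =
    T.S n (Z.tot_toT.equiv n ((Z.tot_ofN.equiv n).symm (Z.tot_toG.equiv n x)))
  rw [Z.toG.equiv_S, ← Z.toT.equiv_S Z.tot_toT]
  congr 1
  rw [LinearEquiv.symm_apply_eq, Z.ofN.equiv_S, LinearEquiv.apply_symm_apply]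

/-- Representatives of a class and of its image come from the same cocycle of `N`. -/
theorem exists_representative {n : ℕ} {x : E.HC n} {z : E.Tot n} {t : T.Tot n}
    (hz : Represents z x) (ht : Represents t (Z.hc n x)) :
    ∃ w : N.Tot n, N.totD n w = 0 ∧ Z.toG.tot n z - Z.ofN.tot n w ∈ coboundaries G.totD n ∧
      t - Z.toT.tot n w ∈ coboundaries T.totD n := by
  obtain ⟨w, hw⟩ := exists_represents ((Z.tot_ofN.equiv n).symm (Z.tot_toG.equiv n x))
  refine ⟨w, hw.ker, ?_, ?_⟩
  · have h := Z.tot_ofN.represents hw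
    rw [LinearEquiv.apply_symm_apply] at h
    exact ((Z.tot_toG.represents hz).eq_iff h).1 rfl
  · exact (ht.eq_iff (Z.tot_toT.represents hw)).1 rfl

theorem represents_of_aw {n : ℕ} {z : E.X n} {t : T.X n} (hz : E.b n z = 0) (ht : T.b n t = 0)
    (h : Z.toG.top n z - Z.aw n t ∈ coboundaries G.b n) :
    ∃ (y : E.HH n) (z' : E.X n), Represents z y ∧ Represents z' y ∧
      Z.toG.top n z' = Z.aw n t := by
  obtain ⟨z', hz'⟩ := (Z.bijective_toG n).surjective (Z.aw n t)
  have hb : E.b n z' = 0 := by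
    refine (Z.bijective_toG (n + 1)).injective ?_
    rw [Z.toG_b, hz', ← Z.aw_b, ht, map_zero, map_zero]
  refine ⟨Cohomology.mk _ _ z hz, z', represents_mk z hz, (represents_mk z hz).congr hb ?_, hz'⟩
  refine Z.isQuasiIso_toG.mem_of_map_mem (by rw [map_sub, hb, hz, sub_zero]) ?_
  rw [map_sub, hz', ← neg_sub]
  exact Submodule.neg_mem _ h

theorem hc_totTop {n : ℕ} {x : E.HC n} {z : E.Tot n} {t : T.Tot n}
    (hz : Represents z x) (ht : Represents t (Z.hc n x)) :
    ∃ (y : E.HH n) (z' : E.X n), Represents (E.totTop n z) y ∧ Represents z' y ∧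
      Z.toG.top n z' = Z.aw n (T.totTop n t) := by
  obtain ⟨w, hw, h1, h2⟩ := Z.exists_representative hz ht
  refine Z.represents_of_aw ?_ ?_ ?_
  · rw [← totTop_totD, hz.ker, map_zero]
  · rw [← totTop_totD, ht.ker, map_zero]
  have h3 := map_mem_coboundaries G.totTop_totD h1
  have h4 := map_mem_coboundaries Z.aw_b (map_mem_coboundaries T.totTop_totD h2)
  rw [map_sub, Z.toG.totTop_tot, Z.ofN.totTop_tot] at h3
  rw [map_sub, map_sub, Z.toT.totTop_tot, Z.aw_toT] at h4
  rw [← sub_sub_sub_cancel_right]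
  exact Submodule.sub_mem _ h3 h4

theorem hp_totToPer {n : ℕ} {x : E.HC n} {z : E.Tot n} {t : T.Tot n}
    (hz : Represents z x) (ht : Represents t (Z.hc n x)) :
    ∃ y : E.HP (n : ZMod 2), Represents (E.totToPer n z) y ∧
      Represents (T.totToPer n t) (Z.hp (n : ZMod 2) y) := by
  obtain ⟨w, hw, h1, h2⟩ := Z.exists_representative hz ht
  obtain ⟨y, hy⟩ := represents_totToPer hz
  obtain ⟨y', hy'⟩ := represents_totToPer (represents_mk w hw)
  obtain ⟨y'', hy''⟩ := represents_totToPer ht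
  refine ⟨y, hy, ?_⟩
  have h3 := Z.toG.represents_perEquiv Z.isMixed_E Z.isMixed_G Z.isQuasiIso_toG hy
  have h4 := Z.ofN.represents_perEquiv Z.isMixed_N Z.isMixed_G Z.isQuasiIso_ofN hy'
  have h5 := Z.toT.represents_perEquiv Z.isMixed_N Z.isMixed_T Z.isQuasiIso_toT hy'
  rw [TotMap.per_totToPer] at h3 h4 h5
  have h6 : Z.hp (n : ZMod 2) y =
      Z.toT.perEquiv Z.isMixed_N Z.isMixed_T Z.isQuasiIso_toT _ y' := by
    refine trans_symm_trans_apply _ _ _ ((h3.eq_iff h4).2 ?_)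
    rw [← map_sub]
    exact totToPer_mem_range h1
  rw [h6]
  refine h5.congr hy''.ker ?_
  rw [← map_sub]
  exact totToPer_mem_range h2

/-- The isomorphism on Hochschild cohomology. -/
noncomputable def hh (n : ℕ) : T.HH n ≃ₗ[k] E.HH n :=
  (Z.isQuasiIso_toT.equiv n).symm.trans
    ((Z.isQuasiIso_ofN.equiv n).trans (Z.isQuasiIso_toG.equiv n).symm)

theorem represents_hh {n : ℕ} {t : T.X n} {x : T.HH n} (ht : Represents t x) :
    ∃ z : E.X n, Z.toG.top n z = Z.aw n t ∧ Represents z (Z.hh n x) := by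
  obtain ⟨w, hw⟩ := exists_represents ((Z.isQuasiIso_toT.equiv n).symm x)
  obtain ⟨z, hz⟩ := exists_represents (Z.hh n x)
  have h1 := Z.isQuasiIso_toT.represents hw
  rw [LinearEquiv.apply_symm_apply] at h1
  have h2 := map_mem_coboundaries Z.aw_b ((ht.eq_iff h1).1 rfl)
  rw [map_sub, Z.aw_toT] at h2
  have h3 := Z.isQuasiIso_toG.represents hz
  have e : Z.isQuasiIso_toG.equiv n (Z.hh n x) =
      Z.isQuasiIso_ofN.equiv n ((Z.isQuasiIso_toT.equiv n).symm x) :=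
    LinearEquiv.apply_symm_apply _ _
  have h4 := (h3.eq_iff (Z.isQuasiIso_ofN.represents hw)).1 e
  obtain ⟨y, z', hy, hy', h5⟩ := Z.represents_of_aw hz.ker ht.ker (by
    rw [← sub_sub_sub_cancel_right]
    exact Submodule.sub_mem _ h4 h2)
  exact ⟨z', h5, hy.eq hz ▸ hy'⟩

end Zigzag

end Zigzag

end MixedOperators


variable {k : Type u} [Field k]

namespace CocyclicOperators

section Comparison

variable {C : CocyclicOperators.{u, v} k} {D : CocyclicOperators.{u, w} k}

theorem IsCocyclic.lastCofaces_eq (hC : C.IsCocyclic) {i n : ℕ} (h : i ≤ n) :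
    C.lastCofaces h = hC.cos.lasts h := by
  refine LinearMap.ext fun x => ?_
  induction n, h using Nat.le_induction with
  | base => rw [Cosimplicial.lasts_self, lastCofaces, Nat.leRecOn_self]; rfl
  | succ n h ih =>
    rw [hC.cos.lasts_succ h, lastCofaces, Nat.leRecOn_succ h, LinearMap.comp_apply]
    have e : C.δ n (Fin.last (n + 1)) = C.d n (n + 1) := by
      rw [d, dif_pos (by omega)]
      rfl
    rw [e]
    exact congrArg _ ih

theorem IsCocyclic.zeroCofaces_eq (hD : D.IsCocyclic) {i n : ℕ} (h : i ≤ n) :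
    D.zeroCofaces h = hD.cos.zeros h := by
  refine LinearMap.ext fun x => ?_
  induction n, h using Nat.le_induction with
  | base => rw [Cosimplicial.zeros_self, zeroCofaces, Nat.leRecOn_self]; rfl
  | succ n h ih =>
    rw [hD.cos.zeros_succ h, zeroCofaces, Nat.leRecOn_succ h, LinearMap.comp_apply]
    have e : D.δ n 0 = D.d n 0 := by
      rw [d, dif_pos (by omega)]
      rfl
    rw [e]
    exact congrArg _ ih

theorem alexanderWhitney_eq (hC : C.IsCocyclic) (hD : D.IsCocyclic) (n : ℕ) :
    C.alexanderWhitney D n = Cosimplicial.aw hC.cos hD.cos n := by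
  refine DirectSum.linearMap_ext k fun ⟨⟨i, j⟩, h⟩ => TensorProduct.ext' fun x y => ?_
  rw [alexanderWhitney, Cosimplicial.aw]
  simp only [LinearMap.comp_apply, DirectSum.toModule_lof, hC.lastCofaces_eq, hD.zeroCofaces_eq]

theorem alexanderWhitney_b (hC : C.IsCocyclic) (hD : D.IsCocyclic) (n : ℕ)
    (t : KunnethSum k C.X D.X n) :
    C.alexanderWhitney D (n + 1) (tensorDifferential C.hochschild D.hochschild n t) =
      (diag C D).hochschild n (C.alexanderWhitney D n t) := by
  rw [alexanderWhitney_eq hC hD, alexanderWhitney_eq hC hD, hC.diag_hochschild hD,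
    Cosimplicial.b_aw, Cosimplicial.dT,
    show hC.cos.b = C.hochschild from funext fun n => (hC.hochschild_eq n).symm,
    show hD.cos.b = D.hochschild from funext fun n => (hD.hochschild_eq n).symm]

end Comparison

end CocyclicOperators

section Zigzag

variable [CharZero k] {H : Type v} [Ring H] [HopfAlgebra k H]
  {M : Type w} [AddCommGroup M] [Module k M]
  {K : Type v'} [Ring K] [HopfAlgebra k K]
  {N : Type w'} [AddCommGroup N] [Module k N]
  (S : SAYDModule k H M) (T : SAYDModule k K N)

theorem SAYDModule.isMixed : S.mixed.IsMixed := S.isCocyclic.isMixed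

/-- The comparison of `C(H ⊗ K, M ⊗ N)` with the mixed complex `C(H, M) ⊗ C(K, N)`. -/
noncomputable def hopfZigzag : MixedOperators.Zigzag (S.tensor T).mixed
    (CocyclicOperators.diag S.cocyclic T.cocyclic).toMixed
    (S.isCocyclic.normalizedMixed.tensor T.isCocyclic.normalizedMixed)
    (S.mixed.tensor T.mixed) where
  isMixed_E := (S.tensor T).isMixed
  isMixed_G := (S.isCocyclic.diag T.isCocyclic).isMixed
  isMixed_N := S.isCocyclic.normalizedMixed_isMixed.tensor T.isCocyclic.normalizedMixed_isMixed
  isMixed_T := S.isMixed.tensor T.isMixed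
  toG := .ofHom (omega S T) (omega_hochschild S T) (omega_connes S T)
  ofN := S.isCocyclic.totAW T.isCocyclic
  toT := S.isCocyclic.normalizedTensor T.isCocyclic
  aw := S.cocyclic.alexanderWhitney T.cocyclic
  bijective_toG n := ⟨omega_injective S T n, omega_surjective S T n⟩
  isQuasiIso_ofN := S.isCocyclic.isQuasiIso_normalizedAW T.isCocyclic
  isQuasiIso_toT := S.isCocyclic.isQuasiIso_normalizedTensor T.isCocyclic
  toG_b := omega_hochschild S T
  aw_b := CocyclicOperators.alexanderWhitney_b S.isCocyclic T.isCocyclic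
  aw_toT n x := by
    rw [CocyclicOperators.alexanderWhitney_eq S.isCocyclic T.isCocyclic]
    rfl

end Zigzag

section Exact

variable {V V' A B : Type*} [AddCommGroup V] [Module k V] [AddCommGroup V'] [Module k V']
  [AddCommGroup A] [Module k A] [AddCommGroup B] [Module k B]

theorem exact_symm_comp_equiv {f : V →ₗ[k] B} {g : B →ₗ[k] V'} (h : Function.Exact f g)
    (e : A ≃ₗ[k] B) : Function.Exact (e.symm.toLinearMap ∘ₗ f) (g ∘ₗ e.toLinearMap) := by
  intro x
  refine (h (e x)).trans ⟨?_, ?_⟩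
  · rintro ⟨y, hy⟩
    exact ⟨y, by simp [hy]⟩
  · rintro ⟨y, rfl⟩
    exact ⟨y, by simp⟩

theorem exact_symm_comp {f : V →ₗ[k] V'} {g : V' →ₗ[k] B} (h : Function.Exact f g)
    (e : A ≃ₗ[k] B) : Function.Exact f (e.symm.toLinearMap ∘ₗ g) := by
  intro x
  refine Iff.trans ?_ (h x)
  simp

theorem exact_comp_equiv {f : B →ₗ[k] V} {g : V →ₗ[k] V'} (h : Function.Exact f g)
    (e : A ≃ₗ[k] B) : Function.Exact (f ∘ₗ e.toLinearMap) g := by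
  intro x
  refine (h x).trans ⟨?_, ?_⟩
  · rintro ⟨y, rfl⟩
    exact ⟨e.symm y, by simp⟩
  · rintro ⟨y, rfl⟩
    exact ⟨e y, rfl⟩

/-- Transport of a long exact sequence along isomorphisms of the middle terms. -/
theorem exists_transport {U B A : ℕ → Type*} [∀ n, AddCommGroup (U n)] [∀ n, Module k (U n)]
    [∀ n, AddCommGroup (B n)] [∀ n, Module k (B n)] [∀ n, AddCommGroup (A n)]
    [∀ n, Module k (A n)] (Θ : ∀ n, A n ≃ₗ[k] B n) {d : ∀ n, U n →ₗ[k] U (n + 2)}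
    {μ : ∀ n, U n →ₗ[k] B n} {bd : ∀ n, B (n + 1) →ₗ[k] U n} (h0 : Function.Bijective (μ 0))
    (h1 : Function.Injective (μ 1)) (e1 : ∀ n, Function.Exact (d n) (μ (n + 2)))
    (e2 : ∀ n, Function.Exact (μ (n + 1)) (bd n)) (e3 : ∀ n, Function.Exact (bd n) (d n)) :
    ∃ (μ' : ∀ n, U n →ₗ[k] A n) (bd' : ∀ n, A (n + 1) →ₗ[k] U n),
      (∀ n u, Θ n (μ' n u) = μ n u) ∧ (∀ n y, bd' n ((Θ (n + 1)).symm y) = bd n y) ∧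
      Function.Bijective (μ' 0) ∧ Function.Injective (μ' 1) ∧
      (∀ n, Function.Exact (d n) (μ' (n + 2))) ∧ (∀ n, Function.Exact (μ' (n + 1)) (bd' n)) ∧
      (∀ n, Function.Exact (bd' n) (d n)) :=
  ⟨fun n => (Θ n).symm.toLinearMap ∘ₗ μ n, fun n => bd n ∘ₗ (Θ (n + 1)).toLinearMap,
    fun n u => by simp, fun n y => by simp, (Θ 0).symm.bijective.comp h0,
    (Θ 1).symm.injective.comp h1, fun n => exact_symm_comp (e1 n) (Θ (n + 2)),
    fun n => exact_symm_comp_equiv (e2 n) (Θ (n + 1)),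
    fun n => exact_comp_equiv (e3 n) (Θ (n + 1))⟩

end Exact

set_option maxHeartbeats 1600000 in
/-- The long exact sequence, transported along isomorphisms with the cyclic cohomology of the
tensor product mixed complex. -/
theorem MixedOperators.exists_exact_sequence_of_equiv {C : MixedOperators.{u, v} k}
    {D : MixedOperators.{u, w} k} (hC : C.IsMixed) (hD : D.IsMixed) {A : ℕ → Type w'}
    [∀ n, AddCommGroup (A n)] [∀ n, Module k (A n)] (Θ : ∀ n, A n ≃ₗ[k] (C.tensor D).HC n) :
    ∃ (μ : ∀ n : ℕ, KunnethSum k C.HC D.HC n →ₗ[k] A n)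
      (bd : ∀ n : ℕ, A (n + 1) →ₗ[k] KunnethSum k C.HC D.HC n),
      (∀ (n i j : ℕ) (h : i + j = n) (α : C.Tot i) (β : D.Tot j) (x : C.HC i) (y : D.HC j),
        Represents α x → Represents β y → Represents (totMul i j h α β)
          (Θ n (μ n (KunnethSum.incl k C.HC D.HC i j h (x ⊗ₜ[k] y))))) ∧
      (∀ (n : ℕ) (c : KunnethSum k (fun i => LinearMap.ker (C.totD i))
          (fun j => LinearMap.ker (D.totD j)) n) (t : KunnethSum k C.Tot D.Tot (n + 1)),
        tensorDifferential C.totD D.totD (n + 1) t = differenceS C.totS D.totS n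
          (KunnethSum.map (fun i => (LinearMap.ker (C.totD i)).subtype)
            (fun j => (LinearMap.ker (D.totD j)).subtype) n c) →
        ∃ y : A (n + 1), Represents (totMu C D (n + 1) t) (Θ (n + 1) y) ∧
          bd n y = KunnethSum.map (X' := C.HC) (Y' := D.HC)
            (fun _ => Submodule.mkQ _) (fun _ => Submodule.mkQ _) n c) ∧
      Function.Bijective (μ 0) ∧ Function.Injective (μ 1) ∧
      (∀ n : ℕ, Function.Exact (differenceS C.S D.S n) (μ (n + 2))) ∧
      (∀ n : ℕ, Function.Exact (μ (n + 1)) (bd n)) ∧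
      (∀ n : ℕ, Function.Exact (bd n) (differenceS C.S D.S n)) := by
  obtain ⟨μ, bd, hμ, hbd, h0, h1, e1, e2, e3⟩ :=
    (totSequence hC hD).exists_exact_sequence (sX := C.totS) (sY := D.totS) (SX := C.S)
      (SY := D.S) (fun _ => rfl) hC.totD_totD hD.totD_totD (fun _ _ _ => represents_S)
      fun _ _ _ => represents_S
  obtain ⟨μ', bd', f1, f2, f3⟩ := exists_transport Θ h0 h1 e1 e2 e3
  refine ⟨μ', bd', fun n i j h α β x y hα hβ => ?_, fun n c t ht => ?_, f3⟩
  · have h3 := hμ n i j h α β x y hα hβ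
    rw [show (totSequence hC hD).μ n = totMu C D n from rfl, totMu_incl] at h3
    rw [f1]
    exact h3
  · obtain ⟨y, hy, hy'⟩ := hbd n c t ht
    refine ⟨(Θ (n + 1)).symm y, ?_, (f2 n y).trans hy'⟩
    rwa [LinearEquiv.apply_symm_apply]

/-- The periodic Künneth isomorphism, transported along isomorphisms. -/
theorem MixedOperators.exists_kunneth_per_of_equiv {C : MixedOperators.{u, v} k}
    {D : MixedOperators.{u, w} k} (hC : C.IsMixed) (hD : D.IsMixed) {p : ZMod 2} {A : Type w'}
    [AddCommGroup A] [Module k A] (Θ : A ≃ₗ[k] (C.tensor D).HP p) :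
    ∃ e : KunnethSum k C.HP D.HP p ≃ₗ[k] A,
      ∀ (i j : ZMod 2) (h : i + j = p) (α : C.Per i) (β : D.Per j) (x : C.HP i) (y : D.HP j),
        Represents α x → Represents β y → Represents (perMul i j h α β)
          (Θ (e (KunnethSum.incl k C.HP D.HP i j h (x ⊗ₜ y)))) := by
  obtain ⟨κ, hκ⟩ := exists_kunneth_per hC hD p
  refine ⟨κ.trans Θ.symm, fun i j h α β x y hα hβ => ?_⟩
  rw [LinearEquiv.trans_apply, LinearEquiv.apply_symm_apply]
  exact hκ i j h α β x y hα hβ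

end HopfCyclic

set_option maxHeartbeats 1600000 in
theorem mainTheorem6 {k : Type u} [Field k] [CharZero k]
    {H : Type v} [Ring H] [HopfAlgebra k H]
    (hH : Function.Bijective (HopfAlgebra.antipode k (A := H)))
    {K : Type v'} [Ring K] [HopfAlgebra k K]
    (hK : Function.Bijective (HopfAlgebra.antipode k (A := K)))
    {M : Type w} [AddCommGroup M] [Module k M] (S : SAYDModule k H M)
    {N : Type w'} [AddCommGroup N] [Module k N] (T : SAYDModule k K N) :
    -- Hochschild cohomology, with the isomorphism `[α] ⊗ [β] ↦ [Ω⁻¹ AW (α ⊗ β)]`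
    (∀ n : ℕ, ∃ e : KunnethSum k S.HH T.HH n ≃ₗ[k] (S.tensor T).HH n,
      ∀ (i j : ℕ) (h : i + j = n) (α : HopfCochain S i) (β : HopfCochain T j)
        (x : S.HH i) (y : T.HH j), Represents α x → Represents β y →
        ∃ z : HopfCochain (S.tensor T) n,
          omega S T n z = S.cocyclic.alexanderWhitney T.cocyclic n
            (KunnethSum.incl k (HopfCochain S) (HopfCochain T) i j h (α ⊗ₜ[k] β)) ∧
          Represents z (e (KunnethSum.incl k S.HH T.HH i j h (x ⊗ₜ[k] y)))) ∧
    -- Eilenberg-Zilber isomorphisms with the tensor product mixed complex, on `HC` and on `HP`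
    ∃ (Θ : ∀ n : ℕ, (S.tensor T).HC n ≃ₗ[k] (S.mixed.tensor T.mixed).HC n)
      (ΘP : ∀ p : ZMod 2, (S.tensor T).HP p ≃ₗ[k] (S.mixed.tensor T.mixed).HP p),
      -- `Θ` commutes with the periodicity operator `S`
      (∀ (n : ℕ) (x : (S.tensor T).HC n),
        Θ (n + 2) ((S.tensor T).mixed.S n x) = (S.mixed.tensor T.mixed).S n (Θ n x)) ∧
      -- `Θ` lies over the inverse of the Alexander-Whitney isomorphism on Hochschild cohomology
      (∀ (n : ℕ) (x : (S.tensor T).HC n) (z : (S.tensor T).mixed.Tot n)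
        (t : (S.mixed.tensor T.mixed).Tot n), Represents z x → Represents t (Θ n x) →
        ∃ (y : (S.tensor T).HH n) (z' : HopfCochain (S.tensor T) n),
          Represents ((S.tensor T).mixed.totTop n z) y ∧ Represents z' y ∧
          omega S T n z' = S.cocyclic.alexanderWhitney T.cocyclic n
            ((S.mixed.tensor T.mixed).totTop n t)) ∧
      -- `Θ` and `ΘP` are compatible with the canonical maps from `HC` to `HP`
      (∀ (n : ℕ) (x : (S.tensor T).HC n) (z : (S.tensor T).mixed.Tot n)
        (t : (S.mixed.tensor T.mixed).Tot n), Represents z x → Represents t (Θ n x) →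
        ∃ y : (S.tensor T).HP (n : ZMod 2),
          Represents ((S.tensor T).mixed.totToPer n z) y ∧
          Represents ((S.mixed.tensor T.mixed).totToPer n t) (ΘP (n : ZMod 2) y)) ∧
      -- the long exact sequence in cyclic cohomology
      (∃ (μ : ∀ n : ℕ, KunnethSum k S.HC T.HC n →ₗ[k] (S.tensor T).HC n)
        (bd : ∀ n : ℕ, (S.tensor T).HC (n + 1) →ₗ[k] KunnethSum k S.HC T.HC n),
        -- `μ` is induced by the product of total complexes
        (∀ (n i j : ℕ) (h : i + j = n) (α : S.mixed.Tot i) (β : T.mixed.Tot j)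
          (x : S.HC i) (y : T.HC j), Represents α x → Represents β y →
          Represents (MixedOperators.totMul i j h α β)
            (Θ n (μ n (KunnethSum.incl k S.HC T.HC i j h (x ⊗ₜ[k] y))))) ∧
        -- `bd` is the connecting homomorphism
        (∀ (n : ℕ)
          (c : KunnethSum k (fun i => LinearMap.ker (S.mixed.totD i))
            (fun j => LinearMap.ker (T.mixed.totD j)) n)
          (t : KunnethSum k S.mixed.Tot T.mixed.Tot (n + 1)),
          tensorDifferential S.mixed.totD T.mixed.totD (n + 1) t =
            differenceS S.mixed.totS T.mixed.totS n
              (KunnethSum.map (fun i => (LinearMap.ker (S.mixed.totD i)).subtype)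
                (fun j => (LinearMap.ker (T.mixed.totD j)).subtype) n c) →
          ∃ y : (S.tensor T).HC (n + 1),
            Represents (MixedOperators.totMu S.mixed T.mixed (n + 1) t) (Θ (n + 1) y) ∧
            bd n y = KunnethSum.map (X' := S.HC) (Y' := T.HC)
              (fun _ => Submodule.mkQ _) (fun _ => Submodule.mkQ _) n c) ∧
        -- exactness; the terms of negative degree vanish
        Function.Bijective (μ 0) ∧ Function.Injective (μ 1) ∧
        (∀ n : ℕ, Function.Exact (differenceS S.mixed.S T.mixed.S n) (μ (n + 2))) ∧
        (∀ n : ℕ, Function.Exact (μ (n + 1)) (bd n)) ∧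
        (∀ n : ℕ, Function.Exact (bd n) (differenceS S.mixed.S T.mixed.S n))) ∧
      -- periodic cyclic cohomology
      (∀ p : ZMod 2, ∃ e : KunnethSum k S.HP T.HP p ≃ₗ[k] (S.tensor T).HP p,
        ∀ (i j : ZMod 2) (h : i + j = p) (α : S.mixed.Per i) (β : T.mixed.Per j)
          (x : S.HP i) (y : T.HP j), Represents α x → Represents β y →
          Represents (MixedOperators.perMul i j h α β)
            (ΘP p (e (KunnethSum.incl k S.HP T.HP i j h (x ⊗ₜ[k] y))))) := by
  have hS := S.isMixed
  have hT := T.isMixed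
  let Z := hopfZigzag S T
  refine ⟨fun n => ?_, Z.hc, Z.hp, Z.hc_S, fun n x z t => Z.hc_totTop,
    fun n x z t => Z.hp_totToPer, MixedOperators.exists_exact_sequence_of_equiv hS hT Z.hc,
    fun p => MixedOperators.exists_kunneth_per_of_equiv hS hT (Z.hp p)⟩
  obtain ⟨κ, hκ⟩ := exists_kunneth_nat hS.b_b hT.b_b n
  refine ⟨κ.trans (Z.hh n), fun i j h α β x y hα hβ => ?_⟩
  obtain ⟨z, hz, hz'⟩ := Z.represents_hh (hκ i j h α β x y hα hβ)
  exact ⟨z, hz, hz'⟩
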